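/- Let $r,n\ge 1$ be integers, $q=e^{\pi \mathsf i/r}$, $q^{1/2}=e^{\pi \mathsf i/2r}$, $\{x\}=q^x-q^{-x}$, $[x]=\{x\}/\{1\}$ and $\{t\}!=\{t\}\{t-1\}\cdots\{1\}$. (For $r=1$ the quantum integers $[x]$ play no role below.) **The algebra.** Let $D$ be the $\mathbb C$-Hopf algebra generated by $E,F,k,k^{-1}$ with $E^r=F^r=0$, $k^{4r}=1$, $kk^{-1}=1$, $kE=qEk$, $kF=q^{-1}Fk$, $(q-q^{-1})[E,F]=k^2-k^{-2}$, and $\Delta(E)=1\otimes E+E\otimes k^2$, $\Delta(F)=k^{-2}\otimes F+F\otimes 1$, $\Delta(k)=k\otimes k$, with universal $R$-matrix $$R=\frac1{4r}\sum_{t=0}^{r-1}\sum_{m,m'=0}^{4r-1}\frac{\{1\}^{2t}}{\{t\}!}\,q^{t(t-1)/2+t(m-m')-mm'/2}\,E^tk^m\otimes F^tk^{m'} .$$ **The modules.** Let $\alpha\in\{\pm1,\pm\mathsf i\}$. For $0\le i\le r-1$ the simple module $\mathsf V_i^\alpha$ has basis $u_0,\dots,u_i$ with $k u_m=\alpha q^{(i-2m)/2}u_m$,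 $E u_m=u_{m-1}$, $F u_m=\alpha^2[m+1][i-m]u_{m+1}$ ($u_{-1}=u_{i+1}=0$); put $\mathsf V_{r-1}=\mathsf V_{r-1}^1$. For $0\le i\le r-2$, with $i^*=r-2-i$ and $\gamma_{a,m}=[m][a-m+1]$, the $2r$-dimensional indecomposable projective module $\mathsf P_i^\alpha$ (the projective cover of $\mathsf V^\alpha_i$) has basis $w^H_m,w^S_m$ $(0\le m\le i)$, $w^L_m,w^R_m$ $(0\le m\le i^*)$. On it $k$ acts by $\alpha q^{(i-2m)/2}$ on $w^H_m,w^S_m$, by $\alpha q^{-(i+2+2m)/2}$ on $w_m^L$ and by $\alpha q^{(i^*+r-2m)/2}$ on $w_m^R$; moreover $$E w^H_0=w^R_{i^*},\quad E w_m^H=\gamma_{i,m}w^H_{m-1}+w^S_{m-1}\ (m\ge1),\quad E w^S_0=0,\quad E w^S_m=\gamma_{i,m}w^S_{m-1}\ (m\ge 1),$$ $$E w^L_0=w^S_i,\quad E w^L_m=-\gamma_{i^*,m}w^L_{m-1}\ (m\ge1),\quad E w^R_0=0,\quad E w^R_m=w^R_{m-1}\ (m\ge1),$$ $$\alpha^2F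 w^H_m=w^H_{m+1}\ (m<i),\quad \alpha^2F w^H_i=w^L_0,\quad \alpha^2Fw^S_m=w^S_{m+1},\quad \alpha^2Fw^L_m=w^L_{m+1},$$ $$\alpha^2Fw^R_m=-\gamma_{i^*,m+1}w^R_{m+1}\ (m<i^*),\quad \alpha^2Fw^R_{i^*}=w^S_0,\qquad w^S_{i+1}=w^L_{i^*+1}=0 .$$ **The braid group representations.** Let $\tau$ be the flip and $\mathsf R=q^{-(r-1)^2/2}\,\tau\circ R$ on $\mathsf V_{r-1}\otimes\mathsf V_{r-1}$. The braid group $B_n$ acts on $\mathsf V_{r-1}^{\otimes n}$ by letting $\sigma_a$ act as $\mathsf R$ on the tensor factors $a,a+1$. For $\ell\ge0$ let $\boldsymbol V_{n,\ell}$ be the span of the $u_{\varepsilon_1}\otimes\cdots\otimes u_{\varepsilon_n}$ with $\varepsilon_1+\dots+\varepsilon_n=\ell$, and $\boldsymbol W_{n,\ell}=\ker E\cap\boldsymbol V_{n,\ell}$, which is a $B_n$-subrepresentation. **The subspaces.** The $D$-module $\mathsf V_{r-1}^{\otimes n}$ is a finite direct sum of $D$-submodules, each isomorphic to some $\mathsf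 V^\alpha_{r-1}$ or some $\mathsf P_i^\alpha$ and each the sum of its intersections with the spaces $\boldsymbol V_{n,\ell}$. Fix any such decomposition. Let $\boldsymbol C_{n,\ell}$, $\boldsymbol S_{n,\ell}$, $\boldsymbol R_{n,\ell}$ be the spans of those vectors of $\boldsymbol V_{n,\ell}$ which correspond, respectively, to the highest weight vector $u_0$ of a summand isomorphic to some $\mathsf V_{r-1}^\alpha$, to the socle vector $w_0^S$ of a summand isomorphic to some $\mathsf P^\alpha_i$, and to the right-most highest weight vector $w_0^R$ of a summand isomorphic to some $\mathsf P^\alpha_i$. **Theorem.** Let $0\le\ell<r$ and let $0\le j\le r-1$ with $j\equiv n+2(\ell-1)\pmod r$. 1. If $j=r-1$, then $\boldsymbol W_{n,\ell}=\boldsymbol C_{n,\ell}$. 2. If $\ell\le j<r-1$, then $\boldsymbol W_{n,\ell}=\boldsymbol R_{n,\ell}$. 3. If $j<\ell$ and $n\ge3$, then $\boldsymbol W_{n,\ell}=\boldsymbol S_{n,\ell}\oplus\boldsymbol R_{n,\ell}$ as vector spaces; moreover $\boldsymbol W_{n,\ell}$ is not a simple representation of $B_n$, and $\boldsymbol S_{n,\ell}$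 is a subrepresentation of it, isomorphic to $\boldsymbol W_{n,\ell-j-1}$. 4. If $j<\ell$ and $n=2$, then $\boldsymbol W_{2,\ell}=\boldsymbol S_{2,\ell}$. -/

import Mathlib

open scoped TensorProduct

noncomputable section

namespace RestrictedSl2

/-! ### Quantum numbers at `q = exp (π i / r)` -/

/-- `q ^ (1/2) = exp (π i / (2 r))`. -/
def qHalf (r : ℕ) : ℂ := Complex.exp (Real.pi * Complex.I / (2 * r))

/-- `q = exp (π i / r)`. -/
def q (r : ℕ) : ℂ := Complex.exp (Real.pi * Complex.I / r)

/-- `{x} = q ^ x - q ^ (-x)`. -/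
def qNum (r : ℕ) (x : ℤ) : ℂ := q r ^ x - q r ^ (-x)

/-- `[x] = {x} / {1}`. -/
def qInt (r : ℕ) (x : ℤ) : ℂ := qNum r x / qNum r 1

/-- `{n}! = {n} {n - 1} ⋯ {1}`. -/
def qNumFactorial (r n : ℕ) : ℂ := ∏ m ∈ Finset.range n, qNum r ((m : ℤ) + 1)

/-- `γ_{i,m} = [m] [i - m + 1]`. -/
def gam (r i m : ℕ) : ℂ := qInt r m * qInt r ((i : ℤ) - m + 1)

theorem q_ne_zero (r : ℕ) : q r ≠ 0 := Complex.exp_ne_zero _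

theorem qHalf_ne_zero (r : ℕ) : qHalf r ≠ 0 := Complex.exp_ne_zero _

theorem qHalf_sq (r : ℕ) : qHalf r ^ 2 = q r := by
  rw [qHalf, q, ← Complex.exp_nat_mul]
  congr 1
  push_cast
  by_cases h : (r : ℂ) = 0
  · simp [h]
  · field_simp

theorem qHalf_zpow_two_mul (r : ℕ) (x : ℤ) : qHalf r ^ (2 * x) = q r ^ x := by
  rw [zpow_mul, ← qHalf_sq]
  norm_cast

theorem q_pow_r {r : ℕ} (hr : 0 < r) : q r ^ r = -1 := by
  rw [q, ← Complex.exp_nat_mul, mul_div_cancel₀ _ (by exact_mod_cast hr.ne'), Complex.exp_pi_mul_I]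

theorem qHalf_pow {r : ℕ} (hr : 0 < r) : qHalf r ^ (4 * r) = 1 := by
  rw [show 4 * r = 2 * (r * 2) by ring, pow_mul, qHalf_sq, pow_mul, q_pow_r hr]
  norm_num

theorem q_sq_primitive {r : ℕ} (hr : 0 < r) : IsPrimitiveRoot (q r ^ 2) r := by
  have := Complex.isPrimitiveRoot_exp r hr.ne'
  convert this using 1
  rw [q, ← Complex.exp_nat_mul]
  congr 1
  push_cast
  ring

theorem qNum_one_ne_zero {r : ℕ} (hr : 2 ≤ r) : qNum r 1 ≠ 0 := by
  intro h
  have hq := q_ne_zero r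
  have h1 : q r ^ 2 = 1 := by
    simp only [qNum, zpow_neg, zpow_one] at h
    field_simp at h
    linear_combination h
  have := (q_sq_primitive (r := r) (by omega)).pow_eq_one_iff_dvd 1
  rw [pow_one] at this
  have h2 := Nat.le_of_dvd one_pos (this.1 h1)
  omega

/-- `[a] [b + 1] - [a - 1] [b + 2] = [b + 2 - a]`, multiplied by `q - q⁻¹`. -/
theorem qInt_identity {r : ℕ} (hr : 2 ≤ r) (a b : ℤ) :
    (q r - (q r)⁻¹) * (qInt r (a + 1) * qInt r b - qInt r a * qInt r (b + 1)) =
      q r ^ (b - a) - q r ^ (-(b - a)) := by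
  have hq := q_ne_zero r
  have h1 := qNum_one_ne_zero hr
  have h1' : q r - (q r)⁻¹ = qNum r 1 := by simp [qNum]
  rw [h1']
  simp only [qInt]
  field_simp
  simp only [qNum, neg_sub, neg_add, zpow_add₀ hq, zpow_sub₀ hq, zpow_neg, zpow_one]
  have ha := zpow_ne_zero a hq
  have hb := zpow_ne_zero b hq
  field_simp
  ring

/-! ### Modules over `D` -/

/-- The structure of a `D`-module on a complex vector space `X`, that is, the action of the
generators `E, F, k, k⁻¹` of `D`, subject to the defining relations of `D`. -/
structure DModule (r : ℕ) (X : Type*) [AddCommGroup X] [Module ℂ X] where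
  E : Module.End ℂ X
  F : Module.End ℂ X
  k : Module.End ℂ X
  kinv : Module.End ℂ X
  E_pow : E ^ r = 0
  F_pow : F ^ r = 0
  k_pow : k ^ (4 * r) = 1
  k_mul_kinv : k * kinv = 1
  k_mul_E : k * E = q r • (E * k)
  k_mul_F : k * F = (q r)⁻¹ • (F * k)
  E_F : (q r - (q r)⁻¹) • (E * F - F * E) = k ^ 2 - kinv ^ 2

/-- An injective homomorphism of `D`-modules. (Compatibility with `k⁻¹` is automatic.) -/
structure DEmbedding {r : ℕ} {X Y : Type*} [AddCommGroup X] [Module ℂ X] [AddCommGroup Y]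
    [Module ℂ Y] (A : DModule r X) (B : DModule r Y) where
  toLin : X →ₗ[ℂ] Y
  injective : Function.Injective toLin
  map_E : ∀ x, toLin (A.E x) = B.E (toLin x)
  map_F : ∀ x, toLin (A.F x) = B.F (toLin x)
  map_k : ∀ x, toLin (A.k x) = B.k (toLin x)

/-! A criterion for nilpotency: an operator that lowers a height function on a basis. -/

theorem pow_eq_zero_of_height {ι : Type*} (T : Module.End ℂ (ι →₀ ℂ)) (ht : ι → ℕ) (r : ℕ)
    (hr : ∀ b, ht b < r)
    (hT : ∀ b, T (Finsupp.single b 1) ∈ Finsupp.supported ℂ ℂ {c | ht c < ht b}) :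
    T ^ r = 0 := by
  have step : ∀ s : ℕ, ∀ x ∈ Finsupp.supported ℂ ℂ {c | ht c < s + 1},
      T x ∈ Finsupp.supported ℂ ℂ {c | ht c < s} := by
    intro s x hx
    rw [Finsupp.supported_eq_span_single] at hx
    induction hx using Submodule.span_induction with
    | mem y hy =>
      obtain ⟨b, hb, rfl⟩ := hy
      refine Finsupp.supported_mono ?_ (hT b)
      intro c hc
      simp only [Set.mem_ofPred_eq] at *
      omega
    | zero => simp
    | add y z _ _ h1 h2 => rw [map_add]; exact Submodule.add_mem _ h1 h2
    | smul a y _ h => rw [map_smul]; exact Submodule.smul_mem _ _ h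
  have key : ∀ s : ℕ, ∀ x ∈ Finsupp.supported ℂ ℂ {c | ht c < s}, (T ^ s) x = 0 := by
    intro s
    induction s with
    | zero => intro x hx; simpa [Finsupp.supported_empty] using hx
    | succ s ih => intro x hx; rw [pow_succ]; exact ih _ (step s x hx)
  refine LinearMap.ext fun x => ?_
  rw [LinearMap.zero_apply]
  apply key
  have : {c | ht c < r} = Set.univ := by ext c; simp [hr c]
  rw [this, Finsupp.supported_univ]
  trivial

theorem end_ext {ι : Type*} {S T : Module.End ℂ (ι →₀ ℂ)}
    (h : ∀ b, S (Finsupp.single b 1) = T (Finsupp.single b 1)) : S = T :=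
  Finsupp.lhom_ext' fun b => LinearMap.ext_ring (h b)

/-- The operator that acts on the basis vector `b` by the scalar `c b`. -/
def diag {ι : Type*} (c : ι → ℂ) : Module.End ℂ (ι →₀ ℂ) :=
  Finsupp.linearCombination ℂ fun b => Finsupp.single b (c b)

theorem diag_single {ι : Type*} (c : ι → ℂ) (b : ι) :
    diag c (Finsupp.single b 1) = c b • Finsupp.single b 1 := by
  simp [diag]

theorem diag_mul {ι : Type*} (c d : ι → ℂ) : diag c * diag d = diag fun b => c b * d b := by
  refine end_ext fun b => ?_
  rw [Module.End.mul_apply, diag_single, map_smul, diag_single, diag_single, smul_smul, mul_comm]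

theorem diag_eq_one {ι : Type*} (c : ι → ℂ) (h : ∀ b, c b = 1) : diag c = 1 := by
  refine end_ext fun b => ?_
  rw [diag_single, h, one_smul, Module.End.one_apply]

theorem diag_pow {ι : Type*} (c : ι → ℂ) (n : ℕ) : diag c ^ n = diag fun b => c b ^ n := by
  induction n with
  | zero => simp [diag_eq_one]
  | succ n ih => simp only [pow_succ, ih, diag_mul]

theorem qHalf_weight_pow {r : ℕ} (hr : 0 < r) {α : ℂ} (hα : α ^ 4 = 1) (x : ℤ) :
    (α * qHalf r ^ x) ^ (4 * r) = 1 := by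
  rw [mul_pow, pow_mul, hα, one_pow, one_mul, ← zpow_natCast, ← zpow_mul, mul_comm, zpow_mul,
    zpow_natCast, qHalf_pow hr, one_zpow]

theorem alpha_ne_zero {α : ℂ} (hα : α ^ 4 = 1) : α ≠ 0 := by
  rintro rfl
  norm_num at hα

theorem weight_ne_zero (r : ℕ) {α : ℂ} (hα : α ^ 4 = 1) (x : ℤ) : α * qHalf r ^ x ≠ 0 :=
  mul_ne_zero (alpha_ne_zero hα) (zpow_ne_zero _ (qHalf_ne_zero r))

theorem weight_sq (r : ℕ) (α : ℂ) (x : ℤ) : (α * qHalf r ^ x) ^ 2 = α ^ 2 * q r ^ x := by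
  rw [mul_pow, ← qHalf_zpow_two_mul, mul_comm 2 x, zpow_mul]
  norm_cast

theorem weight_inv_sq (r : ℕ) {α : ℂ} (hα : α ^ 4 = 1) (x : ℤ) :
    ((α * qHalf r ^ x)⁻¹) ^ 2 = α ^ 2 * q r ^ (-x) := by
  rw [inv_pow, weight_sq, mul_inv, zpow_neg]
  congr 1
  have := alpha_ne_zero hα
  field_simp
  linear_combination -hα

theorem weight_add_two (r : ℕ) (α : ℂ) (x : ℤ) :
    α * qHalf r ^ (x + 2) = q r * (α * qHalf r ^ x) := by
  rw [zpow_add₀ (qHalf_ne_zero r), ← qHalf_sq]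
  norm_cast
  ring

/-! ### The simple modules -/

/-- The basis vector `u_m` of a vector space with basis `u_0, …, u_i`; it is `0` for `m > i`. -/
def u (i m : ℕ) : Fin (i + 1) →₀ ℂ :=
  if h : m < i + 1 then Finsupp.single ⟨m, h⟩ 1 else 0

theorem single_eq_u {i : ℕ} (m : Fin (i + 1)) : Finsupp.single m (1 : ℂ) = u i m := by
  rw [u, dif_pos m.2]

theorem u_eq_zero {i m : ℕ} (h : i < m) : u i m = 0 := by
  simp [u, show ¬ m < i + 1 by omega]

theorem u_mem (i m : ℕ) (s : Set (Fin (i + 1))) (h : ∀ hm : m < i + 1, ⟨m, hm⟩ ∈ s) :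
    u i m ∈ Finsupp.supported ℂ ℂ s := by
  unfold u
  split_ifs with hm
  · exact Finsupp.single_mem_supported ℂ _ (h hm)
  · exact Submodule.zero_mem _

/-- The operator `E` on the simple module: `E u_m = u_{m-1}`, where `u_{-1} = 0`. -/
def simpleE (i : ℕ) : Module.End ℂ (Fin (i + 1) →₀ ℂ) :=
  Finsupp.linearCombination ℂ fun m => if (m : ℕ) = 0 then 0 else u i (m - 1)

/-- The operator `F` on the simple module: `F u_m = α² [m + 1] [i - m] u_{m+1}`. -/
def simpleF (r : ℕ) (α : ℂ) (i : ℕ) : Module.End ℂ (Fin (i + 1) →₀ ℂ) :=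
  Finsupp.linearCombination ℂ fun m =>
    (α ^ 2 * qInt r ((m : ℤ) + 1) * qInt r ((i : ℤ) - m)) • u i (m + 1)

theorem simpleE_u {i m : ℕ} (h : m ≤ i) :
    simpleE i (u i m) = if m = 0 then 0 else u i (m - 1) := by
  rw [u, dif_pos (by omega)]
  simp [simpleE]

theorem simpleF_u (r : ℕ) (α : ℂ) (i m : ℕ) :
    simpleF r α i (u i m) = (α ^ 2 * qInt r ((m : ℤ) + 1) * qInt r ((i : ℤ) - m)) • u i (m + 1) := by
  by_cases h : m < i + 1
  · rw [u, dif_pos h]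
    simp [simpleF]
  · rw [u_eq_zero (by omega), u_eq_zero (by omega)]
    simp

/-- The simple `D`-module `V^α_i` of highest weight `α q^{i/2}`, where `α ∈ {±1, ±i}`, with basis
`u_0, …, u_i`, on which `k u_m = α q^{(i-2m)/2} u_m`. -/
def simpleModule (r : ℕ) (α : ℂ) (hα : α ^ 4 = 1) (i : ℕ) (hi : i < r) :
    DModule r (Fin (i + 1) →₀ ℂ) where
  E := simpleE i
  F := simpleF r α i
  k := diag fun m => α * qHalf r ^ ((i : ℤ) - 2 * (m : ℕ))
  kinv := diag fun m => (α * qHalf r ^ ((i : ℤ) - 2 * (m : ℕ)))⁻¹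
  E_pow := by
    refine pow_eq_zero_of_height _ (fun m : Fin (i + 1) => (m : ℕ)) r (fun m => lt_of_lt_of_le m.2 hi) fun m => ?_
    rw [single_eq_u, simpleE_u (by omega)]
    split_ifs
    · exact Submodule.zero_mem _
    · exact u_mem _ _ _ fun hm => by simp only [Set.mem_ofPred_eq]; omega
  F_pow := by
    refine pow_eq_zero_of_height _ (fun m : Fin (i + 1) => i - (m : ℕ)) r
      (fun m => lt_of_le_of_lt (Nat.sub_le _ _) hi) fun m => ?_
    rw [single_eq_u, simpleF_u]
    exact Submodule.smul_mem _ _ (u_mem _ _ _ fun hm => by simp only [Set.mem_ofPred_eq]; omega)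
  k_pow := by
    rw [diag_pow]
    exact diag_eq_one _ fun m => qHalf_weight_pow (by omega) hα _
  k_mul_kinv := by
    rw [diag_mul]
    exact diag_eq_one _ fun m => mul_inv_cancel₀ (weight_ne_zero r hα _)
  k_mul_E := by
    refine end_ext fun m => ?_
    simp only [Module.End.mul_apply, LinearMap.smul_apply, diag_single, map_smul]
    rw [single_eq_u, simpleE_u (by omega)]
    split_ifs with h
    · simp
    · rw [u, dif_pos (by omega), diag_single, smul_smul, ← weight_add_two]
      congr 3
      push_cast
      omega
  k_mul_F := by
    refine end_ext fun m => ?_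
    simp only [Module.End.mul_apply, LinearMap.smul_apply, diag_single, map_smul]
    rw [single_eq_u, simpleF_u, map_smul]
    by_cases h : (m : ℕ) + 1 < i + 1
    · rw [u, dif_pos h, diag_single, smul_smul, smul_smul, smul_smul]
      congr 1
      have e : (i : ℤ) - 2 * (m : ℕ) = (i : ℤ) - 2 * ((m + 1 : ℕ) : ℤ) + 2 := by
        push_cast
        ring
      have hq := q_ne_zero r
      rw [e, weight_add_two]
      field_simp
    · rw [u_eq_zero (by omega)]
      simp
  E_F := by
    refine end_ext fun m => ?_
    simp only [Module.End.mul_apply, LinearMap.smul_apply, LinearMap.sub_apply, diag_pow,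
      diag_single, weight_sq, weight_inv_sq r hα]
    rw [single_eq_u]
    have hm := m.2
    rcases Nat.lt_or_ge r 2 with hr | hr
    · obtain rfl : i = 0 := by omega
      have hm0 : (m : ℕ) = 0 := by omega
      rw [hm0, simpleF_u, u_eq_zero (show 0 < 0 + 1 by omega), simpleE_u (by omega)]
      simp
    · have h1 : simpleE i (simpleF r α i (u i m)) =
          (α ^ 2 * qInt r ((m : ℤ) + 1) * qInt r ((i : ℤ) - m)) • u i m := by
        rw [simpleF_u, map_smul]
        by_cases h : (m : ℕ) + 1 ≤ i
        · rw [simpleE_u h]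
          simp
        · have : (i : ℤ) - (m : ℕ) = 0 := by omega
          rw [this]
          simp [qInt, qNum]
      have h2 : simpleF r α i (simpleE i (u i m)) =
          (α ^ 2 * qInt r (m : ℕ) * qInt r ((i : ℤ) - m + 1)) • u i m := by
        rw [simpleE_u (by omega)]
        split_ifs with h
        · rw [h]
          simp [qInt, qNum]
        · rw [simpleF_u, Nat.sub_add_cancel (by omega), Nat.cast_sub (by omega)]
          congr 3
          · simp
          · push_cast
            ring
      rw [h1, h2, ← sub_smul, ← sub_smul, smul_smul]
      congr 1
      have := qInt_identity hr (m : ℕ) ((i : ℤ) - m)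
      have e : (i : ℤ) - (m : ℕ) - (m : ℕ) = (i : ℤ) - 2 * (m : ℕ) := by ring
      rw [e] at this
      linear_combination α ^ 2 * this

/-! ### The non-simple indecomposable projective modules -/

/-- Indices of the basis `w_m^H, w_m^S` (`0 ≤ m ≤ i`), `w_m^L, w_m^R` (`0 ≤ m ≤ j`). -/
inductive PIdx (i j : ℕ) : Type
  | H (m : Fin (i + 1)) : PIdx i j
  | S (m : Fin (i + 1)) : PIdx i j
  | L (m : Fin (j + 1)) : PIdx i j
  | R (m : Fin (j + 1)) : PIdx i j

/-- `w_m^H` (zero if out of range). -/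
def wH (i j m : ℕ) : PIdx i j →₀ ℂ :=
  if h : m < i + 1 then Finsupp.single (.H ⟨m, h⟩) 1 else 0

/-- `w_m^S` (zero if out of range). -/
def wS (i j m : ℕ) : PIdx i j →₀ ℂ :=
  if h : m < i + 1 then Finsupp.single (.S ⟨m, h⟩) 1 else 0

/-- `w_m^L` (zero if out of range). -/
def wL (i j m : ℕ) : PIdx i j →₀ ℂ :=
  if h : m < j + 1 then Finsupp.single (.L ⟨m, h⟩) 1 else 0

/-- `w_m^R` (zero if out of range). -/
def wR (i j m : ℕ) : PIdx i j →₀ ℂ :=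
  if h : m < j + 1 then Finsupp.single (.R ⟨m, h⟩) 1 else 0

/-- The operator `E` on `P_i`, and on `P^α_i`. -/
def projE (r i j : ℕ) : Module.End ℂ (PIdx i j →₀ ℂ) :=
  Finsupp.linearCombination ℂ fun
    | .H m => if (m : ℕ) = 0 then wR i j j else gam r i m • wH i j (m - 1) + wS i j (m - 1)
    | .S m => if (m : ℕ) = 0 then 0 else gam r i m • wS i j (m - 1)
    | .L m => if (m : ℕ) = 0 then wS i j i else -gam r j m • wL i j (m - 1)
    | .R m => if (m : ℕ) = 0 then 0 else wR i j (m - 1)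

/-- The operator `F` on `P_i`. -/
def projF (r i j : ℕ) : Module.End ℂ (PIdx i j →₀ ℂ) :=
  Finsupp.linearCombination ℂ fun
    | .H m => if (m : ℕ) = i then wL i j 0 else wH i j (m + 1)
    | .S m => wS i j (m + 1)
    | .L m => wL i j (m + 1)
    | .R m => if (m : ℕ) = j then wS i j 0 else -gam r j (m + 1) • wR i j (m + 1)

/-- The basis vector with index `b` of `P_i` satisfies `k b = q^{x/2} b` for `x = projWeight b`. -/
def projWeight (r i j : ℕ) : PIdx i j → ℤ
  | .H m => (i : ℤ) - 2 * (m : ℕ)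
  | .S m => (i : ℤ) - 2 * (m : ℕ)
  | .L m => -((i : ℤ) + 2 + 2 * (m : ℕ))
  | .R m => (j : ℤ) + r - 2 * (m : ℕ)

theorem single_eq_wH {i j : ℕ} (m : Fin (i + 1)) :
    Finsupp.single (PIdx.H m) (1 : ℂ) = wH i j m := by rw [wH, dif_pos m.2]

theorem single_eq_wS {i j : ℕ} (m : Fin (i + 1)) :
    Finsupp.single (PIdx.S m) (1 : ℂ) = wS i j m := by rw [wS, dif_pos m.2]

theorem single_eq_wL {i j : ℕ} (m : Fin (j + 1)) :
    Finsupp.single (PIdx.L m) (1 : ℂ) = wL i j m := by rw [wL, dif_pos m.2]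

theorem single_eq_wR {i j : ℕ} (m : Fin (j + 1)) :
    Finsupp.single (PIdx.R m) (1 : ℂ) = wR i j m := by rw [wR, dif_pos m.2]

theorem wS_eq_zero {i j m : ℕ} (h : i < m) : wS i j m = 0 := by
  rw [wS, dif_neg (by omega)]

theorem wL_eq_zero {i j m : ℕ} (h : j < m) : wL i j m = 0 := by
  rw [wL, dif_neg (by omega)]

theorem wH_mem (i j m : ℕ) (s : Set (PIdx i j)) (h : ∀ hm : m < i + 1, .H ⟨m, hm⟩ ∈ s) :
    wH i j m ∈ Finsupp.supported ℂ ℂ s := by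
  unfold wH
  split_ifs with hm
  · exact Finsupp.single_mem_supported ℂ _ (h hm)
  · exact Submodule.zero_mem _

theorem wS_mem (i j m : ℕ) (s : Set (PIdx i j)) (h : ∀ hm : m < i + 1, .S ⟨m, hm⟩ ∈ s) :
    wS i j m ∈ Finsupp.supported ℂ ℂ s := by
  unfold wS
  split_ifs with hm
  · exact Finsupp.single_mem_supported ℂ _ (h hm)
  · exact Submodule.zero_mem _

theorem wL_mem (i j m : ℕ) (s : Set (PIdx i j)) (h : ∀ hm : m < j + 1, .L ⟨m, hm⟩ ∈ s) :
    wL i j m ∈ Finsupp.supported ℂ ℂ s := by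
  unfold wL
  split_ifs with hm
  · exact Finsupp.single_mem_supported ℂ _ (h hm)
  · exact Submodule.zero_mem _

theorem wR_mem (i j m : ℕ) (s : Set (PIdx i j)) (h : ∀ hm : m < j + 1, .R ⟨m, hm⟩ ∈ s) :
    wR i j m ∈ Finsupp.supported ℂ ℂ s := by
  unfold wR
  split_ifs with hm
  · exact Finsupp.single_mem_supported ℂ _ (h hm)
  · exact Submodule.zero_mem _

theorem projE_wH {r i j m : ℕ} (h : m ≤ i) : projE r i j (wH i j m) =
    if m = 0 then wR i j j else gam r i m • wH i j (m - 1) + wS i j (m - 1) := by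
  rw [wH, dif_pos (by omega)]
  simp [projE]

theorem projE_wS {r i j m : ℕ} (h : m ≤ i) : projE r i j (wS i j m) =
    if m = 0 then 0 else gam r i m • wS i j (m - 1) := by
  rw [wS, dif_pos (by omega)]
  simp [projE]

theorem projE_wL {r i j m : ℕ} (h : m ≤ j) : projE r i j (wL i j m) =
    if m = 0 then wS i j i else -gam r j m • wL i j (m - 1) := by
  rw [wL, dif_pos (by omega)]
  simp [projE]

theorem projE_wR {r i j m : ℕ} (h : m ≤ j) : projE r i j (wR i j m) =
    if m = 0 then 0 else wR i j (m - 1) := by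
  rw [wR, dif_pos (by omega)]
  simp [projE]

theorem projF_wH {r i j m : ℕ} (h : m ≤ i) : projF r i j (wH i j m) =
    if m = i then wL i j 0 else wH i j (m + 1) := by
  rw [wH, dif_pos (by omega)]
  simp [projF]

theorem projF_wS {r i j m : ℕ} (h : m ≤ i) : projF r i j (wS i j m) = wS i j (m + 1) := by
  rw [wS, dif_pos (by omega)]
  simp [projF]

theorem projF_wL {r i j m : ℕ} (h : m ≤ j) : projF r i j (wL i j m) = wL i j (m + 1) := by
  rw [wL, dif_pos (by omega)]
  simp [projF]

theorem projF_wR {r i j m : ℕ} (h : m ≤ j) : projF r i j (wR i j m) =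
    if m = j then wS i j 0 else -gam r j (m + 1) • wR i j (m + 1) := by
  rw [wR, dif_pos (by omega)]
  simp [projF]

theorem gam_zero (r i : ℕ) : gam r i 0 = 0 := by simp [gam, qInt, qNum]

theorem gam_succ_self (r i : ℕ) : gam r i (i + 1) = 0 := by simp [gam, qInt, qNum]

theorem gam_identity {r : ℕ} (hr : 2 ≤ r) (i m : ℕ) :
    (q r - (q r)⁻¹) * (gam r i (m + 1) - gam r i m) =
      q r ^ ((i : ℤ) - 2 * m) - q r ^ (-((i : ℤ) - 2 * m)) := by
  have := qInt_identity hr m ((i : ℤ) - m)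
  rw [show (i : ℤ) - m - m = i - 2 * m by ring] at this
  rw [← this, gam, gam]
  push_cast
  rw [show (i : ℤ) - (m + 1) + 1 = i - m by ring]

theorem q_zpow_add_r {r : ℕ} (hr : 0 < r) (x : ℤ) : q r ^ (x + r) = -q r ^ x := by
  rw [zpow_add₀ (q_ne_zero r), zpow_natCast, q_pow_r hr]
  ring

theorem projE_pow {r i j : ℕ} (h : i + j + 2 = r) : projE r i j ^ r = 0 := by
  refine pow_eq_zero_of_height _ (fun
    | .H m => j + 1 + m
    | .S m => (m : ℕ)
    | .L m => i + 1 + m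
    | .R m => (m : ℕ)) r ?_ ?_
  · rintro (m | m | m | m) <;> simp only <;> omega
  · rintro (m | m | m | m)
    · rw [single_eq_wH, projE_wH (by omega)]
      split_ifs
      · exact wR_mem _ _ _ _ fun hm => by simp only [Set.mem_ofPred_eq]; omega
      · exact Submodule.add_mem _ (Submodule.smul_mem _ _
          (wH_mem _ _ _ _ fun hm => by simp only [Set.mem_ofPred_eq]; omega))
          (wS_mem _ _ _ _ fun hm => by simp only [Set.mem_ofPred_eq]; omega)
    · rw [single_eq_wS, projE_wS (by omega)]
      split_ifs
      · exact Submodule.zero_mem _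
      · exact Submodule.smul_mem _ _
          (wS_mem _ _ _ _ fun hm => by simp only [Set.mem_ofPred_eq]; omega)
    · rw [single_eq_wL, projE_wL (by omega)]
      split_ifs
      · exact wS_mem _ _ _ _ fun hm => by simp only [Set.mem_ofPred_eq]; omega
      · exact Submodule.smul_mem _ _
          (wL_mem _ _ _ _ fun hm => by simp only [Set.mem_ofPred_eq]; omega)
    · rw [single_eq_wR, projE_wR (by omega)]
      split_ifs
      · exact Submodule.zero_mem _
      · exact wR_mem _ _ _ _ fun hm => by simp only [Set.mem_ofPred_eq]; omega

theorem projF_pow {r i j : ℕ} (h : i + j + 2 = r) : projF r i j ^ r = 0 := by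
  refine pow_eq_zero_of_height _ (fun
    | .H m => j + 1 + (i - m)
    | .S m => i - m
    | .L m => j - m
    | .R m => i + 1 + (j - m)) r ?_ ?_
  · rintro (m | m | m | m) <;> simp only <;> omega
  · rintro (m | m | m | m)
    · rw [single_eq_wH, projF_wH (by omega)]
      split_ifs
      · exact wL_mem _ _ _ _ fun hm => by simp only [Set.mem_ofPred_eq]; omega
      · exact wH_mem _ _ _ _ fun hm => by simp only [Set.mem_ofPred_eq]; omega
    · rw [single_eq_wS, projF_wS (by omega)]
      exact wS_mem _ _ _ _ fun hm => by simp only [Set.mem_ofPred_eq]; omega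
    · rw [single_eq_wL, projF_wL (by omega)]
      exact wL_mem _ _ _ _ fun hm => by simp only [Set.mem_ofPred_eq]; omega
    · rw [single_eq_wR, projF_wR (by omega)]
      split_ifs
      · exact wS_mem _ _ _ _ fun hm => by simp only [Set.mem_ofPred_eq]; omega
      · exact Submodule.smul_mem _ _
          (wR_mem _ _ _ _ fun hm => by simp only [Set.mem_ofPred_eq]; omega)

/-- The commutator of `E` and `F` on `P_i`. -/
theorem projE_projF {r i j : ℕ} (h : i + j + 2 = r) (b : PIdx i j) :
    (q r - (q r)⁻¹) • (projE r i j (projF r i j (Finsupp.single b 1)) -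
      projF r i j (projE r i j (Finsupp.single b 1))) =
    (q r ^ projWeight r i j b - q r ^ (-projWeight r i j b)) • Finsupp.single b 1 := by
  have hr : 2 ≤ r := by omega
  rcases b with m | m | m | m
  · rw [single_eq_wH, projWeight, ← gam_identity hr, mul_smul]
    congr 1
    obtain ⟨m, hm⟩ := m
    simp only
    rw [projF_wH (by omega), projE_wH (by omega)]
    rcases Nat.eq_zero_or_pos m with rfl | hm0
    · rw [if_pos rfl, projF_wR le_rfl, if_pos rfl, gam_zero]
      split_ifs with hi
      · subst hi
        rw [projE_wL (by omega), if_pos rfl, gam_succ_self]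
        simp
      · rw [projE_wH (by omega), if_neg (by omega)]
        simp
    · obtain ⟨m, rfl⟩ : ∃ p, m = p + 1 := ⟨m - 1, by omega⟩
      rw [if_neg (show ¬ m + 1 = 0 by omega), map_add, map_smul, Nat.add_sub_cancel,
        projF_wH (m := m) (by omega), projF_wS (m := m) (by omega),
        if_neg (show ¬ m = i by omega)]
      split_ifs with hi
      · subst hi
        rw [projE_wL (by omega), if_pos rfl, gam_succ_self]
        module
      · rw [projE_wH (by omega), if_neg (by omega), Nat.add_sub_cancel]
        module
  · rw [single_eq_wS, projWeight, ← gam_identity hr, mul_smul]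
    congr 1
    obtain ⟨m, hm⟩ := m
    simp only
    rw [projF_wS (by omega), projE_wS (m := m) (by omega)]
    have h1 : projE r i j (wS i j (m + 1)) = gam r i (m + 1) • wS i j m := by
      by_cases hi : m = i
      · subst hi
        rw [wS_eq_zero (by omega), gam_succ_self]
        simp
      · rw [projE_wS (by omega), if_neg (by omega), Nat.add_sub_cancel]
    rw [h1]
    rcases Nat.eq_zero_or_pos m with rfl | hm0
    · simp [gam_zero]
    · obtain ⟨m, rfl⟩ : ∃ p, m = p + 1 := ⟨m - 1, by omega⟩
      rw [if_neg (show ¬ m + 1 = 0 by omega), map_smul, Nat.add_sub_cancel, projF_wS (by omega)]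
      module
  · have e1 : q r ^ (-((i : ℤ) + 2 + 2 * (m : ℕ))) = -q r ^ ((j : ℤ) - 2 * (m : ℕ)) := by
      have := q_zpow_add_r (r := r) (by omega) (-((i : ℤ) + 2 + 2 * (m : ℕ)))
      rw [show (-((i : ℤ) + 2 + 2 * (m : ℕ))) + r = (j : ℤ) - 2 * (m : ℕ) by omega] at this
      rw [this, neg_neg]
    have e2 : q r ^ (-(-((i : ℤ) + 2 + 2 * (m : ℕ)))) = -q r ^ (-((j : ℤ) - 2 * (m : ℕ))) := by
      rw [← q_zpow_add_r (by omega)]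
      congr 1
      omega
    rw [single_eq_wL, projWeight, e1, e2]
    have e3 : -q r ^ ((j : ℤ) - 2 * (m : ℕ)) - -q r ^ (-((j : ℤ) - 2 * (m : ℕ))) =
        (q r - (q r)⁻¹) * -(gam r j (m + 1) - gam r j m) := by
      rw [mul_neg, gam_identity hr]
      ring
    rw [e3, mul_smul]
    congr 1
    obtain ⟨m, hm⟩ := m
    simp only
    rw [projF_wL (by omega), projE_wL (m := m) (by omega)]
    have h1 : projE r i j (wL i j (m + 1)) = -gam r j (m + 1) • wL i j m := by
      by_cases hi : m = j
      · subst hi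
        rw [wL_eq_zero (by omega), gam_succ_self]
        simp
      · rw [projE_wL (by omega), if_neg (by omega), Nat.add_sub_cancel]
    rw [h1]
    rcases Nat.eq_zero_or_pos m with rfl | hm0
    · rw [if_pos rfl, projF_wS le_rfl, wS_eq_zero (by omega), gam_zero]
      module
    · obtain ⟨m, rfl⟩ : ∃ p, m = p + 1 := ⟨m - 1, by omega⟩
      rw [if_neg (show ¬ m + 1 = 0 by omega), map_smul, Nat.add_sub_cancel, projF_wL (by omega)]
      module
  · have e1 : q r ^ ((j : ℤ) + r - 2 * (m : ℕ)) = -q r ^ ((j : ℤ) - 2 * (m : ℕ)) := by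
      rw [← q_zpow_add_r (by omega)]
      congr 1
      ring
    have e2 : q r ^ (-((j : ℤ) + r - 2 * (m : ℕ))) = -q r ^ (-((j : ℤ) - 2 * (m : ℕ))) := by
      have := q_zpow_add_r (r := r) (by omega) (-((j : ℤ) + r - 2 * (m : ℕ)))
      rw [show (-((j : ℤ) + r - 2 * (m : ℕ))) + r = -((j : ℤ) - 2 * (m : ℕ)) by ring] at this
      rw [this, neg_neg]
    rw [single_eq_wR, projWeight, e1, e2]
    have e3 : -q r ^ ((j : ℤ) - 2 * (m : ℕ)) - -q r ^ (-((j : ℤ) - 2 * (m : ℕ))) =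
        (q r - (q r)⁻¹) * -(gam r j (m + 1) - gam r j m) := by
      rw [mul_neg, gam_identity hr]
      ring
    rw [e3, mul_smul]
    congr 1
    obtain ⟨m, hm⟩ := m
    simp only
    rw [projF_wR (by omega), projE_wR (by omega)]
    have h1 : projE r i j (if m = j then wS i j 0 else -gam r j (m + 1) • wR i j (m + 1)) =
        -gam r j (m + 1) • wR i j m := by
      split_ifs with hi
      · subst hi
        rw [projE_wS (by omega), gam_succ_self]
        simp
      · rw [map_smul, projE_wR (by omega), if_neg (by omega), Nat.add_sub_cancel]
    rw [h1]
    rcases Nat.eq_zero_or_pos m with rfl | hm0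
    · rw [if_pos rfl, map_zero, gam_zero]
      module
    · obtain ⟨m, rfl⟩ : ∃ p, m = p + 1 := ⟨m - 1, by omega⟩
      rw [if_neg (show ¬ m + 1 = 0 by omega), Nat.add_sub_cancel, projF_wR (by omega),
        if_neg (by omega)]
      module

/-- `E` raises the weight on `P_i`, and `F` lowers it. -/
theorem projE_mem_weight {r i j : ℕ} (h : i + j + 2 = r) (b : PIdx i j) :
    projE r i j (Finsupp.single b 1) ∈
      Finsupp.supported ℂ ℂ {c | projWeight r i j c = projWeight r i j b + 2} := by
  rcases b with m | m | m | m
  · rw [single_eq_wH, projE_wH (by omega)]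
    split_ifs
    · exact wR_mem _ _ _ _ fun hm => by simp only [Set.mem_ofPred_eq, projWeight]; omega
    · exact Submodule.add_mem _ (Submodule.smul_mem _ _
        (wH_mem _ _ _ _ fun hm => by simp only [Set.mem_ofPred_eq, projWeight]; omega))
        (wS_mem _ _ _ _ fun hm => by simp only [Set.mem_ofPred_eq, projWeight]; omega)
  · rw [single_eq_wS, projE_wS (by omega)]
    split_ifs
    · exact Submodule.zero_mem _
    · exact Submodule.smul_mem _ _
        (wS_mem _ _ _ _ fun hm => by simp only [Set.mem_ofPred_eq, projWeight]; omega)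
  · rw [single_eq_wL, projE_wL (by omega)]
    split_ifs
    · exact wS_mem _ _ _ _ fun hm => by simp only [Set.mem_ofPred_eq, projWeight]; omega
    · exact Submodule.smul_mem _ _
        (wL_mem _ _ _ _ fun hm => by simp only [Set.mem_ofPred_eq, projWeight]; omega)
  · rw [single_eq_wR, projE_wR (by omega)]
    split_ifs
    · exact Submodule.zero_mem _
    · exact wR_mem _ _ _ _ fun hm => by simp only [Set.mem_ofPred_eq, projWeight]; omega

theorem projF_mem_weight {r i j : ℕ} (h : i + j + 2 = r) (b : PIdx i j) :
    projF r i j (Finsupp.single b 1) ∈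
      Finsupp.supported ℂ ℂ {c | projWeight r i j c = projWeight r i j b - 2} := by
  rcases b with m | m | m | m
  · rw [single_eq_wH, projF_wH (by omega)]
    split_ifs
    · exact wL_mem _ _ _ _ fun hm => by simp only [Set.mem_ofPred_eq, projWeight]; omega
    · exact wH_mem _ _ _ _ fun hm => by simp only [Set.mem_ofPred_eq, projWeight]; omega
  · rw [single_eq_wS, projF_wS (by omega)]
    exact wS_mem _ _ _ _ fun hm => by simp only [Set.mem_ofPred_eq, projWeight]; omega
  · rw [single_eq_wL, projF_wL (by omega)]
    exact wL_mem _ _ _ _ fun hm => by simp only [Set.mem_ofPred_eq, projWeight]; omega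
  · rw [single_eq_wR, projF_wR (by omega)]
    split_ifs
    · exact wS_mem _ _ _ _ fun hm => by simp only [Set.mem_ofPred_eq, projWeight]; omega
    · exact Submodule.smul_mem _ _
        (wR_mem _ _ _ _ fun hm => by simp only [Set.mem_ofPred_eq, projWeight]; omega)

theorem diag_apply_of_supported {ι : Type*} {c : ι → ℂ} {a : ℂ} {x : ι →₀ ℂ}
    (hx : x ∈ Finsupp.supported ℂ ℂ {b | c b = a}) : diag c x = a • x := by
  rw [Finsupp.supported_eq_span_single] at hx
  induction hx using Submodule.span_induction with
  | mem y hy =>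
    obtain ⟨b, hb, rfl⟩ := hy
    rw [diag_single, show c b = a from hb]
  | zero => simp
  | add y z _ _ h1 h2 => rw [map_add, h1, h2, smul_add]
  | smul t y _ h => rw [map_smul, h, smul_comm]

/-- The projective cover `P^α_i = V^α_0 ⊗ P_i` of `V^α_i`, of dimension `2r`, where `0 ≤ i ≤ r - 2`
and `j = r - 2 - i`. The basis vector `u_0^α ⊗ w` is written `w`; thus `E` acts as on `P_i`, while
`F` acts as `α^{-2} F = α² F` and `k` as `α k`. -/
def projModule (r : ℕ) (α : ℂ) (hα : α ^ 4 = 1) (i j : ℕ) (h : i + j + 2 = r) :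
    DModule r (PIdx i j →₀ ℂ) where
  E := projE r i j
  F := α ^ 2 • projF r i j
  k := diag fun b => α * qHalf r ^ projWeight r i j b
  kinv := diag fun b => (α * qHalf r ^ projWeight r i j b)⁻¹
  E_pow := projE_pow h
  F_pow := by rw [smul_pow, projF_pow h, smul_zero]
  k_pow := by
    rw [diag_pow]
    exact diag_eq_one _ fun m => qHalf_weight_pow (by omega) hα _
  k_mul_kinv := by
    rw [diag_mul]
    exact diag_eq_one _ fun m => mul_inv_cancel₀ (weight_ne_zero r hα _)
  k_mul_E := by
    refine end_ext fun b => ?_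
    simp only [Module.End.mul_apply, LinearMap.smul_apply, diag_single, map_smul]
    rw [smul_smul, ← weight_add_two]
    refine diag_apply_of_supported (Finsupp.supported_mono ?_ (projE_mem_weight h b))
    intro c hc
    simp only [Set.mem_ofPred_eq] at *
    rw [hc]
  k_mul_F := by
    refine end_ext fun b => ?_
    simp only [Module.End.mul_apply, LinearMap.smul_apply, diag_single, map_smul]
    rw [diag_apply_of_supported (a := (q r)⁻¹ * (α * qHalf r ^ projWeight r i j b))
      (Finsupp.supported_mono ?_ (projF_mem_weight h b))]
    · module
    intro c hc
    simp only [Set.mem_ofPred_eq] at *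
    have hq := q_ne_zero r
    have := weight_add_two r α (projWeight r i j c)
    rw [hc, sub_add_cancel] at this
    rw [this, hc, inv_mul_cancel_left₀ hq]
  E_F := by
    refine end_ext fun b => ?_
    have := projE_projF h b
    simp only [Module.End.mul_apply, LinearMap.smul_apply, LinearMap.sub_apply, diag_pow,
      diag_single, weight_sq, weight_inv_sq r hα, map_smul]
    rw [← smul_sub, smul_comm, this, ← sub_smul, smul_smul, mul_sub]

/-! ### Tensor powers -/

/-- Coefficients of the `q`-binomial expansion. -/
def gaussCoeff (ω : ℂ) : ℕ → ℕ → ℂ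
  | 0, 0 => 1
  | 0, _ + 1 => 0
  | n + 1, 0 => gaussCoeff ω n 0
  | n + 1, k + 1 => gaussCoeff ω n k + ω ^ (k + 1) * gaussCoeff ω n (k + 1)

theorem gaussCoeff_zero (ω : ℂ) (n : ℕ) : gaussCoeff ω n 0 = 1 := by
  induction n with
  | zero => rfl
  | succ n ih => rw [gaussCoeff, ih]

theorem gaussCoeff_of_lt (ω : ℂ) (n k : ℕ) (h : n < k) : gaussCoeff ω n k = 0 := by
  induction n generalizing k with
  | zero =>
    obtain ⟨k, rfl⟩ : ∃ p, k = p + 1 := ⟨k - 1, by omega⟩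
    rfl
  | succ n ih =>
    obtain ⟨k, rfl⟩ : ∃ p, k = p + 1 := ⟨k - 1, by omega⟩
    rw [gaussCoeff, ih k (by omega), ih (k + 1) (by omega)]
    simp

theorem gaussCoeff_self (ω : ℂ) (n : ℕ) : gaussCoeff ω n n = 1 := by
  induction n with
  | zero => rfl
  | succ n ih => rw [gaussCoeff, ih, gaussCoeff_of_lt _ _ _ (by omega)]; simp

theorem gaussCoeff_step (ω : ℂ) (n k : ℕ) (h : k ≤ n) :
    (1 - ω ^ (k + 1)) * gaussCoeff ω n (k + 1) = (1 - ω ^ (n - k)) * gaussCoeff ω n k := by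
  induction n generalizing k with
  | zero =>
    obtain rfl : k = 0 := by omega
    simp [gaussCoeff]
  | succ n ih =>
    rcases Nat.eq_zero_or_pos k with rfl | hk
    · have := ih 0 (by omega)
      simp only [gaussCoeff, gaussCoeff_zero, zero_add, Nat.sub_zero, pow_one] at *
      linear_combination ω * this
    · obtain ⟨k, rfl⟩ : ∃ p, k = p + 1 := ⟨k - 1, by omega⟩
      simp only [gaussCoeff]
      have h1 := ih k (by omega)
      rw [show n + 1 - (k + 1) = n - k by omega]
      rcases Nat.lt_or_ge n (k + 1) with hn | hn
      · rw [gaussCoeff_of_lt ω n (k + 1) hn, gaussCoeff_of_lt ω n (k + 1 + 1) (by omega)]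
        rw [gaussCoeff_of_lt ω n (k + 1) hn] at h1
        linear_combination h1
      · have h2 := ih (k + 1) hn
        have e : ω ^ (n - k) = ω * ω ^ (n - (k + 1)) := by
          rw [← pow_succ']
          congr 1
          omega
        rw [e] at h1 ⊢
        linear_combination h1 + ω ^ (k + 1 + 1) * h2

theorem gaussCoeff_eq_zero {ω : ℂ} {r : ℕ} (hω : IsPrimitiveRoot ω r) {k : ℕ} (h0 : 0 < k)
    (hk : k < r) : gaussCoeff ω r k = 0 := by
  induction k with
  | zero => omega
  | succ k ih =>
    have h1 := gaussCoeff_step ω r k (by omega)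
    have h2 : (1 - ω ^ (r - k)) * gaussCoeff ω r k = 0 := by
      rcases Nat.eq_zero_or_pos k with rfl | hk0
      · simp [hω.pow_eq_one]
      · rw [ih hk0 (by omega), mul_zero]
    rw [h2] at h1
    refine (mul_eq_zero.1 h1).resolve_left ?_
    exact fun h => hω.pow_ne_one_of_pos_of_lt (by omega) hk (sub_eq_zero.1 h).symm

/-- The `q`-binomial formula. -/
theorem add_pow_of_qcomm {A : Type*} [Ring A] [Algebra ℂ A] {x y : A} {ω : ℂ}
    (h : y * x = ω • (x * y)) (n : ℕ) :
    (x + y) ^ n = ∑ k ∈ Finset.range (n + 1), gaussCoeff ω n k • (x ^ k * y ^ (n - k)) := by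
  have hk : ∀ k, y * x ^ k = ω ^ k • (x ^ k * y) := by
    intro k
    induction k with
    | zero => simp
    | succ k ih =>
      rw [pow_succ x, ← mul_assoc, ih, smul_mul_assoc, mul_assoc, h, mul_smul_comm, smul_smul,
        ← pow_succ, mul_assoc]
  induction n with
  | zero => simp [gaussCoeff]
  | succ n ih =>
    rw [pow_succ', ih, add_mul, Finset.mul_sum, Finset.mul_sum, Finset.sum_range_succ' _ (n + 1)]
    simp only [gaussCoeff, add_smul, Finset.sum_add_distrib]
    rw [add_assoc]
    congr 1
    · refine Finset.sum_congr rfl fun k _ => ?_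
      rw [mul_smul_comm, ← mul_assoc, ← pow_succ', Nat.add_sub_add_right]
    · have e : ∀ k ∈ Finset.range (n + 1), y * gaussCoeff ω n k • (x ^ k * y ^ (n - k)) =
          (ω ^ k * gaussCoeff ω n k) • (x ^ k * y ^ (n + 1 - k)) := by
        intro k hk'
        rw [mul_smul_comm, ← mul_assoc, hk, smul_mul_assoc, smul_smul, mul_assoc, ← pow_succ',
          mul_comm (ω ^ k)]
        congr 3
        have := Finset.mem_range.1 hk'
        omega
      rw [Finset.sum_congr rfl e, Finset.sum_range_succ', Finset.sum_range_succ _ n,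
        gaussCoeff_of_lt ω n (n + 1) (by omega)]
      simp

theorem add_pow_eq_zero_of_qcomm {A : Type*} [Ring A] [Algebra ℂ A] {x y : A} {ω : ℂ} {r : ℕ}
    (hr : 0 < r) (hω : IsPrimitiveRoot ω r) (h : y * x = ω • (x * y)) (hx : x ^ r = 0)
    (hy : y ^ r = 0) : (x + y) ^ r = 0 := by
  rw [add_pow_of_qcomm h]
  refine Finset.sum_eq_zero fun k hk => ?_
  have hk' := Finset.mem_range.1 hk
  rcases Nat.eq_zero_or_pos k with rfl | h0
  · simp [hy]
  · rcases Nat.lt_or_ge k r with h1 | h1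
    · rw [gaussCoeff_eq_zero hω h0 h1, zero_smul]
    · obtain rfl : k = r := by omega
      simp [hx]

theorem sum_pow_eq_zero_of_qcomm {A : Type*} [Ring A] [Algebra ℂ A] {n : ℕ} (x : Fin n → A)
    {ω : ℂ} {r : ℕ} (hr : 0 < r) (hω : IsPrimitiveRoot ω r)
    (h : ∀ a b, a < b → x a * x b = ω • (x b * x a)) (hx : ∀ a, x a ^ r = 0) :
    (∑ a, x a) ^ r = 0 := by
  suffices H : ∀ s : Finset (Fin n), (∑ a ∈ s, x a) ^ r = 0 from H Finset.univ
  intro s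
  induction s using Finset.induction_on_max with
  | empty => simp [hr.ne']
  | insert b s hb ih =>
    rw [Finset.sum_insert (fun hbs => lt_irrefl _ (hb b hbs))]
    refine add_pow_eq_zero_of_qcomm hr hω ?_ (hx b) ih
    rw [Finset.mul_sum, Finset.sum_mul, Finset.smul_sum]
    exact Finset.sum_congr rfl fun a ha => h a b (hb a ha)

section TensorPower

variable {r : ℕ} {X : Type*} [AddCommGroup X] [Module ℂ X] (A : DModule r X) (n : ℕ)

namespace DModule

/-- The summand `1 ⊗ ⋯ ⊗ 1 ⊗ E ⊗ k² ⊗ ⋯ ⊗ k²` of the iterated coproduct of `E`. -/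
def termE (a : Fin n) : Module.End ℂ (⨂[ℂ] _ : Fin n, X) :=
  PiTensorProduct.map fun b => if b < a then 1 else if b = a then A.E else A.k ^ 2

/-- The summand `k⁻² ⊗ ⋯ ⊗ k⁻² ⊗ F ⊗ 1 ⊗ ⋯ ⊗ 1` of the iterated coproduct of `F`. -/
def termF (a : Fin n) : Module.End ℂ (⨂[ℂ] _ : Fin n, X) :=
  PiTensorProduct.map fun b => if b < a then A.kinv ^ 2 else if b = a then A.F else 1

variable {A n}

theorem map_eq_smul_map (f g : Fin n → Module.End ℂ X) (a : Fin n) (c : ℂ) (ha : f a = c • g a)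
    (hb : ∀ b, b ≠ a → f b = g b) :
    PiTensorProduct.map f = c • PiTensorProduct.map g := by
  have : f = Function.update g a (c • g a) := by
    ext1 b
    by_cases h : b = a
    · subst h; rw [ha, Function.update_self]
    · rw [hb b h, Function.update_of_ne h]
  rw [this, PiTensorProduct.map_update_smul, Function.update_eq_self]

theorem map_eq_zero (f : Fin n → Module.End ℂ X) (a : Fin n) (ha : f a = 0) :
    PiTensorProduct.map f = 0 := by
  have := map_eq_smul_map f f a 0 (by rw [ha, zero_smul]) fun _ _ => rfl
  rw [this, zero_smul]

theorem kinv_mul_k (hr : 0 < r) : A.kinv * A.k = 1 := by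
  have h : A.k ^ (4 * r - 1) * A.k = 1 := by
    rw [← pow_succ, Nat.sub_add_cancel (by omega), A.k_pow]
  have : A.kinv = A.k ^ (4 * r - 1) := by
    rw [← one_mul A.kinv, ← h, mul_assoc, A.k_mul_kinv, mul_one]
  rw [this, h]

theorem kinv_mul_E (hr : 0 < r) : A.E * A.kinv = q r • (A.kinv * A.E) := by
  have h := congrArg (fun T => A.kinv * T * A.kinv) A.k_mul_E
  simp only [mul_smul_comm, smul_mul_assoc] at h
  rw [← mul_assoc, kinv_mul_k hr, one_mul, mul_assoc, mul_assoc, A.k_mul_kinv, mul_one] at h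
  exact h

theorem kinv_mul_F (hr : 0 < r) : A.F * A.kinv = (q r)⁻¹ • (A.kinv * A.F) := by
  have h := congrArg (fun T => A.kinv * T * A.kinv) A.k_mul_F
  simp only [mul_smul_comm, smul_mul_assoc] at h
  rw [← mul_assoc, kinv_mul_k hr, one_mul, mul_assoc, mul_assoc, A.k_mul_kinv, mul_one] at h
  exact h

theorem k_sq_mul_E : A.k ^ 2 * A.E = q r ^ 2 • (A.E * A.k ^ 2) := by
  rw [pow_two, mul_assoc, A.k_mul_E, mul_smul_comm, ← mul_assoc, A.k_mul_E, smul_mul_assoc,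
    smul_smul, mul_assoc, ← pow_two]

theorem k_sq_mul_F : A.F * A.k ^ 2 = q r ^ 2 • (A.k ^ 2 * A.F) := by
  have h : A.F * A.k = q r • (A.k * A.F) := by
    rw [A.k_mul_F, smul_smul, mul_inv_cancel₀ (q_ne_zero r), one_smul]
  rw [pow_two, ← mul_assoc, h, smul_mul_assoc, mul_assoc, h, mul_smul_comm, smul_smul, ← mul_assoc,
    ← pow_two, ← pow_two]

theorem kinv_sq_mul_E (hr : 0 < r) : A.E * A.kinv ^ 2 = q r ^ 2 • (A.kinv ^ 2 * A.E) := by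
  rw [pow_two, ← mul_assoc, kinv_mul_E hr, smul_mul_assoc, mul_assoc, kinv_mul_E hr, mul_smul_comm,
    smul_smul, ← mul_assoc, ← pow_two, ← pow_two]

theorem kinv_sq_mul_F (hr : 0 < r) : A.kinv ^ 2 * A.F = q r ^ 2 • (A.F * A.kinv ^ 2) := by
  have h : A.kinv * A.F = q r • (A.F * A.kinv) := by
    rw [kinv_mul_F hr, smul_smul, mul_inv_cancel₀ (q_ne_zero r), one_smul]
  rw [pow_two, mul_assoc, h, mul_smul_comm, ← mul_assoc, h, smul_mul_assoc, smul_smul, mul_assoc,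
    ← pow_two, ← pow_two]

theorem termE_mul_termE (a b : Fin n) (hab : a < b) :
    A.termE n a * A.termE n b = q r ^ 2 • (A.termE n b * A.termE n a) := by
  simp only [termE, ← PiTensorProduct.map_mul]
  refine map_eq_smul_map _ _ b _ ?_ ?_
  · simp [not_lt_of_gt hab, hab.ne', k_sq_mul_E]
  · intro c hc
    rcases lt_trichotomy c a with h | h | h
    · simp [h, h.trans hab]
    · subst h
      simp [hab]
    · rcases lt_or_gt_of_ne hc with h' | h'
      · simp [h', not_lt_of_gt h, h.ne']
      · simp [not_lt_of_gt h', not_lt_of_gt h, h.ne', h'.ne']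

theorem termF_mul_termF (hr : 0 < r) (a b : Fin n) (hab : a < b) :
    A.termF n a * A.termF n b = (q r ^ 2)⁻¹ • (A.termF n b * A.termF n a) := by
  rw [eq_inv_smul_iff₀ (pow_ne_zero 2 (q_ne_zero r)), eq_comm]
  simp only [termF, ← PiTensorProduct.map_mul]
  refine map_eq_smul_map _ _ a _ ?_ ?_
  · simp [hab, kinv_sq_mul_F hr]
  · intro c hc
    rcases lt_or_gt_of_ne hc with h | h
    · simp [h, h.trans hab]
    · rcases lt_trichotomy c b with h' | h' | h'
      · simp [h', not_lt_of_gt h, h.ne']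
      · subst h'
        simp [not_lt_of_gt h, h.ne']
      · simp [not_lt_of_gt h', not_lt_of_gt h, h.ne', h'.ne']

theorem k_sq_mul_kinv_sq (hr : 0 < r) : A.k ^ 2 * A.kinv ^ 2 = A.kinv ^ 2 * A.k ^ 2 := by
  have h : Commute A.k A.kinv := A.k_mul_kinv.trans (kinv_mul_k hr).symm
  exact (h.pow_pow 2 2).eq

theorem termE_termF_comm (hr : 0 < r) (a b : Fin n) (hab : a ≠ b) :
    A.termE n a * A.termF n b = A.termF n b * A.termE n a := by
  rcases lt_or_gt_of_ne hab with h | h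
  · have h1 : A.termE n a * A.termF n b = q r ^ 2 • PiTensorProduct.map
        (fun c => if c = a then A.kinv ^ 2 * A.E else
          (if c < a then 1 else A.k ^ 2) * (if c < b then A.kinv ^ 2 else if c = b then A.F else 1)) := by
      simp only [termE, termF, ← PiTensorProduct.map_mul]
      refine map_eq_smul_map _ _ a _ ?_ ?_
      · simp [h, kinv_sq_mul_E hr]
      · intro c hc
        simp [hc]
    have h2 : A.termF n b * A.termE n a = q r ^ 2 • PiTensorProduct.map
        (fun c => if c = a then A.kinv ^ 2 * A.E else
          (if c < a then 1 else A.k ^ 2) * (if c < b then A.kinv ^ 2 else if c = b then A.F else 1)) := by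
      simp only [termE, termF, ← PiTensorProduct.map_mul]
      refine map_eq_smul_map _ _ b _ ?_ ?_
      · simp [not_lt_of_gt h, h.ne', k_sq_mul_F]
      · intro c hc
        by_cases hca : c = a
        · simp [hca, h]
        · rcases lt_or_gt_of_ne hca with h' | h'
          · simp [hca, h', h'.trans h]
          · rcases lt_or_gt_of_ne hc with h'' | h''
            · simp [hca, not_lt_of_gt h', h'', k_sq_mul_kinv_sq hr]
            · simp [hca, hc, not_lt_of_gt h', not_lt_of_gt h'']
    rw [h1, h2]
  · simp only [termE, termF, ← PiTensorProduct.map_mul]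
    congr 1
    ext1 c
    rcases lt_trichotomy c b with h' | h' | h'
    · simp [h', h'.trans h]
    · subst h'
      simp [h]
    · rcases lt_trichotomy c a with h'' | h'' | h''
      · simp [h'', not_lt_of_gt h', h'.ne']
      · subst h''
        simp [not_lt_of_gt h', h'.ne']
      · simp [not_lt_of_gt h', h'.ne', not_lt_of_gt h'', h''.ne']

/-- The operator `k⁻² ⊗ ⋯ ⊗ k⁻² ⊗ k² ⊗ ⋯ ⊗ k²` with `a` factors `k⁻²`. -/
def termK (A : DModule r X) (n a : ℕ) : Module.End ℂ (⨂[ℂ] _ : Fin n, X) :=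
  PiTensorProduct.map fun b : Fin n => if (b : ℕ) < a then A.kinv ^ 2 else A.k ^ 2

theorem termE_termF_self (a : Fin n) :
    (q r - (q r)⁻¹) • (A.termE n a * A.termF n a - A.termF n a * A.termE n a) =
      A.termK n a - A.termK n (a + 1) := by
  let g : Fin n → Module.End ℂ X := fun c => if c < a then A.kinv ^ 2 else A.k ^ 2
  have key : ∀ f : Fin n → Module.End ℂ X, (∀ b, b ≠ a → f b = g b) →
      PiTensorProduct.map f = PiTensorProduct.mapMultilinear ℂ (fun _ : Fin n => X) (fun _ => X)
        (Function.update g a (f a)) := by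
    intro f hf
    have : f = Function.update g a (f a) := by
      ext1 b
      by_cases h : b = a
      · subst h; rw [Function.update_self]
      · rw [hf b h, Function.update_of_ne h]
    rw [← this]
    rfl
  simp only [termE, termF, termK, ← PiTensorProduct.map_mul]
  rw [key, key, key, key]
  · rw [← MultilinearMap.map_update_sub, ← MultilinearMap.map_update_smul,
      ← MultilinearMap.map_update_sub]
    simp [A.E_F]
  · intro b hb
    have : ¬ b < a ↔ ¬ (b : ℕ) < a + 1 := by
      have := Fin.val_ne_of_ne hb
      rw [Fin.lt_def]
      omega
    by_cases h : b < a
    · simp [g, h, not_not.1 (this.not.1 (not_not.2 h))]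
    · simp [g, h, this.1 h]
  · intro b hb
    rfl
  · intro b hb
    by_cases h : b < a <;> simp [g, h, hb]
  · intro b hb
    by_cases h : b < a <;> simp [g, h, hb]

/-- The tensor power `X^{⊗ n}` of a `D`-module `X`, with the action given by the iterated
coproduct, where `Δ(E) = 1 ⊗ E + E ⊗ k²`, `Δ(F) = k⁻² ⊗ F + F ⊗ 1` and `Δ(k) = k ⊗ k`. -/
def tensorPower (A : DModule r X) (n : ℕ) (hr : 0 < r) : DModule r (⨂[ℂ] _ : Fin n, X) where
  E := ∑ a, A.termE n a
  F := ∑ a, A.termF n a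
  k := PiTensorProduct.map fun _ => A.k
  kinv := PiTensorProduct.map fun _ => A.kinv
  E_pow := by
    refine sum_pow_eq_zero_of_qcomm _ hr (q_sq_primitive hr) termE_mul_termE fun a => ?_
    rw [termE, ← PiTensorProduct.map_pow]
    exact map_eq_zero _ a (by simp [A.E_pow])
  F_pow := by
    refine sum_pow_eq_zero_of_qcomm _ hr (q_sq_primitive hr).inv (termF_mul_termF hr) fun a => ?_
    rw [termF, ← PiTensorProduct.map_pow]
    exact map_eq_zero _ a (by simp [A.F_pow])
  k_pow := by
    rw [← PiTensorProduct.map_pow]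
    simp only [Pi.pow_def, A.k_pow]
    exact PiTensorProduct.map_one
  k_mul_kinv := by
    rw [← PiTensorProduct.map_mul]
    simp only [A.k_mul_kinv]
    exact PiTensorProduct.map_one
  k_mul_E := by
    rw [Finset.mul_sum, Finset.sum_mul, Finset.smul_sum]
    refine Finset.sum_congr rfl fun a _ => ?_
    simp only [termE, ← PiTensorProduct.map_mul]
    refine map_eq_smul_map _ _ a _ ?_ ?_
    · simp [A.k_mul_E]
    · intro b hb
      simp only [hb, if_false]
      split_ifs
      · simp
      · rw [← pow_succ', ← pow_succ]
  k_mul_F := by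
    rw [Finset.mul_sum, Finset.sum_mul, Finset.smul_sum]
    refine Finset.sum_congr rfl fun a _ => ?_
    simp only [termF, ← PiTensorProduct.map_mul]
    refine map_eq_smul_map _ _ a _ ?_ ?_
    · simp [A.k_mul_F]
    · intro b hb
      simp only [hb, if_false]
      have hc : A.k * A.kinv ^ 2 = A.kinv ^ 2 * A.k := by
        rw [pow_two, ← mul_assoc, A.k_mul_kinv, mul_assoc, kinv_mul_k hr, one_mul, mul_one]
      split_ifs
      · exact hc
      · simp
  E_F := by
    have h : (∑ a, A.termE n a) * (∑ a, A.termF n a) - (∑ a, A.termF n a) * (∑ a, A.termE n a) =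
        ∑ a, (A.termE n a * A.termF n a - A.termF n a * A.termE n a) := by
      rw [Finset.sum_mul_sum, Finset.sum_mul_sum, Finset.sum_comm (γ := Fin n), 
        ← Finset.sum_sub_distrib]
      refine Finset.sum_congr rfl fun b _ => ?_
      rw [← Finset.sum_sub_distrib]
      refine Finset.sum_eq_single b (fun a _ hab => ?_) (by simp)
      rw [termE_termF_comm hr a b hab, sub_self]
    rw [h, Finset.smul_sum, Finset.sum_congr rfl fun a _ => termE_termF_self a]
    rw [Fin.sum_univ_eq_sum_range (fun a : ℕ => A.termK n a - A.termK n (a + 1)) n,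
      Finset.sum_range_sub', ← PiTensorProduct.map_pow, ← PiTensorProduct.map_pow]
    congr 1
    unfold termK
    congr 1
    ext1 b
    rw [if_pos b.2]
    rfl

end DModule

end TensorPower

/-! ### The braid group and its action -/

/-- The defining relators of the braid group `B_n` on the generators `σ_1, …, σ_{n-1}`, which are
indexed here by `0, …, n - 2`. -/
def braidRelators (n : ℕ) : Set (FreeGroup (Fin (n - 1))) :=
  {x | ∃ a b : Fin (n - 1), (a : ℕ) + 1 = b ∧
    x = .of a * .of b * .of a * (.of b * .of a * .of b)⁻¹} ∪
  {x | ∃ a b : Fin (n - 1), (a : ℕ) + 2 ≤ b ∧ x = .of a * .of b * (.of b * .of a)⁻¹}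

/-- The braid group on `n` strands. -/
abbrev BraidGroup (n : ℕ) : Type := PresentedGroup (braidRelators n)

section Action

variable {r : ℕ} {X : Type*} [AddCommGroup X] [Module ℂ X]

/-- The action of the universal `R`-matrix
`(1 / 4r) ∑_{t,m,m'} {1}^{2t} / {t}! q^{t(t-1)/2 + t(m-m') - mm'/2} E^t k^m ⊗ F^t k^{m'}`
of `D` on the tensor factors `a` and `b` (first and second leg) of `X^{⊗ n}`. -/
def DModule.rMatrix (A : DModule r X) (n : ℕ) (a b : Fin n) :
    Module.End ℂ (⨂[ℂ] _ : Fin n, X) :=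
  (1 / (4 * r : ℂ)) • ∑ t ∈ Finset.range r, ∑ m ∈ Finset.range (4 * r),
    ∑ m' ∈ Finset.range (4 * r),
      (qNum r 1 ^ (2 * t) / qNumFactorial r t *
        qHalf r ^ ((t : ℤ) * (t - 1) + 2 * t * (m - m') - m * m')) •
      PiTensorProduct.map fun c : Fin n =>
        if c = a then A.E ^ t * A.k ^ m else if c = b then A.F ^ t * A.k ^ m' else 1

/-- The operator `1 ⊗ ⋯ ⊗ (τ ∘ R) ⊗ ⋯ ⊗ 1`, the braiding applied to the tensor factors `a, b`. -/
def DModule.braiding (A : DModule r X) (n : ℕ) (a b : Fin n) :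
    Module.End ℂ (⨂[ℂ] _ : Fin n, X) :=
  (PiTensorProduct.reindex ℂ (fun _ : Fin n => X) (Equiv.swap a b)).toLinearMap ∘ₗ
    A.rMatrix n a b

end Action

/-! ### The tensor powers of `V_{r-1}` and their highest weight spaces -/

variable (r : ℕ) (hr : 0 < r) (n : ℕ)

/-- The module `V_{r-1} = V^1_{r-1}`. -/
def steinberg : DModule r (Fin (r - 1 + 1) →₀ ℂ) :=
  simpleModule r 1 (one_pow 4) (r - 1) (Nat.sub_lt hr one_pos)

/-- The vector space `V_{r-1}^{⊗ n}`. -/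
abbrev VPow : Type := ⨂[ℂ] _ : Fin n, (Fin (r - 1 + 1) →₀ ℂ)

/-- The `D`-module `V_{r-1}^{⊗ n}`. -/
def steinbergPow : DModule r (VPow r n) := (steinberg r hr).tensorPower n hr

/-- The operator `1^{⊗ a-1} ⊗ 𝖱 ⊗ 1^{⊗ n-a-1}` through which the generator `σ_a` of the braid group
acts on `V_{r-1}^{⊗ n}`, where `𝖱 = q^{-(r-1)²/2} τ ∘ R`. -/
def braidOp (a : Fin (n - 1)) : Module.End ℂ (VPow r n) :=
  qHalf r ^ (-((r : ℤ) - 1) ^ 2) •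
    (steinberg r hr).braiding n ⟨a, by omega⟩ ⟨a + 1, by omega⟩

/-- The strong weight space `V_{n,ℓ}`, of strong weight `n (r - 1) - 2 ℓ`, spanned by the vectors
`u_{ε_1} ⊗ ⋯ ⊗ u_{ε_n}` with `ε_1 + ⋯ + ε_n = ℓ`. -/
def weightSpace (l : ℕ) : Submodule ℂ (VPow r n) :=
  Submodule.span ℂ {v | ∃ ε : Fin n → Fin (r - 1 + 1), ∑ a, (ε a : ℕ) = l ∧
    v = PiTensorProduct.tprod ℂ fun a => u (r - 1) (ε a)}

/-- The highest strong weight space `W_{n,ℓ} = ker E ∩ V_{n,ℓ}`. -/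
def highestWeightSpace (l : ℕ) : Submodule ℂ (VPow r n) :=
  LinearMap.ker (steinbergPow r hr n).E ⊓ weightSpace r n l

/-- A decomposition of `V_{r-1}^{⊗ n}` as a direct sum of `D`-submodules, each of which is
compatible with the grading by strong weights and isomorphic either to a simple projective module
`V^α_{r-1}` or to one of the modules `P^α_i`. -/
structure Decomposition where
  card : ℕ
  summand : Fin card → Submodule ℂ (VPow r n)
  isInternal : DirectSum.IsInternal summand
  homogeneous : ∀ s, summand s = ⨆ l, summand s ⊓ weightSpace r n l
  type : ∀ s,
    (∃ (α : ℂ) (hα : α ^ 4 = 1)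
      (f : DEmbedding (simpleModule r α hα (r - 1) (Nat.sub_lt hr one_pos)) (steinbergPow r hr n)),
        LinearMap.range f.toLin = summand s) ∨
    (∃ (α : ℂ) (hα : α ^ 4 = 1) (i j : ℕ) (h : i + j + 2 = r)
      (f : DEmbedding (projModule r α hα i j h) (steinbergPow r hr n)),
        LinearMap.range f.toLin = summand s)

variable {r hr n}

namespace Decomposition

variable (𝒟 : Decomposition r hr n) (l : ℕ)

/-- `C_{n,ℓ}`: the span of the highest weight vectors `u_0` of the summands isomorphic to some
`V^α_{r-1}`, as far as they lie in `V_{n,ℓ}`. -/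
def C : Submodule ℂ (VPow r n) :=
  Submodule.span ℂ {v | v ∈ weightSpace r n l ∧ ∃ (s : Fin 𝒟.card) (α : ℂ) (hα : α ^ 4 = 1)
    (f : DEmbedding (simpleModule r α hα (r - 1) (Nat.sub_lt hr one_pos)) (steinbergPow r hr n)),
      LinearMap.range f.toLin = 𝒟.summand s ∧ v = f.toLin (u (r - 1) 0)}

/-- `S_{n,ℓ}`: the span of the socle vectors `w_0^S` of the summands isomorphic to some `P^α_i`,
as far as they lie in `V_{n,ℓ}`. -/
def S : Submodule ℂ (VPow r n) :=
  Submodule.span ℂ {v | v ∈ weightSpace r n l ∧ ∃ (s : Fin 𝒟.card) (α : ℂ) (hα : α ^ 4 = 1)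
    (i j : ℕ) (h : i + j + 2 = r)
    (f : DEmbedding (projModule r α hα i j h) (steinbergPow r hr n)),
      LinearMap.range f.toLin = 𝒟.summand s ∧ v = f.toLin (wS i j 0)}

/-- `R_{n,ℓ}`: the span of the right-most highest weight vectors `w_0^R` of the summands isomorphic
to some `P^α_i`, as far as they lie in `V_{n,ℓ}`. -/
def R : Submodule ℂ (VPow r n) :=
  Submodule.span ℂ {v | v ∈ weightSpace r n l ∧ ∃ (s : Fin 𝒟.card) (α : ℂ) (hα : α ^ 4 = 1)
    (i j : ℕ) (h : i + j + 2 = r)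
    (f : DEmbedding (projModule r α hα i j h) (steinbergPow r hr n)),
      LinearMap.range f.toLin = 𝒟.summand s ∧ v = f.toLin (wR i j 0)}

end Decomposition

end RestrictedSl2

end

open RestrictedSl2

/-! The kernel of `E` is a line in `V^α_{r-1}`, spanned by `u_0`, and a plane in `P^α_i`, spanned by
`w^S_0` and `w^R_0`. Both `E` and the strong grading are compatible with a decomposition, so
`W_{n,ℓ}` is spanned by vectors of these three kinds. The weight decides which kinds occur: the
fourth power of the eigenvalue of `k` forgets `α` and leaves the strong weight modulo `r`, which is
`-(j + 2)` (`dvd_of_k_apply`). This is compatible with `u_0` only if `j = r - 1`, with `w^S_0` only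
in `P^α_{r-2-j}`, and with `w^R_0` only in `P^α_j`. Thus `W = C` or `W = S + R`, and the latter sum
is direct because one summand cannot supply both a `w^S_0` and a `w^R_0` in the same degree.

In `P^α_{r-2-j}` the operator `F^{j+1}` takes `w^R_0` to a non-zero multiple of `w^S_0`. So a vector
`w^S_0` of degree `ℓ` comes from a highest weight vector of degree `ℓ - j - 1`. For `ℓ ≤ j` there is
none, and only `R` is left. For `j < ℓ` the degree `ℓ - j - 1` is in turn one where only `R` occurs,
with `r - 2 - j` in place of `j`, and `F^{j+1}` maps `W_{n,ℓ-j-1}` isomorphically onto `S_{n,ℓ}`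
(`map_F_pow_eq_S`, `eq_zero_of_F_pow_eq_zero`). The braid group commutes with `F`, so this is an
isomorphism of representations.

The dimension of `W_{n,ℓ}` is the number of multi-indices of total `ℓ` with vanishing first entry
(`finrank_highestWeightSpace`). For `ℓ < r` it increases strictly with `ℓ` if `n ≥ 3` and is always
`1` if `n = 2`. Hence `S_{n,ℓ}` is non-zero and proper in the first case and everything in the
second.

Two foundations are needed. A decomposition exists because the tensor power is free over
`ℂ[E]/(E^r)` and over `ℂ[F]/(F^r)` (`isExact_steinbergPow`). In a finite dimensional graded module
with this property the Casimir operator splits every weight space. Where the eigenvalue does not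
match the weight, `F E` is invertible; at the matching weights a complement of the radical is
chosen, and each vector of a basis of these complements generates a copy of some `P^α_i` or
`V^α_{r-1}`. These copies are independent and exhaust the module (`exists_decomposition`).

The braid relations and the commutation with `E` and `F` come from writing the `R`-matrix as a
Cartan part times a quasi-`R`-matrix, which is a truncated `q`-exponential. The latter intertwines
the coproduct with its conjugate (`theta_mul`) and satisfies an addition law (`theta_mul_theta`);
together these give the Yang–Baxter equation (`yang_baxter`). -/

noncomputable section

namespace RestrictedSl2

/-! ### Linear algebra -/

section LinearAlgebra

variable {X Y : Type*} [AddCommGroup X] [Module ℂ X] [AddCommGroup Y] [Module ℂ Y]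

/-- A graded linear map: a homogeneous value is the value at a homogeneous element. -/
theorem exists_mem_of_apply_mem {ι κ : Type*} {N : ι → Submodule ℂ X} {N' : κ → Submodule ℂ Y}
    (hN' : iSupIndep N') {τ : ι → κ} (hτ : Function.Injective τ) (T : X →ₗ[ℂ] Y)
    (hT : ∀ i, ∀ x ∈ N i, T x ∈ N' (τ i)) {w : X} (hw : w ∈ ⨆ i, N i) (i : ι)
    (hTw : T w ∈ N' (τ i)) : ∃ w' ∈ N i, T w' = T w := by
  have h1 : w ∈ N i ⊔ ⨆ j, ⨆ _ : j ≠ i, N j := by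
    refine (iSup_le fun j => ?_ : (⨆ i, N i) ≤ _) hw
    by_cases h : j = i
    · subst h; exact le_sup_left
    · exact le_sup_of_le_right (le_iSup₂_of_le j h le_rfl)
  obtain ⟨w', hw', w'', hw'', rfl⟩ := Submodule.mem_sup.1 h1
  refine ⟨w', hw', ?_⟩
  -- `T w'' = T w - T w'` has degree `τ i`, but by injectivity of `τ` its components lie in other
  -- degrees; so it is zero.
  have h2 : T w'' ∈ ⨆ j, ⨆ _ : j ≠ τ i, N' j := by
    have : (⨆ j, ⨆ _ : j ≠ i, N j) ≤ (⨆ j, ⨆ _ : j ≠ τ i, N' j).comap T := by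
      refine iSup₂_le fun j hj x hx => ?_
      exact Submodule.mem_iSup_of_mem (τ j)
        (Submodule.mem_iSup_of_mem (hτ.ne hj) (hT j x hx))
    exact this hw''
  have h3 : T w'' ∈ N' (τ i) := by
    have := Submodule.sub_mem _ hTw (hT i w' hw')
    rwa [map_add, add_sub_cancel_left] at this
  rw [map_add, Submodule.disjoint_def.1 (hN' (τ i)) _ h3 h2, add_zero]

/-- Submodules stable under a nilpotent operator are independent as soon as their intersections
with its kernel are. -/
theorem iSupIndep_of_inf_ker {ι : Type*} (N : ι → Submodule ℂ X) (E : Module.End ℂ X) {p : ℕ}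
    (hE : E ^ p = 0) (hN : ∀ i, ∀ x ∈ N i, E x ∈ N i)
    (h : iSupIndep fun i => N i ⊓ LinearMap.ker E) : iSupIndep N := by
  rw [iSupIndep_iff_finsetSum_eq_zero_imp_eq_zero] at h ⊢
  intro s v hv h0
  -- If all `E^{t+1} (v i)` vanish, then the `E^t (v i)` lie in the kernels and add up to zero, so
  -- they vanish as well. The exponent thus descends from `p` to `0`.
  have key : ∀ t, (∀ i ∈ s, (E ^ t) (v i) = 0) → ∀ i ∈ s, v i = 0 := by
    intro t
    induction t with
    | zero => exact fun h i hi => h i hi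
    | succ t ih =>
      intro ht
      refine ih (h s (fun i => (E ^ t) (v i)) (fun i hi => ⟨?_, ?_⟩) ?_)
      · have : ∀ t, (E ^ t) (v i) ∈ N i := by
          intro t
          induction t with
          | zero => exact hv i hi
          | succ t ih => rw [pow_succ']; exact hN i _ ih
        exact this t
      · have := ht i hi
        rwa [pow_succ'] at this
      · rw [← map_sum, h0, map_zero]
  exact key p fun i _ => by rw [hE]; rfl

/-- The powers of `E` applied to a vector of `ker f` stay in `ker f`, and the last non-zero one lies
in `ker E`. Injectivity need therefore be tested on highest weight vectors only. -/
theorem injective_of_ker_nilpotent {E : Module.End ℂ X} {E' : Module.End ℂ Y} {p : ℕ}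
    (hE : E ^ p = 0) (f : X →ₗ[ℂ] Y) (hf : ∀ x, f (E x) = E' (f x))
    (h : ∀ x, E x = 0 → f x = 0 → x = 0) : Function.Injective f := by
  rw [injective_iff_map_eq_zero]
  intro x hx
  have hx' : ∀ t, f ((E ^ t) x) = 0 := by
    intro t
    induction t with
    | zero => exact hx
    | succ t ih => rw [pow_succ', Module.End.mul_apply, hf, ih, map_zero]
  have key : ∀ t, (E ^ t) x = 0 → x = 0 := by
    intro t
    induction t with
    | zero => exact id
    | succ t ih =>
      intro ht
      rw [pow_succ'] at ht
      exact ih (h _ ht (hx' t))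
  exact key p (by rw [hE]; rfl)

/-- An injective endomorphism preserves a finite dimensional subspace only by a surjection. -/
theorem exists_mem_apply_eq [FiniteDimensional ℂ X] (p : Submodule ℂ X) (T : Module.End ℂ X)
    (hT : ∀ x ∈ p, T x ∈ p) (h : ∀ x ∈ p, T x = 0 → x = 0) {y : X} (hy : y ∈ p) :
    ∃ x ∈ p, T x = y := by
  have hinj : Function.Injective (T.restrict hT) := by
    rw [injective_iff_map_eq_zero]
    intro x hx
    exact Subtype.ext (h x x.2 (congrArg Subtype.val hx))
  obtain ⟨x, hx⟩ := LinearMap.injective_iff_surjective.1 hinj ⟨y, hy⟩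
  exact ⟨x, x.2, congrArg Subtype.val hx⟩

end LinearAlgebra

/-! ### Quantum numbers -/

theorem qHalf_primitive {r : ℕ} (hr : 0 < r) : IsPrimitiveRoot (qHalf r) (4 * r) := by
  have := Complex.isPrimitiveRoot_exp (4 * r) (by omega)
  convert this using 1
  rw [qHalf]
  congr 1
  push_cast
  have : (r : ℂ) ≠ 0 := by exact_mod_cast hr.ne'
  field_simp
  ring

theorem qHalf_zpow_eq_iff {r : ℕ} (hr : 0 < r) (x y : ℤ) :
    qHalf r ^ x = qHalf r ^ y ↔ ((4 * r : ℕ) : ℤ) ∣ x - y := by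
  rw [← (qHalf_primitive hr).zpow_eq_one_iff_dvd, zpow_sub₀ (qHalf_ne_zero r),
    div_eq_one_iff_eq (zpow_ne_zero _ (qHalf_ne_zero r))]

theorem q_zpow_eq_iff {r : ℕ} (hr : 0 < r) (x y : ℤ) :
    q r ^ x = q r ^ y ↔ ((2 * r : ℕ) : ℤ) ∣ x - y := by
  rw [← qHalf_zpow_two_mul, ← qHalf_zpow_two_mul, qHalf_zpow_eq_iff hr, ← mul_sub,
    show ((4 * r : ℕ) : ℤ) = 2 * (2 * r : ℕ) by push_cast; ring]
  exact mul_dvd_mul_iff_left two_ne_zero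

theorem qNum_add_r {r : ℕ} (hr : 0 < r) (x : ℤ) : qNum r (x + r) = -qNum r x := by
  have h := q_zpow_add_r hr (-(x + r))
  rw [show -(x + (r : ℤ)) + r = -x by ring] at h
  rw [qNum, q_zpow_add_r hr, qNum, h]
  ring

theorem qNum_neg (r : ℕ) (x : ℤ) : qNum r (-x) = -qNum r x := by
  simp [qNum]

theorem qInt_add_r {r : ℕ} (hr : 0 < r) (x : ℤ) : qInt r (x + r) = -qInt r x := by
  rw [qInt, qNum_add_r hr, qInt, neg_div]

theorem qInt_neg (r : ℕ) (x : ℤ) : qInt r (-x) = -qInt r x := by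
  rw [qInt, qNum_neg, qInt, neg_div]

/-- With `i + j + 2 = r` this gives `[j] = [i + 2]`, which relates the coefficients on the two
halves of `P^α_i`. -/
theorem qInt_r_sub {r : ℕ} (hr : 0 < r) (x : ℤ) : qInt r (r - x) = qInt r x := by
  rw [show (r : ℤ) - x = -x + r by ring, qInt_add_r hr, qInt_neg, neg_neg]

theorem qInt_one {r : ℕ} (hr : 2 ≤ r) : qInt r 1 = 1 := div_self (qNum_one_ne_zero hr)

theorem qInt_zero (r : ℕ) : qInt r 0 = 0 := by simp [qInt, qNum]

theorem qNum_eq_zero_iff {r : ℕ} (hr : 0 < r) (x : ℤ) : qNum r x = 0 ↔ (r : ℤ) ∣ x := by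
  rw [qNum, sub_eq_zero, q_zpow_eq_iff hr, sub_neg_eq_add, ← two_mul, Nat.cast_mul]
  exact mul_dvd_mul_iff_left two_ne_zero

theorem qInt_ne_zero {r : ℕ} (hr : 2 ≤ r) {x : ℤ} (hx : ¬ (r : ℤ) ∣ x) : qInt r x ≠ 0 :=
  div_ne_zero (mt (qNum_eq_zero_iff (by omega) x).1 hx) (qNum_one_ne_zero hr)

theorem qInt_ne_zero_of_lt {r : ℕ} (hr : 2 ≤ r) {x : ℤ} (h0 : 0 < x) (hx : x < r) :
    qInt r x ≠ 0 :=
  qInt_ne_zero hr fun h => absurd (Int.le_of_dvd h0 h) (by omega)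

theorem q_sub_inv_ne_zero {r : ℕ} (hr : 2 ≤ r) : q r - (q r)⁻¹ ≠ 0 := by
  have := qNum_one_ne_zero hr
  simpa [qNum] using this

theorem q_zpow_sub (r : ℕ) (hr : 2 ≤ r) (x : ℤ) :
    q r ^ x - q r ^ (-x) = (q r - (q r)⁻¹) * qInt r x := by
  have h : q r - (q r)⁻¹ = qNum r 1 := by simp [qNum]
  rw [h, qInt, mul_div_cancel₀ _ (qNum_one_ne_zero hr), qNum]

/-- `[m + 1] [p - m] - [m] [p - m + 1] = [p - 2 m]`. -/
theorem qInt_mul_sub {r : ℕ} (hr : 2 ≤ r) (p m : ℤ) :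
    qInt r (m + 1) * qInt r (p - m) = qInt r m * qInt r (p - m + 1) + qInt r (p - 2 * m) := by
  have := qInt_identity hr m (p - m)
  rw [q_zpow_sub r hr, show p - m - m = p - 2 * m by ring] at this
  have h := mul_left_cancel₀ (q_sub_inv_ne_zero hr) this
  linear_combination h

/-- `[m + 1] [p - m] - [m] [p - m - 1] = [p]`. -/
theorem qInt_mul_sub' {r : ℕ} (hr : 2 ≤ r) (p m : ℤ) :
    qInt r (m + 1) * qInt r (p - m) = qInt r m * qInt r (p - m - 1) + qInt r p := by
  -- The substitution `p ↦ 2m - p` changes every sign and turns the first identity into the second.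
  have := qInt_mul_sub hr (2 * m - p) m
  rw [show 2 * m - p - m = -(p - m) by ring, show -(p - m) + 1 = -(p - m - 1) by ring,
    show 2 * m - p - 2 * m = -p by ring, qInt_neg, qInt_neg, qInt_neg] at this
  linear_combination -this

theorem gam_ne_zero {r i m : ℕ} (hi : i + 1 < r) (h0 : 0 < m) (hm : m ≤ i) : gam r i m ≠ 0 :=
  mul_ne_zero (qInt_ne_zero_of_lt (by omega) (by omega) (by omega))
    (qInt_ne_zero_of_lt (by omega) (by omega) (by omega))

end RestrictedSl2

end

noncomputable section

namespace RestrictedSl2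

theorem single_H {i j m : ℕ} (hm : m < i + 1) :
    Finsupp.single (PIdx.H (j := j) ⟨m, hm⟩) (1 : ℂ) = wH i j m := single_eq_wH _

theorem single_S {i j m : ℕ} (hm : m < i + 1) :
    Finsupp.single (PIdx.S (j := j) ⟨m, hm⟩) (1 : ℂ) = wS i j m := single_eq_wS _

theorem single_L {i j m : ℕ} (hm : m < j + 1) :
    Finsupp.single (PIdx.L (i := i) ⟨m, hm⟩) (1 : ℂ) = wL i j m := single_eq_wL _

theorem single_R {i j m : ℕ} (hm : m < j + 1) :
    Finsupp.single (PIdx.R (i := i) ⟨m, hm⟩) (1 : ℂ) = wR i j m := single_eq_wR _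

theorem single_u {i m : ℕ} (hm : m < i + 1) :
    Finsupp.single (⟨m, hm⟩ : Fin (i + 1)) (1 : ℂ) = u i m := single_eq_u _

/-! ### The kernel of `E` on the indecomposable projective modules -/

theorem wH_apply_H (i j m : ℕ) (p : Fin (i + 1)) : wH i j m (.H p) = if m = p then 1 else 0 := by
  unfold wH
  split_ifs <;> simp_all [Fin.ext_iff]
  omega

theorem wS_apply_S (i j m : ℕ) (p : Fin (i + 1)) : wS i j m (.S p) = if m = p then 1 else 0 := by
  unfold wS
  split_ifs <;> simp_all [Fin.ext_iff]
  omega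

theorem wL_apply_L (i j m : ℕ) (p : Fin (j + 1)) : wL i j m (.L p) = if m = p then 1 else 0 := by
  unfold wL
  split_ifs <;> simp_all [Fin.ext_iff]
  omega

theorem wR_apply_R (i j m : ℕ) (p : Fin (j + 1)) : wR i j m (.R p) = if m = p then 1 else 0 := by
  unfold wR
  split_ifs <;> simp_all [Fin.ext_iff]
  omega

@[simp] theorem wH_apply_S (i j m : ℕ) (p) : wH i j m (.S p) = 0 := by
  unfold wH; split_ifs <;> simp

@[simp] theorem wH_apply_L (i j m : ℕ) (p) : wH i j m (.L p) = 0 := by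
  unfold wH; split_ifs <;> simp

@[simp] theorem wH_apply_R (i j m : ℕ) (p) : wH i j m (.R p) = 0 := by
  unfold wH; split_ifs <;> simp

@[simp] theorem wS_apply_H (i j m : ℕ) (p) : wS i j m (.H p) = 0 := by
  unfold wS; split_ifs <;> simp

@[simp] theorem wS_apply_L (i j m : ℕ) (p) : wS i j m (.L p) = 0 := by
  unfold wS; split_ifs <;> simp

@[simp] theorem wS_apply_R (i j m : ℕ) (p) : wS i j m (.R p) = 0 := by
  unfold wS; split_ifs <;> simp

@[simp] theorem wL_apply_H (i j m : ℕ) (p) : wL i j m (.H p) = 0 := by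
  unfold wL; split_ifs <;> simp

@[simp] theorem wL_apply_S (i j m : ℕ) (p) : wL i j m (.S p) = 0 := by
  unfold wL; split_ifs <;> simp

@[simp] theorem wL_apply_R (i j m : ℕ) (p) : wL i j m (.R p) = 0 := by
  unfold wL; split_ifs <;> simp

@[simp] theorem wR_apply_H (i j m : ℕ) (p) : wR i j m (.H p) = 0 := by
  unfold wR; split_ifs <;> simp

@[simp] theorem wR_apply_S (i j m : ℕ) (p) : wR i j m (.S p) = 0 := by
  unfold wR; split_ifs <;> simp

@[simp] theorem wR_apply_L (i j m : ℕ) (p) : wR i j m (.L p) = 0 := by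
  unfold wR; split_ifs <;> simp

theorem lhom_ext_apply {ι Y : Type*} [AddCommGroup Y] [Module ℂ Y] {f g : (ι →₀ ℂ) →ₗ[ℂ] Y}
    (h : ∀ b, f (Finsupp.single b 1) = g (Finsupp.single b 1)) (x : ι →₀ ℂ) : f x = g x :=
  LinearMap.congr_fun (Finsupp.lhom_ext' fun b => LinearMap.ext_ring (h b)) x

/-- This formula and those that follow transpose the table of `E`: a coordinate of `E x` involves at
most two coordinates of `x`. The kernel is then found by solving for the coordinates one at a time.
-/
theorem projE_apply_H {r i j : ℕ} (x : PIdx i j →₀ ℂ) (m : ℕ) (hm : m + 1 < i + 1) :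
    projE r i j x (.H ⟨m, by omega⟩) = gam r i (m + 1) * x (.H ⟨m + 1, hm⟩) := by
  refine lhom_ext_apply (f := Finsupp.lapply _ ∘ₗ projE r i j)
    (g := gam r i (m + 1) • Finsupp.lapply _) (fun b => ?_) x
  rcases b with p | p | p | p
  · rw [LinearMap.comp_apply, single_eq_wH, projE_wH (by omega)]
    split_ifs with h
    · simp [wH_apply_H, h]
    · by_cases h' : (p : ℕ) = m + 1
      · simp [wH_apply_H, h']
      · have h'' : ¬ (p : ℕ) - 1 = m := by omega
        simp [wH_apply_H, h', h'']
  · rw [LinearMap.comp_apply, single_eq_wS, projE_wS (by omega)]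
    split_ifs <;> simp
  · rw [LinearMap.comp_apply, single_eq_wL, projE_wL (by omega)]
    split_ifs <;> simp
  · rw [LinearMap.comp_apply, single_eq_wR, projE_wR (by omega)]
    split_ifs <;> simp

theorem projE_apply_L {r i j : ℕ} (x : PIdx i j →₀ ℂ) (m : ℕ) (hm : m + 1 < j + 1) :
    projE r i j x (.L ⟨m, by omega⟩) = -gam r j (m + 1) * x (.L ⟨m + 1, hm⟩) := by
  refine lhom_ext_apply (f := Finsupp.lapply _ ∘ₗ projE r i j)
    (g := -gam r j (m + 1) • Finsupp.lapply _) (fun b => ?_) x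
  rcases b with p | p | p | p
  · rw [LinearMap.comp_apply, single_eq_wH, projE_wH (by omega)]
    split_ifs <;> simp
  · rw [LinearMap.comp_apply, single_eq_wS, projE_wS (by omega)]
    split_ifs <;> simp
  · rw [LinearMap.comp_apply, single_eq_wL, projE_wL (by omega)]
    split_ifs with h
    · simp [wL_apply_L, h]
    · by_cases h' : (p : ℕ) = m + 1
      · simp [wL_apply_L, h']
      · have h'' : ¬ (p : ℕ) - 1 = m := by omega
        simp [wL_apply_L, h', h'']
  · rw [LinearMap.comp_apply, single_eq_wR, projE_wR (by omega)]
    split_ifs <;> simp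

theorem projE_apply_R {r i j : ℕ} (x : PIdx i j →₀ ℂ) (m : ℕ) (hm : m + 1 < j + 1) :
    projE r i j x (.R ⟨m, by omega⟩) = x (.R ⟨m + 1, hm⟩) := by
  refine lhom_ext_apply (f := Finsupp.lapply _ ∘ₗ projE r i j)
    (g := Finsupp.lapply _) (fun b => ?_) x
  rcases b with p | p | p | p
  · rw [LinearMap.comp_apply, single_eq_wH, projE_wH (by omega)]
    split_ifs with h
    · have : ¬ j = m := by omega
      simp [wR_apply_R, this]
    · simp
  · rw [LinearMap.comp_apply, single_eq_wS, projE_wS (by omega)]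
    split_ifs <;> simp
  · rw [LinearMap.comp_apply, single_eq_wL, projE_wL (by omega)]
    split_ifs <;> simp
  · rw [LinearMap.comp_apply, single_eq_wR, projE_wR (by omega)]
    split_ifs with h
    · simp [wR_apply_R, h]
    · by_cases h' : (p : ℕ) = m + 1
      · simp [wR_apply_R, h']
      · have h'' : ¬ (p : ℕ) - 1 = m := by omega
        simp [wR_apply_R, h', h'']

theorem projE_apply_R_last {r i j : ℕ} (x : PIdx i j →₀ ℂ) :
    projE r i j x (.R ⟨j, by omega⟩) = x (.H ⟨0, by omega⟩) := by
  refine lhom_ext_apply (f := Finsupp.lapply _ ∘ₗ projE r i j)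
    (g := Finsupp.lapply _) (fun b => ?_) x
  rcases b with p | p | p | p
  · rw [LinearMap.comp_apply, single_eq_wH, projE_wH (by omega)]
    split_ifs with h
    · simp [wR_apply_R, wH_apply_H, h]
    · simp [wH_apply_H, h]
  · rw [LinearMap.comp_apply, single_eq_wS, projE_wS (by omega)]
    split_ifs <;> simp
  · rw [LinearMap.comp_apply, single_eq_wL, projE_wL (by omega)]
    split_ifs <;> simp
  · rw [LinearMap.comp_apply, single_eq_wR, projE_wR (by omega)]
    split_ifs with h
    · simp
    · have h'' : ¬ (p : ℕ) - 1 = j := by omega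
      simp [wR_apply_R, h'']

theorem projE_apply_S {r i j : ℕ} (x : PIdx i j →₀ ℂ) (m : ℕ) (hm : m + 1 < i + 1) :
    projE r i j x (.S ⟨m, by omega⟩) =
      x (.H ⟨m + 1, hm⟩) + gam r i (m + 1) * x (.S ⟨m + 1, hm⟩) := by
  refine lhom_ext_apply (f := Finsupp.lapply _ ∘ₗ projE r i j)
    (g := Finsupp.lapply _ + gam r i (m + 1) • Finsupp.lapply _) (fun b => ?_) x
  rcases b with p | p | p | p
  · rw [LinearMap.comp_apply, single_eq_wH, projE_wH (by omega)]
    split_ifs with h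
    · simp [wH_apply_H, h]
    · by_cases h' : (p : ℕ) = m + 1
      · simp [wH_apply_H, wS_apply_S, h']
      · have h'' : ¬ (p : ℕ) - 1 = m := by omega
        simp [wH_apply_H, wS_apply_S, h', h'']
  · rw [LinearMap.comp_apply, single_eq_wS, projE_wS (by omega)]
    split_ifs with h
    · simp [wS_apply_S, h]
    · by_cases h' : (p : ℕ) = m + 1
      · simp [wS_apply_S, h']
      · have h'' : ¬ (p : ℕ) - 1 = m := by omega
        simp [wS_apply_S, h', h'']
  · rw [LinearMap.comp_apply, single_eq_wL, projE_wL (by omega)]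
    split_ifs with h
    · have : ¬ i = m := by omega
      simp [wS_apply_S, this]
    · simp
  · rw [LinearMap.comp_apply, single_eq_wR, projE_wR (by omega)]
    split_ifs <;> simp

theorem projE_apply_S_last {r i j : ℕ} (x : PIdx i j →₀ ℂ) :
    projE r i j x (.S ⟨i, by omega⟩) = x (.L ⟨0, by omega⟩) := by
  refine lhom_ext_apply (f := Finsupp.lapply _ ∘ₗ projE r i j)
    (g := Finsupp.lapply _) (fun b => ?_) x
  rcases b with p | p | p | p
  · rw [LinearMap.comp_apply, single_eq_wH, projE_wH (by omega)]
    split_ifs with h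
    · simp
    · have h'' : ¬ (p : ℕ) - 1 = i := by omega
      simp [wS_apply_S, h'']
  · rw [LinearMap.comp_apply, single_eq_wS, projE_wS (by omega)]
    split_ifs with h
    · simp
    · have h'' : ¬ (p : ℕ) - 1 = i := by omega
      simp [wS_apply_S, h'']
  · rw [LinearMap.comp_apply, single_eq_wL, projE_wL (by omega)]
    split_ifs with h
    · simp [wL_apply_L, wS_apply_S, h]
    · simp [wL_apply_L, h]
  · rw [LinearMap.comp_apply, single_eq_wR, projE_wR (by omega)]
    split_ifs <;> simp

/-- The kernel of `E` on `P_i` is spanned by `w_0^S` and `w_0^R`. -/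
theorem projE_eq_zero {r i j : ℕ} (h : i + j + 2 = r) {x : PIdx i j →₀ ℂ}
    (hx : projE r i j x = 0) : ∃ a b : ℂ, x = a • wS i j 0 + b • wR i j 0 := by
  -- The `H`-coordinates have to vanish first, since they enter the equations for the
  -- `S`-coordinates.
  have hH : ∀ m : Fin (i + 1), x (.H m) = 0 := by
    rintro ⟨m, hm⟩
    rcases m with _ | m
    · have := projE_apply_R_last (r := r) x
      rw [hx] at this
      exact this.symm
    · have := projE_apply_H (r := r) x m hm
      rw [hx] at this
      exact (mul_eq_zero.1 this.symm).resolve_left (gam_ne_zero (by omega) (by omega) (by omega))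
  refine ⟨x (.S ⟨0, by omega⟩), x (.R ⟨0, by omega⟩), Finsupp.ext fun c => ?_⟩
  rcases c with ⟨m, hm⟩ | ⟨m, hm⟩ | ⟨m, hm⟩ | ⟨m, hm⟩
  · simp [hH]
  · rcases m with _ | m
    · simp [wS_apply_S]
    · have := projE_apply_S (r := r) x m hm
      rw [hx, hH, zero_add] at this
      have h0 := (mul_eq_zero.1 this.symm).resolve_left
        (gam_ne_zero (by omega) (by omega) (by omega))
      simp [wS_apply_S, h0]
  · have : x (.L ⟨m, hm⟩) = 0 := by
      rcases m with _ | m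
      · have := projE_apply_S_last (r := r) x
        rw [hx] at this
        exact this.symm
      · have := projE_apply_L (r := r) x m hm
        rw [hx] at this
        exact (mul_eq_zero.1 this.symm).resolve_left
          (neg_ne_zero.2 (gam_ne_zero (by omega) (by omega) (by omega)))
    simp [this]
  · rcases m with _ | m
    · simp [wR_apply_R]
    · have := projE_apply_R (r := r) x m hm
      rw [hx] at this
      simp [wR_apply_R, this.symm]

/-- No value of `F` has a component along `w^R_0`, whereas `w^S_0` is a value of `F`. This separates
the two highest weight vectors whatever isomorphism with `P^α_i` is used. -/
theorem projF_apply_R_zero {r i j : ℕ} (x : PIdx i j →₀ ℂ) :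
    projF r i j x (.R ⟨0, by omega⟩) = 0 := by
  refine lhom_ext_apply (f := Finsupp.lapply _ ∘ₗ projF r i j) (g := 0) (fun b => ?_) x
  rcases b with p | p | p | p
  · rw [LinearMap.comp_apply, single_eq_wH, projF_wH (by omega)]
    split_ifs <;> simp
  · rw [LinearMap.comp_apply, single_eq_wS, projF_wS (by omega)]
    simp
  · rw [LinearMap.comp_apply, single_eq_wL, projF_wL (by omega)]
    simp
  · rw [LinearMap.comp_apply, single_eq_wR, projF_wR (by omega)]
    split_ifs
    · simp
    · simp [wR_apply_R]

theorem u_apply (i m : ℕ) (p : Fin (i + 1)) : u i m p = if m = p then 1 else 0 := by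
  unfold u
  split_ifs <;> simp_all [Fin.ext_iff]
  omega

/-- On the simple module `V_i`, the kernel of `E` is spanned by `u_0`. -/
theorem simpleE_eq_zero {i : ℕ} {x : Fin (i + 1) →₀ ℂ} (hx : simpleE i x = 0) :
    ∃ a : ℂ, x = a • u i 0 := by
  have key : ∀ m (hm : m + 1 < i + 1), simpleE i x ⟨m, by omega⟩ = x ⟨m + 1, hm⟩ := by
    intro m hm
    refine lhom_ext_apply (f := Finsupp.lapply _ ∘ₗ simpleE i)
      (g := Finsupp.lapply _) (fun b => ?_) x
    rw [LinearMap.comp_apply, single_eq_u, simpleE_u (by omega)]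
    split_ifs with h
    · simp [u_apply, h]
    · have h2 : (b : ℕ) - 1 = m ↔ (b : ℕ) = m + 1 := by omega
      simp [u_apply, h2]
  refine ⟨x ⟨0, by omega⟩, Finsupp.ext fun ⟨m, hm⟩ => ?_⟩
  rcases m with _ | m
  · simp [u]
  · rw [← key m hm, hx]
    simp [u]

/-! ### Embeddings of the simple and of the indecomposable projective modules -/

namespace DModule

section Embedding

variable {r : ℕ} {X : Type*} [AddCommGroup X] [Module ℂ X] {A : DModule r X}

theorem pow_succ_apply (T : Module.End ℂ X) (m : ℕ) (x : X) :
    (T ^ (m + 1)) x = T ((T ^ m) x) := by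
  rw [pow_succ', Module.End.mul_apply]

theorem kinv_apply (hr : 0 < r) {ζ : ℂ} (hζ : ζ ≠ 0) {x : X} (hx : A.k x = ζ • x) :
    A.kinv x = ζ⁻¹ • x := by
  have h := LinearMap.congr_fun (kinv_mul_k (A := A) hr) x
  rw [Module.End.mul_apply, hx, map_smul, Module.End.one_apply] at h
  rw [← h, smul_smul, inv_mul_cancel₀ hζ, one_smul, h]

theorem k_E_apply {ζ : ℂ} {x : X} (hx : A.k x = ζ • x) :
    A.k (A.E x) = (q r * ζ) • A.E x := by
  have h := LinearMap.congr_fun A.k_mul_E x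
  rw [Module.End.mul_apply] at h
  rw [h, LinearMap.smul_apply, Module.End.mul_apply, hx, map_smul, smul_smul]

theorem k_F_apply {ζ : ℂ} {x : X} (hx : A.k x = ζ • x) :
    A.k (A.F x) = ((q r)⁻¹ * ζ) • A.F x := by
  have h := LinearMap.congr_fun A.k_mul_F x
  rw [Module.End.mul_apply] at h
  rw [h, LinearMap.smul_apply, Module.End.mul_apply, hx, map_smul, smul_smul]

theorem weight_E {α : ℂ} {p : ℤ} {x : X} (hx : A.k x = (α * qHalf r ^ p) • x) :
    A.k (A.E x) = (α * qHalf r ^ (p + 2)) • A.E x := by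
  rw [k_E_apply hx, weight_add_two]

theorem weight_F {α : ℂ} {p : ℤ} {x : X} (hx : A.k x = (α * qHalf r ^ p) • x) :
    A.k (A.F x) = (α * qHalf r ^ (p - 2)) • A.F x := by
  have h := weight_add_two r α (p - 2)
  rw [sub_add_cancel] at h
  rw [k_F_apply hx, h, inv_mul_cancel_left₀ (q_ne_zero r)]

theorem weight_E_pow {α : ℂ} {p : ℤ} {x : X} (hx : A.k x = (α * qHalf r ^ p) • x) (m : ℕ) :
    A.k ((A.E ^ m) x) = (α * qHalf r ^ (p + 2 * m)) • (A.E ^ m) x := by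
  induction m with
  | zero => simpa using hx
  | succ m ih =>
    rw [pow_succ', Module.End.mul_apply, weight_E ih]
    push_cast
    congr 3
    ring

/-- The operator `α² F`. -/
def scaledF (A : DModule r X) (α : ℂ) : Module.End ℂ X := α ^ 2 • A.F

theorem weight_scaledF_pow {α : ℂ} {p : ℤ} {x : X} (hx : A.k x = (α * qHalf r ^ p) • x) (m : ℕ) :
    A.k ((A.scaledF α ^ m) x) = (α * qHalf r ^ (p - 2 * m)) • (A.scaledF α ^ m) x := by
  induction m with
  | zero => simpa using hx
  | succ m ih =>
    rw [pow_succ', Module.End.mul_apply, scaledF, LinearMap.smul_apply, map_smul, ← scaledF,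
      weight_F ih, smul_comm]
    push_cast
    congr 3
    ring

theorem F_eq_scaledF {α : ℂ} (hα : α ^ 4 = 1) (x : X) : A.F x = α ^ 2 • A.scaledF α x := by
  rw [scaledF, LinearMap.smul_apply, smul_smul, ← pow_add, hα, one_smul]

/-- The relation for `[E, F]` produces `α² [p]` on such a vector. Because `α⁴ = 1`, passing to `α²
F` removes `α`, and all twists can be treated alike. -/
theorem E_scaledF (hr : 2 ≤ r) {α : ℂ} (hα : α ^ 4 = 1) {p : ℤ} {x : X}
    (hx : A.k x = (α * qHalf r ^ p) • x) :
    A.E (A.scaledF α x) = A.scaledF α (A.E x) + qInt r p • x := by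
  have h := LinearMap.congr_fun A.E_F x
  have hkinv := kinv_apply (by omega) (weight_ne_zero r hα p) hx
  simp only [LinearMap.smul_apply, LinearMap.sub_apply, Module.End.mul_apply, pow_two] at h
  rw [hx, hkinv, map_smul, map_smul, hx, hkinv, smul_smul, smul_smul, ← pow_two, ← pow_two,
    weight_sq, weight_inv_sq r hα, ← sub_smul, ← mul_sub, q_zpow_sub r hr, mul_left_comm,
    mul_smul] at h
  have h' := smul_right_injective X (q_sub_inv_ne_zero hr) h
  simp only [scaledF, LinearMap.smul_apply, map_smul]
  rw [sub_eq_iff_eq_add] at h'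
  rw [h', smul_add, smul_smul, ← mul_assoc, ← pow_add, hα, one_mul, add_comm]

/-- The usual `sl₂` ladder: each further `F` contributes one more commutator, and `qInt_mul_sub`
sums the contributions to a product. -/
theorem E_scaledF_pow (hr : 2 ≤ r) {α : ℂ} (hα : α ^ 4 = 1) {p : ℤ} {x : X}
    (hx : A.k x = (α * qHalf r ^ p) • x) (m : ℕ) :
    A.E ((A.scaledF α ^ (m + 1)) x) = (A.scaledF α ^ (m + 1)) (A.E x) +
      (qInt r (m + 1) * qInt r (p - m)) • (A.scaledF α ^ m) x := by
  induction m with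
  | zero =>
    simp only [zero_add, pow_one, pow_zero, Module.End.one_apply, Nat.cast_zero, sub_zero]
    rw [E_scaledF hr hα hx, qInt_one hr, one_mul]
  | succ m ih =>
    rw [pow_succ', Module.End.mul_apply, E_scaledF hr hα (weight_scaledF_pow hx (m + 1)), ih,
      map_add, map_smul, ← pow_succ_apply, ← pow_succ_apply, add_assoc, ← add_smul]
    have := qInt_mul_sub hr p ((m : ℤ) + 1)
    rw [show p - ((m : ℤ) + 1) + 1 = p - m by ring] at this
    push_cast
    rw [this, pow_succ' _ (m + 1)]

theorem scaledF_pow_eq_zero (α : ℂ) : A.scaledF α ^ r = 0 := by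
  rw [scaledF, smul_pow, A.F_pow, smul_zero]

section Projective

variable (A) (α : ℂ) (i j : ℕ) (h : X)

/-- The images of the basis of `P^α_i` under the homomorphism that maps `w_0^H` to `h`. -/
def projVec : PIdx i j → X
  | .H m => (A.scaledF α ^ (m : ℕ)) h
  | .S m => (A.scaledF α ^ ((m : ℕ) + 1)) (A.E h)
  | .L m => (A.scaledF α ^ (i + 1 + (m : ℕ))) h
  | .R m => (A.E ^ (j + 1 - (m : ℕ))) h

/-- The linear map that underlies the homomorphism that maps `w_0^H` to `h`. -/
def projMap : (PIdx i j →₀ ℂ) →ₗ[ℂ] X := Finsupp.linearCombination ℂ (A.projVec α i j h)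

variable {A α i j h}

theorem projMap_wH {m : ℕ} (hm : m ≤ i) :
    A.projMap α i j h (wH i j m) = (A.scaledF α ^ m) h := by
  rw [wH, dif_pos (by omega)]
  simp [projMap, projVec]

theorem projMap_wS {m : ℕ} (hm : m ≤ i) :
    A.projMap α i j h (wS i j m) = (A.scaledF α ^ (m + 1)) (A.E h) := by
  rw [wS, dif_pos (by omega)]
  simp [projMap, projVec]

theorem projMap_wL {m : ℕ} (hm : m ≤ j) :
    A.projMap α i j h (wL i j m) = (A.scaledF α ^ (i + 1 + m)) h := by
  rw [wL, dif_pos (by omega)]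
  simp [projMap, projVec]

theorem projMap_wR {m : ℕ} (hm : m ≤ j) :
    A.projMap α i j h (wR i j m) = (A.E ^ (j + 1 - m)) h := by
  rw [wR, dif_pos (by omega)]
  simp [projMap, projVec]

theorem projMap_k (hα : α ^ 4 = 1) (hij : i + j + 2 = r)
    (hk : A.k h = (α * qHalf r ^ (i : ℤ)) • h) (x : PIdx i j →₀ ℂ) :
    A.projMap α i j h ((projModule r α hα i j hij).k x) = A.k (A.projMap α i j h x) := by
  refine lhom_ext_apply (f := A.projMap α i j h ∘ₗ (projModule r α hα i j hij).k)
    (g := A.k ∘ₗ A.projMap α i j h) (fun b => ?_) x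
  simp only [LinearMap.comp_apply, projModule, diag_single, map_smul]
  have hE := weight_E hk
  rcases b with m | m | m | m
  · rw [single_eq_wH, projMap_wH (by omega), weight_scaledF_pow hk, projWeight]
  · rw [single_eq_wS, projMap_wS (by omega), weight_scaledF_pow hE, projWeight]
    congr 3
    push_cast
    ring
  · rw [single_eq_wL, projMap_wL (by omega), weight_scaledF_pow hk, projWeight]
    congr 3
    push_cast
    ring
  · rw [single_eq_wR, projMap_wR (by omega), weight_E_pow hk, projWeight]
    congr 3
    omega

/-- As `E F E h = 0`, the commutator of `E` and `F` on `E h`, a vector of weight `i + 2`, reduces to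
one term; its coefficient is `[i + 2] = [j]`. -/
theorem scaledF_E_E (hα : α ^ 4 = 1) (hij : i + j + 2 = r)
    (hk : A.k h = (α * qHalf r ^ (i : ℤ)) • h) (h1 : A.E (A.F (A.E h)) = 0) :
    A.scaledF α (A.E (A.E h)) = -qInt r j • A.E h := by
  have h2 := E_scaledF (by omega) hα (weight_E hk)
  rw [scaledF, LinearMap.smul_apply, map_smul, h1, smul_zero, ← scaledF] at h2
  rw [eq_neg_of_add_eq_zero_left h2.symm, neg_smul, show (j : ℤ) = r - (i + 2) by omega,
    qInt_r_sub (by omega)]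

/-- Under the identification of `w^R_m` with `E^{j+1-m} h`, this is the row of `w^R_m`, with `m = j
- 1 - b`, in the table of `F`. -/
theorem scaledF_E_pow (hα : α ^ 4 = 1) (hij : i + j + 2 = r)
    (hk : A.k h = (α * qHalf r ^ (i : ℤ)) • h) (h1 : A.E (A.F (A.E h)) = 0) (b : ℕ) :
    A.scaledF α ((A.E ^ (b + 2)) h) =
      -(qInt r (b + 1) * qInt r ((j : ℤ) - b)) • (A.E ^ (b + 1)) h := by
  induction b with
  | zero =>
    have := scaledF_E_E hα hij hk h1
    simpa [pow_succ, qInt_one (show 2 ≤ r by omega)] using this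
  | succ b ih =>
    have h2 := E_scaledF (by omega) hα (weight_E_pow hk (b + 2))
    rw [ih, map_smul, ← pow_succ_apply, ← pow_succ_apply] at h2
    rw [show b + 1 + 2 = b + 2 + 1 by ring, ← sub_eq_iff_eq_add.2 h2, ← sub_smul]
    congr 1
    have h3 := qInt_mul_sub (r := r) (by omega) j ((b : ℤ) + 1)
    rw [show (j : ℤ) - (b + 1) + 1 = j - b by ring,
      show (j : ℤ) - 2 * (b + 1) = r - (i + 2 * ((b + 2 : ℕ) : ℤ)) by push_cast; omega,
      qInt_r_sub (by omega)] at h3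
    push_cast at h3 ⊢
    linear_combination h3

/-- The row of `w^H_m` holds for every vector of this weight. The rows of `w^S_m` need `E F E h =
0`, that of `w^R_0` needs `E^{j+2} h = 0`, and those of `w^L_m` with `m > 0` need `F^{i+2} E h = 0`.
-/
theorem projMap_E (hα : α ^ 4 = 1) (hij : i + j + 2 = r)
    (hk : A.k h = (α * qHalf r ^ (i : ℤ)) • h) (h1 : A.E (A.F (A.E h)) = 0)
    (h2 : (A.E ^ (j + 2)) h = 0) (h3 : (A.scaledF α ^ (i + 2)) (A.E h) = 0) (x : PIdx i j →₀ ℂ) :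
    A.projMap α i j h (projE r i j x) = A.E (A.projMap α i j h x) := by
  refine lhom_ext_apply (f := A.projMap α i j h ∘ₗ projE r i j)
    (g := A.E ∘ₗ A.projMap α i j h) (fun b => ?_) x
  have hr : 2 ≤ r := by omega
  simp only [LinearMap.comp_apply]
  have hE := weight_E hk
  rcases b with ⟨m, hm⟩ | ⟨m, hm⟩ | ⟨m, hm⟩ | ⟨m, hm⟩
  · rw [single_H, projMap_wH (by omega), projE_wH (by omega)]
    rcases m with _ | m
    · simp [projMap_wR le_rfl]
    · rw [if_neg (by omega), Nat.add_sub_cancel, map_add, map_smul, projMap_wH (by omega),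
        projMap_wS (by omega), E_scaledF_pow hr hα hk, add_comm, gam]
      push_cast
      rw [show (i : ℤ) - (m + 1) + 1 = i - m by ring]
  · rw [single_S, projMap_wS (by omega), projE_wS (by omega)]
    have h4 := E_scaledF_pow hr hα hE m
    rw [pow_succ, Module.End.mul_apply, Module.End.mul_apply, scaledF_E_E hα hij hk h1, map_smul,
      ← add_smul] at h4
    rw [pow_succ, Module.End.mul_apply, h4]
    have h5 : -qInt r j + qInt r (m + 1) * qInt r ((i : ℤ) + 2 - m) =
        qInt r m * qInt r ((i : ℤ) - m + 1) := by
      have h6 := qInt_mul_sub' hr ((i : ℤ) + 2) m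
      rw [show (j : ℤ) = r - (i + 2) by omega, qInt_r_sub (by omega), h6]
      ring_nf
    rw [h5]
    rcases m with _ | m
    · simp [qInt_zero]
    · rw [if_neg (by omega), Nat.add_sub_cancel, map_smul, projMap_wS (by omega), gam]
  · rw [single_L, projMap_wL (by omega), projE_wL (by omega)]
    rw [show i + 1 + m = i + m + 1 by ring, E_scaledF_pow hr hα hk]
    rcases m with _ | m
    · simp [projMap_wS le_rfl, qInt_zero]
    -- Beyond `w^L_0` the exponent reaches `i + 2`, so the `S`-term of the ladder formula
    -- disappears; for `w^L_0` it is `w^S_i`.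
    · have h8 : (A.scaledF α ^ (i + (m + 1) + 1)) (A.E h) = 0 := by
        rw [show i + (m + 1) + 1 = m + (i + 2) by ring, pow_add, Module.End.mul_apply, h3, map_zero]
      rw [if_neg (by omega), Nat.add_sub_cancel, map_smul, projMap_wL (by omega), h8,
        zero_add]
      rw [show i + 1 + m = i + (m + 1) by ring]
      congr 1
      rw [gam, show (i : ℤ) - ((i + (m + 1) : ℕ) : ℤ) = -((m + 1 : ℕ) : ℤ) by push_cast; ring,
        qInt_neg, show ((i + (m + 1) : ℕ) : ℤ) + 1 = r - ((j : ℤ) - (m + 1 : ℕ) + 1) by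
          push_cast; omega, qInt_r_sub (by omega)]
      ring
  · rw [single_R, projMap_wR (by omega), projE_wR (by omega), ← pow_succ_apply]
    rcases m with _ | m
    · simpa using h2.symm
    · rw [if_neg (by omega), Nat.add_sub_cancel, projMap_wR (by omega)]
      congr 2
      omega

theorem projMap_F (hα : α ^ 4 = 1) (hij : i + j + 2 = r)
    (hk : A.k h = (α * qHalf r ^ (i : ℤ)) • h) (h1 : A.E (A.F (A.E h)) = 0)
    (h3 : (A.scaledF α ^ (i + 2)) (A.E h) = 0) (x : PIdx i j →₀ ℂ) :
    A.projMap α i j h (projF r i j x) = A.scaledF α (A.projMap α i j h x) := by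
  refine lhom_ext_apply (f := A.projMap α i j h ∘ₗ projF r i j)
    (g := A.scaledF α ∘ₗ A.projMap α i j h) (fun b => ?_) x
  have hr : 2 ≤ r := by omega
  simp only [LinearMap.comp_apply]
  rcases b with ⟨m, hm⟩ | ⟨m, hm⟩ | ⟨m, hm⟩ | ⟨m, hm⟩
  · rw [single_H, projMap_wH (by omega), projF_wH (by omega), ← pow_succ_apply]
    split_ifs with h'
    · rw [projMap_wL (by omega), h', add_zero]
    · rw [projMap_wH (by omega)]
  · rw [single_S, projMap_wS (by omega), projF_wS (by omega), ← pow_succ_apply]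
    by_cases h' : m = i
    · rw [wS_eq_zero (by omega), map_zero, h', h3]
    · rw [projMap_wS (by omega)]
  · rw [single_L, projMap_wL (by omega), projF_wL (by omega), ← pow_succ_apply]
    by_cases h' : m = j
    · rw [wL_eq_zero (by omega), map_zero, h', show i + 1 + j + 1 = r by omega,
        scaledF_pow_eq_zero, LinearMap.zero_apply]
    · rw [projMap_wL (by omega)]
      rfl
  · rw [single_R, projMap_wR (by omega), projF_wR (by omega)]
    split_ifs with h'
    · rw [projMap_wS (by omega), h']
      simp
    · obtain ⟨b, hb⟩ : ∃ b, j = m + b + 1 := ⟨j - m - 1, by omega⟩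
      rw [map_smul, projMap_wR (by omega)]
      rw [show j + 1 - m = b + 2 by omega, show j + 1 - (m + 1) = b + 1 by omega,
        scaledF_E_pow hα hij hk h1, gam]
      congr 2
      rw [mul_comm]
      congr 2 <;> (push_cast; omega)

/-- The vectors of weight `α q^{i/2}` that generate a submodule isomorphic to `P^α_i`. -/
theorem exists_projEmbedding (hα : α ^ 4 = 1) (hij : i + j + 2 = r)
    (hk : A.k h = (α * qHalf r ^ (i : ℤ)) • h) (h1 : A.E (A.F (A.E h)) = 0)
    (h2 : (A.E ^ (j + 2)) h = 0) (h3 : (A.F ^ (i + 2)) (A.E h) = 0) (h4 : A.F (A.E h) ≠ 0)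
    (h5 : (A.E ^ (j + 1)) h ≠ 0) :
    ∃ f : DEmbedding (projModule r α hα i j hij) A, f.toLin = A.projMap α i j h := by
  have h3' : (A.scaledF α ^ (i + 2)) (A.E h) = 0 := by
    rw [scaledF, smul_pow, LinearMap.smul_apply, h3, smul_zero]
  have hα0 := alpha_ne_zero hα
  refine ⟨⟨A.projMap α i j h, ?_, projMap_E hα hij hk h1 h2 h3', fun x => ?_,
    projMap_k hα hij hk⟩, rfl⟩
  -- On `ker E` injectivity holds because the images of `w^S_0` and `w^R_0` are non-zero
  -- eigenvectors of `k` whose exponents differ by `2(j + 1)`, strictly between `0` and `4r`.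
  · refine injective_of_ker_nilpotent (projE_pow hij) _ (projMap_E hα hij hk h1 h2 h3') ?_
    intro x hx hfx
    obtain ⟨a, b, rfl⟩ := projE_eq_zero hij hx
    rw [map_add, map_smul, map_smul, projMap_wS (by omega), projMap_wR (by omega), zero_add,
      pow_one, Nat.sub_zero] at hfx
    set y := A.scaledF α (A.E h) with hy
    set z := (A.E ^ (j + 1)) h with hz
    have hy0 : y ≠ 0 := by
      rw [hy, scaledF, LinearMap.smul_apply]
      exact smul_ne_zero (pow_ne_zero 2 hα0) h4
    have ky : A.k y = (α * qHalf r ^ (i : ℤ)) • y := by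
      have := weight_scaledF_pow (weight_E hk) 1
      rw [pow_one] at this
      rw [this]
      simp [hy]
    have kz := weight_E_pow hk (j + 1)
    rw [← hz] at kz
    have hne : α * qHalf r ^ (i : ℤ) ≠ α * qHalf r ^ ((i : ℤ) + 2 * (j + 1 : ℕ)) := by
      rw [Ne, mul_right_inj' hα0, qHalf_zpow_eq_iff (by omega)]
      intro hdvd
      rw [← dvd_neg] at hdvd
      have := Int.le_of_dvd (by push_cast; omega) hdvd
      push_cast at this
      omega
    have hk0 := congrArg A.k hfx
    rw [map_add, map_smul, map_smul, ky, kz, map_zero] at hk0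
    have hb : b = 0 := by
      have : ((α * qHalf r ^ ((i : ℤ) + 2 * (j + 1 : ℕ)) - α * qHalf r ^ (i : ℤ)) * b) • z = 0 := by
        have h6 := congrArg (fun t => (α * qHalf r ^ (i : ℤ)) • t) hfx
        simp only [smul_zero] at h6
        rw [← sub_eq_zero.2 (hk0.trans h6.symm)]
        module
      rcases smul_eq_zero.1 this with h' | h'
      · exact (mul_eq_zero.1 h').resolve_left (sub_ne_zero.2 hne.symm)
      · exact absurd h' h5
    rw [hb, zero_smul, add_zero] at hfx
    rw [hb, (smul_eq_zero.1 hfx).resolve_right hy0]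
    simp
  · change A.projMap α i j h ((α ^ 2 • projF r i j) x) = _
    rw [LinearMap.smul_apply, map_smul, projMap_F hα hij hk h1 h3', ← F_eq_scaledF hα]

end Projective

section Steinberg

variable {α : ℂ} {i : ℕ} {h : X}

/-- `[1] ⋯ [m] [i] ⋯ [i - m + 1]`. -/
def simpleCoeff (r i m : ℕ) : ℂ :=
  ∏ t ∈ Finset.range m, (qInt r ((t : ℤ) + 1) * qInt r ((i : ℤ) - t))

theorem simpleCoeff_succ (r i m : ℕ) : simpleCoeff r i (m + 1) =
    simpleCoeff r i m * (qInt r ((m : ℤ) + 1) * qInt r ((i : ℤ) - m)) :=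
  Finset.prod_range_succ _ _

theorem simpleCoeff_ne_zero (hr : 2 ≤ r) (hi : i < r) {m : ℕ} (hm : m ≤ i) :
    simpleCoeff r i m ≠ 0 := by
  rw [simpleCoeff, Finset.prod_ne_zero_iff]
  intro t ht
  have := Finset.mem_range.1 ht
  exact mul_ne_zero (qInt_ne_zero_of_lt hr (by omega) (by omega))
    (qInt_ne_zero_of_lt hr (by omega) (by omega))

variable (A α i h) in
/-- The linear map that underlies the homomorphism that maps `u_0` to `h`. -/
def simpleMap : (Fin (i + 1) →₀ ℂ) →ₗ[ℂ] X :=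
  Finsupp.linearCombination ℂ fun m => (simpleCoeff r i m)⁻¹ • (A.scaledF α ^ (m : ℕ)) h

theorem simpleMap_u {m : ℕ} (hm : m ≤ i) :
    A.simpleMap α i h (u i m) = (simpleCoeff r i m)⁻¹ • (A.scaledF α ^ m) h := by
  rw [u, dif_pos (by omega)]
  simp [simpleMap]

/-- The highest weight vectors that generate a submodule isomorphic to `V^α_i`. -/
theorem exists_simpleEmbedding (hr : 2 ≤ r) (hα : α ^ 4 = 1) (hi : i < r)
    (hk : A.k h = (α * qHalf r ^ (i : ℤ)) • h) (h1 : A.E h = 0) (h2 : (A.F ^ (i + 1)) h = 0)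
    (h3 : h ≠ 0) :
    ∃ f : DEmbedding (simpleModule r α hα i hi) A, f.toLin = A.simpleMap α i h := by
  -- Dividing `F^m h` by `simpleCoeff` is what makes `E` act without coefficients, as in the simple
  -- module.
  have hE : ∀ x, A.simpleMap α i h (simpleE i x) = A.E (A.simpleMap α i h x) := by
    refine lhom_ext_apply (f := A.simpleMap α i h ∘ₗ simpleE i)
      (g := A.E ∘ₗ A.simpleMap α i h) fun b => ?_
    obtain ⟨m, hm⟩ := b
    rw [LinearMap.comp_apply, LinearMap.comp_apply, single_u, simpleMap_u (by omega),
      simpleE_u (by omega)]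
    rcases m with _ | m
    · simp [h1]
    · rw [if_neg (by omega), map_smul, Nat.add_sub_cancel, E_scaledF_pow hr hα hk, h1, map_zero, zero_add,
        smul_smul, simpleMap_u (by omega)]
      congr 1
      have := simpleCoeff_ne_zero hr hi (show m + 1 ≤ i by omega)
      rw [simpleCoeff_succ] at this ⊢
      rw [mul_inv, mul_assoc, inv_mul_cancel₀ (right_ne_zero_of_mul this), mul_one]
  refine ⟨⟨A.simpleMap α i h, ?_, hE, ?_, ?_⟩, rfl⟩
  · refine injective_of_ker_nilpotent (simpleModule r α hα i hi).E_pow _ hE ?_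
    intro x hx hfx
    obtain ⟨a, rfl⟩ := simpleE_eq_zero hx
    rw [map_smul, simpleMap_u (by omega)] at hfx
    simp only [simpleCoeff, Finset.range_zero, Finset.prod_empty, inv_one, pow_zero, one_smul,
      Module.End.one_apply] at hfx
    rw [(smul_eq_zero.1 hfx).resolve_right h3, zero_smul]
  · refine lhom_ext_apply (f := A.simpleMap α i h ∘ₗ simpleF r α i)
      (g := A.F ∘ₗ A.simpleMap α i h) fun b => ?_
    obtain ⟨m, hm⟩ := b
    rw [LinearMap.comp_apply, LinearMap.comp_apply, single_u, simpleMap_u (by omega),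
      simpleF_u, map_smul, map_smul, F_eq_scaledF hα, ← pow_succ_apply]
    by_cases hmi : m = i
    · have : (A.scaledF α ^ (m + 1)) h = 0 := by
        rw [scaledF, smul_pow, LinearMap.smul_apply, hmi, h2, smul_zero]
      rw [this, u_eq_zero (by omega)]
      simp
    · rw [simpleMap_u (by omega), smul_smul, smul_smul]
      congr 1
      have := simpleCoeff_ne_zero hr hi (show m + 1 ≤ i by omega)
      rw [simpleCoeff_succ] at this ⊢
      have h5 := right_ne_zero_of_mul this
      rw [mul_inv, mul_assoc (α ^ 2), mul_comm (simpleCoeff r i m)⁻¹, ← mul_assoc,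
        mul_assoc (α ^ 2), mul_inv_cancel₀ h5, mul_one, mul_comm]
  · refine lhom_ext_apply (f := A.simpleMap α i h ∘ₗ (simpleModule r α hα i hi).k)
      (g := A.k ∘ₗ A.simpleMap α i h) fun b => ?_
    simp only [LinearMap.comp_apply, simpleModule, diag_single, map_smul]
    rw [single_u, simpleMap_u (by omega), map_smul, weight_scaledF_pow hk, smul_comm]

end Steinberg

end Embedding

end DModule

end RestrictedSl2

end

noncomputable section

namespace RestrictedSl2

/-! ### Graded modules and the Casimir operator -/

/-- The eigenvalue of the Casimir operator on a highest weight vector of weight `q^{l/2}`. -/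
def casimirValue (r : ℕ) (l : ℤ) : ℂ :=
  (q r ^ (l + 1) + q r ^ (-(l + 1))) / (q r - (q r)⁻¹) ^ 2

/-- With `a = q^{l+1}` and `b = q^{m+1}` the difference of the numerators is `(a - b)(a - b⁻¹)/a`:
the values agree for equal weights and for weights reflected in `-1`, modulo `2r`. -/
theorem casimirValue_eq_iff {r : ℕ} (hr : 2 ≤ r) (l m : ℤ) :
    casimirValue r l = casimirValue r m ↔
      ((2 * r : ℕ) : ℤ) ∣ l - m ∨ ((2 * r : ℕ) : ℤ) ∣ l + m + 2 := by
  have hq := q_ne_zero r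
  rw [casimirValue, casimirValue, div_left_inj' (pow_ne_zero 2 (q_sub_inv_ne_zero hr)),
    show l - m = (l + 1) - (m + 1) by ring, show l + m + 2 = (l + 1) - (-(m + 1)) by ring,
    ← q_zpow_eq_iff (by omega), ← q_zpow_eq_iff (by omega), ← sub_eq_zero, zpow_neg, zpow_neg]
  have ha := zpow_ne_zero (l + 1) hq
  have hb := zpow_ne_zero (m + 1) hq
  generalize q r ^ (l + 1) = a at *
  generalize q r ^ (m + 1) = b at *
  have : a + a⁻¹ - (b + b⁻¹) = (a - b) * (a - b⁻¹) / a := by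
    field_simp
    ring
  rw [this, div_eq_zero_iff, mul_eq_zero, sub_eq_zero, sub_eq_zero]
  tauto

/-- Consistency of the two forms `F E + c_l` and `E F + c_{l-2}` of the Casimir operator on vectors
of weight `l`. -/
theorem casimirValue_sub_two {r : ℕ} (hr : 2 ≤ r) (l : ℤ) :
    casimirValue r (l - 2) + qInt r l = casimirValue r l := by
  have hq := q_ne_zero r
  have h := q_zpow_sub r hr l
  have h1 := q_sub_inv_ne_zero hr
  rw [casimirValue, casimirValue, ← sub_eq_zero]
  have h2 : qInt r l = (q r ^ l - q r ^ (-l)) / (q r - (q r)⁻¹) := by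
    rw [h, mul_div_cancel_left₀ _ h1]
  rw [h2, show l - 2 + 1 = l - 1 by ring, show -(l - 1) = -l + 1 by ring,
    show -(l + 1) = -l - 1 by ring, zpow_add₀ hq, zpow_add₀ hq, zpow_sub₀ hq, zpow_sub₀ hq,
    zpow_one]
  generalize q r ^ l = a
  generalize q r ^ (-l) = b
  rw [div_add_div _ _ (pow_ne_zero 2 h1) h1, div_sub_div _ _
    (mul_ne_zero (pow_ne_zero 2 h1) h1) (pow_ne_zero 2 h1), div_eq_zero_iff]
  left
  field_simp
  ring

/-- The numbers `g, g'` with `g + g' = r`, and `g ≡ l + 1` modulo `r`, govern the structure of a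
module near the weight `l`. -/
structure Linked (r : ℕ) (c : ℂ) (l : ℤ) (g g' : ℕ) : Prop where
  two_le : 2 ≤ r
  add_eq : g + g' = r
  pos : 0 < g'
  dvd : (r : ℤ) ∣ l + 1 - g
  eq : c = casimirValue r l

namespace Linked

variable {r : ℕ} {c : ℂ} {l : ℤ} {g g' : ℕ}

/-- The weights with Casimir value `c` form a chain whose gaps are alternately `2g` and `2g'`.
`down` and `up` move to the neighbours of `l`, where the roles of `g` and `g'` are exchanged. -/
theorem down (h : Linked r c l g g') (hg : 0 < g) : Linked r c (l - 2 * g) g' g := by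
  have h1 := h.add_eq
  refine ⟨h.two_le, by omega, hg, ?_, ?_⟩
  · obtain ⟨x, hx⟩ := h.dvd
    refine ⟨x - 1, ?_⟩
    have : (g : ℤ) + g' = r := by exact_mod_cast h1
    linear_combination hx - this
  · rw [h.eq, casimirValue_eq_iff h.two_le]
    right
    obtain ⟨x, hx⟩ := h.dvd
    refine ⟨x, ?_⟩
    push_cast
    linear_combination 2 * hx

theorem up (h : Linked r c l g g') (hg : 0 < g) : Linked r c (l + 2 * g') g' g := by
  have h1 := h.add_eq
  refine ⟨h.two_le, by omega, hg, ?_, ?_⟩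
  · obtain ⟨x, hx⟩ := h.dvd
    refine ⟨x + 1, ?_⟩
    have : (g : ℤ) + g' = r := by exact_mod_cast h1
    linear_combination hx + this
  · rw [h.eq, casimirValue_eq_iff h.two_le]
    right
    obtain ⟨x, hx⟩ := h.dvd
    refine ⟨x + 1, ?_⟩
    have : (g : ℤ) + g' = r := by exact_mod_cast h1
    push_cast
    linear_combination 2 * hx + 2 * this

/-- Strictly between neighbours of the chain the Casimir value is not `c`, so `C - c_{l+2m}` will be
invertible on the piece for `c`. -/
theorem ne_up (h : Linked r c l g g') {m : ℕ} (h0 : 0 < m) (hm : m < g') :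
    c ≠ casimirValue r (l + 2 * m) := by
  have h1 := h.add_eq
  obtain ⟨x, hx⟩ := h.dvd
  rw [h.eq, Ne, casimirValue_eq_iff h.two_le]
  rintro (⟨y, hy⟩ | ⟨y, hy⟩)
  · have : (m : ℤ) = r * (-y) := by push_cast at hy; linarith
    have h2 : (r : ℤ) ∣ m := ⟨_, this⟩
    have := Int.le_of_dvd (by omega) h2
    omega
  · have : (g + m : ℤ) = r * (y - x) := by push_cast at hy; linarith
    have h2 : (r : ℤ) ∣ g + m := ⟨_, this⟩
    have := Int.le_of_dvd (by omega) h2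
    omega

theorem ne_down (h : Linked r c l g g') {m : ℕ} (h0 : 0 < m) (hm : m < r) (hmg : m ≠ g) :
    c ≠ casimirValue r (l - 2 * m) := by
  have h1 := h.add_eq
  obtain ⟨x, hx⟩ := h.dvd
  rw [h.eq, Ne, casimirValue_eq_iff h.two_le]
  rintro (⟨y, hy⟩ | ⟨y, hy⟩)
  · have : (m : ℤ) = r * y := by push_cast at hy; linarith
    have h2 : (r : ℤ) ∣ m := ⟨_, this⟩
    have := Int.le_of_dvd (by omega) h2
    omega
  · have : (g - m : ℤ) = r * (y - x) := by push_cast at hy; linarith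
    have h2 : (r : ℤ) ∣ g - m := ⟨_, this⟩
    have := Int.eq_zero_of_abs_lt_dvd h2 (by rw [abs_lt]; constructor <;> omega)
    omega

theorem exists_of (hr : 2 ≤ r) (l : ℤ) : ∃ g g', Linked r (casimirValue r l) l g g' := by
  have h1 := Int.emod_nonneg (l + 1) (show (r : ℤ) ≠ 0 by omega)
  have h2 := Int.emod_lt_of_pos (l + 1) (show (0 : ℤ) < r by omega)
  refine ⟨((l + 1) % r).toNat, r - ((l + 1) % r).toNat, hr, by omega, by omega, ?_, rfl⟩
  rw [Int.toNat_of_nonneg h1]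
  exact Int.dvd_self_sub_emod

theorem unique {c₁ : ℂ} {g₁ g₁' : ℕ} (h : Linked r c l g g') (h' : Linked r c₁ l g₁ g₁') :
    g = g₁ ∧ g' = g₁' := by
  have h1 := h.add_eq
  have h2 := h'.add_eq
  have h3 := h.pos
  have h4 := h'.pos
  have h5 : (r : ℤ) ∣ g₁ - g := by
    have := dvd_sub h.dvd h'.dvd
    rwa [show l + 1 - (g : ℤ) - (l + 1 - g₁) = g₁ - g by ring] at this
  have := Int.eq_zero_of_abs_lt_dvd h5 (by rw [abs_lt]; constructor <;> omega)
  omega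

end Linked

namespace DModule

variable {r : ℕ} {X : Type*} [AddCommGroup X] [Module ℂ X]

/-- A grading of a `D`-module by integral weights. -/
structure IsGrading (A : DModule r X) (G : ℤ → Submodule ℂ X) : Prop where
  iSup_eq_top : ⨆ l, G l = ⊤
  indep : iSupIndep G
  E_mem : ∀ l, ∀ x ∈ G l, A.E x ∈ G (l + 2)
  F_mem : ∀ l, ∀ x ∈ G l, A.F x ∈ G (l - 2)
  k_apply : ∀ l, ∀ x ∈ G l, A.k x = qHalf r ^ l • x
  bounded : ∃ B : ℤ, ∀ l, B < l → G l = ⊥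

/-- The Casimir operator. -/
def casimir (A : DModule r X) : Module.End ℂ X :=
  A.F * A.E + ((q r - (q r)⁻¹) ^ 2)⁻¹ • (q r • A.k ^ 2 + (q r)⁻¹ • A.kinv ^ 2)

/-- The part of weight `l` of the generalized eigenspace of the Casimir operator for `c`. -/
def piece (A : DModule r X) (G : ℤ → Submodule ℂ X) (l : ℤ) (c : ℂ) : Submodule ℂ X :=
  G l ⊓ A.casimir.maxGenEigenspace c

namespace IsGrading

variable {A : DModule r X} {G : ℤ → Submodule ℂ X}

theorem end_ext (h : A.IsGrading G) {S T : Module.End ℂ X} (hST : ∀ l, ∀ x ∈ G l, S x = T x) :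
    S = T := by
  ext x
  have hx : x ∈ ⨆ l, G l := by rw [h.iSup_eq_top]; trivial
  induction hx using Submodule.iSup_induction' with
  | mem l x hx => exact hST l x hx
  | zero => simp
  | add x y _ _ h1 h2 => rw [map_add, map_add, h1, h2]

theorem casimir_apply (h : A.IsGrading G) (hr : 0 < r) {l : ℤ} {x : X} (hx : x ∈ G l) :
    A.casimir x = A.F (A.E x) + casimirValue r l • x := by
  have h1 := h.k_apply l x hx
  have h2 := kinv_apply hr (zpow_ne_zero l (qHalf_ne_zero r)) h1
  have h3 : (A.k ^ 2) x = q r ^ l • x := by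
    rw [pow_two, Module.End.mul_apply, h1, map_smul, h1, smul_smul, ← zpow_add₀ (qHalf_ne_zero r),
      ← two_mul, qHalf_zpow_two_mul]
  have h4 : (A.kinv ^ 2) x = q r ^ (-l) • x := by
    rw [pow_two, Module.End.mul_apply, h2, map_smul, h2, smul_smul, ← zpow_neg,
      ← zpow_add₀ (qHalf_ne_zero r), ← two_mul, qHalf_zpow_two_mul]
  simp only [casimir, LinearMap.add_apply, LinearMap.smul_apply, Module.End.mul_apply, h3, h4]
  rw [smul_smul, smul_smul, ← add_smul, smul_smul, casimirValue, neg_add, zpow_add₀ (q_ne_zero r),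
    zpow_add₀ (q_ne_zero r), zpow_one, zpow_neg_one]
  congr 2
  ring

theorem E_F_apply (h : A.IsGrading G) (hr : 2 ≤ r) {l : ℤ} {x : X} (hx : x ∈ G l) :
    A.E (A.F x) = A.F (A.E x) + qInt r l • x := by
  have h1 := h.k_apply l x hx
  have h2 := E_scaledF hr (one_pow 4) (A := A) (p := l) (x := x) (by rw [one_mul]; exact h1)
  simpa [scaledF] using h2

theorem casimir_apply' (h : A.IsGrading G) (hr : 2 ≤ r) {l : ℤ} {x : X} (hx : x ∈ G l) :
    A.casimir x = A.E (A.F x) + casimirValue r (l - 2) • x := by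
  rw [h.casimir_apply (by omega) hx, h.E_F_apply hr hx, ← casimirValue_sub_two hr l, add_smul]
  abel

/-- The form `E F + c` at `E x` and the form `F E + c` at `x` both lead to `E F E x + c_l E x`. -/
theorem commute_E (h : A.IsGrading G) (hr : 2 ≤ r) : Commute A.casimir A.E := by
  refine h.end_ext fun l x hx => ?_
  rw [Module.End.mul_apply, Module.End.mul_apply, h.casimir_apply' hr (h.E_mem l x hx),
    h.casimir_apply (by omega) hx, map_add, map_smul, add_sub_cancel_right]

theorem commute_F (h : A.IsGrading G) (hr : 2 ≤ r) : Commute A.casimir A.F := by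
  refine h.end_ext fun l x hx => ?_
  rw [Module.End.mul_apply, Module.End.mul_apply, h.casimir_apply (by omega) (h.F_mem l x hx),
    h.casimir_apply' hr hx, map_add, map_smul]

theorem E_mem_piece (h : A.IsGrading G) (hr : 2 ≤ r) {l : ℤ} {c : ℂ} {x : X}
    (hx : x ∈ A.piece G l c) : A.E x ∈ A.piece G (l + 2) c :=
  ⟨h.E_mem l x hx.1, Module.End.mapsTo_maxGenEigenspace_of_comm (h.commute_E hr) c hx.2⟩

theorem E_pow_mem (h : A.IsGrading G) {l : ℤ} {x : X} (hx : x ∈ G l) (m : ℕ) :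
    (A.E ^ m) x ∈ G (l + 2 * m) := by
  induction m with
  | zero => simpa using hx
  | succ m ih =>
    rw [pow_succ_apply]
    have := h.E_mem _ _ ih
    rwa [show l + 2 * (m : ℤ) + 2 = l + 2 * ((m + 1 : ℕ) : ℤ) by push_cast; ring] at this

theorem F_pow_mem (h : A.IsGrading G) {l : ℤ} {x : X} (hx : x ∈ G l) (m : ℕ) :
    (A.F ^ m) x ∈ G (l - 2 * m) := by
  induction m with
  | zero => simpa using hx
  | succ m ih =>
    rw [pow_succ_apply]
    have := h.F_mem _ _ ih
    rwa [show l - 2 * (m : ℤ) - 2 = l - 2 * ((m + 1 : ℕ) : ℤ) by push_cast; ring] at this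

theorem E_pow_mem_piece (h : A.IsGrading G) (hr : 2 ≤ r) {l : ℤ} {c : ℂ} {x : X}
    (hx : x ∈ A.piece G l c) (m : ℕ) : (A.E ^ m) x ∈ A.piece G (l + 2 * m) c :=
  ⟨h.E_pow_mem hx.1 m, Module.End.mapsTo_maxGenEigenspace_of_comm
    ((h.commute_E hr).pow_right m) c hx.2⟩

theorem F_pow_mem_piece (h : A.IsGrading G) (hr : 2 ≤ r) {l : ℤ} {c : ℂ} {x : X}
    (hx : x ∈ A.piece G l c) (m : ℕ) : (A.F ^ m) x ∈ A.piece G (l - 2 * m) c :=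
  ⟨h.F_pow_mem hx.1 m, Module.End.mapsTo_maxGenEigenspace_of_comm
    ((h.commute_F hr).pow_right m) c hx.2⟩

theorem casimir_mem_piece (h : A.IsGrading G) (hr : 2 ≤ r) {l : ℤ} {c : ℂ} {x : X}
    (hx : x ∈ A.piece G l c) : A.casimir x ∈ A.piece G l c := by
  refine ⟨?_, Module.End.mapsTo_maxGenEigenspace_of_comm (Commute.refl _) c hx.2⟩
  rw [h.casimir_apply (by omega) hx.1]
  have := h.F_mem _ _ (h.E_mem _ _ hx.1)
  rw [add_sub_cancel_right] at this
  exact Submodule.add_mem _ this (Submodule.smul_mem _ _ hx.1)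

/-- The Casimir operator minus `d`. -/
def _root_.RestrictedSl2.DModule.casimirSub (A : DModule r X) (d : ℂ) : Module.End ℂ X :=
  A.casimir - d • 1

theorem casimirSub_apply (d : ℂ) (x : X) : A.casimirSub d x = A.casimir x - d • x := rfl

theorem casimirSub_mem_piece (h : A.IsGrading G) (hr : 2 ≤ r) {l : ℤ} {c : ℂ} (d : ℂ) {x : X}
    (hx : x ∈ A.piece G l c) : A.casimirSub d x ∈ A.piece G l c :=
  Submodule.sub_mem _ (h.casimir_mem_piece hr hx) (Submodule.smul_mem _ _ hx)

theorem eq_zero_of_casimirSub {l : ℤ} {c d : ℂ} (hcd : c ≠ d) {x : X} (hx : x ∈ A.piece G l c)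
    (h0 : A.casimirSub d x = 0) : x = 0 := by
  have h1 : x ∈ A.casimir.genEigenspace d 1 := by
    rw [Module.End.mem_genEigenspace_one]
    exact sub_eq_zero.1 h0
  exact Submodule.disjoint_def.1 (A.casimir.disjoint_genEigenspace hcd _ _) x hx.2 h1

/-- `C - d` is injective on a generalized eigenspace for `c ≠ d`, hence bijective on the finite
dimensional piece. -/
theorem exists_casimirSub_eq (h : A.IsGrading G) (hr : 2 ≤ r) [FiniteDimensional ℂ X] {l : ℤ}
    {c d : ℂ} (hcd : c ≠ d) {x : X} (hx : x ∈ A.piece G l c) :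
    ∃ y ∈ A.piece G l c, A.casimirSub d y = x :=
  exists_mem_apply_eq _ _ (fun _ => h.casimirSub_mem_piece hr d)
    (fun _ => eq_zero_of_casimirSub hcd) hx

theorem F_E_apply (h : A.IsGrading G) (hr : 2 ≤ r) {l : ℤ} {x : X} (hx : x ∈ G l) :
    A.F (A.E x) = A.casimirSub (casimirValue r l) x := by
  rw [casimirSub_apply, h.casimir_apply (by omega) hx, add_sub_cancel_right]

theorem E_F_apply' (h : A.IsGrading G) (hr : 2 ≤ r) {l : ℤ} {x : X} (hx : x ∈ G l) :
    A.E (A.F x) = A.casimirSub (casimirValue r (l - 2)) x := by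
  rw [casimirSub_apply, h.casimir_apply' hr hx, add_sub_cancel_right]

theorem casimirSub_E_pow (h : A.IsGrading G) (hr : 2 ≤ r) (d : ℂ) (m : ℕ) (x : X) :
    A.casimirSub d ((A.E ^ m) x) = (A.E ^ m) (A.casimirSub d x) := by
  have := LinearMap.congr_fun ((h.commute_E hr).pow_right m) x
  rw [Module.End.mul_apply, Module.End.mul_apply] at this
  rw [casimirSub_apply, casimirSub_apply, map_sub, map_smul, this]

theorem casimirSub_F_pow (h : A.IsGrading G) (hr : 2 ≤ r) (d : ℂ) (m : ℕ) (x : X) :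
    A.casimirSub d ((A.F ^ m) x) = (A.F ^ m) (A.casimirSub d x) := by
  have := LinearMap.congr_fun ((h.commute_F hr).pow_right m) x
  rw [Module.End.mul_apply, Module.End.mul_apply] at this
  rw [casimirSub_apply, casimirSub_apply, map_sub, map_smul, this]

theorem F_E_casimirSub (h : A.IsGrading G) (hr : 2 ≤ r) (d : ℂ) (x : X) :
    A.F (A.E (A.casimirSub d x)) = A.casimirSub d (A.F (A.E x)) := by
  have h1 := h.casimirSub_F_pow hr d 1 (A.E x)
  have h2 := h.casimirSub_E_pow hr d 1 x
  rw [pow_one] at h1 h2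
  rw [h1, h2]

/-- `F^{m+1} E^{m+1} = F^m E^m (C - c_{l + 2m})` on vectors of weight `l`. -/
theorem F_pow_E_pow_succ (h : A.IsGrading G) (hr : 2 ≤ r) {l : ℤ} {x : X} (hx : x ∈ G l) (m : ℕ) :
    (A.F ^ (m + 1)) ((A.E ^ (m + 1)) x) =
      (A.F ^ m) ((A.E ^ m) (A.casimirSub (casimirValue r (l + 2 * m)) x)) := by
  rw [pow_succ, Module.End.mul_apply, pow_succ_apply, h.F_E_apply hr (h.E_pow_mem hx m),
    h.casimirSub_E_pow hr]

theorem E_pow_F_pow_succ (h : A.IsGrading G) (hr : 2 ≤ r) {l : ℤ} {x : X} (hx : x ∈ G l) (m : ℕ) :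
    (A.E ^ (m + 1)) ((A.F ^ (m + 1)) x) =
      (A.E ^ m) ((A.F ^ m) (A.casimirSub (casimirValue r (l - 2 * (m + 1 : ℕ))) x)) := by
  rw [pow_succ, Module.End.mul_apply, pow_succ_apply, h.E_F_apply' hr (h.F_pow_mem hx m),
    h.casimirSub_F_pow hr]
  congr 5
  push_cast
  ring

/-- At a weight whose Casimir value differs from `c`, the operator `F E` is injective on the piece,
and so is `E`. Only at the weights of the chain can `E` have a kernel. -/
theorem eq_zero_of_E_pow (h : A.IsGrading G) (hr : 2 ≤ r) {l : ℤ} {c : ℂ} {x : X}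
    (hx : x ∈ A.piece G l c) (n : ℕ) (hn : ∀ m < n, c ≠ casimirValue r (l + 2 * m))
    (h0 : (A.E ^ n) x = 0) : x = 0 := by
  induction n with
  | zero => exact h0
  | succ n ih =>
    refine ih (fun m hm => hn m (by omega)) (eq_zero_of_casimirSub (hn n (by omega))
      (h.E_pow_mem_piece hr hx n) ?_)
    rw [pow_succ_apply] at h0
    rw [← h.F_E_apply hr (h.E_pow_mem hx.1 n), h0, map_zero]

theorem eq_zero_of_F_pow (h : A.IsGrading G) (hr : 2 ≤ r) {l : ℤ} {c : ℂ} {x : X}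
    (hx : x ∈ A.piece G l c) (n : ℕ) (hn : ∀ m < n, c ≠ casimirValue r (l - 2 * (m + 1 : ℕ)))
    (h0 : (A.F ^ n) x = 0) : x = 0 := by
  induction n with
  | zero => exact h0
  | succ n ih =>
    refine ih (fun m hm => hn m (by omega)) (eq_zero_of_casimirSub (hn n (by omega))
      (h.F_pow_mem_piece hr hx n) ?_)
    rw [pow_succ_apply] at h0
    have := h.E_F_apply' hr (h.F_pow_mem hx.1 n)
    rw [h0, map_zero] at this
    rw [this]
    congr 2
    push_cast
    ring_nf

theorem le_iSup_piece (h : A.IsGrading G) (hr : 2 ≤ r) [FiniteDimensional ℂ X] (l : ℤ) :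
    G l ≤ ⨆ c, A.piece G l c := by
  refine (Submodule.eq_iSup_inf_genEigenspace (f := A.casimir) ⊤ (fun x hx => ?_)
    A.casimir.iSup_maxGenEigenspace_eq_top).le
  rw [h.casimir_apply (by omega) hx]
  have := h.F_mem _ _ (h.E_mem _ _ hx)
  rw [add_sub_cancel_right] at this
  exact Submodule.add_mem _ this (Submodule.smul_mem _ _ hx)

/-- Vectors in a piece that are values of an operator `T` which commutes with the Casimir operator
and shifts weights are values of `T` on a piece. -/
theorem exists_mem_piece (h : A.IsGrading G) (hr : 2 ≤ r) [FiniteDimensional ℂ X]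
    (T : Module.End ℂ X) (d : ℤ) (hT : ∀ l, ∀ x ∈ G l, T x ∈ G (l + d))
    (hTc : Commute A.casimir T) {l : ℤ} {c : ℂ} {x : X} (hx : x ∈ A.piece G (l + d) c)
    (hxT : x ∈ LinearMap.range T) : ∃ y ∈ A.piece G l c, T y = x := by
  obtain ⟨w, rfl⟩ := hxT
  obtain ⟨w', hw', hw'T⟩ := exists_mem_of_apply_mem h.indep (add_left_injective d) T hT
    (w := w) (by rw [h.iSup_eq_top]; trivial) l hx.1
  rw [← hw'T] at hx ⊢
  exact exists_mem_of_apply_mem (N := fun c => A.piece G l c)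
    A.casimir.independent_maxGenEigenspace Function.injective_id T
    (fun c x hx => Module.End.mapsTo_maxGenEigenspace_of_comm hTc c hx.2)
    (h.le_iSup_piece hr l hw') c hx.2

end IsGrading

end DModule

end RestrictedSl2

end

/-! ### Exact graded modules: chains of linked weights, radicals and heads -/

noncomputable section

namespace RestrictedSl2

namespace DModule

variable {r : ℕ} {X : Type*} [AddCommGroup X] [Module ℂ X]

/-- A module is free over `ℂ[E]/(E^r)` and over `ℂ[F]/(F^r)`, expressed by exactness. -/
structure IsExact (A : DModule r X) : Prop where
  E : LinearMap.ker A.E ≤ LinearMap.range (A.E ^ (r - 1))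
  F : LinearMap.ker A.F ≤ LinearMap.range (A.F ^ (r - 1))

namespace IsGrading

variable {A : DModule r X} {G : ℤ → Submodule ℂ X} {c : ℂ} {l : ℤ} {g g' : ℕ}

theorem mem_piece_congr {l l' : ℤ} {x : X} (hx : x ∈ A.piece G l c) (hl : l = l') :
    x ∈ A.piece G l' c := hl ▸ hx

section

variable (h : A.IsGrading G) (hL : Linked r c l g g')
include h hL

/-- At a weight of the chain `F E` is the nilpotent part of the Casimir operator. It therefore
commutes with everything that the Casimir operator commutes with. -/
theorem F_E_eq {x : X} (hx : x ∈ A.piece G l c) : A.F (A.E x) = A.casimirSub c x := by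
  rw [h.F_E_apply hL.two_le hx.1, hL.eq]

theorem F_E_mem {x : X} (hx : x ∈ A.piece G l c) : A.F (A.E x) ∈ A.piece G l c := by
  rw [h.F_E_eq hL hx]
  exact h.casimirSub_mem_piece hL.two_le _ hx

/-- The next weight of the chain above `l` is `l + 2g'`, so `E^{g'-1}` is injective on the piece at
`l + 2`. -/
theorem E_eq_zero_of_E_pow {x : X} (hx : x ∈ A.piece G l c) (h0 : (A.E ^ g') x = 0) :
    A.E x = 0 := by
  have hpos := hL.pos
  refine h.eq_zero_of_E_pow hL.two_le (h.E_mem_piece hL.two_le hx) (g' - 1) (fun m hm => ?_) ?_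
  · have := hL.ne_up (m := m + 1) (by omega) (by omega)
    rwa [show l + 2 * ((m + 1 : ℕ) : ℤ) = l + 2 + 2 * m by push_cast; ring] at this
  · rwa [← Module.End.mul_apply, ← pow_succ, Nat.sub_add_cancel hpos]

theorem eq_zero_of_F_pow_pred {x : X} (hx : x ∈ A.piece G l c) (h0 : (A.F ^ (g - 1)) x = 0) :
    x = 0 := by
  have h1 := hL.add_eq
  exact h.eq_zero_of_F_pow hL.two_le hx (g - 1)
    (fun m hm => hL.ne_down (by omega) (by omega) (by omega)) h0

/-- Exactness gives `x = E^{r-1} w`. Since `r - 1 = g + (g' - 1)`, the vector `E^{g'-1} w` lies at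
the next weight of the chain below `l`. -/
theorem exists_E_pow_eq [FiniteDimensional ℂ X] (hA : A.IsExact) {x : X}
    (hx : x ∈ A.piece G l c) (h0 : (A.E ^ g') x = 0) :
    ∃ y ∈ A.piece G (l - 2 * g) c, (A.E ^ g) y = x := by
  have hr := hL.two_le
  have h1 := hL.add_eq
  have hpos := hL.pos
  have h2 := h.E_eq_zero_of_E_pow hL hx h0
  obtain ⟨w, hw, rfl⟩ := h.exists_mem_piece hr (A.E ^ (r - 1)) (2 * (r - 1 : ℕ))
    (fun l x hx => h.E_pow_mem hx _) ((h.commute_E hr).pow_right _) (l := l - 2 * (r - 1 : ℕ))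
    (mem_piece_congr hx (by ring)) (hA.E h2)
  refine ⟨(A.E ^ (g' - 1)) w, mem_piece_congr (h.E_pow_mem_piece hr hw _) ?_, ?_⟩
  · omega
  · rw [← Module.End.mul_apply, ← pow_add, show g + (g' - 1) = r - 1 by omega]

/-- It is `F^{g-1} x`, and not `x`, that lies in `ker F` and is lifted by exactness to `F^{r-1} w`.
The factor `F^{g-1}` can be cancelled because no weight of the chain lies strictly between `l - 2g`
and `l`. -/
theorem exists_F_pow_eq [FiniteDimensional ℂ X] (hA : A.IsExact) (hg : 0 < g) {x : X}
    (hx : x ∈ A.piece G l c) (h0 : (A.F ^ g) x = 0) :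
    ∃ y ∈ A.piece G (l + 2 * g') c, (A.F ^ g') y = x := by
  have hr := hL.two_le
  have h1 := hL.add_eq
  have hpos := hL.pos
  have h2 : A.F ((A.F ^ (g - 1)) x) = 0 := by
    rwa [← pow_succ_apply, Nat.sub_add_cancel hg]
  obtain ⟨w, hw, hwx⟩ := h.exists_mem_piece hr (A.F ^ (r - 1)) (-(2 * (r - 1 : ℕ)))
    (fun l x hx => h.F_pow_mem hx _) ((h.commute_F hr).pow_right _) (l := l + 2 * g')
    (mem_piece_congr (h.F_pow_mem_piece hr hx _) (by omega)) (hA.F h2)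
  refine ⟨w, hw, ?_⟩
  have h3 : (A.F ^ g') w ∈ A.piece G l c :=
    mem_piece_congr (h.F_pow_mem_piece hr hw _) (by ring)
  refine sub_eq_zero.1 (h.eq_zero_of_F_pow_pred hL (Submodule.sub_mem _ h3 hx) ?_)
  rw [map_sub, ← hwx, ← Module.End.mul_apply, ← pow_add, show g - 1 + g' = r - 1 by omega, sub_self]

/-- On the piece `E^g F^g` is the product of the `C - c_{l-2m}` for `1 ≤ m ≤ g`. The last factor is
`C - c = F E`, and the others are invertible. -/
theorem exists_E_F_pow [FiniteDimensional ℂ X] (hg : 0 < g) {x : X} (hx : x ∈ A.piece G l c) :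
    ∃ y ∈ A.piece G l c, A.F (A.E x) = (A.E ^ g) ((A.F ^ g) y) := by
  have hr := hL.two_le
  have h1 := hL.add_eq
  have hpos := hL.pos
  have key : ∀ m < g, ∃ y ∈ A.piece G l c, x = (A.E ^ m) ((A.F ^ m) y) := by
    intro m
    induction m with
    | zero => exact fun _ => ⟨x, hx, rfl⟩
    | succ m ih =>
      intro hm
      obtain ⟨y, hy, hxy⟩ := ih (by omega)
      obtain ⟨z, hz, rfl⟩ := h.exists_casimirSub_eq hr
        (hL.ne_down (m := m + 1) (by omega) (by omega) (by omega)) hy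
      exact ⟨z, hz, by rw [h.E_pow_F_pow_succ hr hz.1, hxy]⟩
  obtain ⟨y, hy, hxy⟩ := key (g - 1) (by omega)
  refine ⟨y, hy, ?_⟩
  obtain ⟨p, rfl⟩ : ∃ p, g = p + 1 := ⟨g - 1, by omega⟩
  rw [h.F_E_eq hL hx, h.E_pow_F_pow_succ hr hy.1, ← (hL.down hg).eq, hxy, Nat.add_sub_cancel,
    h.casimirSub_E_pow hr, h.casimirSub_F_pow hr]

theorem E_F_pow_eq (hg : 0 < g) {x : X} (hx : x ∈ A.piece G l c) :
    (A.E ^ g) ((A.F ^ g) x) = (A.E ^ (g - 1)) ((A.F ^ (g - 1)) (A.F (A.E x))) := by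
  have hr := hL.two_le
  obtain ⟨p, rfl⟩ : ∃ p, g = p + 1 := ⟨g - 1, by omega⟩
  rw [h.F_E_eq hL hx, h.E_pow_F_pow_succ hr hx.1, ← (hL.down hg).eq, Nat.add_sub_cancel]

theorem E_F_pow_eq' (hg : 0 < g) {x : X} (hx : x ∈ A.piece G l c) :
    ∃ y ∈ A.piece G l c, (A.E ^ g) ((A.F ^ g) x) = A.F (A.E y) := by
  have hr := hL.two_le
  have hy : (A.E ^ (g - 1)) ((A.F ^ (g - 1)) x) ∈ A.piece G l c :=
    mem_piece_congr (h.E_pow_mem_piece hr (h.F_pow_mem_piece hr hx _) _) (by ring)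
  refine ⟨_, hy, ?_⟩
  rw [h.E_F_pow_eq hL hg hx, h.F_E_eq hL hy, h.F_E_eq hL hx, h.casimirSub_E_pow hr,
    h.casimirSub_F_pow hr]

theorem F_E_eq_zero_of_E_F_pow (hg : 0 < g) {x : X} (hx : x ∈ A.piece G l c)
    (h0 : (A.E ^ g) ((A.F ^ g) x) = 0) : A.F (A.E x) = 0 := by
  have hr := hL.two_le
  have h1 := hL.add_eq
  have hpos := hL.pos
  rw [h.E_F_pow_eq hL hg hx] at h0
  have hy := h.F_E_mem hL hx
  refine h.eq_zero_of_F_pow_pred hL hy (h.eq_zero_of_E_pow hr (h.F_pow_mem_piece hr hy _) (g - 1)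
    (fun m hm => ?_) h0)
  have := hL.ne_down (m := g - 1 - m) (by omega) (by omega) (by omega)
  rwa [show l - 2 * ((g - 1 - m : ℕ) : ℤ) = l - 2 * ((g - 1 : ℕ) : ℤ) + 2 * m by omega] at this

/-- Here `F^m E^m` is the product of the `C - c_{l+2p}` for `p < m`: its factor for `p = 0` is `F
E`, and for `m ≤ g'` the others are invertible. -/
theorem exists_F_E_pow [FiniteDimensional ℂ X] {x : X} (hx : x ∈ A.piece G l c) {m : ℕ}
    (h0 : 0 < m) (hm : m ≤ g') :
    ∃ y ∈ A.piece G l c, A.F (A.E x) = (A.F ^ m) ((A.E ^ m) y) := by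
  have hr := hL.two_le
  induction m, h0 using Nat.le_induction with
  | base => exact ⟨x, hx, by simp⟩
  | succ m h0 ih =>
    obtain ⟨y, hy, hxy⟩ := ih (by omega)
    obtain ⟨z, hz, rfl⟩ := h.exists_casimirSub_eq hr (hL.ne_up (m := m) (by omega) (by omega)) hy
    exact ⟨z, hz, by rw [h.F_pow_E_pow_succ hr hz.1, hxy]⟩

theorem F_E_pow_eq {m : ℕ} (h0 : 0 < m) {x : X} (hx : x ∈ A.piece G l c) :
    ∃ y ∈ A.piece G l c, (A.F ^ m) ((A.E ^ m) x) = A.F (A.E y) := by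
  have hr := hL.two_le
  induction m, h0 using Nat.le_induction generalizing x with
  | base => exact ⟨x, hx, by simp⟩
  | succ m h0 ih =>
    obtain ⟨y, hy, hxy⟩ := ih (h.casimirSub_mem_piece hr _ hx)
    exact ⟨y, hy, by rw [h.F_pow_E_pow_succ hr hx.1, hxy]⟩

theorem F_E_pow_eq_zero {m : ℕ} (h0 : 0 < m) {x : X} (hx : x ∈ A.piece G l c)
    (hx0 : A.F (A.E x) = 0) : (A.F ^ m) ((A.E ^ m) x) = 0 := by
  have hr := hL.two_le
  induction m, h0 using Nat.le_induction generalizing x with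
  | base => simpa using hx0
  | succ m h0 ih =>
    rw [h.F_pow_E_pow_succ hr hx.1]
    refine ih (h.casimirSub_mem_piece hr _ hx) ?_
    rw [h.F_E_casimirSub hr, hx0, map_zero]

theorem F_E_eq_zero_of_F_E_pow {m : ℕ} (h0 : 0 < m) (hm : m ≤ g') {x : X}
    (hx : x ∈ A.piece G l c) (hx0 : (A.F ^ m) ((A.E ^ m) x) = 0) : A.F (A.E x) = 0 := by
  have hr := hL.two_le
  induction m, h0 using Nat.le_induction generalizing x with
  | base => simpa using hx0
  | succ m h0 ih =>
    rw [h.F_pow_E_pow_succ hr hx.1] at hx0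
    have h1 := ih (by omega) (h.casimirSub_mem_piece hr _ hx) hx0
    rw [h.F_E_casimirSub hr] at h1
    exact eq_zero_of_casimirSub (hL.ne_up (by omega) (by omega)) (h.F_E_mem hL hx) h1

/-- Written as `E^g F^g y`, the vector `F E x` is killed by `E^{g'}` because `g + g' = r`, hence
already by `E`. -/
theorem E_F_E_eq_zero [FiniteDimensional ℂ X] (hg : 0 < g) {x : X} (hx : x ∈ A.piece G l c) :
    A.E (A.F (A.E x)) = 0 := by
  obtain ⟨y, hy, hxy⟩ := h.exists_E_F_pow hL hg hx
  refine h.E_eq_zero_of_E_pow hL (h.F_E_mem hL hx) ?_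
  rw [hxy, ← Module.End.mul_apply, ← pow_add, show g' + g = r by have := hL.add_eq; omega, A.E_pow,
    LinearMap.zero_apply]

theorem F_pow_F_E_eq_zero [FiniteDimensional ℂ X] {x : X} (hx : x ∈ A.piece G l c) :
    (A.F ^ g) (A.F (A.E x)) = 0 := by
  obtain ⟨y, hy, hxy⟩ := h.exists_F_E_pow hL hx hL.pos le_rfl
  rw [hxy, ← Module.End.mul_apply, ← pow_add, hL.add_eq, A.F_pow, LinearMap.zero_apply]

/-- A vector of highest weight type vanishes if `l + 1` is divisible by `r`. -/
theorem E_eq_zero_of_steinberg (hg : g = 0) {x : X} (hx : x ∈ A.piece G l c) : A.E x = 0 := by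
  refine h.E_eq_zero_of_E_pow hL hx ?_
  rw [show g' = r by have := hL.add_eq; omega, A.E_pow, LinearMap.zero_apply]

end

/-- The radical of a piece. -/
def _root_.RestrictedSl2.DModule.radical (A : DModule r X) (G : ℤ → Submodule ℂ X) (c : ℂ) (l : ℤ)
    (g g' : ℕ) : Submodule ℂ X :=
  (A.piece G (l + 2 * g') c).map (A.F ^ g') ⊔ (A.piece G (l - 2 * g) c).map (A.E ^ g)

theorem radical_le (h : A.IsGrading G) (hL : Linked r c l g g') :
    A.radical G c l g g' ≤ A.piece G l c := by
  refine sup_le ?_ ?_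
  · rintro _ ⟨x, hx, rfl⟩
    exact mem_piece_congr (h.F_pow_mem_piece hL.two_le hx _) (by ring)
  · rintro _ ⟨x, hx, rfl⟩
    exact mem_piece_congr (h.E_pow_mem_piece hL.two_le hx _) (by ring)

/-- The decisive use of exactness. The vector `z = E^{g'} x` is killed by `F^{g'}`, so `z = F^g w`
with `w` of weight `l + 2r`. From `E^g z = E^r x = 0` follows `F E w = 0`, and induction from the
top of the grading puts `w` into its radical. This allows `x` to be corrected by a value of `F^{g'}`
so that `E^{g'}` kills it; what remains is a value of `E^g`. -/
theorem mem_radical_of_F_E_eq_zero [FiniteDimensional ℂ X] (h : A.IsGrading G) (hA : A.IsExact)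
    (hL : Linked r c l g g') (hg : 0 < g) {x : X} (hx : x ∈ A.piece G l c)
    (hx0 : A.F (A.E x) = 0) : x ∈ A.radical G c l g g' := by
  obtain ⟨B, hB⟩ := h.bounded
  have hr := hL.two_le
  have hadd := hL.add_eq
  have hpos := hL.pos
  obtain ⟨n, hn⟩ : ∃ n : ℕ, B < l + 2 * r * n := by
    refine ⟨(B - l).toNat + 1, ?_⟩
    have h1 := Int.self_le_toNat (B - l)
    push_cast
    nlinarith
  induction n generalizing l x with
  | zero =>
    have h1 : x ∈ G l := hx.1
    rw [hB l (by simpa using hn), Submodule.mem_bot] at h1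
    rw [h1]
    exact Submodule.zero_mem _
  | succ n ih =>
    have hL' := hL.up hg
    have hL'' := hL'.up hpos
    have hz := h.E_pow_mem_piece hr hx g'
    obtain ⟨w, hw, hwz⟩ := h.exists_F_pow_eq hL' hA hpos hz (h.F_E_pow_eq_zero hL hpos hx hx0)
    have hw0 : A.F (A.E w) = 0 := by
      refine h.F_E_eq_zero_of_E_F_pow hL'' hg hw ?_
      rw [hwz, ← Module.End.mul_apply, ← pow_add, hadd, A.E_pow, LinearMap.zero_apply]
    have hbound : B < l + 2 * (g' : ℤ) + 2 * g + 2 * r * n := by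
      have : (g : ℤ) + g' = r := by exact_mod_cast hadd
      push_cast at hn
      linarith
    obtain ⟨_, ⟨a, ha, rfl⟩, _, ⟨b, hb, rfl⟩, hab⟩ := Submodule.mem_sup.1 (ih hL'' hw hw0 hbound)
    have hb' : b ∈ A.piece G (l + 2 * g') c := mem_piece_congr hb (by ring)
    -- The part `F^{g'} a` of `w` contributes `F^r a = 0` to `z`. The part `E^g b` contributes `F^g
    -- E^g b`, which is rewritten, through `F E`, as `E^{g'} F^{g'} b₂`.
    obtain ⟨b₁, hb₁, hbb₁⟩ := h.F_E_pow_eq hL' hg hb'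
    obtain ⟨b₂, hb₂, hbb₂⟩ := h.exists_E_F_pow hL' hpos hb₁
    have h1 : (A.E ^ g') x = (A.E ^ g') ((A.F ^ g') b₂) := by
      rw [← hwz, ← hab, map_add, ← Module.End.mul_apply, ← pow_add, hadd, A.F_pow,
        LinearMap.zero_apply, zero_add, hbb₁, hbb₂]
    have h2 : (A.F ^ g') b₂ ∈ A.piece G l c :=
      mem_piece_congr (h.F_pow_mem_piece hr hb₂ _) (by ring)
    obtain ⟨y, hy, hyx⟩ := h.exists_E_pow_eq hL hA (Submodule.sub_mem _ hx h2)
      (by rw [map_sub, h1, sub_self])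
    rw [← sub_add_cancel x ((A.F ^ g') b₂), ← hyx, add_comm]
    exact Submodule.add_mem_sup ⟨_, hb₂, rfl⟩ ⟨_, hy, rfl⟩

/-- A complement of the radical in every piece that contains highest weight vectors. -/
structure IsHead (A : DModule r X) (G : ℤ → Submodule ℂ X) (H : ℤ → Submodule ℂ X) : Prop where
  le : ∀ l, H l ≤ A.piece G l (casimirValue r l)
  sup : ∀ {c l g g'}, Linked r c l g g' → 0 < g →
    A.piece G l c ≤ A.radical G c l g g' ⊔ H l
  disjoint : ∀ {c l g g'}, Linked r c l g g' → 0 < g → Disjoint (A.radical G c l g g') (H l)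
  steinberg : ∀ {c l g g'}, Linked r c l g g' → g = 0 → H l = A.piece G l c

/-- A complement of the radical in the whole space, cut down to the piece, is a complement inside
the piece by the modular law. For `g = 0` the head is the whole piece. -/
theorem exists_isHead (h : A.IsGrading G) (hr : 2 ≤ r) : ∃ H, IsHead A G H := by
  have key : ∀ l, ∃ K ≤ A.piece G l (casimirValue r l), ∀ {c g g'}, Linked r c l g g' →
      (0 < g → A.piece G l c ≤ A.radical G c l g g' ⊔ K ∧ Disjoint (A.radical G c l g g') K) ∧
      (g = 0 → K = A.piece G l c) := by
    intro l
    obtain ⟨g, g', hL⟩ := Linked.exists_of hr l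
    rcases Nat.eq_zero_or_pos g with hg | hg
    · refine ⟨_, le_rfl, fun {c g₁ g₁'} hL₁ => ⟨fun h0 => ?_, fun _ => ?_⟩⟩
      · have := hL.unique hL₁
        omega
      · rw [hL₁.eq]
    · obtain ⟨K, hK⟩ := Submodule.exists_isCompl (A.radical G (casimirValue r l) l g g')
      refine ⟨K ⊓ A.piece G l (casimirValue r l), inf_le_right,
        fun {c g₁ g₁'} hL₁ => ⟨fun _ => ?_, fun h0 => ?_⟩⟩
      · obtain ⟨rfl, rfl⟩ := hL.unique hL₁
        rw [hL₁.eq]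
        refine ⟨?_, hK.disjoint.mono_right inf_le_left⟩
        rw [← sup_inf_assoc_of_le _ (h.radical_le hL), hK.sup_eq_top, top_inf_eq]
      · have := hL.unique hL₁
        omega
  choose H hH₁ hH₂ using key
  exact ⟨H, hH₁, fun hL hg => ((hH₂ _ hL).1 hg).1, fun hL hg => ((hH₂ _ hL).1 hg).2,
    fun hL hg => (hH₂ _ hL).2 hg⟩

/-! ### Generation by the heads -/

section Generation

variable [FiniteDimensional ℂ X] (h : A.IsGrading G) {H : ℤ → Submodule ℂ X} (hH : IsHead A G H)
  {T : Submodule ℂ X} (hTE : ∀ x ∈ T, A.E x ∈ T) (hTF : ∀ x ∈ T, A.F x ∈ T) (hTH : ∀ l, H l ≤ T)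
include h hH hTE hTF hTH

omit [FiniteDimensional ℂ X] h hH hTF hTH in
theorem E_pow_mem_of_stable {x : X} (hx : x ∈ T) (m : ℕ) : (A.E ^ m) x ∈ T := by
  induction m with
  | zero => exact hx
  | succ m ih => rw [pow_succ_apply]; exact hTE _ ih

omit [FiniteDimensional ℂ X] h hH hTE hTH in
theorem F_pow_mem_of_stable {x : X} (hx : x ∈ T) (m : ℕ) : (A.F ^ m) x ∈ T := by
  induction m with
  | zero => exact hx
  | succ m ih => rw [pow_succ_apply]; exact hTF _ ih

omit [FiniteDimensional ℂ X] h hTE hTF hTH in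
theorem exists_eq_add (hL : Linked r c l g g') (hg : 0 < g) {x : X} (hx : x ∈ A.piece G l c) :
    ∃ a ∈ A.piece G (l + 2 * g') c, ∃ b ∈ A.piece G (l - 2 * g) c, ∃ y ∈ H l,
      x = (A.F ^ g') a + (A.E ^ g) b + y := by
  obtain ⟨_, hz, y, hy, rfl⟩ := Submodule.mem_sup.1 (hH.sup hL hg hx)
  obtain ⟨_, ⟨a, ha, rfl⟩, _, ⟨b, hb, rfl⟩, rfl⟩ := Submodule.mem_sup.1 hz
  exact ⟨a, ha, b, hb, y, hy, rfl⟩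

/-- `F E` annihilates the radical: it commutes with `F^{g'}` and `E^g`, and these kill the vectors
`F E a` and `F E b` of the neighbouring pieces. Only the head contributes. -/
theorem F_E_mem_of_stable (hL : Linked r c l g g') (hg : 0 < g) {x : X}
    (hx : x ∈ A.piece G l c) : A.F (A.E x) ∈ T := by
  have hr := hL.two_le
  obtain ⟨a, ha, b, hb, y, hy, rfl⟩ := exists_eq_add hH hL hg hx
  have h1 : A.F (A.E ((A.F ^ g') a)) = 0 := by
    rw [h.F_E_eq hL (mem_piece_congr (h.F_pow_mem_piece hr ha g') (by ring)),
      h.casimirSub_F_pow hr, ← h.F_E_eq (hL.up hg) ha, h.F_pow_F_E_eq_zero (hL.up hg) ha]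
  have h2 : A.F (A.E ((A.E ^ g) b)) = 0 := by
    rw [h.F_E_eq hL (mem_piece_congr (h.E_pow_mem_piece hr hb g) (by ring)),
      h.casimirSub_E_pow hr, ← h.F_E_eq (hL.down hg) hb]
    obtain ⟨p, rfl⟩ : ∃ p, g = p + 1 := ⟨g - 1, by omega⟩
    rw [pow_succ, Module.End.mul_apply, h.E_F_E_eq_zero (hL.down hg) hL.pos hb, map_zero]
  rw [map_add, map_add, map_add, map_add, h1, h2, zero_add, zero_add]
  exact hTF _ (hTE _ (hTH l hy))

/-- The term from above becomes `F^r a = 0`, and the one from below is `F^g E^g b`, a value of `F E`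
on the neighbouring piece. -/
theorem F_pow_mem_of_stable' (hL : Linked r c l g g') (hg : 0 < g) {x : X}
    (hx : x ∈ A.piece G l c) : (A.F ^ g) x ∈ T := by
  have hr := hL.two_le
  obtain ⟨a, ha, b, hb, y, hy, rfl⟩ := exists_eq_add hH hL hg hx
  rw [map_add, map_add]
  refine Submodule.add_mem _ (Submodule.add_mem _ ?_ ?_) (F_pow_mem_of_stable hTF (hTH l hy) g)
  · rw [← Module.End.mul_apply, ← pow_add, hL.add_eq, A.F_pow]
    exact Submodule.zero_mem _
  · obtain ⟨z, hz, hbz⟩ := h.F_E_pow_eq (hL.down hg) hg hb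
    rw [hbz]
    exact h.F_E_mem_of_stable hH hTE hTF hTH (hL.down hg) hL.pos hz

theorem E_pow_mem_of_stable' (hL : Linked r c l g g') (hg : 0 < g) {x : X}
    (hx : x ∈ A.piece G l c) : (A.E ^ g') x ∈ T := by
  have hr := hL.two_le
  obtain ⟨a, ha, b, hb, y, hy, rfl⟩ := exists_eq_add hH hL hg hx
  rw [map_add, map_add]
  refine Submodule.add_mem _ (Submodule.add_mem _ ?_ ?_) (E_pow_mem_of_stable hTE (hTH l hy) g')
  · obtain ⟨z, hz, haz⟩ := h.E_F_pow_eq' (hL.up hg) hL.pos ha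
    rw [haz]
    exact h.F_E_mem_of_stable hH hTE hTF hTH (hL.up hg) hL.pos hz
  · rw [← Module.End.mul_apply, ← pow_add, add_comm, hL.add_eq, A.E_pow]
    exact Submodule.zero_mem _

theorem singular_piece_le (hL : Linked r c l g g') : A.piece G l c ≤ T := by
  intro x hx
  rcases Nat.eq_zero_or_pos g with hg | hg
  · exact hTH l (by rwa [hH.steinberg hL hg])
  · obtain ⟨a, ha, b, hb, y, hy, rfl⟩ := exists_eq_add hH hL hg hx
    exact Submodule.add_mem _ (Submodule.add_mem _
      (h.F_pow_mem_of_stable' hH hTE hTF hTH (hL.up hg) hL.pos ha)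
      (h.E_pow_mem_of_stable' hH hTE hTF hTH (hL.down hg) hL.pos hb)) (hTH l hy)

/-- Away from the chain `F E` is onto the piece, which is thus reached from the weight above it;
descending induction from the bound covers these pieces. The pieces at the weights of the chain are
generated by heads. -/
theorem eq_top_of_stable (hr : 2 ≤ r) : T = ⊤ := by
  obtain ⟨B, hB⟩ := h.bounded
  have key : ∀ (n : ℕ) (l : ℤ) (c : ℂ), B < l + 2 * n → A.piece G l c ≤ T := by
    intro n
    induction n with
    | zero =>
      intro l c hl x hx
      have h1 : x ∈ G l := hx.1
      rw [hB l (by simpa using hl), Submodule.mem_bot] at h1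
      rw [h1]
      exact Submodule.zero_mem _
    | succ n ih =>
      intro l c hl x hx
      by_cases hc : c = casimirValue r l
      · obtain ⟨g, g', hL⟩ := Linked.exists_of hr l
        rw [← hc] at hL
        exact h.singular_piece_le hH hTE hTF hTH hL hx
      · obtain ⟨y, hy, rfl⟩ := h.exists_casimirSub_eq hr hc hx
        rw [← h.F_E_apply hr hy.1]
        exact hTF _ (ih (l + 2) c (by push_cast at hl; linarith) (h.E_mem_piece hr hy))
  rw [eq_top_iff, ← h.iSup_eq_top]
  refine iSup_le fun l => (h.le_iSup_piece hr l).trans (iSup_le fun c => ?_)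
  refine key ((B - l).toNat + 1) l c ?_
  have h1 := Int.self_le_toNat (B - l)
  push_cast
  linarith

end Generation

end IsGrading

end DModule

end RestrictedSl2

end

/-! ### Summands generated by head vectors, and the decomposition theorem -/

noncomputable section

namespace RestrictedSl2

namespace DModule

variable {r : ℕ} {X : Type*} [AddCommGroup X] [Module ℂ X]

theorem span_range_eq_iSup_inf {ι κ : Type*} (G : κ → Submodule ℂ X) (v : ι → X)
    (hv : ∀ i, ∃ l, v i ∈ G l) : Submodule.span ℂ (Set.range v) =
      ⨆ l, Submodule.span ℂ (Set.range v) ⊓ G l := by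
  refine le_antisymm (Submodule.span_le.2 ?_) (iSup_le fun l => inf_le_left)
  rintro _ ⟨i, rfl⟩
  obtain ⟨l, hl⟩ := hv i
  exact Submodule.mem_iSup_of_mem l ⟨Submodule.subset_span ⟨i, rfl⟩, hl⟩

/-- Components of a vanishing sum of homogeneous vectors. -/
theorem sum_filter_eq_zero {ι κ : Type*} [DecidableEq κ] {G : κ → Submodule ℂ X}
    (hG : iSupIndep G) (s : Finset ι) (x y : ι → X) (w w' : ι → κ) (hx : ∀ i ∈ s, x i ∈ G (w i))
    (hy : ∀ i ∈ s, y i ∈ G (w' i)) (h0 : ∑ i ∈ s, (x i + y i) = 0) (l : κ) :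
    ∑ i ∈ s with w i = l, x i + ∑ i ∈ s with w' i = l, y i = 0 := by
  rw [iSupIndep_iff_finsetSum_eq_zero_imp_eq_zero] at hG
  have h1 := hG (s.image w ∪ s.image w')
    (fun l => ∑ i ∈ s with w i = l, x i + ∑ i ∈ s with w' i = l, y i) ?_ ?_
  · by_cases hl : l ∈ s.image w ∪ s.image w'
    · exact h1 l hl
    · rw [Finset.mem_union, not_or, Finset.mem_image, Finset.mem_image] at hl
      rw [Finset.filter_eq_empty_iff.2 fun i hi h => hl.1 ⟨i, hi, h⟩,
        Finset.filter_eq_empty_iff.2 fun i hi h => hl.2 ⟨i, hi, h⟩]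
      simp
  · intro l _
    refine Submodule.add_mem _ (Submodule.sum_mem _ fun i hi => ?_)
      (Submodule.sum_mem _ fun i hi => ?_)
    · obtain ⟨hi', rfl⟩ := Finset.mem_filter.1 hi
      exact hx i hi'
    · obtain ⟨hi', rfl⟩ := Finset.mem_filter.1 hi
      exact hy i hi'
  · rw [Finset.sum_add_distrib, Finset.sum_fiberwise_of_maps_to, Finset.sum_fiberwise_of_maps_to,
      ← Finset.sum_add_distrib, h0]
    · exact fun i hi => Finset.mem_union_right _ (Finset.mem_image_of_mem _ hi)
    · exact fun i hi => Finset.mem_union_left _ (Finset.mem_image_of_mem _ hi)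

theorem linearIndependent_of_fiber {ι κ : Type*} {G : κ → Submodule ℂ X} (hG : iSupIndep G)
    (v : ι → X) (w : ι → κ) (hv : ∀ i, v i ∈ G (w i))
    (h : ∀ l, LinearIndependent ℂ fun i : {i // w i = l} => v i) : LinearIndependent ℂ v := by
  classical
  rw [linearIndependent_iff']
  intro s a h0 i hi
  have h1 := sum_filter_eq_zero hG s (fun i => a i • v i) 0 w w
    (fun i _ => Submodule.smul_mem _ _ (hv i)) (fun i _ => Submodule.zero_mem _)
    (by simpa using h0) (w i)
  simp only [Pi.zero_apply, Finset.sum_const_zero, add_zero] at h1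
  have h2 := (linearIndependent_iff'.1 (h (w i))) ((s.filter (w · = w i)).subtype (w · = w i))
    (fun j => a j) ?_ ⟨i, rfl⟩ (by simpa using hi)
  · exact h2
  · rw [← h1, Finset.sum_subtype_of_mem (fun j => a j • v j)]
    exact fun j hj => (Finset.mem_filter.1 hj).2

variable {A : DModule r X} {G : ℤ → Submodule ℂ X} {H : ℤ → Submodule ℂ X}

/-- The properties of the summand that is generated by a vector `x` of weight `l` in a head. -/
structure IsSummand (A : DModule r X) (hr : 0 < r) (G : ℤ → Submodule ℂ X) (l : ℤ) (x : X)
    (N : Submodule ℂ X) : Prop where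
  mem : x ∈ N
  E_mem : ∀ y ∈ N, A.E y ∈ N
  F_mem : ∀ y ∈ N, A.F y ∈ N
  homogeneous : N = ⨆ l, N ⊓ G l
  type : (∃ (α : ℂ) (hα : α ^ 4 = 1)
      (f : DEmbedding (simpleModule r α hα (r - 1) (Nat.sub_lt hr one_pos)) A),
        LinearMap.range f.toLin = N) ∨
    (∃ (α : ℂ) (hα : α ^ 4 = 1) (i j : ℕ) (h : i + j + 2 = r)
      (f : DEmbedding (projModule r α hα i j h) A), LinearMap.range f.toLin = N)
  ker : ∀ {c g g'}, Linked r c l g g' → ∀ y ∈ N, A.E y = 0 →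
    ∃ a b : ℂ, y = a • (if g = 0 then x else A.F (A.E x)) + b • (A.E ^ g') x

/-- The choice `α = q^{(l-i)/2}` satisfies `α⁴ = 1` precisely because `r` divides `l - i` and
`q^{1/2}` has order `4r`. -/
theorem exists_twist {c : ℂ} {l : ℤ} {g g' : ℕ} (hL : Linked r c l g g') (i : ℤ)
    (hi : (r : ℤ) ∣ l - i) : ∃ α : ℂ, α ^ 4 = 1 ∧ qHalf r ^ l = α * qHalf r ^ i := by
  refine ⟨qHalf r ^ (l - i), ?_, ?_⟩
  · rw [← zpow_natCast, ← zpow_mul, (qHalf_primitive (by have := hL.two_le; omega)).zpow_eq_one_iff_dvd]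
    obtain ⟨x, hx⟩ := hi
    exact ⟨x, by rw [hx]; push_cast; ring⟩
  · rw [← zpow_add₀ (qHalf_ne_zero r), sub_add_cancel]

/-- For `g = 0` the weight is that of a simple projective module. Otherwise `i = g - 1` and `j = g'
- 1`: the vector `x` is outside the radical, whence `F E x ≠ 0`, and the other conditions on a
generator of `P^α_i` hold for every vector of the piece. -/
theorem IsGrading.exists_isSummand [FiniteDimensional ℂ X] (h : A.IsGrading G) (hA : A.IsExact)
    (hr : 2 ≤ r) (hH : IsGrading.IsHead A G H) {l : ℤ} {x : X} (hx : x ∈ H l) (hx0 : x ≠ 0) :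
    ∃ N, IsSummand A (by omega) G l x N := by
  obtain ⟨g, g', hL⟩ := Linked.exists_of hr l
  have hxl := hH.le l hx
  have hadd := hL.add_eq
  have hpos := hL.pos
  have hk := h.k_apply l x hxl.1
  rcases Nat.eq_zero_or_pos g with hg | hg
  · obtain ⟨α, hα, hαl⟩ := exists_twist hL (r - 1 : ℕ) (by
      obtain ⟨y, hy⟩ := hL.dvd
      refine ⟨y - 1, ?_⟩
      rw [hg] at hy
      rw [Nat.cast_sub (by omega)]
      push_cast at hy ⊢
      linear_combination hy)
    rw [hαl] at hk
    have hE := h.E_eq_zero_of_steinberg hL hg hxl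
    obtain ⟨f, hf⟩ := exists_simpleEmbedding hr hα (Nat.sub_lt (by omega) one_pos) hk hE
      (by rw [Nat.sub_add_cancel (by omega), A.F_pow, LinearMap.zero_apply]) hx0
    have hfu : f.toLin (u (r - 1) 0) = x := by
      rw [hf, simpleMap_u (by omega)]
      simp [simpleCoeff]
    refine ⟨LinearMap.range f.toLin, ⟨⟨_, hfu⟩, ?_, ?_, ?_, Or.inl ⟨α, hα, f, rfl⟩, ?_⟩⟩
    · rintro _ ⟨y, rfl⟩
      exact ⟨_, f.map_E y⟩
    · rintro _ ⟨y, rfl⟩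
      exact ⟨_, f.map_F y⟩
    · rw [hf, simpleMap, Finsupp.range_linearCombination]
      refine span_range_eq_iSup_inf _ _ fun m => ⟨l - 2 * (m : ℕ), Submodule.smul_mem _ _ ?_⟩
      rw [scaledF, smul_pow]
      exact Submodule.smul_mem _ _ (h.F_pow_mem hxl.1 m)
    · rintro c₁ g₁ g₁' hL₁ _ ⟨y, rfl⟩ hy
      obtain ⟨rfl, rfl⟩ := hL.unique hL₁
      rw [← f.map_E, ← map_zero f.toLin] at hy
      obtain ⟨a, rfl⟩ := simpleE_eq_zero (f.injective hy)
      exact ⟨a, 0, by rw [if_pos hg, map_smul, hfu, zero_smul, add_zero]⟩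
  · obtain ⟨i, rfl⟩ : ∃ i, g = i + 1 := ⟨g - 1, by omega⟩
    obtain ⟨j, rfl⟩ : ∃ j, g' = j + 1 := ⟨g' - 1, by omega⟩
    obtain ⟨α, hα, hαl⟩ := exists_twist hL i (by
      have := hL.dvd
      push_cast at this
      rwa [show l + 1 - ((i : ℤ) + 1) = l - i by ring] at this)
    rw [hαl] at hk
    have hFE : A.F (A.E x) ≠ 0 := fun h0 => hx0
      (Submodule.disjoint_def.1 (hH.disjoint hL hg) x
        (h.mem_radical_of_F_E_eq_zero hA hL hg hxl h0) hx)
    have hEg : (A.E ^ (j + 1)) x ≠ 0 := fun h0 => hFE (by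
      rw [h.E_eq_zero_of_E_pow hL hxl h0, map_zero])
    -- `E^{g'} x` lies at the next weight of the chain and is killed by `E^g`, hence by `E`.
    have hEg' : (A.E ^ (j + 2)) x = 0 := by
      rw [pow_succ_apply]
      refine h.E_eq_zero_of_E_pow (hL.up hg) (h.E_pow_mem_piece hr hxl _) ?_
      rw [← Module.End.mul_apply, ← pow_add, hadd, A.E_pow, LinearMap.zero_apply]
    obtain ⟨f, hf⟩ := exists_projEmbedding (j := j) hα (by omega) hk
      (h.E_F_E_eq_zero hL hg hxl) hEg'
      (by rw [pow_succ, Module.End.mul_apply, h.F_pow_F_E_eq_zero hL hxl]) hFE hEg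
    have hfH : f.toLin (wH i j 0) = x := by
      rw [hf, projMap_wH (by omega)]
      simp
    refine ⟨LinearMap.range f.toLin, ⟨⟨_, hfH⟩, ?_, ?_, ?_, Or.inr ⟨α, hα, i, j, _, f, rfl⟩, ?_⟩⟩
    · rintro _ ⟨y, rfl⟩
      exact ⟨_, f.map_E y⟩
    · rintro _ ⟨y, rfl⟩
      exact ⟨_, f.map_F y⟩
    · rw [hf, projMap, Finsupp.range_linearCombination]
      refine span_range_eq_iSup_inf _ _ ?_
      have hF : ∀ {l y}, y ∈ G l → ∀ m : ℕ, (A.scaledF α ^ m) y ∈ G (l - 2 * m) := by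
        intro l y hy m
        rw [scaledF, smul_pow]
        exact Submodule.smul_mem _ _ (h.F_pow_mem hy m)
      rintro (m | m | m | m)
      · exact ⟨_, hF hxl.1 _⟩
      · exact ⟨_, hF (h.E_mem _ _ hxl.1) _⟩
      · exact ⟨_, hF hxl.1 _⟩
      · exact ⟨_, h.E_pow_mem hxl.1 _⟩
    · rintro c₁ g₁ g₁' hL₁ _ ⟨y, rfl⟩ hy
      obtain ⟨rfl, rfl⟩ := hL.unique hL₁
      rw [← f.map_E, ← map_zero f.toLin] at hy
      obtain ⟨a, b, rfl⟩ := projE_eq_zero (by omega) (f.injective hy)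
      refine ⟨a * α ^ 2, b, ?_⟩
      rw [if_neg (by omega), map_add, map_smul, map_smul, hf, projMap_wS (by omega),
        projMap_wR (by omega), zero_add, pow_one, scaledF, LinearMap.smul_apply, smul_smul,
        Nat.sub_zero]

/-- The summands that are generated by a basis of the heads are independent. -/
theorem IsGrading.iSupIndep_of_isSummand [FiniteDimensional ℂ X] (h : A.IsGrading G)
    (hA : A.IsExact) (hr : 2 ≤ r) (hH : IsGrading.IsHead A G H) {ι : Type*} (v : ι → X)
    (w : ι → ℤ) (hvH : ∀ i, v i ∈ H (w i)) (hv : LinearIndependent ℂ v) (N : ι → Submodule ℂ X)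
    (hN : ∀ i, IsSummand A (by omega) G (w i) (v i) (N i)) : iSupIndep N := by
  classical
  refine iSupIndep_of_inf_ker N A.E A.E_pow (fun i => (hN i).E_mem) ?_
  rw [iSupIndep_iff_finsetSum_eq_zero_imp_eq_zero]
  intro s y hy hy0
  choose g g' hL using fun i => Linked.exists_of hr (w i)
  have key : ∀ i, ∃ a b : ℂ, i ∈ s → y i = a • (if g i = 0 then v i else A.F (A.E (v i))) +
      b • (A.E ^ g' i) (v i) := by
    intro i
    by_cases hi : i ∈ s
    · obtain ⟨a, b, hab⟩ := (hN i).ker (hL i) (y i) (hy i hi).1 (hy i hi).2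
      exact ⟨a, b, fun _ => hab⟩
    · exact ⟨0, 0, fun h => absurd h hi⟩
  choose a b hab using key
  rw [Finset.sum_congr rfl hab] at hy0
  have hvG : ∀ i, v i ∈ G (w i) := fun i => (hH.le _ (hvH i)).1
  have hsum := sum_filter_eq_zero h.indep s _ _ w (fun i => w i + 2 * g' i)
    (fun i _ => Submodule.smul_mem _ _ (by
      split_ifs
      · exact hvG i
      · have := h.F_mem _ _ (h.E_mem _ _ (hvG i))
        rwa [add_sub_cancel_right] at this))
    (fun i _ => Submodule.smul_mem _ _ (h.E_pow_mem (hvG i) (g' i))) hy0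
  have hind : ∀ (t : Finset ι) (a : ι → ℂ), ∑ i ∈ t, a i • v i = 0 → ∀ i ∈ t, a i = 0 :=
    linearIndependent_iff'.1 hv
  have hmem : ∀ (a : ι → ℂ) l, ∑ i ∈ s with w i = l, a i • v i ∈ H l := by
    intro a l
    refine Submodule.sum_mem _ fun i hi => Submodule.smul_mem _ _ ?_
    obtain ⟨_, rfl⟩ := Finset.mem_filter.1 hi
    exact hvH i
  -- At a fixed weight `l` only two kinds of terms meet: the `F E v_i` with `v_i` of weight `l`, and
  -- the `E^γ v_i` with `v_i` of weight `l - 2γ`.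
  have main : ∀ {c l γ γ'}, Linked r c l γ γ' → 0 < γ →
      ∑ i ∈ s with w i = l, a i • v i = 0 ∧ ∑ i ∈ s with w i = l - 2 * γ, b i • v i = 0 := by
    intro c l γ γ' hLl hγ
    have hL' := hLl.down hγ
    have h1 := hsum l
    have e1 : ∑ i ∈ s with w i = l, a i • (if g i = 0 then v i else A.F (A.E (v i))) =
        A.F (A.E (∑ i ∈ s with w i = l, a i • v i)) := by
      rw [map_sum, map_sum]
      refine Finset.sum_congr rfl fun i hi => ?_
      obtain ⟨_, rfl⟩ := Finset.mem_filter.1 hi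
      have := (hL i).unique hLl
      rw [if_neg (by omega), map_smul, map_smul]
    have e2 : ∑ i ∈ s with w i + 2 * (g' i : ℤ) = l, b i • (A.E ^ g' i) (v i) =
        (A.E ^ γ) (∑ i ∈ s with w i = l - 2 * γ, b i • v i) := by
      rw [map_sum]
      have e3 : s.filter (fun i => w i + 2 * (g' i : ℤ) = l) = s.filter (w · = l - 2 * γ) := by
        refine Finset.filter_congr fun i _ => ⟨fun hi => ?_, fun hi => ?_⟩
        · by_cases hgi : g i = 0
          · have hd := (hL i).dvd
            have hadd := (hL i).add_eq
            have hd' := hLl.dvd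
            have hadd' := hLl.add_eq
            have hpos' := hLl.pos
            exfalso
            obtain ⟨x, hx⟩ := hd
            obtain ⟨z, hz⟩ := hd'
            have : (r : ℤ) ∣ γ := ⟨x + 2 - z, by
              rw [hgi] at hx hadd
              have : (g' i : ℤ) = r := by omega
              rw [this] at hi
              push_cast at hx
              linear_combination hx - hz - hi⟩
            have := Int.le_of_dvd (by omega) this
            omega
          · have hh := ((hL i).up (by omega))
            rw [hi] at hh
            have := hh.unique hLl
            omega
        · have hh := hL i
          rw [hi] at hh
          have := hh.unique hL'
          omega
      rw [e3]
      refine Finset.sum_congr rfl fun i hi => ?_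
      obtain ⟨_, hi⟩ := Finset.mem_filter.1 hi
      have hh := hL i
      rw [hi] at hh
      rw [map_smul, (hh.unique hL').2]
    rw [e1, e2] at h1
    have hAl := hH.le _ (hmem a l)
    have hBl := hH.le _ (hmem b (l - 2 * γ))
    rw [← hLl.eq] at hAl
    rw [← hL'.eq] at hBl
    -- `F^γ` kills the terms `F E v_i`. What is left shows that the combination at `l - 2γ` lies in
    -- the radical as well as in the head, so it is zero; after that the same holds for the
    -- combination at `l`.
    have h2 := congrArg (A.F ^ γ) h1
    rw [map_add, h.F_pow_F_E_eq_zero hLl hAl, map_zero, zero_add] at h2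
    have h3 := h.F_E_eq_zero_of_F_E_pow hL' hγ le_rfl hBl h2
    have h4 := Submodule.disjoint_def.1 (hH.disjoint hL' hLl.pos) _
      (h.mem_radical_of_F_E_eq_zero hA hL' hLl.pos hBl h3) (hmem b _)
    refine ⟨?_, h4⟩
    rw [h4, map_zero, add_zero] at h1
    exact Submodule.disjoint_def.1 (hH.disjoint hLl hγ) _
      (h.mem_radical_of_F_E_eq_zero hA hLl hγ hAl h1) (hmem a _)
  intro i hi
  rw [hab i hi]
  rcases Nat.eq_zero_or_pos (g i) with hg | hg
  · have hE : (A.E ^ g' i) (v i) = 0 := by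
      rw [show g' i = r by have := (hL i).add_eq; omega, A.E_pow, LinearMap.zero_apply]
    have h1 := hsum (w i)
    -- At a weight with `g = 0` no right-hand highest weight vector can interfere: a simple summand
    -- gives `E^r v_p = 0`, and from `g p > 0` the weight reached has a positive parameter.
    have e2 : ∑ p ∈ s with w p + 2 * (g' p : ℤ) = w i, b p • (A.E ^ g' p) (v p) = 0 := by
      refine Finset.sum_eq_zero fun p hp => ?_
      obtain ⟨_, hp⟩ := Finset.mem_filter.1 hp
      rcases Nat.eq_zero_or_pos (g p) with hgp | hgp
      · rw [show g' p = r by have := (hL p).add_eq; omega, A.E_pow, LinearMap.zero_apply,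
          smul_zero]
      · have hh := (hL p).up hgp
        rw [hp] at hh
        have := hh.unique (hL i)
        have := (hL p).pos
        omega
    rw [e2, add_zero] at h1
    have e1 : ∑ p ∈ s with w p = w i, a p • (if g p = 0 then v p else A.F (A.E (v p))) =
        ∑ p ∈ s with w p = w i, a p • v p := by
      refine Finset.sum_congr rfl fun p hp => ?_
      obtain ⟨_, hp⟩ := Finset.mem_filter.1 hp
      have hh := hL p
      rw [hp] at hh
      have := hh.unique (hL i)
      rw [if_pos (by omega)]
    rw [e1] at h1
    rw [hind _ a h1 i (Finset.mem_filter.2 ⟨hi, rfl⟩), hE, zero_smul, smul_zero, add_zero]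
  · have h1 := hind _ a (main (hL i) hg).1 i (Finset.mem_filter.2 ⟨hi, rfl⟩)
    have h2 := hind _ b (main ((hL i).up hg) (hL i).pos).2 i
      (Finset.mem_filter.2 ⟨hi, by ring⟩)
    rw [h1, h2, zero_smul, zero_smul, add_zero]

/-- A graded module that is free over `ℂ[E]/(E^r)` and over `ℂ[F]/(F^r)` is a direct sum of
graded submodules isomorphic to some `V^α_{r-1}` or to some `P^α_i`. -/
theorem IsGrading.exists_decomposition [FiniteDimensional ℂ X] (h : A.IsGrading G)
    (hA : A.IsExact) (hr : 2 ≤ r) :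
    ∃ (m : ℕ) (N : Fin m → Submodule ℂ X), DirectSum.IsInternal N ∧
      (∀ s, N s = ⨆ l, N s ⊓ G l) ∧ ∀ s,
      (∃ (α : ℂ) (hα : α ^ 4 = 1)
        (f : DEmbedding (simpleModule r α hα (r - 1) (Nat.sub_lt (by omega) one_pos)) A),
          LinearMap.range f.toLin = N s) ∨
      (∃ (α : ℂ) (hα : α ^ 4 = 1) (i j : ℕ) (h : i + j + 2 = r)
        (f : DEmbedding (projModule r α hα i j h) A), LinearMap.range f.toLin = N s) := by
  obtain ⟨H, hH⟩ := h.exists_isHead hr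
  choose S hS hspan hlin using fun l => exists_linearIndependent ℂ (H l : Set X)
  let ι := {p : ℤ × X // p.2 ∈ S p.1}
  let v : ι → X := fun p => p.1.2
  let w : ι → ℤ := fun p => p.1.1
  have hvH : ∀ i, v i ∈ H (w i) := fun i => hS _ i.2
  have hv : LinearIndependent ℂ v := by
    refine linearIndependent_of_fiber h.indep v w (fun i => (hH.le _ (hvH i)).1) fun l => ?_
    -- Bases of the heads at different weights are independent since the weight spaces are; within
    -- one weight they are independent by choice.
    refine (hlin l).comp (fun i : {i // w i = l} => ⟨v i, (congrArg S i.2 : S i.1.1.1 = S l) ▸ i.1.2⟩) ?_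
    rintro ⟨⟨⟨l₁, x₁⟩, h₁⟩, h₁'⟩ ⟨⟨⟨l₂, x₂⟩, h₂⟩, h₂'⟩ h12
    have h₃ : l₁ = l := h₁'
    have h₄ : l₂ = l := h₂'
    have h₅ : x₁ = x₂ := congrArg Subtype.val h12
    subst h₃ h₄ h₅
    rfl
  have : Finite ι := hv.finite
  choose N hN using fun i : ι => h.exists_isSummand hA hr hH (hvH i) (hv.ne_zero i)
  have hNind := h.iSupIndep_of_isSummand hA hr hH v w hvH hv N hN
  have hNtop : ⨆ i, N i = ⊤ := by
    refine h.eq_top_of_stable hH (T := ⨆ i, N i) (fun x hx => ?_) (fun x hx => ?_) (fun l => ?_) hr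
    · have : (⨆ i, N i) ≤ (⨆ i, N i).comap A.E :=
        iSup_le fun i x hx => Submodule.mem_iSup_of_mem i ((hN i).E_mem x hx)
      exact this hx
    · have : (⨆ i, N i) ≤ (⨆ i, N i).comap A.F :=
        iSup_le fun i x hx => Submodule.mem_iSup_of_mem i ((hN i).F_mem x hx)
      exact this hx
    · rw [← Submodule.span_eq (H l), ← hspan l, Submodule.span_le]
      exact fun x hx => Submodule.mem_iSup_of_mem (⟨(l, x), hx⟩ : ι) (hN _).mem
  obtain ⟨m, ⟨e⟩⟩ := Finite.exists_equiv_fin ι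
  refine ⟨m, N ∘ e.symm, ?_, fun s => (hN _).homogeneous, fun s => (hN _).type⟩
  rw [DirectSum.isInternal_submodule_iff_iSupIndep_and_iSup_eq_top]
  refine ⟨hNind.comp e.symm.injective, ?_⟩
  rw [← hNtop]
  exact e.symm.surjective.iSup_comp N

end DModule

end RestrictedSl2

end

/-! ### Operators on single tensor factors, and twisted shifts -/

noncomputable section

namespace RestrictedSl2

section Leg

variable {X : Type*} [AddCommGroup X] [Module ℂ X] {n : ℕ}

theorem map_ite_eq (a : Fin n) (T : Module.End ℂ X) :
    (PiTensorProduct.map fun b => if b = a then T else 1) =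
      PiTensorProduct.map (Function.update (fun _ : Fin n => (1 : Module.End ℂ X)) a T) := by
  congr 1
  ext1 b
  by_cases h : b = a
  · subst h
    simp
  · simp [h]

/-- The linear map underlying `leg`. -/
def legLinear (a : Fin n) : Module.End ℂ X →ₗ[ℂ] Module.End ℂ (⨂[ℂ] _ : Fin n, X) where
  toFun T := PiTensorProduct.map fun b => if b = a then T else 1
  map_add' S T := by
    rw [map_ite_eq, map_ite_eq, map_ite_eq, PiTensorProduct.map_update_add]
  map_smul' c T := by
    rw [map_ite_eq, map_ite_eq, PiTensorProduct.map_update_smul, RingHom.id_apply]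

/-- The operator that acts by `T` on the tensor factor `a` of `X^{⊗ n}`. -/
def leg (a : Fin n) : Module.End ℂ X →ₐ[ℂ] Module.End ℂ (⨂[ℂ] _ : Fin n, X) :=
  AlgHom.ofLinearMap (legLinear a)
    (by
      change PiTensorProduct.map _ = _
      simp only [ite_self]
      exact PiTensorProduct.map_one)
    (fun S T => by
      change PiTensorProduct.map _ = PiTensorProduct.map _ * PiTensorProduct.map _
      rw [← PiTensorProduct.map_mul]
      congr 1
      ext1 b
      by_cases h : b = a
      · simp [h]
      · simp [h])

theorem leg_eq_map (a : Fin n) (T : Module.End ℂ X) :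
    leg a T = PiTensorProduct.map fun b => if b = a then T else 1 := rfl

theorem leg_commute_map {a : Fin n} {T : Module.End ℂ X} {f : Fin n → Module.End ℂ X}
    (h : Commute T (f a)) : Commute (leg a T) (PiTensorProduct.map f) := by
  rw [leg_eq_map, commute_iff_eq, ← PiTensorProduct.map_mul, ← PiTensorProduct.map_mul]
  congr 1
  ext1 b
  by_cases hb : b = a
  · subst hb
    simpa using h.eq
  · simp [hb]

theorem leg_commute {a b : Fin n} (hab : a ≠ b) (S T : Module.End ℂ X) :
    Commute (leg a S) (leg b T) := by
  rw [leg_eq_map b]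
  exact leg_commute_map (by rw [if_neg hab]; exact Commute.one_right S)

theorem leg_mul_leg {a b : Fin n} (hab : a ≠ b) (S T : Module.End ℂ X) :
    leg a S * leg b T =
      PiTensorProduct.map fun c => if c = a then S else if c = b then T else 1 := by
  rw [leg_eq_map, leg_eq_map, ← PiTensorProduct.map_mul]
  congr 1
  ext1 c
  by_cases h : c = a
  · subst h
    simp [hab]
  · simp [h]

end Leg

/-! ### Exactness of `E` and of `F` on tensor powers -/

section Exact

variable {M : Type*} [AddCommGroup M] [Module ℂ M]

/-- Data by which a nilpotent operator `D` is recognized as a free action of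
`ℂ[D]/(D^(N+1))`: a projection `P` onto a complement of the image of `D` and a family of
sections. -/
structure IsShift {R : Type*} [Ring R] (D : R) (N : ℕ) (P : R) (Q : ℕ → R) : Prop where
  proj : P * P = P
  eq_zero : ∀ k < N, P * D ^ k * Q N = 0
  eq_proj : P * D ^ N * Q N = P
  sum_eq_one : ∑ m ∈ Finset.range (N + 1), Q m * P * D ^ m = 1

theorem IsShift.map {R S : Type*} [Ring R] [Ring S] [Algebra ℂ R] [Algebra ℂ S] {D P : R}
    {N : ℕ} {Q : ℕ → R} (h : IsShift D N P Q) (φ : R →ₐ[ℂ] S) :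
    IsShift (φ D) N (φ P) (fun m => φ (Q m)) where
  proj := by rw [← map_mul, h.proj]
  eq_zero k hk := by rw [← map_pow, ← map_mul, ← map_mul, h.eq_zero k hk, map_zero]
  eq_proj := by rw [← map_pow, ← map_mul, ← map_mul, h.eq_proj]
  sum_eq_one := by
    rw [← map_one φ, ← h.sum_eq_one, map_sum]
    simp only [map_mul, map_pow]

/-- The situation in which an operator `T` is the sum of `D * K`, where `D` is a shift and `K` is
invertible, and of an operator that commutes with it up to a scalar. -/
structure IsTwistedShift (T D K Kinv y P : Module.End ℂ M) (Q : ℕ → Module.End ℂ M) (ω : ℂ)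
    (N : ℕ) : Prop where
  shift : IsShift D N P Q
  eq_add : T = D * K + y
  qcomm : y * (D * K) = ω • (D * K * y)
  ne_zero : ω ≠ 0
  pow_eq_zero : T ^ (N + 1) = 0
  inv_mul : Kinv * K = 1
  mul_inv : K * Kinv = 1
  comm_DK : Commute D K
  comm_PK : Commute P K
  comm_QK : Commute (Q N) K
  comm_Py : Commute P y
  comm_Qy : Commute (Q N) y

variable {T D K Kinv y P : Module.End ℂ M} {Q : ℕ → Module.End ℂ M} {ω : ℂ} {N : ℕ}

theorem qcomm_pow {R : Type*} [Ring R] [Algebra ℂ R] {x y : R} {ω : ℂ} (h : y * x = ω • (x * y))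
    (m : ℕ) : y * x ^ m = ω ^ m • (x ^ m * y) := by
  induction m with
  | zero => simp
  | succ m ih =>
    rw [pow_succ x, ← mul_assoc, ih, smul_mul_assoc, mul_assoc, h, mul_smul_comm, smul_smul,
      ← pow_succ, mul_assoc]

/-- On `ker T` the operator `D K` equals `-y`, and `y` passes `(D K)^m` up to a scalar and commutes
with `P`. So `P x = 0` propagates to `P (D K)^m x = 0`; the invertible `K` is removed, and the
vectors `P D^m x` determine `x`. -/
theorem IsTwistedShift.eq_zero (h : IsTwistedShift T D K Kinv y P Q ω N) {x : M} (hT : T x = 0)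
    (hP : P x = 0) : x = 0 := by
  have h1 : ∀ m, (P * (D * K) ^ m) x = 0 := by
    intro m
    induction m with
    | zero => simpa using hP
    | succ m ih =>
      have e : (D * K) x = -y x := by
        rw [h.eq_add, LinearMap.add_apply] at hT
        exact eq_neg_of_add_eq_zero_left hT
      have e2 : ω ^ m • (P * (D * K) ^ m * y) = y * (P * (D * K) ^ m) := by
        rw [mul_assoc, ← mul_smul_comm, ← qcomm_pow h.qcomm, ← mul_assoc, h.comm_Py.eq, mul_assoc]
      have e3 : ω ^ m • (P * (D * K) ^ m * y) x = 0 := by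
        rw [← LinearMap.smul_apply, e2, Module.End.mul_apply, ih, map_zero]
      rw [smul_eq_zero_iff_right (pow_ne_zero m h.ne_zero)] at e3
      rw [pow_succ, ← mul_assoc, Module.End.mul_apply, e, map_neg, ← Module.End.mul_apply, e3,
        neg_zero]
  have h2 : ∀ m, (P * D ^ m) x = 0 := by
    intro m
    have e : Kinv ^ m * (P * (D * K) ^ m) = P * D ^ m := by
      have hc : Commute Kinv K := h.inv_mul.trans h.mul_inv.symm
      have hPD : Commute (P * D ^ m) (K ^ m) :=
        ((h.comm_PK.pow_right m).mul_left (h.comm_DK.pow_pow m m))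
      rw [h.comm_DK.mul_pow, ← mul_assoc P, hPD.eq, ← mul_assoc, ← hc.mul_pow, h.inv_mul, one_pow,
        one_mul]
    rw [← e, Module.End.mul_apply, h1, map_zero]
  have h3 := congrArg (fun T => T x) h.shift.sum_eq_one
  simp only [LinearMap.sum_apply, Module.End.one_apply] at h3
  rw [← h3]
  refine Finset.sum_eq_zero fun m _ => ?_
  rw [mul_assoc, Module.End.mul_apply, h2, map_zero]

/-- In the `q`-binomial expansion of `T^N` every term with fewer than `N` factors `D` dies between
`P` and `Q N`. The term `(D K)^N` survives with coefficient `1`, and `Kinv^N` cancels `K^N`. -/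
theorem IsTwistedShift.section_eq (h : IsTwistedShift T D K Kinv y P Q ω N) :
    P * (T ^ N * Q N * Kinv ^ N) = P := by
  have hc : Commute K Kinv := h.mul_inv.trans h.inv_mul.symm
  have hterm : ∀ k, P * ((D * K) ^ k * y ^ (N - k)) * Q N =
      P * D ^ k * Q N * (K ^ k * y ^ (N - k)) := by
    intro k
    have h1 : Commute (Q N) (K ^ k * y ^ (N - k)) :=
      (h.comm_QK.pow_right k).mul_right (h.comm_Qy.pow_right _)
    rw [h.comm_DK.mul_pow, mul_assoc (D ^ k), mul_assoc, mul_assoc (D ^ k), ← h1.eq]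
    simp only [mul_assoc]
  have h2 : P * T ^ N * Q N = P * K ^ N := by
    rw [h.eq_add, add_pow_of_qcomm h.qcomm, Finset.mul_sum, Finset.sum_mul,
      Finset.sum_range_succ, Finset.sum_eq_zero, zero_add]
    · rw [mul_smul_comm, smul_mul_assoc, hterm, h.shift.eq_proj, gaussCoeff_self, one_smul,
        Nat.sub_self, pow_zero, mul_one]
    · intro k hk
      rw [mul_smul_comm, smul_mul_assoc, hterm, h.shift.eq_zero k (Finset.mem_range.1 hk), zero_mul,
        smul_zero]
  rw [← mul_assoc, ← mul_assoc, h2, mul_assoc, ← hc.mul_pow, h.mul_inv, one_pow, mul_one]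

/-- A vector of `ker T` is compared with `T^N Q_N Kinv^N` of itself: the latter is in `ker T` as
`T^{N+1} = 0`, and both have the same image under `P`, which determines vectors of `ker T`. -/
theorem IsTwistedShift.ker_le (h : IsTwistedShift T D K Kinv y P Q ω N) :
    LinearMap.ker T ≤ LinearMap.range (T ^ N) := by
  intro x hx
  rw [LinearMap.mem_ker] at hx
  refine ⟨(Q N * Kinv ^ N) x, ?_⟩
  rw [← Module.End.mul_apply, ← mul_assoc]
  refine sub_eq_zero.1 (h.eq_zero ?_ ?_)
  · rw [map_sub, hx, sub_zero, ← Module.End.mul_apply, mul_assoc, ← mul_assoc, ← pow_succ',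
      h.pow_eq_zero, zero_mul, LinearMap.zero_apply]
  · rw [map_sub, ← Module.End.mul_apply, h.section_eq, sub_self]

/-- An operator that maps the vectors of a basis to non-zero multiples of their predecessors is a
shift. -/
theorem exists_isShift {X : Type*} [AddCommGroup X] [Module ℂ X]
    (b : Module.Basis (Fin (N + 1)) ℂ X) (D : Module.End ℂ X) (c : ℕ → ℂ) (hc : ∀ m < N, c m ≠ 0)
    (h0 : D (b 0) = 0) (hD : ∀ m (h : m + 1 < N + 1), D (b ⟨m + 1, h⟩) = c m • b ⟨m, by omega⟩) :
    ∃ (P : Module.End ℂ X) (Q : ℕ → Module.End ℂ X), IsShift D N P Q ∧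
      (∀ m, P (b m) = if m = 0 then b m else 0) ∧
      ∀ m i, ∃ a : ℂ, Q m (b i) = if h : m < N + 1 then (if i = 0 then a • b ⟨m, h⟩ else 0) else 0 := by
  let g : ℕ → ℂ := fun m => ∏ p ∈ Finset.range m, c p
  have hg : ∀ m, m ≤ N → g m ≠ 0 := fun m hm =>
    Finset.prod_ne_zero_iff.2 fun p hp => hc p (lt_of_lt_of_le (Finset.mem_range.1 hp) hm)
  -- The rescaled basis satisfies `D w_{m+1} = w_m` exactly; `Q m` will send `w_0` to `w_m` and kill
  -- the other basis vectors, and `P` will project onto `w_0`.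
  let w : ℕ → X := fun m => if h : m < N + 1 then (g m)⁻¹ • b ⟨m, h⟩ else 0
  have hw : ∀ m (h : m < N + 1), b ⟨m, h⟩ = g m • w m := by
    intro m h
    rw [show w m = (g m)⁻¹ • b ⟨m, h⟩ from dif_pos h, smul_smul, mul_inv_cancel₀ (hg m (by omega)),
      one_smul]
  have hw0 : w 0 = b 0 := by
    rw [show w 0 = (g 0)⁻¹ • b ⟨0, by omega⟩ from dif_pos (by omega)]
    simp [g]
  have hDw0 : D (w 0) = 0 := by rw [hw0, h0]
  have hDw : ∀ m, m < N → D (w (m + 1)) = w m := by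
    intro m h
    rw [show w (m + 1) = (g (m + 1))⁻¹ • b ⟨m + 1, by omega⟩ from dif_pos (by omega),
      show w m = (g m)⁻¹ • b ⟨m, by omega⟩ from dif_pos (by omega), map_smul, hD, smul_smul]
    congr 1
    have h1 := hg m h.le
    have h2 := hc m h
    simp only [g, Finset.prod_range_succ] at h1 ⊢
    field_simp
  have hDpow : ∀ k m, k ≤ N → m ≤ N → (D ^ k) (w m) = if k ≤ m then w (m - k) else 0 := by
    intro k
    induction k with
    | zero => simp
    | succ k ih =>
      intro m hk hm
      rw [pow_succ, Module.End.mul_apply]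
      rcases m with _ | m
      · simp [hDw0]
      · rw [hDw m (by omega), ih m (by omega) (by omega)]
        simp
  let P : Module.End ℂ X := b.constr ℂ fun m => if m = 0 then b m else 0
  let Q : ℕ → Module.End ℂ X := fun m => b.constr ℂ fun i => if i = 0 then w m else 0
  have hP : ∀ m, P (b m) = if m = 0 then b m else 0 := fun m => b.constr_basis ℂ _ m
  have hQ : ∀ m i, Q m (b i) = if i = 0 then w m else 0 := fun m i => b.constr_basis ℂ _ i
  have hPw : ∀ m, P (w m) = if m = 0 then w 0 else 0 := by
    intro m
    by_cases h : m < N + 1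
    · rw [show w m = (g m)⁻¹ • b ⟨m, h⟩ from dif_pos h, map_smul, hP]
      rcases m with _ | m
      · rw [if_pos (by rfl), if_pos rfl]
        exact (dif_pos h : w 0 = _).symm
      · rw [if_neg (by simp), if_neg (by simp), smul_zero]
    · rw [show w m = 0 from dif_neg h, map_zero, if_neg (by omega)]
  refine ⟨P, Q, ⟨?_, ?_, ?_, ?_⟩, hP, ?_⟩
  · refine b.ext fun m => ?_
    rw [Module.End.mul_apply, hP]
    split_ifs with h
    · rw [hP, if_pos h]
    · rw [map_zero]
  · intro k hk
    refine b.ext fun m => ?_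
    rw [Module.End.mul_apply, Module.End.mul_apply, hQ]
    split_ifs with h
    · rw [hDpow k N hk.le le_rfl, if_pos hk.le, hPw, if_neg (by omega), LinearMap.zero_apply]
    · simp
  · refine b.ext fun m => ?_
    rw [Module.End.mul_apply, Module.End.mul_apply, hQ, hP]
    split_ifs with h
    · rw [hDpow N N le_rfl le_rfl, if_pos le_rfl, Nat.sub_self, hPw, if_pos rfl, hw0, h]
    · simp
  · refine b.ext fun i => ?_
    rw [LinearMap.sum_apply, Module.End.one_apply, hw i i.2, Finset.sum_eq_single (i : ℕ)]
    · rw [Module.End.mul_apply, Module.End.mul_apply, map_smul, hDpow _ _ (by omega) (by omega),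
        if_pos le_rfl, Nat.sub_self, map_smul, map_smul, hPw, if_pos rfl, hw0, hQ, if_pos rfl]
    · intro m hm hmi
      have := Finset.mem_range.1 hm
      rw [Module.End.mul_apply, Module.End.mul_apply, map_smul, hDpow _ _ (by omega) (by omega)]
      split_ifs with h
      · rw [map_smul, hPw, if_neg (by omega), smul_zero, map_zero]
      · simp
    · intro h
      exact absurd (Finset.mem_range.2 i.2) h
  · intro m i
    refine ⟨(g m)⁻¹, ?_⟩
    rw [hQ]
    by_cases h : m < N + 1
    · rw [dif_pos h]
      simp only [w, dif_pos h]
    · rw [dif_neg h]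
      rw [show w m = 0 from dif_neg h, ite_self]

end Exact

end RestrictedSl2

end

noncomputable section

namespace RestrictedSl2

/-! ### Coordinates on `V_{r-1}^{⊗ n}` -/

section Coordinates

variable (r n : ℕ)

/-- The basis of `V_{r-1}^{⊗ n}` that consists of the tensors `u_{ε_1} ⊗ ⋯ ⊗ u_{ε_n}`. -/
def powBasis : Module.Basis (Fin n → Fin (r - 1 + 1)) ℂ (VPow r n) :=
  Basis.piTensorProduct fun _ => Finsupp.basisSingleOne

theorem powBasis_apply (ε : Fin n → Fin (r - 1 + 1)) :
    powBasis r n ε = PiTensorProduct.tprod ℂ fun a => Finsupp.single (ε a) (1 : ℂ) := by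
  simp [powBasis]

/-- The number `ε_1 + ⋯ + ε_n`. -/
def total {r n : ℕ} (ε : Fin n → Fin (r - 1 + 1)) : ℕ := ∑ a, (ε a : ℕ)

/-- The span of the basis vectors of degree `c`, where `c` is a complex number. -/
def degSpace (c : ℂ) : Submodule ℂ (VPow r n) :=
  Submodule.span ℂ (powBasis r n '' {ε | (total ε : ℂ) = c})

/-- Complex degrees let `E` and `F` shift by `-1` and `1` without truncated subtraction. Degrees
that are not natural numbers belong to the zero space. -/
theorem weightSpace_eq_degSpace (l : ℕ) : weightSpace r n l = degSpace r n l := by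
  rw [weightSpace, degSpace]
  congr 1
  ext v
  simp only [Set.mem_ofPred_eq, Set.mem_image, powBasis_apply, Nat.cast_inj, total, single_eq_u]
  exact exists_congr fun ε => and_congr_right fun _ => eq_comm

/-- The degree operator. -/
def degOp : Module.End ℂ (VPow r n) :=
  (powBasis r n).constr ℂ fun ε => (total ε : ℂ) • powBasis r n ε

variable {r n}

theorem degOp_basis (ε : Fin n → Fin (r - 1 + 1)) :
    degOp r n (powBasis r n ε) = (total ε : ℂ) • powBasis r n ε :=
  (powBasis r n).constr_basis ℂ _ ε

theorem powBasis_mem (ε : Fin n → Fin (r - 1 + 1)) : powBasis r n ε ∈ degSpace r n (total ε) :=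
  Submodule.subset_span ⟨ε, rfl, rfl⟩

theorem degOp_apply {c : ℂ} {x : VPow r n} (hx : x ∈ degSpace r n c) : degOp r n x = c • x := by
  induction hx using Submodule.span_induction with
  | mem y hy =>
    obtain ⟨ε, rfl, rfl⟩ := hy
    exact degOp_basis ε
  | zero => simp
  | add y z _ _ h1 h2 => rw [map_add, h1, h2, smul_add]
  | smul a y _ h => rw [map_smul, h, smul_comm]

theorem iSupIndep_degSpace : iSupIndep (degSpace r n) :=
  (Module.End.eigenspaces_iSupIndep (M := VPow r n) (degOp r n)).mono
    (t := degSpace r n) fun _ _ hx => Module.End.mem_eigenspace_iff.2 (degOp_apply hx)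

theorem iSup_weightSpace : ⨆ l, weightSpace r n l = ⊤ := by
  rw [eq_top_iff, ← (powBasis r n).span_eq, Submodule.span_le]
  rintro _ ⟨ε, rfl⟩
  refine Submodule.mem_iSup_of_mem (total ε) ?_
  rw [weightSpace_eq_degSpace]
  exact powBasis_mem ε

theorem iSup_degSpace : ⨆ c, degSpace r n c = ⊤ := by
  rw [eq_top_iff, ← iSup_weightSpace]
  refine iSup_le fun l => ?_
  rw [weightSpace_eq_degSpace]
  exact le_iSup (degSpace r n) l

theorem iSupIndep_weightSpace : iSupIndep (weightSpace r n) := by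
  have := (iSupIndep_degSpace (r := r) (n := n)).comp (f := fun l : ℕ => (l : ℂ)) Nat.cast_injective
  convert this using 1
  ext1 l
  exact weightSpace_eq_degSpace r n l

theorem degSpace_eq_bot {c : ℂ} (hc : ∀ l : ℕ, (l : ℂ) ≠ c) : degSpace r n c = ⊥ := by
  rw [degSpace, Submodule.span_eq_bot]
  rintro _ ⟨ε, hε, rfl⟩
  exact absurd hε (hc _)

instance : FiniteDimensional ℂ (VPow r n) := Module.Basis.finiteDimensional_of_finite (powBasis r n)

/-- Since the degree operator recovers the weight spaces, invariance under the braid group becomes a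
question of commuting operators. -/
theorem eigenspace_degOp (c : ℂ) : Module.End.eigenspace (M := VPow r n) (degOp r n) c = degSpace r n c := by
  refine le_antisymm (fun x hx => ?_) fun x hx => Module.End.mem_eigenspace_iff.2 (degOp_apply hx)
  rw [Module.End.mem_eigenspace_iff] at hx
  rw [degSpace, (powBasis r n).mem_span_image]
  intro ε hε
  have h1 : (powBasis r n).coord ε ∘ₗ degOp r n = (total ε : ℂ) • (powBasis r n).coord ε := by
    refine (powBasis r n).ext fun δ => ?_
    rw [LinearMap.comp_apply, degOp_basis, map_smul, LinearMap.smul_apply,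
      Module.Basis.coord_apply, Module.Basis.repr_self]
    by_cases h : δ = ε
    · rw [h]
    · simp [h]
  have h2 := LinearMap.congr_fun h1 x
  rw [LinearMap.comp_apply, LinearMap.smul_apply, Module.Basis.coord_apply,
    Module.Basis.coord_apply] at h2
  rw [hx, map_smul, Finsupp.smul_apply, smul_eq_mul] at h2
  exact (mul_right_cancel₀ (Finsupp.mem_support_iff.1 hε) h2).symm

/-- An operator on a tensor factor that shifts the index of the basis vectors by `d`. -/
def HasShift (T : Module.End ℂ (Fin (r - 1 + 1) →₀ ℂ)) (d : ℂ) : Prop :=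
  ∀ m, T (Finsupp.single m 1) = 0 ∨ ∃ (a : ℂ) (m' : Fin (r - 1 + 1)), (m' : ℂ) = m + d ∧
    T (Finsupp.single m 1) = a • Finsupp.single m' 1

theorem HasShift.one : HasShift (1 : Module.End ℂ (Fin (r - 1 + 1) →₀ ℂ)) 0 := fun m =>
  Or.inr ⟨1, m, by simp, by simp⟩

theorem HasShift.diag (c : Fin (r - 1 + 1) → ℂ) : HasShift (diag c) 0 := fun m =>
  Or.inr ⟨c m, m, by simp, diag_single c m⟩

theorem map_mem_degSpace {f : Fin n → Module.End ℂ (Fin (r - 1 + 1) →₀ ℂ)} {d : Fin n → ℂ}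
    (h : ∀ b, HasShift (f b) (d b)) {c : ℂ} {x : VPow r n} (hx : x ∈ degSpace r n c) :
    PiTensorProduct.map f x ∈ degSpace r n (c + ∑ b, d b) := by
  induction hx using Submodule.span_induction with
  | mem y hy =>
    obtain ⟨ε, rfl, rfl⟩ := hy
    rw [powBasis_apply, PiTensorProduct.map_tprod]
    by_cases h0 : ∃ b, f b (Finsupp.single (ε b) 1) = 0
    · obtain ⟨b, hb⟩ := h0
      rw [(PiTensorProduct.tprod ℂ).map_coord_zero b hb]
      exact Submodule.zero_mem _
    · have h1 := fun b => (h b (ε b)).resolve_left fun hb => h0 ⟨b, hb⟩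
      choose a m ha hm using h1
      simp only [hm]
      rw [MultilinearMap.map_smul_univ, ← powBasis_apply]
      refine Submodule.smul_mem _ _ (Submodule.subset_span ⟨m, ?_, rfl⟩)
      simp only [Set.mem_ofPred_eq, total]
      push_cast
      rw [← Finset.sum_add_distrib]
      exact Finset.sum_congr rfl fun b _ => ha b
  | zero => simp
  | add y z _ _ h1 h2 => rw [map_add]; exact Submodule.add_mem _ h1 h2
  | smul a y _ h => rw [map_smul]; exact Submodule.smul_mem _ _ h

theorem map_mem_degSpace_of_single {f : Fin n → Module.End ℂ (Fin (r - 1 + 1) →₀ ℂ)} (a : Fin n)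
    {d : ℂ} (ha : HasShift (f a) d) (h : ∀ b, b ≠ a → HasShift (f b) 0) {c : ℂ} {x : VPow r n}
    (hx : x ∈ degSpace r n c) : PiTensorProduct.map f x ∈ degSpace r n (c + d) := by
  have := map_mem_degSpace (f := f) (d := fun b => if b = a then d else 0) (fun b => by
    by_cases hb : b = a
    · subst hb
      simpa using ha
    · simpa [hb] using h b hb) hx
  simpa using this

theorem leg_mem_degSpace (a : Fin n) {T : Module.End ℂ (Fin (r - 1 + 1) →₀ ℂ)} {d : ℂ}
    (hT : HasShift T d) {c : ℂ} {x : VPow r n} (hx : x ∈ degSpace r n c) :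
    leg a T x ∈ degSpace r n (c + d) := by
  rw [leg_eq_map]
  refine map_mem_degSpace_of_single a (by simpa using hT) (fun b hb => ?_) hx
  rw [if_neg hb]
  exact HasShift.one

theorem pow_mem_degSpace {T : Module.End ℂ (VPow r n)} {d : ℂ}
    (hT : ∀ c, ∀ x ∈ degSpace r n c, T x ∈ degSpace r n (c + d)) (N : ℕ) {c : ℂ} {x : VPow r n}
    (hx : x ∈ degSpace r n c) : (T ^ N) x ∈ degSpace r n (c + N * d) := by
  induction N with
  | zero => simpa using hx
  | succ N ih =>
    rw [pow_succ', Module.End.mul_apply]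
    have := hT _ _ ih
    rwa [add_assoc, ← add_one_mul, ← Nat.cast_succ] at this

variable {hr : 0 < r}

theorem steinberg_E_single (m : Fin (r - 1 + 1)) : (steinberg r hr).E (Finsupp.single m 1) =
    if (m : ℕ) = 0 then 0 else u (r - 1) (m - 1) := by
  rw [single_eq_u]
  exact simpleE_u (by omega)

theorem steinberg_F_single (m : Fin (r - 1 + 1)) : (steinberg r hr).F (Finsupp.single m 1) =
    (qInt r ((m : ℤ) + 1) * qInt r (((r - 1 : ℕ) : ℤ) - m)) • u (r - 1) (m + 1) := by
  rw [single_eq_u]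
  have := simpleF_u r 1 (r - 1) m
  rw [one_pow, one_mul] at this
  exact this

theorem steinberg_k_single (m : Fin (r - 1 + 1)) : (steinberg r hr).k (Finsupp.single m 1) =
    qHalf r ^ (((r - 1 : ℕ) : ℤ) - 2 * (m : ℕ)) • Finsupp.single m 1 := by
  have := diag_single (fun m : Fin (r - 1 + 1) =>
    (1 : ℂ) * qHalf r ^ (((r - 1 : ℕ) : ℤ) - 2 * (m : ℕ))) m
  rw [one_mul] at this
  exact this

theorem hasShift_E : HasShift (steinberg r hr).E (-1) := by
  intro m
  rw [steinberg_E_single]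
  split_ifs with h
  · exact Or.inl rfl
  · refine Or.inr ⟨1, ⟨m - 1, by omega⟩, ?_, by rw [single_eq_u, one_smul]⟩
    simp only
    rw [Nat.cast_sub (by omega)]
    ring

theorem hasShift_F : HasShift (steinberg r hr).F 1 := by
  intro m
  rw [steinberg_F_single]
  by_cases h : (m : ℕ) + 1 < r - 1 + 1
  · exact Or.inr ⟨_, ⟨m + 1, h⟩, by simp, by rw [single_eq_u]⟩
  · rw [u_eq_zero (by omega), smul_zero]
    exact Or.inl rfl

theorem hasShift_k_sq : HasShift ((steinberg r hr).k ^ 2) 0 := by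
  have : (steinberg r hr).k ^ 2 = diag _ := diag_pow _ _
  rw [this]
  exact HasShift.diag _

theorem hasShift_kinv_sq : HasShift ((steinberg r hr).kinv ^ 2) 0 := by
  have : (steinberg r hr).kinv ^ 2 = diag _ := diag_pow _ _
  rw [this]
  exact HasShift.diag _

theorem E_mem_degSpace {c : ℂ} {x : VPow r n} (hx : x ∈ degSpace r n c) :
    (steinbergPow r hr n).E x ∈ degSpace r n (c + -1) := by
  change (∑ a, (steinberg r hr).termE n a) x ∈ _
  rw [LinearMap.sum_apply]
  refine Submodule.sum_mem _ fun a _ => map_mem_degSpace_of_single a ?_ (fun b hb => ?_) hx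
  · simpa using hasShift_E
  · simp only [hb, if_false]
    split_ifs
    exacts [HasShift.one, hasShift_k_sq]

theorem F_mem_degSpace {c : ℂ} {x : VPow r n} (hx : x ∈ degSpace r n c) :
    (steinbergPow r hr n).F x ∈ degSpace r n (c + 1) := by
  change (∑ a, (steinberg r hr).termF n a) x ∈ _
  rw [LinearMap.sum_apply]
  refine Submodule.sum_mem _ fun a _ => map_mem_degSpace_of_single a ?_ (fun b hb => ?_) hx
  · simpa using hasShift_F
  · simp only [hb, if_false]
    split_ifs
    exacts [hasShift_kinv_sq, HasShift.one]

theorem k_basis (ε : Fin n → Fin (r - 1 + 1)) : (steinbergPow r hr n).k (powBasis r n ε) =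
    qHalf r ^ ((n : ℤ) * ((r : ℤ) - 1) - 2 * total ε) • powBasis r n ε := by
  change PiTensorProduct.map _ _ = _
  rw [powBasis_apply, PiTensorProduct.map_tprod]
  simp only [steinberg_k_single]
  rw [MultilinearMap.map_smul_univ]
  congr 1
  have key : ∀ (s : Finset (Fin n)) (f : Fin n → ℤ),
      ∏ a ∈ s, qHalf r ^ f a = qHalf r ^ ∑ a ∈ s, f a := by
    intro s f
    induction s using Finset.induction_on with
    | empty => simp
    | insert a s ha ih =>
      rw [Finset.prod_insert ha, Finset.sum_insert ha, ih, zpow_add₀ (qHalf_ne_zero r)]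
  rw [key]
  congr 1
  rw [Finset.sum_sub_distrib, ← Finset.mul_sum, total, Nat.cast_sub (by omega)]
  simp [mul_sub]

theorem k_degSpace {c : ℂ} {w : ℤ} (hc : c = ((n : ℤ) * ((r : ℤ) - 1) - w : ℤ) / 2) {x : VPow r n}
    (hx : x ∈ degSpace r n c) : (steinbergPow r hr n).k x = qHalf r ^ w • x := by
  induction hx using Submodule.span_induction with
  | mem y hy =>
    obtain ⟨ε, hε, rfl⟩ := hy
    rw [k_basis]
    congr 2
    rw [Set.mem_ofPred_eq, hc, eq_div_iff (by norm_num)] at hε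
    have : (total ε : ℤ) * 2 = (n : ℤ) * ((r : ℤ) - 1) - w := by exact_mod_cast hε
    omega
  | zero => simp
  | add y z _ _ h1 h2 => rw [map_add, h1, h2, smul_add]
  | smul a y _ h => rw [map_smul, h, smul_comm]

theorem k_weightSpace {l : ℕ} {x : VPow r n} (hx : x ∈ weightSpace r n l) :
    (steinbergPow r hr n).k x = qHalf r ^ ((n : ℤ) * ((r : ℤ) - 1) - 2 * l) • x := by
  rw [weightSpace_eq_degSpace] at hx
  refine k_degSpace ?_ hx
  push_cast
  ring

/-- The strong weight `w` sits in degree `(n(r-1) - w)/2`. Division in `ℂ` makes this meaningful for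
every integer `w`, and weights of the wrong parity get the zero space. -/
theorem isGrading_degSpace : (steinbergPow r hr n).IsGrading fun w : ℤ =>
    degSpace r n (((n : ℤ) * ((r : ℤ) - 1) - w : ℤ) / 2) where
  iSup_eq_top := by
    rw [eq_top_iff, ← (powBasis r n).span_eq, Submodule.span_le]
    rintro _ ⟨ε, rfl⟩
    refine Submodule.mem_iSup_of_mem ((n : ℤ) * ((r : ℤ) - 1) - 2 * total ε) ?_
    have := powBasis_mem ε
    convert this using 1
    congr 1
    push_cast
    ring
  indep := by
    refine iSupIndep_degSpace.comp (f := fun w : ℤ =>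
      ((((n : ℤ) * ((r : ℤ) - 1) - w : ℤ) : ℂ) / 2)) fun v w h => ?_
    simp only at h
    rw [div_left_inj' (by norm_num), Int.cast_inj] at h
    omega
  E_mem w x hx := by
    have := E_mem_degSpace (hr := hr) hx
    convert this using 2
    push_cast
    ring
  F_mem w x hx := by
    have := F_mem_degSpace (hr := hr) hx
    convert this using 2
    push_cast
    ring
  k_apply w x hx := k_degSpace rfl hx
  bounded := by
    refine ⟨(n : ℤ) * ((r : ℤ) - 1), fun w hw => degSpace_eq_bot fun l h => ?_⟩
    rw [eq_div_iff (by norm_num)] at h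
    have : (l : ℤ) * 2 = (n : ℤ) * ((r : ℤ) - 1) - w := by exact_mod_cast h
    omega

end Coordinates

end RestrictedSl2

end

/-! ### Freeness of the tensor powers over `E` and `F`, and its consequences -/

noncomputable section

namespace RestrictedSl2

section TwistedShift

variable {X : Type*} [AddCommGroup X] [Module ℂ X] {n N : ℕ}

/-- The factor `z` is an end of the tensor product: there exactly one summand of the iterated
coproduct acts non-trivially, and that summand is `D` at `z` times a group-like operator `g`
elsewhere. -/
theorem isTwistedShift_sum (z : Fin n) (f : Fin n → Fin n → Module.End ℂ X)
    {D g ginv P : Module.End ℂ X} {Q : ℕ → Module.End ℂ X} {ω : ℂ} (hS : IsShift D N P Q)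
    (hω : ω ≠ 0) (hg : ginv * g = 1) (hg' : g * ginv = 1)
    (hz : f z = fun b => if b = z then D else g) (hf : ∀ a, a ≠ z → f a z = 1)
    (hq : ∀ a, a ≠ z → PiTensorProduct.map (f a) * PiTensorProduct.map (f z) =
      ω • (PiTensorProduct.map (f z) * PiTensorProduct.map (f a)))
    (hpow : (∑ a, PiTensorProduct.map (f a)) ^ (N + 1) = 0) :
    IsTwistedShift (∑ a, PiTensorProduct.map (f a)) (leg z D)
      (PiTensorProduct.map fun b => if b = z then 1 else g)
      (PiTensorProduct.map fun b => if b = z then 1 else ginv)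
      (∑ a ∈ Finset.univ.erase z, PiTensorProduct.map (f a)) (leg z P) (fun m => leg z (Q m)) ω N := by
  have hDK : leg z D * (PiTensorProduct.map fun b => if b = z then 1 else g) =
      PiTensorProduct.map (f z) := by
    rw [leg_eq_map, ← PiTensorProduct.map_mul, hz]
    congr 1
    ext1 b
    by_cases h : b = z <;> simp [h]
  have hcomm : ∀ T : Module.End ℂ X,
      Commute (leg z T) (PiTensorProduct.map fun b => if b = z then 1 else g) := fun T =>
    leg_commute_map (by simp)
  have hcomm' : ∀ T : Module.End ℂ X,
      Commute (leg z T) (∑ a ∈ Finset.univ.erase z, PiTensorProduct.map (f a)) := fun T =>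
    Commute.sum_right _ _ _ fun a ha => leg_commute_map (by
      rw [hf a (Finset.ne_of_mem_erase ha)]
      exact Commute.one_right T)
  have hinv : ∀ S T : Module.End ℂ X, S * T = 1 →
      (PiTensorProduct.map fun b : Fin n => if b = z then 1 else S) *
        (PiTensorProduct.map fun b => if b = z then 1 else T) = 1 := by
    intro S T h
    rw [← PiTensorProduct.map_mul, ← PiTensorProduct.map_one]
    congr 1
    ext1 b
    by_cases h : b = z <;> simp [*]
  exact
  { shift := hS.map (leg z)
    eq_add := by 
      rw [hDK]
      exact (Finset.add_sum_erase _ (fun a => PiTensorProduct.map (f a)) (Finset.mem_univ z)).symm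
    qcomm := by
      rw [hDK, Finset.sum_mul, Finset.mul_sum, Finset.smul_sum]
      exact Finset.sum_congr rfl fun a ha => hq a (Finset.ne_of_mem_erase ha)
    ne_zero := hω
    pow_eq_zero := hpow
    inv_mul := hinv _ _ hg
    mul_inv := hinv _ _ hg'
    comm_DK := hcomm _
    comm_PK := hcomm _
    comm_QK := hcomm _
    comm_Py := hcomm' _
    comm_Qy := hcomm' _ }

end TwistedShift

variable {r : ℕ} {hr : 0 < r} {n : ℕ}

theorem steinberg_kinv_sq_mul (hr : 0 < r) :
    (steinberg r hr).kinv ^ 2 * (steinberg r hr).k ^ 2 = 1 ∧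
      (steinberg r hr).k ^ 2 * (steinberg r hr).kinv ^ 2 = 1 := by
  have h1 := (steinberg r hr).k_mul_kinv
  have h2 := DModule.kinv_mul_k (A := steinberg r hr) hr
  have hc : Commute (steinberg r hr).k (steinberg r hr).kinv := h1.trans h2.symm
  exact ⟨by rw [← hc.symm.mul_pow, h2, one_pow], by rw [← hc.mul_pow, h1, one_pow]⟩

/-- The action of `E` on `V_{r-1}^{⊗ n}` is a twisted shift, with respect to the first tensor
factor. -/
theorem exists_isTwistedShift_E (hr : 0 < r) (hn : 0 < n) :
    ∃ (P : Module.End ℂ (Fin (r - 1 + 1) →₀ ℂ)) (Q : ℕ → Module.End ℂ (Fin (r - 1 + 1) →₀ ℂ))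
      (ω : ℂ), (∀ m, P (Finsupp.single m 1) = if m = 0 then Finsupp.single m 1 else 0) ∧
      HasShift (Q (r - 1)) (r - 1 : ℕ) ∧
      IsTwistedShift (steinbergPow r hr n).E (leg ⟨0, hn⟩ (steinberg r hr).E)
        (PiTensorProduct.map fun b => if b = ⟨0, hn⟩ then 1 else (steinberg r hr).k ^ 2)
        (PiTensorProduct.map fun b => if b = ⟨0, hn⟩ then 1 else (steinberg r hr).kinv ^ 2)
        (∑ a ∈ Finset.univ.erase ⟨0, hn⟩, (steinberg r hr).termE n a) (leg ⟨0, hn⟩ P)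
        (fun m => leg ⟨0, hn⟩ (Q m)) ω (r - 1) := by
  obtain ⟨P, Q, hS, hP, hQ⟩ := exists_isShift (Finsupp.basisSingleOne (R := ℂ))
    (steinberg r hr).E (fun _ => 1) (fun _ _ => one_ne_zero)
    (by rw [Finsupp.coe_basisSingleOne, steinberg_E_single]; simp)
    (fun m h => by
      rw [Finsupp.coe_basisSingleOne, steinberg_E_single, if_neg (by simp), one_smul]
      exact (single_eq_u (⟨m, by omega⟩ : Fin (r - 1 + 1))).symm)
  refine ⟨P, Q, (q r ^ 2)⁻¹, by simpa using hP, fun m => ?_, ?_⟩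
  · obtain ⟨a, ha⟩ := hQ (r - 1) m
    rw [Finsupp.coe_basisSingleOne, dif_pos (by omega)] at ha
    by_cases h : m = 0
    · rw [if_pos h] at ha
      exact Or.inr ⟨a, ⟨r - 1, by omega⟩, by simp [h], ha⟩
    · rw [if_neg h] at ha
      exact Or.inl ha
  · refine isTwistedShift_sum _ _ hS (inv_ne_zero (pow_ne_zero 2 (q_ne_zero r)))
      (steinberg_kinv_sq_mul hr).1 (steinberg_kinv_sq_mul hr).2 ?_ ?_ ?_ ?_
    · ext1 b
      simp [Fin.lt_def]
    · intro a ha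
      have : (0 : ℕ) < a := Nat.pos_of_ne_zero fun h => ha (Fin.ext h)
      exact if_pos this
    · intro a ha
      have h := DModule.termE_mul_termE (A := steinberg r hr) ⟨0, hn⟩ a
        (Nat.pos_of_ne_zero fun h => ha (Fin.ext h))
      rw [eq_inv_smul_iff₀ (pow_ne_zero 2 (q_ne_zero r))]
      exact h.symm
    · exact (congrArg (fun m => (steinbergPow r hr n).E ^ m) (Nat.sub_add_cancel hr)).trans
        (steinbergPow r hr n).E_pow

/-- The mirror image of the case of `E`: the last tensor factor is used, with its basis reversed so
that `F` lowers the index. The coefficients of `F` do not vanish below the last basis vector, as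
their quantum integers have arguments strictly between `0` and `r`. -/
theorem exists_isTwistedShift_F (hr : 0 < r) (hn : 0 < n) :
    ∃ (D K Kinv y P : Module.End ℂ (VPow r n)) (Q : ℕ → Module.End ℂ (VPow r n)) (ω : ℂ),
      IsTwistedShift (steinbergPow r hr n).F D K Kinv y P Q ω (r - 1) := by
  have hlast : n - 1 < n := by omega
  obtain ⟨P, Q, hS, -, -⟩ := exists_isShift
    ((Finsupp.basisSingleOne (R := ℂ)).reindex (Fin.revPerm (n := r - 1 + 1)))
    (steinberg r hr).F
    (fun m => qInt r (((r - 1 - (m + 1) : ℕ) : ℤ) + 1) *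
      qInt r (((r - 1 : ℕ) : ℤ) - (r - 1 - (m + 1) : ℕ)))
    (fun m hm => mul_ne_zero (qInt_ne_zero_of_lt (by omega) (by omega) (by omega))
      (qInt_ne_zero_of_lt (by omega) (by omega) (by omega)))
    (by
      rw [Module.Basis.reindex_apply, Finsupp.coe_basisSingleOne, steinberg_F_single,
        u_eq_zero (by simp), smul_zero])
    (fun m h => by
      rw [Module.Basis.reindex_apply, Module.Basis.reindex_apply, Finsupp.coe_basisSingleOne,
        steinberg_F_single]
      have e1 : ((Fin.revPerm.symm (⟨m + 1, h⟩ : Fin (r - 1 + 1)) : Fin (r - 1 + 1)) : ℕ) =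
          r - 1 - (m + 1) := by
        simp [Fin.val_rev]
        try omega
      have e2 : ((Fin.revPerm.symm (⟨m, by omega⟩ : Fin (r - 1 + 1)) : Fin (r - 1 + 1)) : ℕ) =
          r - 1 - m := by
        simp [Fin.val_rev]
        try omega
      simp only [single_eq_u]
      rw [e1, e2]
      congr 2
      omega)
  refine ⟨_, _, _, _, _, _, _, isTwistedShift_sum ⟨n - 1, hlast⟩ _ hS
    (inv_ne_zero (pow_ne_zero 2 (q_ne_zero r)))
      (steinberg_kinv_sq_mul hr).2 (steinberg_kinv_sq_mul hr).1 ?_ ?_ ?_ ?_⟩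
  · ext1 b
    by_cases h : b = ⟨n - 1, hlast⟩
    · simp [h]
    · have : b < ⟨n - 1, hlast⟩ := by
        have := Fin.val_ne_of_ne h
        rw [Fin.lt_def]
        simp only at this ⊢
        omega
      simp [h, this]
  · intro a ha
    have h1 := Fin.val_ne_of_ne ha
    simp only at h1
    have h2 : ¬ (⟨n - 1, hlast⟩ : Fin n) < a := by
      rw [Fin.lt_def]
      simp only
      omega
    rw [if_neg h2, if_neg ha.symm]
  · intro a ha
    have h1 := Fin.val_ne_of_ne ha
    simp only at h1
    exact DModule.termF_mul_termF (A := steinberg r hr) hr a ⟨n - 1, hlast⟩ (by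
      rw [Fin.lt_def]
      simp only
      omega)
  · exact (congrArg (fun m => (steinbergPow r hr n).F ^ m) (Nat.sub_add_cancel hr)).trans
      (steinbergPow r hr n).F_pow

theorem isExact_steinbergPow (hr : 0 < r) (hn : 0 < n) : (steinbergPow r hr n).IsExact where
  E := by
    obtain ⟨P, Q, ω, -, -, h⟩ := exists_isTwistedShift_E hr hn
    exact h.ker_le
  F := by
    obtain ⟨D, K, Kinv, y, P, Q, ω, h⟩ := exists_isTwistedShift_F hr hn
    exact h.ker_le

theorem eq_iSup_inf_weightSpace {N : Submodule ℂ (VPow r n)} {G : ℤ → Submodule ℂ (VPow r n)}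
    (hG : ∀ w, ∃ c, G w = degSpace r n c) (h : N = ⨆ w, N ⊓ G w) :
    N = ⨆ l, N ⊓ weightSpace r n l := by
  refine le_antisymm ?_ (iSup_le fun l => inf_le_left)
  nth_rewrite 1 [h]
  refine iSup_le fun w => ?_
  obtain ⟨c, hc⟩ := hG w
  rw [hc]
  by_cases hl : ∃ l : ℕ, (l : ℂ) = c
  · obtain ⟨l, rfl⟩ := hl
    rw [← weightSpace_eq_degSpace]
    exact le_iSup (fun l => N ⊓ weightSpace r n l) l
  · rw [degSpace_eq_bot fun l h => hl ⟨l, h⟩, inf_bot_eq]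
    exact bot_le

/-- For `r = 1` one has `q = -1`, so `q - q⁻¹ = 0` and the Casimir operator is of no use. The tensor
power is then a line on which `E = F = 0` and `k = 1`. -/
theorem nonempty_decomposition_one (hr : 0 < 1) : Nonempty (Decomposition 1 hr n) := by
  let d : Fin n → Fin (1 - 1 + 1) := fun _ => 0
  have hd : ∀ ε, ε = d := fun f => funext fun a => Subsingleton.elim (α := Fin 1) _ _
  let e := powBasis 1 n d
  have he : e ≠ 0 := (powBasis 1 n).ne_zero _
  have hspan : Submodule.span ℂ {e} = ⊤ := by
    rw [← (powBasis 1 n).span_eq]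
    congr 1
    ext x
    simp only [Set.mem_singleton_iff, Set.mem_range]
    exact ⟨fun h => ⟨d, h.symm⟩, by rintro ⟨ε, rfl⟩; rw [hd ε]⟩
  have ht : total (r := 1) d = 0 := Finset.sum_eq_zero fun a _ => rfl
  have hk : (steinbergPow 1 hr n).k e = e := by
    have := k_basis (hr := hr) d
    rw [ht] at this
    exact this.trans (by simp [e])
  have hE : (steinbergPow 1 hr n).E = 0 := by simpa using (steinbergPow 1 hr n).E_pow
  have hF : (steinbergPow 1 hr n).F = 0 := by simpa using (steinbergPow 1 hr n).F_pow
  let A := simpleModule 1 1 (one_pow 4) (1 - 1) (Nat.sub_lt hr one_pos)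
  have hE' : A.E = 0 := by simpa using A.E_pow
  have hF' : A.F = 0 := by simpa using A.F_pow
  have hk' : A.k = 1 := diag_eq_one _ fun m => by
    have : (m : ℕ) = 0 := by have := m.2; omega
    simp
  let f : (Fin (1 - 1 + 1) →₀ ℂ) →ₗ[ℂ] VPow 1 n := Finsupp.linearCombination ℂ fun _ => e
  have hf : LinearMap.range f = ⊤ := by
    rw [Finsupp.range_linearCombination, Set.range_const, hspan]
  have hke : ∀ x, (steinbergPow 1 hr n).k x = x := by
    intro x
    obtain ⟨a, rfl⟩ := Submodule.mem_span_singleton.1 (hspan ▸ Submodule.mem_top : x ∈ _)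
    rw [map_smul, hk]
  have hinj : Function.Injective f := by
    have : Subsingleton (Fin (1 - 1 + 1)) := inferInstanceAs (Subsingleton (Fin 1))
    exact LinearIndependent.of_subsingleton (v := fun _ : Fin (1 - 1 + 1) => e) 0 he
  let φ : DEmbedding A (steinbergPow 1 hr n) :=
    ⟨f, hinj, fun x => by rw [hE, hE']; simp, fun x => by rw [hF, hF']; simp,
      fun x => by rw [hk', hke]; simp⟩
  refine ⟨⟨1, fun _ => ⊤, ?_, fun _ => ?_, fun _ => Or.inl ⟨1, one_pow 4, φ, hf⟩⟩⟩
  · exact (DirectSum.isInternal_submodule_iff_iSupIndep_and_iSup_eq_top (M := VPow 1 n) _).2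
      ⟨(iSupIndep_iff_supIndep_univ.2 (by simp [Finset.supIndep_singleton])), by simp⟩
  · simp only [top_inf_eq, iSup_weightSpace]

theorem nonempty_decomposition (hr : 0 < r) (hn : 0 < n) : Nonempty (Decomposition r hr n) := by
  rcases Nat.lt_or_ge r 2 with h | h
  · obtain rfl : r = 1 := by omega
    exact nonempty_decomposition_one hr
  · obtain ⟨m, N, h1, h2, h3⟩ :=
      (isGrading_degSpace (hr := hr) (n := n)).exists_decomposition (isExact_steinbergPow hr hn) h
    exact ⟨⟨m, N, h1, fun s => eq_iSup_inf_weightSpace (fun w => ⟨_, rfl⟩) (h2 s), h3⟩⟩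

/-! ### The dimension of the highest weight spaces -/

/-- The multi-indices of total `l` that vanish at the first place. -/
def topIndices (r n : ℕ) (hn : 0 < n) (l : ℕ) : Set (Fin n → Fin (r - 1 + 1)) :=
  {ε | ε ⟨0, hn⟩ = 0 ∧ total ε = l}

/-- The projection onto `u_0` in the first tensor factor identifies the highest weight space with
the span of the basis tensors that start with `u_0`. It is injective on `ker E` by
`IsTwistedShift.eq_zero`. The section `E^{r-1} Q_{r-1} Kinv^{r-1}` makes it surjective and preserves
the degree, because `Q_{r-1}` raises it by the `r - 1` that `E^{r-1}` takes away. -/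
theorem finrank_highestWeightSpace (hr : 0 < r) (hn : 0 < n) (l : ℕ) :
    Module.finrank ℂ (highestWeightSpace r hr n l) = Nat.card (topIndices r n hn l) := by
  obtain ⟨P, Q, ω, hP, hQ, h⟩ := exists_isTwistedShift_E hr hn
  have hPs : HasShift P 0 := by
    intro m
    rw [hP]
    split_ifs
    · exact Or.inr ⟨1, m, by simp, by simp⟩
    · exact Or.inl rfl
  have hPb : ∀ ε, leg ⟨0, hn⟩ P (powBasis r n ε) =
      if ε ⟨0, hn⟩ = 0 then powBasis r n ε else 0 := by
    intro ε
    rw [leg_eq_map, powBasis_apply, PiTensorProduct.map_tprod]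
    split_ifs with h0
    · congr 1
      ext1 b
      by_cases hb : b = ⟨0, hn⟩
      · rw [if_pos hb, hb, hP, if_pos h0]
      · rw [if_neg hb, Module.End.one_apply]
    · exact (PiTensorProduct.tprod ℂ).map_coord_zero ⟨0, hn⟩ (by simp [hP, h0])
  let U := Submodule.span ℂ (powBasis r n '' topIndices r n hn l)
  have hU : ∀ x ∈ degSpace r n l, leg ⟨0, hn⟩ P x ∈ U := by
    intro x hx
    induction hx using Submodule.span_induction with
    | mem y hy =>
      obtain ⟨ε, hε, rfl⟩ := hy
      rw [hPb]
      split_ifs with h0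
      · exact Submodule.subset_span ⟨ε, ⟨h0, by exact_mod_cast hε⟩, rfl⟩
      · exact Submodule.zero_mem _
    | zero => simp
    | add y z _ _ h1 h2 => rw [map_add]; exact Submodule.add_mem _ h1 h2
    | smul a y _ h => rw [map_smul]; exact Submodule.smul_mem _ _ h
  have hPU : ∀ x ∈ U, leg ⟨0, hn⟩ P x = x ∧ x ∈ degSpace r n l := by
    intro x hx
    induction hx using Submodule.span_induction with
    | mem y hy =>
      obtain ⟨ε, hε, rfl⟩ := hy
      rw [hPb, if_pos hε.1, ← hε.2]
      exact ⟨rfl, powBasis_mem ε⟩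
    | zero => simp
    | add y z _ _ h1 h2 => rw [map_add, h1.1, h2.1]; exact ⟨rfl, Submodule.add_mem _ h1.2 h2.2⟩
    | smul a y _ h => rw [map_smul, h.1]; exact ⟨rfl, Submodule.smul_mem _ _ h.2⟩
  have hW : ∀ x ∈ highestWeightSpace r hr n l, leg ⟨0, hn⟩ P x ∈ U := fun x hx =>
    hU x (by rw [← weightSpace_eq_degSpace]; exact hx.2)
  let φ : highestWeightSpace r hr n l →ₗ[ℂ] U := (leg ⟨0, hn⟩ P).restrict hW
  have hinj : Function.Injective φ := by
    rintro ⟨x, hx⟩ ⟨y, hy⟩ hxy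
    refine Subtype.ext (sub_eq_zero.1 (h.eq_zero (x := x - y) ?_ ?_))
    · rw [map_sub, LinearMap.mem_ker.1 hx.1, LinearMap.mem_ker.1 hy.1, sub_self]
    · rw [map_sub, sub_eq_zero]
      exact congrArg Subtype.val hxy
  have hsurj : Function.Surjective φ := by
    rintro ⟨x, hx⟩
    have hs := LinearMap.congr_fun h.section_eq x
    rw [(hPU x hx).1] at hs
    refine ⟨⟨_, ?_, ?_⟩, Subtype.ext hs⟩
    · change (steinbergPow r hr n).E _ = 0
      rw [Module.End.mul_apply, ← Module.End.mul_apply, ← Module.End.mul_apply,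
        ← pow_succ', h.pow_eq_zero, zero_mul, LinearMap.zero_apply]
    · rw [weightSpace_eq_degSpace]
      have h1 := pow_mem_degSpace (T := PiTensorProduct.map fun b : Fin n =>
        if b = ⟨0, hn⟩ then 1 else (steinberg r hr).kinv ^ 2) (d := 0) (fun c x hx => by
          refine map_mem_degSpace_of_single ⟨0, hn⟩ ?_ (fun b hb => ?_) hx
          · simpa using HasShift.one
          · simpa [hb] using hasShift_kinv_sq) (r - 1) (hPU x hx).2
      have h2 := leg_mem_degSpace ⟨0, hn⟩ hQ h1
      have h3 := pow_mem_degSpace (fun c x hx => E_mem_degSpace (hr := hr) hx) (r - 1) h2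
      have e : (l : ℂ) + (r - 1 : ℕ) * 0 + (r - 1 : ℕ) + (r - 1 : ℕ) * -1 = l := by ring
      rw [e] at h3
      exact h3
  rw [(LinearEquiv.ofBijective φ ⟨hinj, hsurj⟩).finrank_eq]
  have : Fintype (topIndices r n hn l) := Fintype.ofFinite _
  rw [Nat.card_eq_fintype_card]
  have hli : LinearIndependent ℂ fun ε : topIndices r n hn l => powBasis r n ε :=
    (powBasis r n).linearIndependent.comp _ Subtype.val_injective
  have := finrank_span_eq_card hli
  rwa [show Set.range (fun ε : topIndices r n hn l => powBasis r n ε) =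
    powBasis r n '' topIndices r n hn l from (Set.image_eq_range _ _).symm] at this

theorem total_update {ε : Fin n → Fin (r - 1 + 1)} (a : Fin n) (x : Fin (r - 1 + 1)) :
    total (Function.update ε a x) + ε a = total ε + x := by
  have h1 : total ε = ε a + ∑ b ∈ Finset.univ.erase a, (ε b : ℕ) :=
    (Finset.add_sum_erase _ _ (Finset.mem_univ a)).symm
  have h2 : total (Function.update ε a x) = (Function.update ε a x a : ℕ) +
      ∑ b ∈ Finset.univ.erase a, (Function.update ε a x b : ℕ) :=
    (Finset.add_sum_erase _ _ (Finset.mem_univ a)).symm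
  have h3 : ∑ b ∈ Finset.univ.erase a, (Function.update ε a x b : ℕ) =
      ∑ b ∈ Finset.univ.erase a, (ε b : ℕ) :=
    Finset.sum_congr rfl fun b hb => by rw [Function.update_of_ne (Finset.ne_of_mem_erase hb)]
  rw [h2, h3, Function.update_self, h1]
  omega

theorem total_zero : total (fun _ : Fin n => (0 : Fin (r - 1 + 1))) = 0 := by
  simp [total]

theorem exists_mem_topIndices {l : ℕ} (hl : l < r) {hn : 0 < n} {a : Fin n} (ha : a ≠ ⟨0, hn⟩) :
    Function.update (fun _ => 0) a ⟨l, lt_of_lt_of_le hl le_tsub_add⟩ ∈ topIndices r n hn l := by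
  refine ⟨by rw [Function.update_of_ne ha.symm], ?_⟩
  have := total_update (r := r) (ε := fun _ => 0) a ⟨l, lt_of_lt_of_le hl le_tsub_add⟩
  rw [total_zero] at this
  simpa using this

theorem card_topIndices_pos {l : ℕ} (hl : l < r) (hn : 2 ≤ n) :
    0 < Nat.card (topIndices r n (by omega) l) := by
  rw [Nat.card_pos_iff]
  exact ⟨⟨_, exists_mem_topIndices hl (a := ⟨1, by omega⟩) (by simp)⟩, inferInstance⟩

/-- Adding `l - l'` to the third entry is injective, and stays in range because `l < r`. It misses
the index whose only non-zero entry is `l` in the second place. -/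
theorem card_topIndices_lt {l l' : ℕ} (hl : l < r) (hl' : l' < l) (hn : 3 ≤ n) :
    Nat.card (topIndices r n (by omega) l') < Nat.card (topIndices r n (by omega) l) := by
  have hle : ∀ {ε : Fin n → Fin (r - 1 + 1)}, ∀ a, (ε a : ℕ) ≤ total ε := fun {ε} a =>
    Finset.single_le_sum (f := fun a => (ε a : ℕ)) (fun _ _ => Nat.zero_le _) (Finset.mem_univ a)
  let z : Fin n := ⟨2, by omega⟩
  have hz : z ≠ ⟨0, by omega⟩ := by simp [z]
  let φ : topIndices r n (by omega) l' → topIndices r n (by omega) l := fun ε =>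
    ⟨Function.update ε.1 z ⟨ε.1 z + (l - l'), by
      have h1 := hle (ε := ε.1) z
      have h2 := ε.2.2
      omega⟩, by rw [Function.update_of_ne hz.symm]; exact ε.2.1, by
      have h1 := total_update (ε := ε.1) z ⟨ε.1 z + (l - l'), by
        have h1 := hle (ε := ε.1) z
        have h2 := ε.2.2
        omega⟩
      have h2 := ε.2.2
      simp only at h1
      omega⟩
  have hφ : Function.Injective φ := by
    intro ε δ h
    have h1 : ∀ a, (φ ε).1 a = (φ δ).1 a := fun a => by rw [h]
    refine Subtype.ext (funext fun a => ?_)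
    have h2 := h1 a
    by_cases ha : a = z
    · subst ha
      simp only [φ, Function.update_self, Fin.mk.injEq] at h2
      exact Fin.ext (by omega)
    · simpa only [φ, Function.update_of_ne ha] using h2
  have : Fintype (topIndices r n (by omega) l) := Fintype.ofFinite _
  have : Fintype (topIndices r n (by omega) l') := Fintype.ofFinite _
  rw [Nat.card_eq_fintype_card, Nat.card_eq_fintype_card]
  refine Fintype.card_lt_of_injective_of_notMem φ hφ
    (b := ⟨_, exists_mem_topIndices hl (a := ⟨1, by omega⟩) (by simp)⟩) ?_
  rintro ⟨ε, hε⟩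
  have h1 := congrArg (fun ε => (ε.1 z : ℕ)) hε
  simp only [φ, Function.update_self] at h1
  rw [Function.update_of_ne (by simp [z])] at h1
  simp at h1
  omega

theorem card_topIndices_two {l : ℕ} (hl : l < r) : Nat.card (topIndices r 2 two_pos l) = 1 := by
  rw [Nat.card_eq_one_iff_unique]
  refine ⟨⟨fun ε δ => Subtype.ext (funext fun a => ?_)⟩,
    ⟨_, exists_mem_topIndices hl (a := 1) (by simp)⟩⟩
  have h : ∀ ε : topIndices r 2 two_pos l, ε.1 0 = 0 ∧ (ε.1 1 : ℕ) = l := fun ε => by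
    have h1 : ε.1 0 = 0 := ε.2.1
    have h2 := ε.2.2
    rw [total, Fin.sum_univ_two, h1] at h2
    exact ⟨h1, by simpa using h2⟩
  match a with
  | 0 => rw [(h ε).1, (h δ).1]
  | 1 => exact Fin.ext (by rw [(h ε).2, (h δ).2])

end RestrictedSl2

end

noncomputable section

namespace RestrictedSl2

/-! ### The quasi-`R`-matrix -/

section Theta

variable {r : ℕ}

/-- The coefficients `{1}^{2t} / {t}! q^{t(t-1)/2}` of the quasi-`R`-matrix. -/
def thetaCoeff (r t : ℕ) : ℂ :=
  qNum r 1 ^ (2 * t) / qNumFactorial r t * qHalf r ^ ((t : ℤ) * (t - 1))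

theorem qNum_ne_zero {m : ℕ} (h0 : 0 < m) (hm : m < r) : qNum r m ≠ 0 := by
  intro h
  have := qInt_ne_zero_of_lt (r := r) (by omega) (x := m) (by omega) (by omega)
  rw [qInt, h, zero_div] at this
  exact this rfl

theorem qNumFactorial_ne_zero {m : ℕ} (hm : m < r) : qNumFactorial r m ≠ 0 :=
  Finset.prod_ne_zero_iff.2 fun p hp => by
    have := Finset.mem_range.1 hp
    exact_mod_cast qNum_ne_zero (m := p + 1) (by omega) (by omega)

theorem thetaCoeff_zero : thetaCoeff r 0 = 1 := by
  simp [thetaCoeff, qNumFactorial]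

theorem thetaCoeff_succ {t : ℕ} (ht : t + 1 < r) :
    thetaCoeff r (t + 1) * qNum r ((t : ℤ) + 1) = thetaCoeff r t * q r ^ t * qNum r 1 ^ 2 := by
  have h1 : qNum r ((t : ℤ) + 1) ≠ 0 := by exact_mod_cast qNum_ne_zero (m := t + 1) (by omega) ht
  have h2 := qNumFactorial_ne_zero (r := r) (m := t) (by omega)
  have h3 : qHalf r ^ (((t + 1 : ℕ) : ℤ) * ((t + 1 : ℕ) - 1)) =
      qHalf r ^ ((t : ℤ) * (t - 1)) * q r ^ t := by
    rw [← zpow_natCast (q r), ← qHalf_zpow_two_mul, ← zpow_add₀ (qHalf_ne_zero r)]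
    congr 1
    push_cast
    ring
  rw [thetaCoeff, thetaCoeff, h3, qNumFactorial, Finset.prod_range_succ, ← qNumFactorial]
  field_simp
  ring

/-- The coefficients are those of a `q`-exponential, and this is the identity behind its addition
law. The bound `p < r` keeps the quantum factorials invertible. -/
theorem thetaCoeff_mul_gaussCoeff {p k : ℕ} (hp : p < r) (hk : k ≤ p) :
    thetaCoeff r p * gaussCoeff (q r ^ 2)⁻¹ p k = thetaCoeff r k * thetaCoeff r (p - k) := by
  induction k with
  | zero => rw [gaussCoeff_zero, thetaCoeff_zero, mul_one, one_mul, Nat.sub_zero]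
  | succ k ih =>
    have hq := q_ne_zero r
    have h1 := gaussCoeff_step (q r ^ 2)⁻¹ p k (by omega)
    have h2 := ih (by omega)
    have h3 := thetaCoeff_succ (r := r) (t := k) (by omega)
    have h4 := thetaCoeff_succ (r := r) (t := p - (k + 1)) (by omega)
    rw [show p - (k + 1) + 1 = p - k by omega] at h4
    have e5 : (1 - (q r ^ 2)⁻¹ ^ (k + 1)) * q r ^ (k + 1) = qNum r ((k : ℤ) + 1) := by
      rw [qNum, show ((k : ℤ) + 1) = ((k + 1 : ℕ) : ℤ) by push_cast; rfl, zpow_neg, zpow_natCast,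
        inv_pow, ← pow_mul, mul_comm 2, pow_mul]
      field_simp
    have e6 : (1 - (q r ^ 2)⁻¹ ^ (p - k)) * q r ^ (p - k) =
        qNum r (((p - (k + 1) : ℕ) : ℤ) + 1) := by
      rw [qNum, show (((p - (k + 1) : ℕ) : ℤ) + 1) = ((p - k : ℕ) : ℤ) by omega, zpow_neg,
        zpow_natCast, inv_pow, ← pow_mul, mul_comm 2, pow_mul]
      field_simp
    have h5 : qNum r ((k : ℤ) + 1) ≠ 0 := by
      exact_mod_cast qNum_ne_zero (m := k + 1) (by omega) (by omega)
    have h6 : 1 - (q r ^ 2)⁻¹ ^ (k + 1) ≠ 0 := fun h => h5 (by rw [← e5, h, zero_mul])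
    have h7 : q r ^ (p - k) = q r ^ (p - (k + 1)) * q r := by
      rw [← pow_succ]
      congr 1
      omega
    apply mul_left_cancel₀ h6
    apply mul_left_cancel₀ (pow_ne_zero (k + 1) hq)
    apply mul_left_cancel₀ (pow_ne_zero (p - k) hq)
    rw [← e5] at h3
    rw [← e6] at h4
    rw [h7] at h4 ⊢
    rw [pow_succ] at h3 ⊢
    have hk0 := pow_ne_zero k hq
    have hp0 := pow_ne_zero (p - (k + 1)) hq
    linear_combination (q r ^ k * q r * q r ^ (p - (k + 1)) * q r * thetaCoeff r p) * h1 +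
      (q r ^ k * q r * q r ^ (p - (k + 1)) * q r * (1 - (q r ^ 2)⁻¹ ^ (p - k))) * h2 +
      q r ^ k * q r * thetaCoeff r k * h4 -
      q r ^ (p - (k + 1)) * q r * thetaCoeff r (p - (k + 1)) * h3

variable {R : Type*} [Ring R] [Algebra ℂ R]

/-- The quasi-`R`-matrix `∑ c_t x^t y^t`. -/
def theta (r : ℕ) (x y : R) : R := ∑ t ∈ Finset.range r, thetaCoeff r t • (x ^ t * y ^ t)

theorem theta_swap {x y : R} (h : Commute x y) : theta r x y = theta r y x :=
  Finset.sum_congr rfl fun t _ => by rw [(h.pow_pow t t).eq]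

theorem theta_commute {x y z : R} (hx : Commute z x) (hy : Commute z y) :
    Commute z (theta r x y) :=
  Commute.sum_right _ _ _ fun t _ => ((hx.pow_right t).mul_right (hy.pow_right t)).smul_right _

theorem theta_commute_of_mul {x y z : R} (hxy : Commute x y) (h : Commute z (x * y)) :
    Commute z (theta r x y) :=
  Commute.sum_right _ _ _ fun t _ => by
    rw [← hxy.mul_pow]
    exact (h.pow_right t).smul_right _

/-- The constant term is `1`, and everything else is a multiple of the nilpotent element `x y`. -/
theorem isUnit_theta (hr : 0 < r) {x y : R} (hxy : Commute x y) (hx : x ^ r = 0) :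
    IsUnit (theta r x y) := by
  obtain ⟨p, rfl⟩ : ∃ p, r = p + 1 := ⟨r - 1, by omega⟩
  have h : theta (p + 1) x y =
      1 + x * y * ∑ t ∈ Finset.range p, thetaCoeff (p + 1) (t + 1) • (x * y) ^ t := by
    rw [theta, Finset.sum_range_succ', thetaCoeff_zero, pow_zero, pow_zero, mul_one, one_smul,
      add_comm, Finset.mul_sum]
    congr 1
    refine Finset.sum_congr rfl fun t _ => ?_
    rw [mul_smul_comm, ← pow_succ', hxy.mul_pow]
  rw [h]
  refine IsNilpotent.isUnit_one_add ?_
  have hN : IsNilpotent (x * y) := ⟨p + 1, by rw [hxy.mul_pow, hx, zero_mul]⟩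
  exact Commute.isNilpotent_mul_right (Commute.sum_right _ _ _ fun t _ =>
    ((Commute.refl _).pow_right t).smul_right _) hN

theorem commutator_pow {e f K L : R} (hr : 2 ≤ r)
    (hef : (q r - (q r)⁻¹) • (e * f - f * e) = K - L)
    (hK : K * f = (q r ^ 2)⁻¹ • (f * K)) (hL : L * f = q r ^ 2 • (f * L)) (t : ℕ) :
    e * f ^ (t + 1) - f ^ (t + 1) * e =
      (qNum r ((t : ℤ) + 1) / qNum r 1 ^ 2) • (f ^ t * ((q r ^ t)⁻¹ • K - q r ^ t • L)) := by
  have hq := q_ne_zero r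
  have h1 := qNum_one_ne_zero hr
  have hq1 : q r - (q r)⁻¹ = qNum r 1 := by simp [qNum]
  have h0 : e * f - f * e = (qNum r 1)⁻¹ • (K - L) := by
    rw [← hef, hq1, smul_smul, inv_mul_cancel₀ h1, one_smul]
  induction t with
  | zero =>
    simp only [zero_add, pow_one, Nat.cast_zero, pow_zero, inv_one, one_smul, one_mul, h0]
    congr 1
    field_simp
  | succ t ih =>
    have e1 : e * f ^ (t + 1 + 1) - f ^ (t + 1 + 1) * e =
        (e * f ^ (t + 1) - f ^ (t + 1) * e) * f + f ^ (t + 1) * (e * f - f * e) := by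
      rw [pow_succ f (t + 1)]
      noncomm_ring
    -- `a1` and `a2` are the recursions in `t` for the coefficients of `K` and of `L`.
    have a1 : qNum r ((t : ℤ) + 1) / qNum r 1 ^ 2 * ((q r ^ t)⁻¹ * (q r ^ 2)⁻¹) + (qNum r 1)⁻¹ =
        qNum r (((t + 1 : ℕ) : ℤ) + 1) / qNum r 1 ^ 2 * (q r ^ (t + 1))⁻¹ := by
      have e : (q r - (q r)⁻¹) = qNum r 1 := hq1
      have e2 : qNum r ((t : ℤ) + 1) = q r ^ (t + 1) - (q r ^ (t + 1))⁻¹ := by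
        rw [qNum, zpow_neg]; norm_cast
      have e3 : qNum r (((t + 1 : ℕ) : ℤ) + 1) = q r ^ (t + 2) - (q r ^ (t + 2))⁻¹ := by
        rw [qNum, zpow_neg]; norm_cast
      field_simp
      rw [e2, e3, ← e]
      field_simp
      ring
    have a2 : qNum r ((t : ℤ) + 1) / qNum r 1 ^ 2 * (q r ^ t * q r ^ 2) + (qNum r 1)⁻¹ =
        qNum r (((t + 1 : ℕ) : ℤ) + 1) / qNum r 1 ^ 2 * q r ^ (t + 1) := by
      have e : (q r - (q r)⁻¹) = qNum r 1 := hq1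
      have e2 : qNum r ((t : ℤ) + 1) = q r ^ (t + 1) - (q r ^ (t + 1))⁻¹ := by
        rw [qNum, zpow_neg]; norm_cast
      have e3 : qNum r (((t + 1 : ℕ) : ℤ) + 1) = q r ^ (t + 2) - (q r ^ (t + 2))⁻¹ := by
        rw [qNum, zpow_neg]; norm_cast
      field_simp
      rw [e2, e3, ← e]
      field_simp
      ring
    have b1 : ((q r ^ t)⁻¹ • K - q r ^ t • L) * f =
        f * (((q r ^ t)⁻¹ * (q r ^ 2)⁻¹) • K - (q r ^ t * q r ^ 2) • L) := by
      rw [sub_mul, smul_mul_assoc, smul_mul_assoc, hK, hL, mul_sub, smul_smul, smul_smul,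
        mul_smul_comm, mul_smul_comm]
    rw [e1, ih, h0, smul_mul_assoc, mul_assoc, b1, ← mul_assoc, ← pow_succ, ← mul_smul_comm,
      ← mul_smul_comm, ← mul_add, smul_sub, smul_sub, smul_sub, smul_smul, smul_smul, smul_smul,
      smul_smul, ← a1, ← a2, add_smul, add_smul]
    congr 1
    abel

/-- The quasi-`R`-matrix intertwines the coproduct and its conjugate. -/
theorem theta_mul {x e f K L : R} (hr : 0 < r)
    (hef : (q r - (q r)⁻¹) • (e * f - f * e) = K - L)
    (hK : K * f = (q r ^ 2)⁻¹ • (f * K)) (hL : L * f = q r ^ 2 • (f * L)) (hx : x ^ r = 0)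
    (hxe : Commute x e) (hxf : Commute x f) (hxL : Commute x L) :
    theta r x f * (e + x * K) = (e + x * L) * theta r x f := by
  obtain ⟨p, rfl⟩ : ∃ p, r = p + 1 := ⟨r - 1, by omega⟩
  have hLf : ∀ t, L * f ^ t = (q (p + 1) ^ t * q (p + 1) ^ t) • (f ^ t * L) := by
    intro t
    rw [qcomm_pow hL]
    congr 1
    ring
  -- By `thetaCoeff_succ` the commutator of `e` with the term of index `t + 1` equals the defect
  -- that `x K` and `x L` produce at index `t`. The defect at the last index carries the factor `x^r
  -- = 0`.
  have h1 : e * theta (p + 1) x f - theta (p + 1) x f * e =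
      ∑ t ∈ Finset.range p, thetaCoeff (p + 1) t •
        (x ^ (t + 1) * (f ^ t * K - (q (p + 1) ^ t * q (p + 1) ^ t) • (f ^ t * L))) := by
    rw [theta, Finset.mul_sum, Finset.sum_mul, ← Finset.sum_sub_distrib, Finset.sum_range_succ']
    rw [pow_zero, pow_zero, mul_one, mul_smul_comm, smul_mul_assoc, mul_one, one_mul, sub_self,
      add_zero]
    refine Finset.sum_congr rfl fun t ht => ?_
    have ht' := Finset.mem_range.1 ht
    have hr2 : 2 ≤ p + 1 := by omega
    have hq := q_ne_zero (p + 1)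
    have hc := thetaCoeff_succ (r := p + 1) (t := t) (by omega)
    have h1 := qNum_one_ne_zero hr2
    rw [mul_smul_comm, smul_mul_assoc, ← smul_sub, ← mul_assoc, ← (hxe.pow_left (t + 1)).eq,
      mul_assoc, mul_assoc, ← mul_sub, commutator_pow hr2 hef hK hL, mul_smul_comm, smul_smul,
      ← mul_div_assoc, hc, mul_div_assoc, div_self (pow_ne_zero 2 h1), mul_one, mul_smul,
      ← mul_smul_comm]
    congr 2
    rw [mul_sub, mul_smul_comm, mul_smul_comm, smul_sub, smul_smul, smul_smul,
      mul_inv_cancel₀ (pow_ne_zero t hq), one_smul]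
  have h2 : theta (p + 1) x f * (x * K) - x * L * theta (p + 1) x f =
      ∑ t ∈ Finset.range p, thetaCoeff (p + 1) t •
        (x ^ (t + 1) * (f ^ t * K - (q (p + 1) ^ t * q (p + 1) ^ t) • (f ^ t * L))) := by
    have key : ∀ t, thetaCoeff (p + 1) t • (x ^ t * f ^ t) * (x * K) -
        x * L * thetaCoeff (p + 1) t • (x ^ t * f ^ t) = thetaCoeff (p + 1) t •
        (x ^ (t + 1) * (f ^ t * K - (q (p + 1) ^ t * q (p + 1) ^ t) • (f ^ t * L))) := by
      intro t
      rw [smul_mul_assoc, mul_smul_comm, ← smul_sub, ← hLf]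
      congr 1
      have e1 : x ^ t * f ^ t * (x * K) = x ^ (t + 1) * (f ^ t * K) := by
        rw [mul_assoc, ← mul_assoc (f ^ t), ← (hxf.pow_right t).eq, pow_succ]
        simp only [mul_assoc]
      have e2 : x * L * (x ^ t * f ^ t) = x ^ (t + 1) * (L * f ^ t) := by
        rw [mul_assoc, ← mul_assoc L, ← (hxL.pow_left t).eq, pow_succ']
        simp only [mul_assoc]
      rw [e1, e2, mul_sub]
    rw [theta, Finset.sum_mul, Finset.mul_sum, ← Finset.sum_sub_distrib,
      Finset.sum_congr rfl fun t _ => key t, Finset.sum_range_succ, hx, zero_mul, smul_zero,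
      add_zero]
  rw [mul_add, add_mul]
  have h3 := h1.trans h2.symm
  rw [sub_eq_sub_iff_add_eq_add] at h3
  rw [h3, add_comm]

/-- The multiplicativity of the quasi-`R`-matrix. -/
theorem theta_mul_theta {x y f : R} (hyx : y * x = (q r ^ 2)⁻¹ • (x * y)) (hfy : Commute f y)
    (hf : f ^ r = 0) : theta r x f * theta r y f = theta r (x + y) f := by
  have h1 : theta r x f * theta r y f = ∑ t ∈ Finset.range r, ∑ s ∈ Finset.range r,
      (thetaCoeff r t * thetaCoeff r s) • (x ^ t * y ^ s * f ^ (t + s)) := by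
    rw [theta, theta, Finset.sum_mul_sum]
    refine Finset.sum_congr rfl fun t _ => Finset.sum_congr rfl fun s _ => ?_
    rw [smul_mul_smul_comm]
    congr 1
    rw [mul_assoc, ← mul_assoc (f ^ t), (hfy.pow_pow t s).eq, pow_add]
    simp only [mul_assoc]
  -- Because `f^r = 0`, the square of indices may be replaced by the triangle `t + s < r`, whose
  -- diagonals are `q`-binomial expansions of `(x + y)^p`.
  have h2 : ∀ t ∈ Finset.range r, ∑ s ∈ Finset.range r,
      (thetaCoeff r t * thetaCoeff r s) • (x ^ t * y ^ s * f ^ (t + s)) =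
      ∑ s ∈ Finset.range (r - t),
        (thetaCoeff r t * thetaCoeff r s) • (x ^ t * y ^ s * f ^ (t + s)) := by
    intro t _
    symm
    refine Finset.sum_subset (Finset.range_mono (Nat.sub_le r t)) fun s _ hs => ?_
    have hs' : r ≤ t + s := by
      rw [Finset.mem_range] at hs
      omega
    rw [pow_eq_zero_of_le hs' hf, mul_zero, smul_zero]
  rw [h1, Finset.sum_congr rfl h2, ← Finset.sum_range_diag_flip r fun t s =>
    (thetaCoeff r t * thetaCoeff r s) • (x ^ t * y ^ s * f ^ (t + s)), theta]
  refine Finset.sum_congr rfl fun p hp => ?_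
  rw [add_pow_of_qcomm hyx, Finset.sum_mul, Finset.smul_sum]
  refine Finset.sum_congr rfl fun k hk => ?_
  have hk' := Finset.mem_range.1 hk
  rw [smul_mul_assoc, smul_smul, thetaCoeff_mul_gaussCoeff (Finset.mem_range.1 hp) (by omega),
    Nat.add_sub_cancel' (by omega)]

theorem theta_semiconj {z x x' y : R} (hx : SemiconjBy z x x') (hy : Commute z y) :
    SemiconjBy z (theta r x y) (theta r x' y) := by
  rw [SemiconjBy, theta, theta, Finset.mul_sum, Finset.sum_mul]
  refine Finset.sum_congr rfl fun t _ => ?_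
  rw [mul_smul_comm, smul_mul_assoc]
  congr 1
  exact (hx.pow_right t).mul_right (hy.pow_right t)

/-- The `R`-matrix `D * theta` intertwines the coproduct and the opposite coproduct. -/
theorem semiconj_coproduct {D x e f J K L : R} (hr : 0 < r)
    (hef : (q r - (q r)⁻¹) • (e * f - f * e) = K - L)
    (hK : K * f = (q r ^ 2)⁻¹ • (f * K)) (hL : L * f = q r ^ 2 • (f * L)) (hx : x ^ r = 0)
    (hxe : Commute x e) (hxf : Commute x f) (hxL : Commute x L) (hDx : D * x = x * K * D)
    (hDe : D * e = e * J * D) (hDL : Commute D L) (hKL : K * L = 1) :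
    SemiconjBy (D * theta r x f) (e + x * K) (x + e * J) := by
  have h : SemiconjBy D (e + x * L) (x + e * J) := by
    rw [SemiconjBy, mul_add, hDe, ← mul_assoc, hDx, mul_assoc _ D, hDL.eq, ← mul_assoc,
      mul_assoc x, hKL, mul_one, ← add_mul, add_comm]
  exact h.mul_left (theta_mul hr hef hK hL hx hxe hxf hxL)

/-- The abstract form of `(Δ ⊗ 1) R = R₁₃ R₂₃`: moving the Cartan factor `D'` to the left replaces
`x` by `x K`, after which the addition law joins the two quasi-`R`-matrices. -/
theorem hexagon {D D' x y f K : R} (hD : D' * (K * f) = f * D') (hxD : Commute x D')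
    (hKf : Commute K f) (hxK : Commute x K) (hyx : y * x = x * y)
    (hyK : y * K = (q r ^ 2)⁻¹ • (K * y)) (hfy : Commute f y) (hf : f ^ r = 0) :
    D * theta r x f * (D' * theta r y f) = D * D' * theta r (y + x * K) f := by
  have h1 : theta r x f * D' = D' * theta r (x * K) f := by
    rw [theta, theta, Finset.mul_sum, Finset.sum_mul]
    refine Finset.sum_congr rfl fun t _ => ?_
    have h2 : SemiconjBy D' (K * f) f := hD
    rw [smul_mul_assoc, mul_smul_comm, mul_assoc, ← (h2.pow_right t).eq, hKf.mul_pow, ← mul_assoc,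
      (hxD.pow_left t).eq, hxK.mul_pow]
    simp only [mul_assoc]
  have h2 : y * (x * K) = (q r ^ 2)⁻¹ • (x * K * y) := by
    rw [← mul_assoc, hyx, mul_assoc, hyK, mul_smul_comm, mul_assoc]
  rw [mul_assoc, ← mul_assoc (theta r x f), h1, mul_assoc D', theta_mul_theta h2 hfy hf,
    add_comm y, mul_assoc]

/-! ### The Cartan part of the `R`-matrix -/

/-- The operator `(1 / 4r) ∑ q^{-mm'/2} x^m y^{m'}`. -/
def cartan (r : ℕ) (x y : R) : R := (1 / (4 * r : ℂ)) • ∑ m ∈ Finset.range (4 * r),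
  ∑ m' ∈ Finset.range (4 * r), qHalf r ^ (-((m : ℤ) * m')) • (x ^ m * y ^ m')

theorem cartan_swap {x y : R} (h : Commute x y) : cartan r x y = cartan r y x := by
  rw [cartan, cartan, Finset.sum_comm]
  refine congrArg _ (Finset.sum_congr rfl fun m _ => Finset.sum_congr rfl fun m' _ => ?_)
  rw [(h.pow_pow m' m).eq, mul_comm (m : ℤ)]

theorem cartan_commute {x y z : R} (hx : Commute z x) (hy : Commute z y) :
    Commute z (cartan r x y) :=
  (Commute.sum_right _ _ _ fun _ _ => Commute.sum_right _ _ _ fun _ _ =>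
    ((hx.pow_right _).mul_right (hy.pow_right _)).smul_right _).smul_right _

theorem sum_range_add_two {M : Type*} [AddCommGroup M] {N : ℕ} (g : ℕ → M)
    (hg : ∀ m, g (m + N) = g m) :
    ∑ m ∈ Finset.range N, g (m + 2) = ∑ m ∈ Finset.range N, g m := by
  have key : ∀ g : ℕ → M, (∀ m, g (m + N) = g m) →
      ∑ m ∈ Finset.range N, g (m + 1) = ∑ m ∈ Finset.range N, g m := by
    intro g hg
    have h1 := Finset.sum_range_succ g N
    rw [Finset.sum_range_succ', show g N = g 0 by rw [← hg 0, zero_add]] at h1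
    exact add_right_cancel h1
  rw [← key g hg, ← key (fun m => g (m + 1)) fun m => by rw [← hg (m + 1), add_right_comm]]

theorem sum_gauss_shift (hr : 0 < r) {y : R} (hy : y ^ (4 * r) = 1) (m : ℕ) :
    ∑ m' ∈ Finset.range (4 * r), qHalf r ^ (-((m : ℤ) * (m' + 2 : ℕ))) • y ^ (m' + 2) =
      ∑ m' ∈ Finset.range (4 * r), qHalf r ^ (-((m : ℤ) * m')) • y ^ m' := by
  refine sum_range_add_two (fun m' : ℕ => qHalf r ^ (-((m : ℤ) * m')) • y ^ m') fun m' => ?_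
  rw [pow_add, hy, mul_one]
  congr 1
  rw [qHalf_zpow_eq_iff hr]
  exact ⟨-m, by push_cast; ring⟩

/-- Up to the factor `4r`, the sum is the spectral projection of `y` for the eigenvalue `q^{m/2}`,
where `y²` acts by `q^m`. -/
theorem sq_mul_sum_gauss (hr : 0 < r) {y : R} (hy : y ^ (4 * r) = 1) (m : ℕ) :
    y ^ 2 * ∑ m' ∈ Finset.range (4 * r), qHalf r ^ (-((m : ℤ) * m')) • y ^ m' =
      q r ^ m • ∑ m' ∈ Finset.range (4 * r), qHalf r ^ (-((m : ℤ) * m')) • y ^ m' := by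
  conv_rhs => rw [← sum_gauss_shift hr hy m]
  rw [Finset.mul_sum, Finset.smul_sum]
  refine Finset.sum_congr rfl fun m' _ => ?_
  rw [mul_smul_comm, ← pow_add, smul_smul, add_comm 2]
  congr 1
  rw [← zpow_natCast (q r), ← qHalf_zpow_two_mul, ← zpow_add₀ (qHalf_ne_zero r)]
  congr 1
  push_cast
  ring

/-- Moving `e` past `x^m` costs the scalar `q^m`, which the spectral projection of `y` turns into
`y²`. -/
theorem cartan_mul (hr : 0 < r) {x y e : R} (hxe : x * e = q r • (e * x)) (hye : Commute y e)
    (hxy : Commute x y) (hy : y ^ (4 * r) = 1) :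
    cartan r x y * e = e * y ^ 2 * cartan r x y := by
  rw [cartan, smul_mul_assoc, mul_smul_comm, Finset.mul_sum, Finset.sum_mul]
  congr 1
  have hxe' : ∀ m, x ^ m * e = q r ^ m • (e * x ^ m) := by
    intro m
    induction m with
    | zero => simp
    | succ m ih =>
      rw [pow_succ', mul_assoc, ih, mul_smul_comm, ← mul_assoc, hxe, smul_mul_assoc, smul_smul,
        ← pow_succ, mul_assoc]
  refine Finset.sum_congr rfl fun m _ => ?_
  have h1 : ∀ m' : ℕ, qHalf r ^ (-((m : ℤ) * m')) • (x ^ m * y ^ m') =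
      x ^ m * qHalf r ^ (-((m : ℤ) * m')) • y ^ m' := fun m' => (mul_smul_comm _ _ _).symm
  simp only [h1]
  rw [← Finset.mul_sum]
  have h2 := sq_mul_sum_gauss hr hy m
  have hc : Commute (∑ m' ∈ Finset.range (4 * r), qHalf r ^ (-((m : ℤ) * m')) • y ^ m') e :=
    Commute.sum_left _ _ _ fun m' _ => (hye.pow_left m').smul_left _
  rw [mul_assoc (x ^ m), hc.eq, ← mul_assoc, hxe', mul_assoc e, ← mul_assoc (y ^ 2),
    ← (hxy.pow_pow m 2).eq, mul_assoc (x ^ m), h2, mul_smul_comm, mul_smul_comm, smul_mul_assoc,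
    mul_assoc]

theorem cartan_mul_inv (hr : 0 < r) {x y y' f : R} (hxf : x * f = (q r)⁻¹ • (f * x))
    (hyf : Commute y f) (hxy : Commute x y) (hy : y ^ (4 * r) = 1) (hyy : y' * y = 1)
    (hyy' : y * y' = 1) :
    cartan r x y * f = f * y' ^ 2 * cartan r x y := by
  have hinv : Commute y' y := hyy.trans hyy'.symm
  have hxf' : ∀ m, x ^ m * f = (q r ^ m)⁻¹ • (f * x ^ m) := by
    intro m
    induction m with
    | zero => simp
    | succ m ih =>
      rw [pow_succ', mul_assoc, ih, mul_smul_comm, ← mul_assoc, hxf, smul_mul_assoc, smul_smul,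
        pow_succ, mul_inv, mul_assoc]
  have h : y ^ 2 * (cartan r x y * f) = f * cartan r x y := by
    rw [cartan, smul_mul_assoc, mul_smul_comm, mul_smul_comm, Finset.mul_sum, Finset.sum_mul,
      Finset.mul_sum]
    congr 1
    refine Finset.sum_congr rfl fun m _ => ?_
    have h1 : ∀ m' : ℕ, qHalf r ^ (-((m : ℤ) * m')) • (x ^ m * y ^ m') =
        x ^ m * qHalf r ^ (-((m : ℤ) * m')) • y ^ m' := fun m' => (mul_smul_comm _ _ _).symm
    simp only [h1]
    rw [← Finset.mul_sum]
    have h2 := sq_mul_sum_gauss hr hy m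
    have hc : Commute (∑ m' ∈ Finset.range (4 * r), qHalf r ^ (-((m : ℤ) * m')) • y ^ m') f :=
      Commute.sum_left _ _ _ fun m' _ => (hyf.pow_left m').smul_left _
    have hq := pow_ne_zero m (q_ne_zero r)
    rw [mul_assoc (x ^ m), hc.eq, ← mul_assoc (x ^ m), hxf', smul_mul_assoc, mul_smul_comm,
      mul_assoc f, ← mul_assoc (y ^ 2), (hyf.pow_left 2).eq, mul_assoc f, ← mul_assoc (y ^ 2),
      ← (hxy.pow_pow m 2).eq, mul_assoc (x ^ m), h2, mul_smul_comm, mul_smul_comm, smul_smul,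
      inv_mul_cancel₀ hq, one_smul]
  have hf' : Commute y' f := by
    have := congrArg (fun z => y' * z * y') hyf.eq
    rw [← mul_assoc, hyy, one_mul, mul_assoc, mul_assoc, hyy', mul_one] at this
    exact this.symm
  have h3 := congrArg (fun z => y' ^ 2 * z) h
  rw [← mul_assoc, ← hinv.mul_pow, hyy, one_pow, one_mul, ← mul_assoc, (hf'.pow_left 2).eq] at h3
  exact h3

end Theta

end RestrictedSl2

end

noncomputable section

namespace RestrictedSl2

/-! ### Permutations of the tensor factors -/

section Perm

variable {X : Type*} [AddCommGroup X] [Module ℂ X] {n : ℕ}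

/-- The operator that permutes the tensor factors. -/
def permOp (σ : Equiv.Perm (Fin n)) : Module.End ℂ (⨂[ℂ] _ : Fin n, X) :=
  (PiTensorProduct.reindex ℂ (fun _ : Fin n => X) σ).toLinearMap

theorem permOp_tprod (σ : Equiv.Perm (Fin n)) (x : Fin n → X) :
    permOp σ (PiTensorProduct.tprod ℂ x) = PiTensorProduct.tprod ℂ fun a => x (σ.symm a) :=
  PiTensorProduct.reindex_tprod (s := fun _ => X) σ x

theorem permOp_mul (σ τ : Equiv.Perm (Fin n)) :
    permOp (X := X) (σ * τ) = permOp σ * permOp τ := by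
  refine PiTensorProduct.ext (MultilinearMap.ext fun x => ?_)
  simp only [LinearMap.compMultilinearMap_apply, Module.End.mul_apply, permOp_tprod]
  rfl

theorem permOp_one : permOp (X := X) (1 : Equiv.Perm (Fin n)) = 1 := by
  refine PiTensorProduct.ext (MultilinearMap.ext fun x => ?_)
  simp only [LinearMap.compMultilinearMap_apply, permOp_tprod]
  rfl

theorem isUnit_permOp (σ : Equiv.Perm (Fin n)) : IsUnit (permOp (X := X) σ) :=
  ⟨⟨permOp σ, permOp σ⁻¹, by rw [← permOp_mul, mul_inv_cancel, permOp_one],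
    by rw [← permOp_mul, inv_mul_cancel, permOp_one]⟩, rfl⟩

theorem permOp_mul_map (σ : Equiv.Perm (Fin n)) (f : Fin n → Module.End ℂ X) :
    permOp σ * PiTensorProduct.map f =
      PiTensorProduct.map (fun a => f (σ.symm a)) * permOp σ := by
  refine PiTensorProduct.ext (MultilinearMap.ext fun x => ?_)
  simp only [LinearMap.compMultilinearMap_apply, Module.End.mul_apply, permOp_tprod,
    PiTensorProduct.map_tprod]

theorem permOp_semiconj_leg (σ : Equiv.Perm (Fin n)) (a : Fin n) (T : Module.End ℂ X) :
    SemiconjBy (permOp σ) (leg a T) (leg (σ a) T) := by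
  rw [SemiconjBy, leg_eq_map, permOp_mul_map, leg_eq_map]
  simp only [Equiv.symm_apply_eq]

end Perm

/-! ### The braiding on two tensor factors -/

namespace DModule

section Braiding

variable {r : ℕ} {X : Type*} [AddCommGroup X] [Module ℂ X] (A : DModule r X) {n : ℕ}

/-- The action of the universal `R`-matrix on two tensor factors, as the product of its Cartan part
and of the quasi-`R`-matrix. -/
def rOp (a b : Fin n) : Module.End ℂ (⨂[ℂ] _ : Fin n, X) :=
  cartan r (leg a A.k) (leg b A.k) * theta r (leg a A.E) (leg b A.F)

variable {A}

theorem k_pow_mul_E_pow (m t : ℕ) : A.k ^ m * A.E ^ t = q r ^ (m * t) • (A.E ^ t * A.k ^ m) := by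
  have h1 : ∀ t, A.k * A.E ^ t = q r ^ t • (A.E ^ t * A.k) := qcomm_pow A.k_mul_E
  induction m with
  | zero => simp
  | succ m ih =>
    rw [pow_succ', mul_assoc, ih, mul_smul_comm, ← mul_assoc, h1, smul_mul_assoc, smul_smul,
      mul_assoc, ← pow_add]
    congr 2
    ring

theorem k_pow_mul_F_pow (m t : ℕ) :
    A.k ^ m * A.F ^ t = (q r)⁻¹ ^ (m * t) • (A.F ^ t * A.k ^ m) := by
  have h1 : ∀ t, A.k * A.F ^ t = (q r)⁻¹ ^ t • (A.F ^ t * A.k) := qcomm_pow A.k_mul_F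
  induction m with
  | zero => simp
  | succ m ih =>
    rw [pow_succ', mul_assoc, ih, mul_smul_comm, ← mul_assoc, h1, smul_mul_assoc, smul_smul,
      mul_assoc, ← pow_add]
    congr 2
    ring

theorem map_eq_leg_mul_leg {a b : Fin n} (hab : a ≠ b) (t m m' : ℕ) :
    (PiTensorProduct.map fun c : Fin n =>
      if c = a then A.E ^ t * A.k ^ m else if c = b then A.F ^ t * A.k ^ m' else 1) =
    (q r ^ (m * t))⁻¹ • ((q r)⁻¹ ^ (m' * t))⁻¹ •
      (leg a A.k ^ m * leg b A.k ^ m' * (leg a A.E ^ t * leg b A.F ^ t)) := by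
  have h : leg a A.k ^ m * leg b A.k ^ m' * (leg a A.E ^ t * leg b A.F ^ t) =
      leg a (A.k ^ m * A.E ^ t) * leg b (A.k ^ m' * A.F ^ t) := by
    rw [map_mul, map_mul, map_pow, map_pow, map_pow, map_pow, mul_assoc, mul_assoc,
      ← mul_assoc (leg b A.k ^ m'), ((leg_commute hab.symm A.k A.E).pow_pow m' t).eq]
    simp only [mul_assoc]
  rw [h, k_pow_mul_E_pow, k_pow_mul_F_pow, map_smul, map_smul, smul_mul_smul_comm, smul_smul,
    smul_smul, leg_mul_leg hab, ← mul_inv,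
    inv_mul_cancel₀ (mul_ne_zero (pow_ne_zero _ (q_ne_zero r))
      (pow_ne_zero _ (inv_ne_zero (q_ne_zero r)))), one_smul]

/-- Moving the powers of `k` to the left of `E^t` and `F^t` cancels the factor `q^{t(m-m')}`. This
separates the sum over `t` from the sum over `m` and `m'`. -/
theorem rMatrix_eq_rOp {a b : Fin n} (hab : a ≠ b) : A.rMatrix n a b = A.rOp a b := by
  have key : ∀ t m m' : ℕ, (qNum r 1 ^ (2 * t) / qNumFactorial r t *
        qHalf r ^ ((t : ℤ) * (t - 1) + 2 * t * (m - m') - m * m')) •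
      (PiTensorProduct.map fun c : Fin n =>
        if c = a then A.E ^ t * A.k ^ m else if c = b then A.F ^ t * A.k ^ m' else 1) =
      qHalf r ^ (-((m : ℤ) * m')) • (leg a A.k ^ m * leg b A.k ^ m') *
        thetaCoeff r t • (leg a A.E ^ t * leg b A.F ^ t) := by
    intro t m m'
    rw [map_eq_leg_mul_leg hab, smul_mul_smul_comm, smul_smul, smul_smul]
    congr 1
    rw [thetaCoeff, inv_pow, inv_inv, ← zpow_natCast (q r), ← zpow_natCast (q r), ← zpow_neg,
      ← qHalf_zpow_two_mul, ← qHalf_zpow_two_mul]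
    have h : qHalf r ^ (-((m : ℤ) * m')) * qHalf r ^ ((t : ℤ) * (t - 1)) =
        qHalf r ^ ((t : ℤ) * (t - 1) + 2 * t * (m - m') - m * m') *
        (qHalf r ^ (2 * -((m * t : ℕ) : ℤ)) * qHalf r ^ (2 * ((m' * t : ℕ) : ℤ))) := by
      rw [← zpow_add₀ (qHalf_ne_zero r), ← zpow_add₀ (qHalf_ne_zero r),
        ← zpow_add₀ (qHalf_ne_zero r)]
      congr 1
      push_cast
      ring
    rw [mul_left_comm, h]
    ring
  rw [rMatrix, rOp, cartan, theta, smul_mul_assoc]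
  congr 1
  rw [Finset.mul_sum]
  refine Finset.sum_congr rfl fun t _ => ?_
  rw [Finset.sum_mul]
  refine Finset.sum_congr rfl fun m _ => ?_
  rw [Finset.sum_mul]
  exact Finset.sum_congr rfl fun m' _ => key t m m'

theorem leg_k_mul_E (a : Fin n) : leg a A.k * leg a A.E = q r • (leg a A.E * leg a A.k) := by
  rw [← map_mul, A.k_mul_E, map_smul, map_mul]

theorem leg_k_mul_F (a : Fin n) : leg a A.k * leg a A.F = (q r)⁻¹ • (leg a A.F * leg a A.k) := by
  rw [← map_mul, A.k_mul_F, map_smul, map_mul]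

theorem leg_k_pow (a : Fin n) : leg a A.k ^ (4 * r) = 1 := by
  rw [← map_pow, A.k_pow, map_one]

theorem leg_kinv_mul_k (hr : 0 < r) (a : Fin n) : leg a A.kinv * leg a A.k = 1 := by
  rw [← map_mul, kinv_mul_k hr, map_one]

theorem leg_k_mul_kinv (a : Fin n) : leg a A.k * leg a A.kinv = 1 := by
  rw [← map_mul, A.k_mul_kinv, map_one]

theorem leg_E_F (a : Fin n) : (q r - (q r)⁻¹) • (leg a A.E * leg a A.F - leg a A.F * leg a A.E) =
    leg a A.k ^ 2 - leg a A.kinv ^ 2 := by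
  rw [← map_mul, ← map_mul, ← map_sub, ← map_smul, A.E_F, map_sub, map_pow, map_pow]

theorem leg_k_sq_mul_F (a : Fin n) :
    leg a A.k ^ 2 * leg a A.F = (q r ^ 2)⁻¹ • (leg a A.F * leg a A.k ^ 2) := by
  rw [eq_inv_smul_iff₀ (pow_ne_zero 2 (q_ne_zero r)), ← map_pow, ← map_mul, ← map_mul, ← map_smul,
    k_sq_mul_F]

theorem leg_k_sq_mul_E (a : Fin n) :
    leg a A.k ^ 2 * leg a A.E = q r ^ 2 • (leg a A.E * leg a A.k ^ 2) := by
  rw [← map_pow, ← map_mul, ← map_mul, ← map_smul, k_sq_mul_E]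

theorem leg_kinv_sq_mul_F (hr : 0 < r) (a : Fin n) :
    leg a A.kinv ^ 2 * leg a A.F = q r ^ 2 • (leg a A.F * leg a A.kinv ^ 2) := by
  rw [← map_pow, ← map_mul, ← map_mul, ← map_smul, kinv_sq_mul_F hr]

theorem leg_kinv_sq_mul_E (hr : 0 < r) (a : Fin n) :
    leg a A.kinv ^ 2 * leg a A.E = (q r ^ 2)⁻¹ • (leg a A.E * leg a A.kinv ^ 2) := by
  rw [eq_inv_smul_iff₀ (pow_ne_zero 2 (q_ne_zero r)), ← map_pow, ← map_mul, ← map_mul, ← map_smul,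
    kinv_sq_mul_E hr]

theorem commute_leg_k_kinv (hr : 0 < r) (a : Fin n) : Commute (leg a A.k) (leg a A.kinv) :=
  (leg_k_mul_kinv a).trans (leg_kinv_mul_k hr a).symm

theorem leg_k_sq_mul_kinv_sq (hr : 0 < r) (a : Fin n) : leg a A.k ^ 2 * leg a A.kinv ^ 2 = 1 := by
  rw [← (commute_leg_k_kinv hr a).mul_pow, leg_k_mul_kinv, one_pow]

theorem commute_leg_k (a b : Fin n) : Commute (leg a A.k) (leg b A.k) := by
  by_cases h : a = b
  · rw [h]
  · exact leg_commute h _ _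

theorem rOp_semiconj_E (hr : 0 < r) {a b : Fin n} (hab : a ≠ b) :
    SemiconjBy (A.rOp a b) (leg b A.E + leg a A.E * leg b A.k ^ 2)
      (leg a A.E + leg b A.E * leg a A.k ^ 2) := by
  refine semiconj_coproduct hr (leg_E_F b) (leg_k_sq_mul_F b) (leg_kinv_sq_mul_F hr b)
    (by rw [← map_pow, A.E_pow, map_zero]) (leg_commute hab _ _) (leg_commute hab _ _)
    ((leg_commute hab _ _).pow_right 2) ?_ ?_ ?_ (leg_k_sq_mul_kinv_sq hr b)
  · exact cartan_mul hr (leg_k_mul_E a) (leg_commute hab.symm _ _) (commute_leg_k a b) (leg_k_pow b)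
  · rw [cartan_swap (commute_leg_k a b)]
    exact cartan_mul hr (leg_k_mul_E b) (leg_commute hab _ _) (commute_leg_k b a) (leg_k_pow a)
  · exact (cartan_commute ((leg_commute hab.symm _ _).pow_left 2)
      ((commute_leg_k_kinv hr b).symm.pow_left 2)).symm

/-- The same intertwining lemma as for `E`, with `E` and `F`, the two legs, and `k²` and `k⁻²`
exchanged; the quasi-`R`-matrix is symmetric because its arguments commute. -/
theorem rOp_semiconj_F (hr : 0 < r) {a b : Fin n} (hab : a ≠ b) :
    SemiconjBy (A.rOp a b) (leg a A.F + leg b A.F * leg a A.kinv ^ 2)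
      (leg b A.F + leg a A.F * leg b A.kinv ^ 2) := by
  rw [rOp, theta_swap (leg_commute hab _ _)]
  refine semiconj_coproduct (L := leg a A.k ^ 2) hr ?_ (leg_kinv_sq_mul_E hr a) (leg_k_sq_mul_E a)
    (by rw [← map_pow, A.F_pow, map_zero]) (leg_commute hab.symm _ _) (leg_commute hab.symm _ _)
    ((leg_commute hab.symm _ _).pow_right 2) ?_ ?_ ?_ ?_
  · have h := leg_E_F (A := A) a
    rw [smul_sub] at h ⊢
    rw [← neg_sub (leg a A.k ^ 2), ← h, neg_sub]
  · rw [cartan_swap (commute_leg_k a b)]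
    exact cartan_mul_inv hr (leg_k_mul_F b) (leg_commute hab _ _) (commute_leg_k b a) (leg_k_pow a)
      (leg_kinv_mul_k hr a) (leg_k_mul_kinv a)
  · exact cartan_mul_inv hr (leg_k_mul_F a) (leg_commute hab.symm _ _) (commute_leg_k a b)
      (leg_k_pow b) (leg_kinv_mul_k hr b) (leg_k_mul_kinv b)
  · exact (cartan_commute ((Commute.refl _).pow_left 2) ((leg_commute hab _ _).pow_left 2)).symm
  · rw [← ((commute_leg_k_kinv hr a).pow_pow 2 2).eq, leg_k_sq_mul_kinv_sq hr]

theorem rOp_mul_rOp (hr : 0 < r) {a b c : Fin n} (hab : a ≠ b) (hac : a ≠ c) (hbc : b ≠ c) :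
    A.rOp a c * A.rOp b c = cartan r (leg a A.k) (leg c A.k) * cartan r (leg b A.k) (leg c A.k) *
      theta r (leg b A.E + leg a A.E * leg b A.k ^ 2) (leg c A.F) := by
  refine hexagon ?_ (cartan_commute (leg_commute hab _ _) (leg_commute hac _ _))
    ((leg_commute hbc _ _).pow_left 2) ((leg_commute hab _ _).pow_right 2)
    (leg_commute hab.symm _ _).eq ?_ (leg_commute hbc.symm _ _)
    (by rw [← map_pow, A.F_pow, map_zero])
  · have h := cartan_mul_inv hr (leg_k_mul_F (A := A) c) (leg_commute hbc _ _) (commute_leg_k c b)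
      (leg_k_pow b) (leg_kinv_mul_k hr b) (leg_k_mul_kinv b)
    rw [cartan_swap (commute_leg_k c b)] at h
    have hK : Commute (leg b A.k ^ 2) (cartan r (leg b A.k) (leg c A.k)) :=
      cartan_commute ((Commute.refl _).pow_left 2) ((leg_commute hbc _ _).pow_left 2)
    rw [← mul_assoc, ← hK.eq, mul_assoc, h, ← mul_assoc, ← mul_assoc,
      ((leg_commute hbc _ _).pow_left 2).eq, mul_assoc (leg c A.F), leg_k_sq_mul_kinv_sq hr,
      mul_one]
  · rw [eq_inv_smul_iff₀ (pow_ne_zero 2 (q_ne_zero r)), leg_k_sq_mul_E]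

/-- Conjugation by `R₁₂` takes `(Δ ⊗ 1) R = R₁₃ R₂₃` to the same expression with the opposite
coproduct, which is `R₂₃ R₁₃`. This also needs `R₁₂` to commute with the product of the two Cartan
factors. -/
theorem yang_baxter (hr : 0 < r) {a b c : Fin n} (hab : a ≠ b) (hac : a ≠ c) (hbc : b ≠ c) :
    A.rOp a b * A.rOp a c * A.rOp b c = A.rOp b c * A.rOp a c * A.rOp a b := by
  have hD : Commute (cartan r (leg a A.k) (leg c A.k)) (cartan r (leg b A.k) (leg c A.k)) :=
    cartan_commute
      (cartan_commute (commute_leg_k b a) (commute_leg_k b c)).symm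
      (cartan_commute (commute_leg_k c a) (commute_leg_k c c)).symm
  have hDD : Commute (A.rOp a b)
      (cartan r (leg a A.k) (leg c A.k) * cartan r (leg b A.k) (leg c A.k)) := by
    have h1 : ∀ d, Commute (leg d A.k)
        (cartan r (leg a A.k) (leg c A.k) * cartan r (leg b A.k) (leg c A.k)) := fun d =>
      (cartan_commute (commute_leg_k d a) (commute_leg_k d c)).mul_right
        (cartan_commute (commute_leg_k d b) (commute_leg_k d c))
    refine Commute.mul_left (cartan_commute (h1 a).symm (h1 b).symm).symm ?_
    -- `E ⊗ F` has total weight zero: the factor `k²` that `E` produces on the third leg is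
    -- cancelled by the `k⁻²` that `F` produces.
    refine (theta_commute_of_mul (leg_commute hab _ _) ?_).symm
    have e1 : cartan r (leg a A.k) (leg c A.k) * leg a A.E = leg a A.E * leg c A.k ^ 2 *
        cartan r (leg a A.k) (leg c A.k) :=
      cartan_mul hr (leg_k_mul_E a) (leg_commute hac.symm _ _) (commute_leg_k a c) (leg_k_pow c)
    have e2 : cartan r (leg b A.k) (leg c A.k) * leg b A.F = leg b A.F * leg c A.kinv ^ 2 *
        cartan r (leg b A.k) (leg c A.k) :=
      cartan_mul_inv hr (leg_k_mul_F b) (leg_commute hbc.symm _ _) (commute_leg_k b c)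
        (leg_k_pow c) (leg_kinv_mul_k hr c) (leg_k_mul_kinv c)
    have e3 : Commute (cartan r (leg b A.k) (leg c A.k)) (leg a A.E) :=
      (cartan_commute (leg_commute hab _ _) (leg_commute hac _ _)).symm
    have e4 : Commute (cartan r (leg a A.k) (leg c A.k)) (leg b A.F) :=
      (cartan_commute (leg_commute hab.symm _ _) (leg_commute hbc _ _)).symm
    have e5 : Commute (cartan r (leg a A.k) (leg c A.k)) (leg c A.kinv ^ 2) :=
      (cartan_commute ((leg_commute hac.symm _ _).pow_left 2)
        ((commute_leg_k_kinv hr c).symm.pow_left 2)).symm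
    have e6 : Commute (leg c A.k ^ 2) (leg b A.F) := (leg_commute hbc.symm _ _).pow_left 2
    generalize cartan r (leg a A.k) (leg c A.k) = D at *
    generalize cartan r (leg b A.k) (leg c A.k) = D' at *
    calc D * D' * (leg a A.E * leg b A.F)
        = D * leg a A.E * (D' * leg b A.F) := by
          rw [mul_assoc, ← mul_assoc D', e3.eq, mul_assoc (leg a A.E), ← mul_assoc]
      _ = leg a A.E * leg c A.k ^ 2 * (D * leg b A.F) * leg c A.kinv ^ 2 * D' := by
          rw [e1, e2]
          simp only [mul_assoc]
      _ = leg a A.E * (leg c A.k ^ 2 * leg b A.F) * (D * leg c A.kinv ^ 2) * D' := by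
          rw [e4.eq]
          simp only [mul_assoc]
      _ = leg a A.E * leg b A.F * (leg c A.k ^ 2 * leg c A.kinv ^ 2) * (D * D') := by
          rw [e5.eq, e6.eq]
          simp only [mul_assoc]
      _ = leg a A.E * leg b A.F * (D * D') := by rw [leg_k_sq_mul_kinv_sq hr, mul_one]
  have hF : Commute (A.rOp a b) (leg c A.F) :=
    Commute.mul_left
      (cartan_commute (leg_commute hac.symm _ _) (leg_commute hbc.symm _ _)).symm
      (theta_commute (leg_commute hac.symm _ _) (leg_commute hbc.symm _ _)).symm
  rw [mul_assoc, rOp_mul_rOp hr hab hac hbc, ← mul_assoc, hDD.eq, mul_assoc,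
    (theta_semiconj (rOp_semiconj_E hr hab) hF).eq, ← mul_assoc, rOp_mul_rOp hr hab.symm hbc hac,
    hD.eq]

theorem permOp_semiconj_rOp (σ : Equiv.Perm (Fin n)) (a b : Fin n) :
    SemiconjBy (permOp σ) (A.rOp a b) (A.rOp (σ a) (σ b)) := by
  have hs : ∀ (c : ℂ) {x y : Module.End ℂ (⨂[ℂ] _ : Fin n, X)},
      SemiconjBy (permOp σ) x y → SemiconjBy (permOp σ) (c • x) (c • y) := by
    intro c x y h
    rw [SemiconjBy, mul_smul_comm, h.eq, smul_mul_assoc]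
  have hsum : ∀ (N : ℕ) {x y : ℕ → Module.End ℂ (⨂[ℂ] _ : Fin n, X)},
      (∀ m, SemiconjBy (permOp σ) (x m) (y m)) →
      SemiconjBy (permOp σ) (∑ m ∈ Finset.range N, x m) (∑ m ∈ Finset.range N, y m) := by
    intro N x y h
    rw [SemiconjBy, Finset.mul_sum, Finset.sum_mul]
    exact Finset.sum_congr rfl fun m _ => (h m).eq
  have hl := fun c T => permOp_semiconj_leg (X := X) σ c T
  refine SemiconjBy.mul_right (hs _ (hsum _ fun m => hsum _ fun m' => hs _ ?_))
    (hsum _ fun t => hs _ ?_)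
  · exact ((hl _ _).pow_right m).mul_right ((hl _ _).pow_right m')
  · exact ((hl _ _).pow_right t).mul_right ((hl _ _).pow_right t)

theorem braiding_eq {a b : Fin n} (hab : a ≠ b) :
    A.braiding n a b = permOp (Equiv.swap a b) * A.rOp a b := by
  rw [braiding, rMatrix_eq_rOp hab]
  rfl

/-- The braid relation. -/
theorem braiding_braid (hr : 0 < r) {a b c : Fin n} (hab : a ≠ b) (hac : a ≠ c) (hbc : b ≠ c) :
    A.braiding n a b * A.braiding n b c * A.braiding n a b =
      A.braiding n b c * A.braiding n a b * A.braiding n b c := by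
  have h1 : A.rOp a b * permOp (Equiv.swap b c) = permOp (Equiv.swap b c) * A.rOp a c := by
    have := permOp_semiconj_rOp (A := A) (Equiv.swap b c) a c
    rw [Equiv.swap_apply_of_ne_of_ne hab hac, Equiv.swap_apply_right] at this
    exact this.eq.symm
  have h2 : A.rOp b c * permOp (Equiv.swap a b) = permOp (Equiv.swap a b) * A.rOp a c := by
    have := permOp_semiconj_rOp (A := A) (Equiv.swap a b) a c
    rw [Equiv.swap_apply_left, Equiv.swap_apply_of_ne_of_ne hac.symm hbc.symm] at this
    exact this.eq.symm
  have h3 : A.rOp a c * permOp (Equiv.swap a b) = permOp (Equiv.swap a b) * A.rOp b c := by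
    have := permOp_semiconj_rOp (A := A) (Equiv.swap a b) b c
    rw [Equiv.swap_apply_right, Equiv.swap_apply_of_ne_of_ne hac.symm hbc.symm] at this
    exact this.eq.symm
  have h4 : A.rOp a c * permOp (Equiv.swap b c) = permOp (Equiv.swap b c) * A.rOp a b := by
    have := permOp_semiconj_rOp (A := A) (Equiv.swap b c) a b
    rw [Equiv.swap_apply_of_ne_of_ne hab hac, Equiv.swap_apply_left] at this
    exact this.eq.symm
  have h5 : permOp (X := X) (Equiv.swap a b) * permOp (Equiv.swap b c) * permOp (Equiv.swap a b) =
      permOp (Equiv.swap b c) * permOp (Equiv.swap a b) * permOp (Equiv.swap b c) := by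
    rw [← permOp_mul, ← permOp_mul, ← permOp_mul, ← permOp_mul]
    congr 1
    rw [Equiv.swap_mul_swap_mul_swap hab hac, Equiv.swap_comm a b, Equiv.swap_comm b c,
      Equiv.swap_mul_swap_mul_swap hbc.symm hac.symm, Equiv.swap_comm]
  rw [braiding_eq hab, braiding_eq hbc]
  generalize permOp (X := X) (Equiv.swap a b) = P at *
  generalize permOp (X := X) (Equiv.swap b c) = Q at *
  -- Once all permutations stand on the left, the relation splits into the Coxeter relation `h5` and
  -- the Yang–Baxter equation.
  calc P * A.rOp a b * (Q * A.rOp b c) * (P * A.rOp a b)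
      = P * (A.rOp a b * Q) * (A.rOp b c * P) * A.rOp a b := by simp only [mul_assoc]
    _ = P * Q * (A.rOp a c * P) * A.rOp a c * A.rOp a b := by
      rw [h1, h2]
      simp only [mul_assoc]
    _ = P * Q * P * (A.rOp b c * A.rOp a c * A.rOp a b) := by
      rw [h3]
      simp only [mul_assoc]
    _ = Q * P * Q * (A.rOp a b * A.rOp a c * A.rOp b c) := by
      rw [h5, yang_baxter hr hab hac hbc]
    _ = Q * P * (A.rOp a c * Q) * A.rOp a c * A.rOp b c := by
      rw [h4]
      simp only [mul_assoc]
    _ = Q * (A.rOp b c * P) * (A.rOp a b * Q) * A.rOp b c := by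
      rw [h1, h2]
      simp only [mul_assoc]
    _ = Q * A.rOp b c * (P * A.rOp a b) * (Q * A.rOp b c) := by simp only [mul_assoc]

theorem braiding_commute {a b c d : Fin n} (hab : a ≠ b) (hcd : c ≠ d) (hac : a ≠ c) (had : a ≠ d)
    (hbc : b ≠ c) (hbd : b ≠ d) : Commute (A.braiding n a b) (A.braiding n c d) := by
  rw [braiding_eq hab, braiding_eq hcd]
  have h1 : Commute (permOp (Equiv.swap a b)) (A.rOp c d) := by
    have := permOp_semiconj_rOp (A := A) (Equiv.swap a b) c d
    rwa [Equiv.swap_apply_of_ne_of_ne hac.symm hbc.symm,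
      Equiv.swap_apply_of_ne_of_ne had.symm hbd.symm] at this
  have h2 : Commute (permOp (Equiv.swap c d)) (A.rOp a b) := by
    have := permOp_semiconj_rOp (A := A) (Equiv.swap c d) a b
    rwa [Equiv.swap_apply_of_ne_of_ne hac had, Equiv.swap_apply_of_ne_of_ne hbc hbd] at this
  have h3 : Commute (permOp (X := X) (Equiv.swap a b)) (permOp (Equiv.swap c d)) := by
    rw [commute_iff_eq, ← permOp_mul, ← permOp_mul, Equiv.mul_swap_eq_swap_mul,
      Equiv.swap_apply_of_ne_of_ne hac.symm hbc.symm, Equiv.swap_apply_of_ne_of_ne had.symm hbd.symm]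
  have h4 : ∀ S T : Module.End ℂ X, Commute (leg a S) (leg c T) ∧ Commute (leg a S) (leg d T) ∧
      Commute (leg b S) (leg c T) ∧ Commute (leg b S) (leg d T) := fun S T =>
    ⟨leg_commute hac _ _, leg_commute had _ _, leg_commute hbc _ _, leg_commute hbd _ _⟩
  have h5 : ∀ {x}, (∀ S, Commute (leg a S) x) → (∀ S, Commute (leg b S) x) →
      Commute (A.rOp a b) x := fun ha hb =>
    Commute.mul_left (cartan_commute (ha _).symm (hb _).symm).symm
      (theta_commute (ha _).symm (hb _).symm).symm
  have h6 : ∀ {x}, (∀ S, Commute (leg c S) x) → (∀ S, Commute (leg d S) x) →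
      Commute (A.rOp c d) x := fun ha hb =>
    Commute.mul_left (cartan_commute (ha _).symm (hb _).symm).symm
      (theta_commute (ha _).symm (hb _).symm).symm
  have h7 : Commute (A.rOp a b) (A.rOp c d) := by
    refine h5 (fun S => (h6 (fun T => ?_) fun T => ?_).symm) fun S => (h6 (fun T => ?_) fun T => ?_).symm
    exacts [(h4 S T).1.symm, (h4 S T).2.1.symm, (h4 S T).2.2.1.symm, (h4 S T).2.2.2.symm]
  exact (h3.mul_right h1).mul_left (h2.symm.mul_right h7)

/-- The operator `g` acts alike on both factors and rescales `E` and `F` inversely, so it commutes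
with `E ⊗ F` and hence with the quasi-`R`-matrix. It is needed for `g = 1`, `k²` and `k⁻²`. -/
theorem braiding_commute_map {a b : Fin n} (hab : a ≠ b) {f : Fin n → Module.End ℂ X}
    {g : Module.End ℂ X} {ω : ℂ} (hω : ω ≠ 0) (ha : f a = g) (hb : f b = g)
    (hE : g * A.E = ω • (A.E * g)) (hF : g * A.F = ω⁻¹ • (A.F * g)) (hk : Commute g A.k) :
    Commute (A.braiding n a b) (PiTensorProduct.map f) := by
  rw [braiding_eq hab]
  refine Commute.mul_left ?_ (Commute.mul_left ?_ ?_)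
  · rw [commute_iff_eq, permOp_mul_map]
    congr 2
    ext1 c
    rw [Equiv.symm_swap]
    by_cases hca : c = a
    · rw [hca, Equiv.swap_apply_left, ha, hb]
    · by_cases hcb : c = b
      · rw [hcb, Equiv.swap_apply_right, ha, hb]
      · rw [Equiv.swap_apply_of_ne_of_ne hca hcb]
  · exact (cartan_commute (leg_commute_map (by rw [ha]; exact hk.symm)).symm
      (leg_commute_map (by rw [hb]; exact hk.symm)).symm).symm
  · refine (theta_commute_of_mul (leg_commute hab _ _) ?_).symm
    have h1 : PiTensorProduct.map f * leg a A.E = ω • (leg a A.E * PiTensorProduct.map f) := by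
      rw [leg_eq_map, ← PiTensorProduct.map_mul, ← PiTensorProduct.map_mul]
      refine map_eq_smul_map _ _ a ω (by simpa [ha] using hE) fun c hc => ?_
      simp [hc]
    have h2 : PiTensorProduct.map f * leg b A.F = ω⁻¹ • (leg b A.F * PiTensorProduct.map f) := by
      rw [leg_eq_map, ← PiTensorProduct.map_mul, ← PiTensorProduct.map_mul]
      refine map_eq_smul_map _ _ b ω⁻¹ (by simpa [hb] using hF) fun c hc => ?_
      simp [hc]
    rw [commute_iff_eq, ← mul_assoc, h1, smul_mul_assoc, mul_assoc, h2, mul_smul_comm, smul_smul,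
      mul_inv_cancel₀ hω, one_smul, mul_assoc]

theorem braiding_commute_map_one {a b : Fin n} (hab : a ≠ b) {f : Fin n → Module.End ℂ X}
    (ha : f a = 1) (hb : f b = 1) : Commute (A.braiding n a b) (PiTensorProduct.map f) :=
  braiding_commute_map hab one_ne_zero ha hb (by simp) (by simp) (Commute.one_left _)

theorem braiding_commute_map_k {a b : Fin n} (hab : a ≠ b) {f : Fin n → Module.End ℂ X}
    (ha : f a = A.k ^ 2) (hb : f b = A.k ^ 2) :
    Commute (A.braiding n a b) (PiTensorProduct.map f) :=
  braiding_commute_map hab (pow_ne_zero 2 (q_ne_zero r)) ha hb k_sq_mul_E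
    (by rw [eq_inv_smul_iff₀ (pow_ne_zero 2 (q_ne_zero r)), k_sq_mul_F])
    ((Commute.refl _).pow_left 2)

theorem braiding_commute_map_kinv (hr : 0 < r) {a b : Fin n} (hab : a ≠ b)
    {f : Fin n → Module.End ℂ X} (ha : f a = A.kinv ^ 2) (hb : f b = A.kinv ^ 2) :
    Commute (A.braiding n a b) (PiTensorProduct.map f) :=
  braiding_commute_map hab (inv_ne_zero (pow_ne_zero 2 (q_ne_zero r))) ha hb
    (by rw [eq_inv_smul_iff₀ (pow_ne_zero 2 (q_ne_zero r)), kinv_sq_mul_E hr])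
    (by rw [inv_inv, kinv_sq_mul_F hr])
    (Commute.pow_left ((kinv_mul_k hr).trans A.k_mul_kinv.symm) 2)

/-- The summands of the coproduct of `E` at `a` and `b` combine to `Δ(E)` on these factors times a
group-like tail. As `a` and `b` are adjacent, each other summand acts on the pair as `1 ⊗ 1` or `k²
⊗ k²`. -/
theorem braiding_commute_E (hr : 0 < r) {a b : Fin n} (hab : (a : ℕ) + 1 = b) :
    Commute (A.braiding n a b) (A.tensorPower n hr).E := by
  have hne : a ≠ b := fun h => by rw [h] at hab; omega
  have hlt : a < b := by rw [Fin.lt_def]; omega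
  change Commute _ (∑ c, A.termE n c)
  rw [← Finset.add_sum_erase _ _ (Finset.mem_univ a),
    ← Finset.add_sum_erase _ _ (Finset.mem_erase.2 ⟨hne.symm, Finset.mem_univ b⟩), ← add_assoc]
  refine Commute.add_right ?_ (Commute.sum_right _ _ _ fun c hc => ?_)
  · have e : A.termE n a + A.termE n b = (leg b A.E + leg a A.E * leg b A.k ^ 2) *
        PiTensorProduct.map fun c => if b < c then A.k ^ 2 else 1 := by
      rw [add_mul, add_comm, ← map_pow, leg_mul_leg hne, leg_eq_map, ← PiTensorProduct.map_mul,
        ← PiTensorProduct.map_mul]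
      unfold termE
      congr 2
      · ext1 c
        rcases lt_trichotomy c b with h | h | h
        · simp [h, h.ne, not_lt_of_gt h]
        · simp [h]
        · simp [h, h.ne', not_lt_of_gt h]
      · ext1 c
        rcases lt_trichotomy c a with h | h | h
        · simp [h, h.ne, (h.trans hlt).ne, not_lt_of_gt (h.trans hlt)]
        · simp [h, not_lt_of_gt hlt]
        · have h1 : c = b ∨ b < c := by
            rw [Fin.ext_iff, Fin.lt_def]
            rw [Fin.lt_def] at h
            omega
          rcases h1 with h1 | h1
          · simp [h1, hne.symm, not_lt_of_gt hlt]
          · simp [h1, h.ne', not_lt_of_gt h, h1.ne']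
    rw [e]
    refine Commute.mul_right ?_ (braiding_commute_map_one hne (by simp [not_lt_of_gt hlt]) (by simp))
    rw [braiding_eq hne]
    refine SemiconjBy.mul_left ?_ (rOp_semiconj_E hr hne)
    have ha := fun T => permOp_semiconj_leg (X := X) (Equiv.swap a b) a T
    have hb := fun T => permOp_semiconj_leg (X := X) (Equiv.swap a b) b T
    rw [Equiv.swap_apply_left] at ha
    rw [Equiv.swap_apply_right] at hb
    exact (ha _).add_right ((hb _).mul_right ((ha _).pow_right 2))
  · have h1 : c ≠ b := Finset.ne_of_mem_erase hc
    have h2 : c ≠ a := Finset.ne_of_mem_erase (Finset.mem_of_mem_erase hc)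
    have h3 : (a < c ∧ b < c) ∨ (¬ a < c ∧ ¬ b < c) := by
      have h1 := Fin.val_ne_of_ne h1
      have h2 := Fin.val_ne_of_ne h2
      simp only [Fin.lt_def]
      omega
    rcases h3 with ⟨h3, h4⟩ | ⟨h3, h4⟩
    · exact braiding_commute_map_one hne (if_pos h3) (if_pos h4)
    · exact braiding_commute_map_k hne (by simp [h3, h2.symm]) (by simp [h4, h1.symm])

theorem braiding_commute_F (hr : 0 < r) {a b : Fin n} (hab : (a : ℕ) + 1 = b) :
    Commute (A.braiding n a b) (A.tensorPower n hr).F := by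
  have hne : a ≠ b := fun h => by rw [h] at hab; omega
  have hlt : a < b := by rw [Fin.lt_def]; omega
  change Commute _ (∑ c, A.termF n c)
  rw [← Finset.add_sum_erase _ _ (Finset.mem_univ a),
    ← Finset.add_sum_erase _ _ (Finset.mem_erase.2 ⟨hne.symm, Finset.mem_univ b⟩), ← add_assoc]
  refine Commute.add_right ?_ (Commute.sum_right _ _ _ fun c hc => ?_)
  · have e : A.termF n a + A.termF n b = (leg a A.F + leg b A.F * leg a A.kinv ^ 2) *
        PiTensorProduct.map fun c => if c < a then A.kinv ^ 2 else 1 := by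
      rw [add_mul, ← map_pow, leg_mul_leg hne.symm, leg_eq_map, ← PiTensorProduct.map_mul,
        ← PiTensorProduct.map_mul]
      unfold termF
      congr 2
      · ext1 c
        rcases lt_trichotomy c a with h | h | h
        · simp [h, h.ne]
        · simp [h]
        · simp [h.ne', not_lt_of_gt h]
      · ext1 c
        rcases lt_trichotomy c a with h | h | h
        · simp [h, h.trans hlt, h.ne, (h.trans hlt).ne]
        · simp [h, hlt, hne]
        · have h1 : c = b ∨ b < c := by
            rw [Fin.ext_iff, Fin.lt_def]
            rw [Fin.lt_def] at h
            omega
          rcases h1 with h1 | h1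
          · simp [h1, not_lt_of_gt hlt]
          · simp [h.ne', not_lt_of_gt h, h1.ne', not_lt_of_gt h1]
    rw [e]
    refine Commute.mul_right ?_ (braiding_commute_map_one hne (by simp) (by simp [not_lt_of_gt hlt]))
    rw [braiding_eq hne]
    refine SemiconjBy.mul_left ?_ (rOp_semiconj_F hr hne)
    have ha := fun T => permOp_semiconj_leg (X := X) (Equiv.swap a b) a T
    have hb := fun T => permOp_semiconj_leg (X := X) (Equiv.swap a b) b T
    rw [Equiv.swap_apply_left] at ha
    rw [Equiv.swap_apply_right] at hb
    exact (hb _).add_right ((ha _).mul_right ((hb _).pow_right 2))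
  · have h1 : c ≠ b := Finset.ne_of_mem_erase hc
    have h2 : c ≠ a := Finset.ne_of_mem_erase (Finset.mem_of_mem_erase hc)
    have h3 : (a < c ∧ b < c) ∨ (¬ a < c ∧ ¬ b < c) := by
      have h1 := Fin.val_ne_of_ne h1
      have h2 := Fin.val_ne_of_ne h2
      simp only [Fin.lt_def]
      omega
    rcases h3 with ⟨h3, h4⟩ | ⟨h3, h4⟩
    · exact braiding_commute_map_kinv hr hne (if_pos h3) (if_pos h4)
    · exact braiding_commute_map_one hne (by simp [h3, h2.symm]) (by simp [h4, h1.symm])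

end Braiding

end DModule

end RestrictedSl2

end

noncomputable section

namespace RestrictedSl2

/-! ### The representation of the braid group -/

section Gauss

variable {r : ℕ}

theorem sum_gauss (hr : 0 < r) (x : ℤ) : ∑ m ∈ Finset.range (4 * r), (qHalf r ^ x) ^ m =
    if ((4 * r : ℕ) : ℤ) ∣ x then ((4 * r : ℕ) : ℂ) else 0 := by
  have h1 : qHalf r ^ x = 1 ↔ ((4 * r : ℕ) : ℤ) ∣ x := by
    have := qHalf_zpow_eq_iff hr x 0
    rwa [zpow_zero, sub_zero] at this
  split_ifs with h
  · rw [h1.2 h]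
    simp
  · have h2 := geom_sum_mul (qHalf r ^ x) (4 * r)
    rw [← zpow_natCast, ← zpow_mul, mul_comm x, zpow_mul, zpow_natCast, qHalf_pow hr, one_zpow,
      sub_self] at h2
    exact (mul_eq_zero.1 h2).resolve_right fun h3 => h (h1.1 (sub_eq_zero.1 h3))

/-- The inner sum vanishes except for the single `m` congruent to `y` modulo `4r`; the whole is `4r`
times a root of unity. -/
theorem gauss_ne_zero (hr : 0 < r) (x y : ℤ) :
    ∑ m ∈ Finset.range (4 * r), ∑ m' ∈ Finset.range (4 * r),
      qHalf r ^ (-((m : ℤ) * m')) * ((qHalf r ^ x) ^ m * (qHalf r ^ y) ^ m') ≠ 0 := by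
  have hs := qHalf_ne_zero r
  have h1 : ∀ m : ℕ, ∑ m' ∈ Finset.range (4 * r),
      qHalf r ^ (-((m : ℤ) * m')) * ((qHalf r ^ x) ^ m * (qHalf r ^ y) ^ m') =
      (qHalf r ^ x) ^ m * if ((4 * r : ℕ) : ℤ) ∣ y - m then ((4 * r : ℕ) : ℂ) else 0 := by
    intro m
    rw [← sum_gauss hr, Finset.mul_sum]
    refine Finset.sum_congr rfl fun m' _ => ?_
    rw [mul_left_comm]
    congr 1
    rw [← zpow_natCast, ← zpow_natCast, ← zpow_mul, ← zpow_mul, ← zpow_add₀ hs]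
    congr 1
    ring
  have hN : (0 : ℤ) < (4 * r : ℕ) := by exact_mod_cast (by omega : 0 < 4 * r)
  have h2 := Int.emod_nonneg y hN.ne'
  have h3 := Int.emod_lt_of_pos y hN
  rw [Finset.sum_congr rfl fun m _ => h1 m, Finset.sum_eq_single (y % (4 * r : ℕ)).toNat]
  · rw [if_pos (by rw [Int.toNat_of_nonneg h2]; exact Int.dvd_self_sub_emod)]
    exact mul_ne_zero (pow_ne_zero _ (zpow_ne_zero _ hs)) (by exact_mod_cast hN.ne')
  · intro m hm hne
    have hm' := Finset.mem_range.1 hm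
    rw [if_neg, mul_zero]
    intro hd
    apply hne
    have h4 : y % (4 * r : ℕ) = m := by
      rw [Int.emod_eq_emod_iff_emod_sub_eq_zero.2 (Int.emod_eq_zero_of_dvd hd)]
      exact Int.emod_eq_of_lt (by omega) (by exact_mod_cast hm')
    omega
  · intro h
    exact absurd (Finset.mem_range.2 (by omega)) h

theorem cartan_apply {M : Type*} [AddCommGroup M] [Module ℂ M] {S T : Module.End ℂ M} {x y : ℤ}
    {v : M} (hS : S v = qHalf r ^ x • v) (hT : T v = qHalf r ^ y • v) :
    cartan r S T v = ((1 / (4 * r : ℂ)) *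
      ∑ m ∈ Finset.range (4 * r), ∑ m' ∈ Finset.range (4 * r),
      qHalf r ^ (-((m : ℤ) * m')) * ((qHalf r ^ x) ^ m * (qHalf r ^ y) ^ m')) • v := by
  have hpow : ∀ {S : Module.End ℂ M} {c : ℂ}, S v = c • v → ∀ m, (S ^ m) v = c ^ m • v := by
    intro S c h m
    induction m with
    | zero => simp
    | succ m ih => rw [pow_succ, Module.End.mul_apply, h, map_smul, ih, smul_smul, pow_succ']
  rw [cartan, LinearMap.smul_apply, mul_smul]
  congr 1
  simp only [LinearMap.sum_apply, LinearMap.smul_apply, Module.End.mul_apply, hpow hT, map_smul,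
    hpow hS, smul_smul, Finset.sum_smul]
  refine Finset.sum_congr rfl fun m _ => Finset.sum_congr rfl fun m' _ => ?_
  congr 1
  ring

theorem isUnit_cartan (hr : 0 < r) {M ι : Type*} [AddCommGroup M] [Module ℂ M]
    (b : Module.Basis ι ℂ M) {S T : Module.End ℂ M} {x y : ι → ℤ}
    (hS : ∀ ε, S (b ε) = qHalf r ^ x ε • b ε) (hT : ∀ ε, T (b ε) = qHalf r ^ y ε • b ε) :
    IsUnit (cartan r S T) := by
  have h4 : (1 / (4 * r : ℂ)) ≠ 0 :=
    one_div_ne_zero (mul_ne_zero (by norm_num) (Nat.cast_ne_zero.2 hr.ne'))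
  have h1 : ∀ ε, ∃ c : ℂ, c ≠ 0 ∧ cartan r S T (b ε) = c • b ε := fun ε =>
    ⟨_, mul_ne_zero h4 (gauss_ne_zero hr (x ε) (y ε)), cartan_apply (hS ε) (hT ε)⟩
  choose c hc0 hc using h1
  let D : Module.End ℂ M := b.constr ℂ fun ε => (c ε)⁻¹ • b ε
  have hD : ∀ ε, D (b ε) = (c ε)⁻¹ • b ε := fun ε => b.constr_basis ℂ _ ε
  refine ⟨⟨cartan r S T, D, ?_, ?_⟩, rfl⟩
  · refine b.ext fun ε => ?_
    rw [Module.End.mul_apply, hD, map_smul, hc, smul_smul, inv_mul_cancel₀ (hc0 ε), one_smul,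
      Module.End.one_apply]
  · refine b.ext fun ε => ?_
    rw [Module.End.mul_apply, hc, map_smul, hD, smul_smul, mul_inv_cancel₀ (hc0 ε), one_smul,
      Module.End.one_apply]

variable {X : Type*} [AddCommGroup X] [Module ℂ X] {A : DModule r X} {n : ℕ}

theorem DModule.isUnit_smul_braiding (hr : 0 < r) {a b : Fin n} (hab : a ≠ b) {ι : Type*}
    (B : Module.Basis ι ℂ (⨂[ℂ] _ : Fin n, X)) {x y : ι → ℤ}
    (ha : ∀ ε, leg a A.k (B ε) = qHalf r ^ x ε • B ε)
    (hb : ∀ ε, leg b A.k (B ε) = qHalf r ^ y ε • B ε) {c : ℂ} (hc : c ≠ 0) :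
    IsUnit (c • A.braiding n a b) := by
  rw [braiding_eq hab, Algebra.smul_def]
  refine ((IsUnit.mk0 _ hc).map _).mul ((isUnit_permOp _).mul ((isUnit_cartan hr B ha hb).mul
    (isUnit_theta hr (leg_commute hab _ _) ?_)))
  rw [← map_pow, A.E_pow, map_zero]

theorem DModule.commute_smul_braiding {a b : Fin n} (hab : a ≠ b)
    {T : Module.End ℂ (⨂[ℂ] _ : Fin n, X)} (hT : ∀ σ, Commute T (permOp σ))
    (ha : Commute T (leg a A.k)) (hb : Commute T (leg b A.k))
    (hEF : Commute T (leg a A.E * leg b A.F)) (c : ℂ) :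
    Commute (c • A.braiding n a b) T := by
  rw [braiding_eq hab]
  exact ((hT _).mul_right ((cartan_commute ha hb).mul_right
    (theta_commute_of_mul (leg_commute hab _ _) hEF))).symm.smul_left c

end Gauss

section BraidRep

variable {r n : ℕ} {hr : 0 < r}

theorem leg_k_basis (a : Fin n) (ε : Fin n → Fin (r - 1 + 1)) :
    leg a (steinberg r hr).k (powBasis r n ε) =
      qHalf r ^ (((r - 1 : ℕ) : ℤ) - 2 * (ε a : ℕ)) • powBasis r n ε := by
  rw [leg_eq_map, powBasis_apply, PiTensorProduct.map_tprod]
  have h : ∀ b, (if b = a then (steinberg r hr).k else 1) (Finsupp.single (ε b) (1 : ℂ)) =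
      (if b = a then qHalf r ^ (((r - 1 : ℕ) : ℤ) - 2 * (ε a : ℕ)) else 1) •
        Finsupp.single (ε b) (1 : ℂ) := by
    intro b
    by_cases hb : b = a
    · rw [if_pos hb, if_pos hb, hb, steinberg_k_single]
    · rw [if_neg hb, if_neg hb, one_smul, Module.End.one_apply]
  simp only [h]
  rw [MultilinearMap.map_smul_univ]
  simp

theorem braidOp_index_ne {N a : ℕ} (h : a < N) (h' : a + 1 < N) :
    (⟨a, h⟩ : Fin N) ≠ ⟨a + 1, h'⟩ := by
  simp

theorem isUnit_braidOp (a : Fin (n - 1)) : IsUnit (braidOp r hr n a) := by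
  rw [braidOp]
  exact DModule.isUnit_smul_braiding hr (braidOp_index_ne _ _) (powBasis r n) (leg_k_basis _) (leg_k_basis _)
    (zpow_ne_zero _ (qHalf_ne_zero r))

variable (r hr n) in
/-- The homomorphism from the braid group to the units of the algebra of operators. -/
def braidHom : BraidGroup n →* (Module.End ℂ (VPow r n))ˣ :=
  PresentedGroup.toGroup (f := fun a => (isUnit_braidOp (hr := hr) a).unit) (by
    rintro _ (⟨a, b, hab, rfl⟩ | ⟨a, b, hab, rfl⟩)
    · simp only [map_mul, map_inv, FreeGroup.lift_apply_of, mul_inv_eq_one]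
      refine Units.ext ?_
      simp only [Units.val_mul, IsUnit.unit_spec, braidOp, smul_mul_smul_comm]
      congr 1
      have hb : (⟨(a : ℕ) + 1, by omega⟩ : Fin n) = ⟨b, by omega⟩ := Fin.ext hab
      rw [hb]
      exact DModule.braiding_braid hr (by rw [Ne, Fin.mk.injEq]; omega)
        (by rw [Ne, Fin.mk.injEq]; omega) (by rw [Ne, Fin.mk.injEq]; omega)
    · simp only [map_mul, map_inv, FreeGroup.lift_apply_of, mul_inv_eq_one]
      refine Units.ext ?_
      simp only [Units.val_mul, IsUnit.unit_spec, braidOp, smul_mul_smul_comm]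
      congr 1
      exact DModule.braiding_commute (by simp) (by simp) (by rw [Ne, Fin.mk.injEq]; omega)
        (by rw [Ne, Fin.mk.injEq]; omega) (by rw [Ne, Fin.mk.injEq]; omega)
        (by rw [Ne, Fin.mk.injEq]; omega))

variable (r hr n) in
/-- The action of the braid group on `V_{r-1}^{⊗ n}`. -/
def braidRep : Representation ℂ (BraidGroup n) (VPow r n) :=
  (Units.coeHom _).comp (braidHom r n hr)

theorem braidRep_of (a : Fin (n - 1)) : braidRep r n hr (PresentedGroup.of a) = braidOp r hr n a := by
  change ((braidHom r n hr (PresentedGroup.of a) : (Module.End ℂ (VPow r n))ˣ) :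
    Module.End ℂ (VPow r n)) = _
  rw [braidHom, PresentedGroup.toGroup.of]
  rfl

theorem braidRep_commute {T : Module.End ℂ (VPow r n)} (h : ∀ a, Commute (braidOp r hr n a) T)
    (g : BraidGroup n) : Commute (braidRep r n hr g) T := by
  let H : Subgroup (BraidGroup n) :=
    { carrier := {g | Commute (braidRep r n hr g) T}
      one_mem' := by
        change Commute (braidRep r n hr 1) T
        rw [map_one]
        exact Commute.one_left T
      mul_mem' := by
        intro g g' h h'
        change Commute (braidRep r n hr (g * g')) T
        rw [map_mul]
        exact Commute.mul_left h h'
      inv_mem' := by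
        intro g h
        have h' : Commute ((braidHom r n hr g : (Module.End ℂ (VPow r n))ˣ) :
          Module.End ℂ (VPow r n)) T := h
        change Commute ((braidHom r n hr g⁻¹ : (Module.End ℂ (VPow r n))ˣ) :
          Module.End ℂ (VPow r n)) T
        rw [map_inv]
        exact h'.units_inv_left }
  exact PresentedGroup.generated_by _ H (fun a => by
    change Commute (braidRep r n hr (PresentedGroup.of a)) T
    rw [braidRep_of]
    exact h a) g

theorem braidRep_commute_E (g : BraidGroup n) :
    Commute (braidRep r n hr g) (steinbergPow r hr n).E :=
  braidRep_commute (fun a => by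
    exact (DModule.braiding_commute_E hr (by rfl)).smul_left _) g

theorem braidRep_commute_F (g : BraidGroup n) :
    Commute (braidRep r n hr g) (steinbergPow r hr n).F :=
  braidRep_commute (fun a => by
    rw [braidOp]
    exact (DModule.braiding_commute_F hr (by rfl)).smul_left _) g

theorem degOp_commute {T : Module.End ℂ (VPow r n)}
    (h : ∀ c, ∀ x ∈ degSpace r n c, T x ∈ degSpace r n c) : Commute (degOp r n) T := by
  refine (powBasis r n).ext fun ε => ?_
  rw [Module.End.mul_apply, Module.End.mul_apply, degOp_basis, map_smul,
    degOp_apply (h _ _ (powBasis_mem ε))]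

theorem degOp_commute_permOp (σ : Equiv.Perm (Fin n)) : Commute (degOp r n) (permOp σ) := by
  refine (powBasis r n).ext fun ε => ?_
  have h : permOp σ (powBasis r n ε) = powBasis r n fun a => ε (σ.symm a) := by
    rw [powBasis_apply, permOp_tprod, powBasis_apply]
  rw [Module.End.mul_apply, Module.End.mul_apply, degOp_basis, map_smul, h, degOp_basis]
  congr 2
  exact Equiv.sum_comp σ.symm fun a => (ε a : ℕ)

theorem degOp_commute_leg_k (a : Fin n) : Commute (degOp r n) (leg a (steinberg r hr).k) :=
  degOp_commute fun d x hx => by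
    have := leg_mem_degSpace a (HasShift.diag _ : HasShift (steinberg r hr).k 0) hx
    rwa [add_zero] at this

theorem degOp_commute_leg_E_mul_leg_F (a b : Fin n) :
    Commute (degOp r n) (leg a (steinberg r hr).E * leg b (steinberg r hr).F) :=
  degOp_commute fun d x hx => by
    have := leg_mem_degSpace a (hasShift_E (hr := hr))
      (leg_mem_degSpace b (hasShift_F (hr := hr)) hx)
    rw [add_neg_cancel_right] at this
    exact this

theorem braidRep_commute_degOp (g : BraidGroup n) : Commute (braidRep r n hr g) (degOp r n) :=
  braidRep_commute (fun a => by
    rw [braidOp]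
    exact DModule.commute_smul_braiding (braidOp_index_ne _ _) degOp_commute_permOp
      (degOp_commute_leg_k _) (degOp_commute_leg_k _) (degOp_commute_leg_E_mul_leg_F _ _) _) g

theorem mem_weightSpace_iff {l : ℕ} {x : VPow r n} :
    x ∈ weightSpace r n l ↔ degOp r n x = (l : ℂ) • x := by
  rw [weightSpace_eq_degSpace]
  refine ⟨degOp_apply, fun h => ?_⟩
  have h1 : x ∈ Module.End.eigenspace (M := VPow r n) (degOp r n) l :=
    Module.End.mem_eigenspace_iff.2 h
  rwa [eigenspace_degOp] at h1

theorem mem_highestWeightSpace_iff {l : ℕ} {x : VPow r n} :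
    x ∈ highestWeightSpace r hr n l ↔
      (steinbergPow r hr n).E x = 0 ∧ degOp r n x = (l : ℂ) • x :=
  and_congr Iff.rfl mem_weightSpace_iff

variable (r hr n) in
/-- The highest weight spaces as representations of the braid group. -/
def highestWeightRep (l : ℕ) : Subrepresentation (braidRep r n hr) where
  toSubmodule := highestWeightSpace r hr n l
  apply_mem_toSubmodule g v hv := by
    rw [mem_highestWeightSpace_iff] at hv ⊢
    have h1 := LinearMap.congr_fun (braidRep_commute_E (hr := hr) g).eq v
    have h2 := LinearMap.congr_fun (braidRep_commute_degOp (hr := hr) g).eq v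
    rw [Module.End.mul_apply, Module.End.mul_apply] at h1 h2
    rw [← h1, ← h2, hv.1, hv.2, map_zero, map_smul]
    exact ⟨rfl, rfl⟩

end BraidRep

end RestrictedSl2

end

noncomputable section

namespace RestrictedSl2

/-! ### Highest weight vectors in the summands of a decomposition -/

section Kernel

variable {X Y : Type*} [AddCommGroup X] [Module ℂ X] [AddCommGroup Y] [Module ℂ Y]

/-- The kernel of a graded linear map is graded. -/
theorem ker_inf_iSup_le {ι κ : Type*} {N : ι → Submodule ℂ X} {N' : κ → Submodule ℂ Y}
    (hN' : iSupIndep N') {τ : ι → κ} (hτ : Function.Injective τ) (T : X →ₗ[ℂ] Y)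
    (hT : ∀ i, ∀ x ∈ N i, T x ∈ N' (τ i)) :
    LinearMap.ker T ⊓ ⨆ i, N i ≤ ⨆ i, N i ⊓ LinearMap.ker T := by
  rintro x ⟨hx0, hx⟩
  obtain ⟨f, hf, rfl⟩ := (Submodule.mem_iSup_iff_exists_finsupp N x).1 hx
  rw [SetLike.mem_coe, LinearMap.mem_ker, Finsupp.sum, map_sum] at hx0
  have h := (iSupIndep_iff_finsetSum_eq_zero_imp_eq_zero _).1 (hN'.comp hτ) f.support
    (fun i => T (f i)) (fun i _ => hT i _ (hf i)) hx0
  exact Submodule.sum_mem _ fun i hi => Submodule.mem_iSup_of_mem i ⟨hf i, h i hi⟩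

theorem disjoint_biSup_biSup {ι : Type*} [Finite ι] {N : ι → Submodule ℂ X} (hN : iSupIndep N)
    {s t : Set ι} (hst : Disjoint s t) : Disjoint (⨆ i ∈ s, N i) (⨆ i ∈ t, N i) :=
  hN.disjoint_biSup_biSup' hst s.toFinite

theorem eq_of_le_of_finrank_eq [FiniteDimensional ℂ X] {S T : Submodule ℂ X} (h : S ≤ T)
    (h' : Module.finrank ℂ S = Module.finrank ℂ T) : S = T :=
  Submodule.eq_of_le_of_finrank_eq h h'

end Kernel

section Embeddings

variable {r : ℕ} {X : Type*} [AddCommGroup X] [Module ℂ X] {A : DModule r X} {α : ℂ}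
  {hα : α ^ 4 = 1}

theorem u_zero_ne_zero (i : ℕ) : u i 0 ≠ 0 := by
  rw [u, dif_pos (Nat.succ_pos i)]
  simp

theorem wS_zero_ne_zero (i j : ℕ) : wS i j 0 ≠ 0 := by
  rw [wS, dif_pos (Nat.succ_pos i)]
  simp

theorem wR_zero_ne_zero (i j : ℕ) : wR i j 0 ≠ 0 := by
  rw [wR, dif_pos (Nat.succ_pos j)]
  simp

theorem k_map_u_zero {i : ℕ} {hi : i < r} (f : DEmbedding (simpleModule r α hα i hi) A) :
    A.k (f.toLin (u i 0)) = (α * qHalf r ^ (i : ℤ)) • f.toLin (u i 0) := by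
  rw [← f.map_k, ← map_smul]
  congr 1
  change diag _ _ = _
  rw [u, dif_pos (Nat.succ_pos i), diag_single]
  simp

variable {i j : ℕ} {h : i + j + 2 = r}

theorem k_map_wS_zero (f : DEmbedding (projModule r α hα i j h) A) :
    A.k (f.toLin (wS i j 0)) = (α * qHalf r ^ (i : ℤ)) • f.toLin (wS i j 0) := by
  rw [← f.map_k, ← map_smul]
  congr 1
  change diag _ _ = _
  rw [wS, dif_pos (Nat.succ_pos i), diag_single]
  simp [projWeight]

theorem k_map_wR_zero (f : DEmbedding (projModule r α hα i j h) A) :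
    A.k (f.toLin (wR i j 0)) = (α * qHalf r ^ ((j : ℤ) + r)) • f.toLin (wR i j 0) := by
  rw [← f.map_k, ← map_smul]
  congr 1
  change diag _ _ = _
  rw [wR, dif_pos (Nat.succ_pos j), diag_single]
  simp [projWeight]

theorem E_map_u_zero {i : ℕ} {hi : i < r} (f : DEmbedding (simpleModule r α hα i hi) A) :
    A.E (f.toLin (u i 0)) = 0 := by
  rw [← f.map_E]
  change f.toLin (simpleE i (u i 0)) = 0
  rw [simpleE_u (Nat.zero_le i), if_pos rfl, map_zero]

theorem E_map_wS_zero (f : DEmbedding (projModule r α hα i j h) A) :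
    A.E (f.toLin (wS i j 0)) = 0 := by
  rw [← f.map_E]
  change f.toLin (projE r i j (wS i j 0)) = 0
  rw [projE_wS (Nat.zero_le i), if_pos rfl, map_zero]

theorem E_map_wR_zero (f : DEmbedding (projModule r α hα i j h) A) :
    A.E (f.toLin (wR i j 0)) = 0 := by
  rw [← f.map_E]
  change f.toLin (projE r i j (wR i j 0)) = 0
  rw [projE_wR (Nat.zero_le j), if_pos rfl, map_zero]

/-- `F^{j+1} w^R_0` is a non-zero multiple of `w^S_0`. -/
theorem exists_F_pow_map_wR_zero (f : DEmbedding (projModule r α hα i j h) A) :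
    ∃ c : ℂ, c ≠ 0 ∧ (A.F ^ (j + 1)) (f.toLin (wR i j 0)) = c • f.toLin (wS i j 0) := by
  have hα2 : α ^ 2 ≠ 0 := pow_ne_zero _ (alpha_ne_zero hα)
  have hF : ∀ y, A.F (f.toLin y) = α ^ 2 • f.toLin (projF r i j y) := fun y => by
    rw [← f.map_F, ← map_smul]
    rfl
  have key : ∀ m ≤ j, ∃ c : ℂ, c ≠ 0 ∧
      (A.F ^ m) (f.toLin (wR i j 0)) = c • f.toLin (wR i j m) := by
    intro m
    induction m with
    | zero => exact fun _ => ⟨1, one_ne_zero, by simp⟩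
    | succ m ih =>
      intro hm
      obtain ⟨c, hc, h1⟩ := ih (by omega)
      refine ⟨c * (α ^ 2 * -gam r j (m + 1)), mul_ne_zero hc (mul_ne_zero hα2 (neg_ne_zero.2
        (gam_ne_zero (by omega) (by omega) hm))), ?_⟩
      rw [DModule.pow_succ_apply, h1, map_smul, hF, projF_wR (by omega), if_neg (by omega), map_smul,
        smul_smul, smul_smul, mul_assoc]
  obtain ⟨c, hc, h1⟩ := key j le_rfl
  refine ⟨c * α ^ 2, mul_ne_zero hc hα2, ?_⟩
  rw [DModule.pow_succ_apply, h1, map_smul, hF, projF_wR le_rfl, if_pos rfl, smul_smul]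

theorem eq_smul_map_u_zero {i : ℕ} {hi : i < r} (f : DEmbedding (simpleModule r α hα i hi) A)
    {x : X} (hx : x ∈ LinearMap.range f.toLin) (hE : A.E x = 0) :
    ∃ a : ℂ, x = a • f.toLin (u i 0) := by
  obtain ⟨y, rfl⟩ := hx
  rw [← f.map_E] at hE
  obtain ⟨a, rfl⟩ := simpleE_eq_zero (f.injective (hE.trans (map_zero _).symm))
  exact ⟨a, map_smul _ _ _⟩

/-- The exponents differ by `j + r - i = 2(j + 1)`, which is not divisible by `4r`. -/
theorem weight_ne (hα : α ^ 4 = 1) (hr : 0 < r) (h : i + j + 2 = r) :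
    α * qHalf r ^ (i : ℤ) ≠ α * qHalf r ^ ((j : ℤ) + r) := by
  intro h1
  have h2 := (qHalf_zpow_eq_iff hr _ _).1 (mul_left_cancel₀ (alpha_ne_zero hα) h1)
  have h3 := Int.le_of_dvd (by omega) ((dvd_sub_comm).1 h2)
  push_cast at h3
  omega

/-- A highest weight vector of `P^α_i` that is an eigenvector of `k` is a multiple of `w^S_0` or
of `w^R_0`. -/
theorem eq_smul_map_wS_zero_or (hr : 0 < r) (f : DEmbedding (projModule r α hα i j h) A)
    {x : X} (hx : x ∈ LinearMap.range f.toLin) (hE : A.E x = 0) {c : ℂ} (hk : A.k x = c • x) :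
    (∃ a : ℂ, x = a • f.toLin (wS i j 0)) ∨ ∃ a : ℂ, x = a • f.toLin (wR i j 0) := by
  obtain ⟨y, rfl⟩ := hx
  rw [← f.map_E] at hE
  obtain ⟨a, b, rfl⟩ := projE_eq_zero h (f.injective (hE.trans (map_zero _).symm))
  by_cases ha : a = 0
  · exact Or.inr ⟨b, by rw [ha, zero_smul, zero_add, map_smul]⟩
  by_cases hb : b = 0
  · exact Or.inl ⟨a, by rw [hb, zero_smul, add_zero, map_smul]⟩
  exfalso
  rw [map_add, map_smul, map_smul, map_add, map_smul, map_smul, k_map_wS_zero, k_map_wR_zero,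
    ← map_smul, ← map_smul, ← map_smul, ← map_smul, ← map_add, ← map_smul, ← map_smul, ← map_add,
    ← map_smul] at hk
  have hk' := f.injective hk
  have h1 := DFunLike.congr_fun hk' (.S ⟨0, Nat.succ_pos i⟩)
  have h2 := DFunLike.congr_fun hk' (.R ⟨0, Nat.succ_pos j⟩)
  simp [wS_apply_S, wR_apply_R] at h1 h2
  rw [← zpow_natCast, mul_comm a] at h1
  rw [mul_comm b] at h2
  exact weight_ne hα hr h ((mul_right_cancel₀ ha h1).trans (mul_right_cancel₀ hb h2).symm)

end Embeddings

section Weights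

variable {r n : ℕ} {hr : 0 < r} {l j : ℕ}

/-- Fourth powers remove `α` and give `w ≡ n(r - 1) - 2l` modulo `r`; the right side is `-(j + 2)`
by the congruence for `j`. -/
theorem dvd_of_k_apply (hj : (j : ℤ) ≡ (n : ℤ) + 2 * ((l : ℤ) - 1) [ZMOD r]) {x : VPow r n}
    (hx : x ∈ weightSpace r n l) (hx0 : x ≠ 0) {α : ℂ} (hα : α ^ 4 = 1) {w : ℤ}
    (hk : (steinbergPow r hr n).k x = (α * qHalf r ^ w) • x) : (r : ℤ) ∣ w + j + 2 := by
  rw [k_weightSpace hx] at hk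
  have h1 := congrArg (· ^ 4) (smul_left_injective ℂ hx0 hk)
  simp only [mul_pow, hα, one_mul] at h1
  rw [← zpow_natCast, ← zpow_natCast, ← zpow_mul, ← zpow_mul, qHalf_zpow_eq_iff hr] at h1
  obtain ⟨a, ha⟩ := h1
  obtain ⟨b, hb⟩ := hj.dvd
  push_cast at ha
  refine ⟨n - a - b, ?_⟩
  refine mul_left_cancel₀ (four_ne_zero (α := ℤ)) ?_
  linear_combination -ha - 4 * hb


end Weights

namespace Decomposition

variable {r n : ℕ} {hr : 0 < r} (𝒟 : Decomposition r hr n) {l j : ℕ}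

theorem indep : iSupIndep 𝒟.summand := 𝒟.isInternal.submodule_iSupIndep

theorem iSup_summand : ⨆ s, 𝒟.summand s = ⊤ := 𝒟.isInternal.submodule_iSup_eq_top

variable {𝒟}

theorem E_mem {s : Fin 𝒟.card} {x : VPow r n} (hx : x ∈ 𝒟.summand s) :
    (steinbergPow r hr n).E x ∈ 𝒟.summand s := by
  obtain ⟨α, hα, f, hf⟩ | ⟨α, hα, i, j, h, f, hf⟩ := 𝒟.type s <;>
  · rw [← hf] at hx ⊢
    obtain ⟨y, rfl⟩ := hx
    rw [← f.map_E]
    exact ⟨_, rfl⟩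

theorem F_mem {s : Fin 𝒟.card} {x : VPow r n} (hx : x ∈ 𝒟.summand s) :
    (steinbergPow r hr n).F x ∈ 𝒟.summand s := by
  obtain ⟨α, hα, f, hf⟩ | ⟨α, hα, i, j, h, f, hf⟩ := 𝒟.type s <;>
  · rw [← hf] at hx ⊢
    obtain ⟨y, rfl⟩ := hx
    rw [← f.map_F]
    exact ⟨_, rfl⟩

theorem F_pow_mem {s : Fin 𝒟.card} {x : VPow r n} (hx : x ∈ 𝒟.summand s) (m : ℕ) :
    ((steinbergPow r hr n).F ^ m) x ∈ 𝒟.summand s := by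
  induction m with
  | zero => exact hx
  | succ m ih =>
    rw [pow_succ', Module.End.mul_apply]
    exact F_mem ih

variable (𝒟) in
theorem weightSpace_le (l : ℕ) : weightSpace r n l ≤ ⨆ s, 𝒟.summand s ⊓ weightSpace r n l := by
  intro x hx
  have htop : ⨆ l, ⨆ s, 𝒟.summand s ⊓ weightSpace r n l = ⊤ := by
    rw [iSup_comm, ← 𝒟.iSup_summand]
    exact iSup_congr fun s => (𝒟.homogeneous s).symm
  obtain ⟨y, hy, hyx⟩ := exists_mem_of_apply_mem (X := VPow r n) (Y := VPow r n)
    (N := fun l => ⨆ s, 𝒟.summand s ⊓ weightSpace r n l) (τ := fun l => l) (T := LinearMap.id)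
    (iSupIndep_weightSpace (r := r) (n := n)) Function.injective_id
    (fun l x hx => (iSup_le fun s => inf_le_right :
      (⨆ s, 𝒟.summand s ⊓ weightSpace r n l) ≤ weightSpace r n l) hx) (w := x)
    (by rw [htop]; trivial) l hx
  have hyx : y = x := hyx
  exact hyx ▸ hy

variable (𝒟) in
-- The components of a homogeneous vector in the summands are homogeneous of the same degree, and
-- `E` respects the summands; so each component is itself a highest weight vector.
theorem highestWeightSpace_le (l : ℕ) :
    highestWeightSpace r hr n l ≤ ⨆ s, 𝒟.summand s ⊓ highestWeightSpace r hr n l := by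
  have h1 := ker_inf_iSup_le (X := VPow r n) (Y := VPow r n)
    (N := fun s => 𝒟.summand s ⊓ weightSpace r n l) (N' := 𝒟.summand) (τ := fun s => s) 𝒟.indep
    Function.injective_id (steinbergPow r hr n).E fun s x hx =>
      E_mem (Submodule.mem_inf.1 hx).1
  refine (inf_le_inf_left _ (𝒟.weightSpace_le l)).trans (h1.trans (iSup_mono fun s => ?_))
  rw [inf_assoc, inf_comm (weightSpace r n l)]
  exact le_rfl

variable (hj : (j : ℤ) ≡ (n : ℤ) + 2 * ((l : ℤ) - 1) [ZMOD r]) (hj' : j < r)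
include hj hj'

/-- A highest weight vector of strong weight `n (r - 1) - 2 l` in one of the summands is, up to a
scalar, one of the generators of `C`, of `S` or of `R`. -/
theorem eq_smul_of_mem {s : Fin 𝒟.card} {x : VPow r n} (hs : x ∈ 𝒟.summand s)
    (hx : x ∈ highestWeightSpace r hr n l) (hx0 : x ≠ 0) :
    (j + 1 = r ∧ x ∈ 𝒟.C l) ∨
    (∃ (α : ℂ) (hα : α ^ 4 = 1) (i : ℕ) (h : i + j + 2 = r)
      (f : DEmbedding (projModule r α hα i j h) (steinbergPow r hr n)),
      LinearMap.range f.toLin = 𝒟.summand s ∧ f.toLin (wS i j 0) ∈ weightSpace r n l ∧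
      ∃ a : ℂ, x = a • f.toLin (wS i j 0)) ∨
    (∃ (α : ℂ) (hα : α ^ 4 = 1) (i : ℕ) (h : j + i + 2 = r)
      (f : DEmbedding (projModule r α hα j i h) (steinbergPow r hr n)),
      LinearMap.range f.toLin = 𝒟.summand s ∧ f.toLin (wR j i 0) ∈ weightSpace r n l ∧
      ∃ a : ℂ, x = a • f.toLin (wR j i 0)) := by
  have hmem : ∀ {a : ℂ} {y : VPow r n}, x = a • y → y ∈ weightSpace r n l := by
    intro a y hxy
    have ha : a ≠ 0 := by
      rintro rfl
      exact hx0 (by rw [hxy, zero_smul])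
    have h1 := hx.2
    rw [hxy] at h1
    exact (Submodule.smul_mem_iff _ ha).1 h1
  obtain ⟨α, hα, f, hf⟩ | ⟨α, hα, i, i', h, f, hf⟩ := 𝒟.type s
  · obtain ⟨a, ha⟩ := eq_smul_map_u_zero f (hf ▸ hs) hx.1
    have h1 := dvd_of_k_apply hj (hmem ha) (by
      rw [Ne, map_eq_zero_iff _ f.injective]
      exact u_zero_ne_zero _) hα (k_map_u_zero f)
    refine Or.inl ⟨?_, ?_⟩
    · have h2 : (r : ℤ) ∣ j + 1 := by
        have := dvd_sub h1 (dvd_refl (r : ℤ))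
        have e : ((r - 1 : ℕ) : ℤ) + j + 2 - r = j + 1 := by omega
        rwa [e] at this
      have := Int.le_of_dvd (by omega) h2
      omega
    · rw [ha]
      exact Submodule.smul_mem _ _ (Submodule.subset_span ⟨hmem ha, s, α, hα, f, hf, rfl⟩)
  · refine Or.inr ?_
    -- A multiple of `r` strictly between `0` and `2r` is `r`.
    have key : ∀ i : ℕ, i + 2 ≤ r → (r : ℤ) ∣ i + j + 2 → i + j + 2 = r := by
      intro i hi h1
      obtain ⟨b, hb⟩ := h1
      have hb1 : b < 2 := by
        by_contra hb2
        have := mul_le_mul_of_nonneg_left (not_lt.1 hb2) (Int.natCast_nonneg r)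
        omega
      have hb0 : 0 < b := by
        by_contra hb2
        have := mul_le_mul_of_nonneg_left (not_lt.1 hb2) (Int.natCast_nonneg r)
        omega
      obtain rfl : b = 1 := by omega
      omega
    obtain ⟨a, ha⟩ | ⟨a, ha⟩ := eq_smul_map_wS_zero_or hr f (hf ▸ hs) hx.1 (k_weightSpace hx.2)
    · have h1 := key i (by omega) (dvd_of_k_apply hj (hmem ha) (by
        rw [Ne, map_eq_zero_iff _ f.injective]
        exact wS_zero_ne_zero _ _) hα (k_map_wS_zero f))
      obtain rfl : i' = j := by omega
      exact Or.inl ⟨α, hα, i, h, f, hf, hmem ha, a, ha⟩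
    · have h1 := dvd_of_k_apply hj (hmem ha) (by
        rw [Ne, map_eq_zero_iff _ f.injective]
        exact wR_zero_ne_zero _ _) hα (k_map_wR_zero f)
      have h2 := key i' (by omega) (by
        have := dvd_sub h1 (dvd_refl (r : ℤ))
        have e : (i' : ℤ) + r + j + 2 - r = i' + j + 2 := by omega
        rwa [e] at this)
      obtain rfl : i = j := by omega
      exact Or.inr ⟨α, hα, i', h, f, hf, hmem ha, a, ha⟩

end Decomposition

end RestrictedSl2

end

noncomputable section

namespace RestrictedSl2

/-! ### The highest weight spaces -/

section Degrees

variable {r n : ℕ} {hr : 0 < r} {l j : ℕ}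

theorem F_pow_mem_degSpace (m : ℕ) {c : ℂ} {x : VPow r n} (hx : x ∈ degSpace r n c) :
    ((steinbergPow r hr n).F ^ m) x ∈ degSpace r n (c + m) := by
  have := pow_mem_degSpace (T := (steinbergPow r hr n).F) (d := 1)
    (fun c x hx => F_mem_degSpace hx) m hx
  rwa [mul_one] at this

theorem ker_E_le : LinearMap.ker (steinbergPow r hr n).E ≤
    ⨆ c, degSpace r n c ⊓ LinearMap.ker (steinbergPow r hr n).E := by
  have := ker_inf_iSup_le (X := VPow r n) (Y := VPow r n) (N := degSpace r n) (N' := degSpace r n)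
    (τ := fun c => c + -1) iSupIndep_degSpace (add_left_injective _) (steinbergPow r hr n).E
    fun c x hx => E_mem_degSpace hx
  rwa [iSup_degSpace, inf_top_eq] at this

variable {α : ℂ} {hα : α ^ 4 = 1} {i : ℕ} {h : i + j + 2 = r}
  (f : DEmbedding (projModule r α hα i j h) (steinbergPow r hr n))

/-- The embedding is arbitrary, so the image of `w^R_0` need not have a strong weight. Its component
of degree `l - (j + 1)` is still in `ker E` and has the required image under `F^{j+1}`. -/
theorem exists_F_pow_eq_map_wS_zero (hf : f.toLin (wS i j 0) ∈ weightSpace r n l) :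
    ∃ x ∈ degSpace r n ((l : ℂ) - (j + 1 : ℕ)), (steinbergPow r hr n).E x = 0 ∧
      ((steinbergPow r hr n).F ^ (j + 1)) x = f.toLin (wS i j 0) := by
  obtain ⟨c, hc, h1⟩ := exists_F_pow_map_wR_zero f
  have h2 : ((steinbergPow r hr n).F ^ (j + 1)) (c⁻¹ • f.toLin (wR i j 0)) =
      f.toLin (wS i j 0) := by
    rw [map_smul, h1, smul_smul, inv_mul_cancel₀ hc, one_smul]
  rw [weightSpace_eq_degSpace] at hf
  obtain ⟨y, hy, hyx⟩ := exists_mem_of_apply_mem (X := VPow r n) (Y := VPow r n)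
    (N := fun c => degSpace r n c ⊓ LinearMap.ker (steinbergPow r hr n).E)
    (τ := fun c : ℂ => c + (j + 1 : ℕ)) (T := (steinbergPow r hr n).F ^ (j + 1))
    iSupIndep_degSpace (add_left_injective _) (fun c x hx => F_pow_mem_degSpace (j + 1) hx.1)
    (w := c⁻¹ • f.toLin (wR i j 0))
    (ker_E_le (Submodule.smul_mem _ _ (E_map_wR_zero f))) ((l : ℂ) - (j + 1 : ℕ)) (by
      rw [h2, sub_add_cancel]
      exact hf)
  exact ⟨y, hy.1, hy.2, hyx.trans h2⟩

/-- Otherwise `w^S_0` would be `F^{j+1}` of a vector of the negative degree `l - j - 1`, that is, of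
zero. -/
theorem map_wS_zero_notMem (hl : l ≤ j) : f.toLin (wS i j 0) ∉ weightSpace r n l := by
  intro hf
  obtain ⟨x, hx, -, hx'⟩ := exists_F_pow_eq_map_wS_zero f hf
  rw [degSpace_eq_bot, Submodule.mem_bot] at hx
  · rw [hx, map_zero] at hx'
    exact wS_zero_ne_zero i j (f.injective (hx'.symm.trans (map_zero _).symm))
  · intro m hm
    rw [eq_sub_iff_add_eq] at hm
    norm_cast at hm
    omega

theorem exists_mem_highestWeightSpace (hf : f.toLin (wS i j 0) ∈ weightSpace r n l) (hl : j < l) :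
    ∃ x ∈ highestWeightSpace r hr n (l - j - 1),
      ((steinbergPow r hr n).F ^ (j + 1)) x = f.toLin (wS i j 0) := by
  obtain ⟨x, hx, hxE, hx'⟩ := exists_F_pow_eq_map_wS_zero f hf
  refine ⟨x, ⟨hxE, ?_⟩, hx'⟩
  rw [weightSpace_eq_degSpace]
  convert hx using 1
  push_cast [show l - j - 1 = l - (j + 1) by omega, Nat.cast_sub hl]
  rfl

/-- A summand does not contribute both to `S` and to `R` in the same degree. -/
theorem map_wR_zero_notMem (hf : f.toLin (wS i j 0) ∈ weightSpace r n l) {β : ℂ} {hβ : β ^ 4 = 1}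
    {i' j' : ℕ} {h' : i' + j' + 2 = r}
    (g : DEmbedding (projModule r β hβ i' j' h') (steinbergPow r hr n))
    (hfg : LinearMap.range f.toLin = LinearMap.range g.toLin) :
    g.toLin (wR i' j' 0) ∉ weightSpace r n l := by
  intro hg
  -- The vector `w^R_0` for `g` is no value of `F` on the summand, so it cannot be a multiple of
  -- `w^S_0` for `f`, which is one.
  have hS : ∀ y, (steinbergPow r hr n).F y = g.toLin (wR i' j' 0) → ∀ x, y = f.toLin x → False := by
    rintro _ h1 x rfl
    obtain ⟨z, hz⟩ : f.toLin x ∈ LinearMap.range g.toLin := hfg ▸ ⟨x, rfl⟩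
    rw [← hz, ← g.map_F] at h1
    have h2 := DFunLike.congr_fun (g.injective h1) (.R ⟨0, Nat.succ_pos j'⟩)
    rw [wR_apply_R, if_pos rfl] at h2
    change (β ^ 2 • projF r i' j' z) _ = _ at h2
    rw [Finsupp.smul_apply, projF_apply_R_zero, smul_zero] at h2
    exact zero_ne_one h2
  have hg0 : g.toLin (wR i' j' 0) ≠ 0 := by
    rw [Ne, map_eq_zero_iff _ g.injective]
    exact wR_zero_ne_zero _ _
  obtain ⟨a, ha⟩ | ⟨a, ha⟩ := eq_smul_map_wS_zero_or hr f (hfg ▸ ⟨_, rfl⟩ :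
    g.toLin (wR i' j' 0) ∈ LinearMap.range f.toLin) (E_map_wR_zero g) (k_weightSpace hg)
  · obtain ⟨c, hc, h1⟩ := exists_F_pow_map_wR_zero f
    have hF : ∀ m, ∃ x, ((steinbergPow r hr n).F ^ m) (f.toLin (wR i j 0)) = f.toLin x := by
      intro m
      induction m with
      | zero => exact ⟨_, rfl⟩
      | succ m ih =>
        obtain ⟨x, hx⟩ := ih
        exact ⟨_, by rw [pow_succ', Module.End.mul_apply, hx, ← f.map_F]⟩
    obtain ⟨x, hx⟩ := hF j
    refine hS ((a * c⁻¹) • f.toLin x) ?_ ((a * c⁻¹) • x) (map_smul _ _ _).symm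
    rw [pow_succ', Module.End.mul_apply, hx] at h1
    rw [map_smul, h1, ha, smul_smul, mul_assoc, inv_mul_cancel₀ hc, mul_one]
  -- If it is a multiple of `w^R_0` for `f`, then `w^S_0` and `w^R_0` for `f` have the same strong
  -- weight, contrary to their different eigenvalues of `k`.
  · have ha0 : a ≠ 0 := by
      rintro rfl
      exact hg0 (by rw [ha, zero_smul])
    rw [ha] at hg
    have h1 := k_weightSpace (hr := hr) ((Submodule.smul_mem_iff _ ha0).1 hg)
    have h2 := k_weightSpace (hr := hr) hf
    rw [k_map_wR_zero] at h1
    rw [k_map_wS_zero] at h2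
    have hfS : f.toLin (wS i j 0) ≠ 0 := by
      rw [Ne, map_eq_zero_iff _ f.injective]
      exact wS_zero_ne_zero _ _
    have hfR : f.toLin (wR i j 0) ≠ 0 := by
      rw [Ne, map_eq_zero_iff _ f.injective]
      exact wR_zero_ne_zero _ _
    exact weight_ne hα hr h ((smul_left_injective ℂ hfS h2).trans
      (smul_left_injective ℂ hfR h1).symm)

end Degrees

namespace Decomposition

variable {r n : ℕ} {hr : 0 < r} {𝒟 : Decomposition r hr n} {l j : ℕ}

theorem C_le : 𝒟.C l ≤ highestWeightSpace r hr n l := by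
  refine Submodule.span_le.2 ?_
  rintro _ ⟨hv, s, α, hα, f, hf, rfl⟩
  exact ⟨E_map_u_zero f, hv⟩

theorem S_le : 𝒟.S l ≤ highestWeightSpace r hr n l := by
  refine Submodule.span_le.2 ?_
  rintro _ ⟨hv, s, α, hα, i, j, h, f, hf, rfl⟩
  exact ⟨E_map_wS_zero f, hv⟩

theorem R_le : 𝒟.R l ≤ highestWeightSpace r hr n l := by
  refine Submodule.span_le.2 ?_
  rintro _ ⟨hv, s, α, hα, i, j, h, f, hf, rfl⟩
  exact ⟨E_map_wR_zero f, hv⟩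

variable (𝒟) in
theorem highestWeightSpace_le_of {T : Submodule ℂ (VPow r n)}
    (h : ∀ s, ∀ x ∈ 𝒟.summand s, x ∈ highestWeightSpace r hr n l → x ≠ 0 → x ∈ T) :
    highestWeightSpace r hr n l ≤ T := by
  refine (𝒟.highestWeightSpace_le l).trans (iSup_le fun s x hx => ?_)
  by_cases hx0 : x = 0
  · rw [hx0]
    exact T.zero_mem
  · exact h s x hx.1 hx.2 hx0

variable (𝒟) in
-- No summand supplies generators to both spaces, even with different embeddings, and the two
-- disjoint families of summands span independent subspaces.
theorem disjoint_S_R (l : ℕ) : Disjoint (𝒟.S l) (𝒟.R l) := by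
  let s : Set (Fin 𝒟.card) := {s | ∃ (α : ℂ) (hα : α ^ 4 = 1) (i j : ℕ) (h : i + j + 2 = r)
    (f : DEmbedding (projModule r α hα i j h) (steinbergPow r hr n)),
      LinearMap.range f.toLin = 𝒟.summand s ∧ f.toLin (wS i j 0) ∈ weightSpace r n l}
  let t : Set (Fin 𝒟.card) := {s | ∃ (α : ℂ) (hα : α ^ 4 = 1) (i j : ℕ) (h : i + j + 2 = r)
    (f : DEmbedding (projModule r α hα i j h) (steinbergPow r hr n)),
      LinearMap.range f.toLin = 𝒟.summand s ∧ f.toLin (wR i j 0) ∈ weightSpace r n l}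
  have hst : Disjoint s t := by
    rw [Set.disjoint_left]
    rintro a ⟨α, hα, i, j, h, f, hf, hS⟩ ⟨β, hβ, i', j', h', g, hg, hR⟩
    exact map_wR_zero_notMem f hS g (hf.trans hg.symm) hR
  refine (disjoint_biSup_biSup (X := VPow r n) 𝒟.indep hst).mono (Submodule.span_le.2 ?_)
    (Submodule.span_le.2 ?_)
  · rintro _ ⟨hv, a, α, hα, i, j, h, f, hf, rfl⟩
    exact Submodule.mem_iSup_of_mem a (Submodule.mem_iSup_of_mem ⟨α, hα, i, j, h, f, hf, hv⟩
      (hf ▸ ⟨_, rfl⟩))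
  · rintro _ ⟨hv, a, α, hα, i, j, h, f, hf, rfl⟩
    exact Submodule.mem_iSup_of_mem a (Submodule.mem_iSup_of_mem ⟨α, hα, i, j, h, f, hf, hv⟩
      (hf ▸ ⟨_, rfl⟩))

variable (hj : (j : ℤ) ≡ (n : ℤ) + 2 * ((l : ℤ) - 1) [ZMOD r])
include hj

theorem highestWeightSpace_eq_C (hjr : j + 1 = r) :
    highestWeightSpace r hr n l = 𝒟.C l := by
  refine le_antisymm (highestWeightSpace_le_of 𝒟 fun s x hs hx hx0 => ?_) C_le
  obtain ⟨-, h⟩ | ⟨α, hα, i, h, -⟩ | ⟨α, hα, i, h, -⟩ := eq_smul_of_mem hj (by omega) hs hx hx0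
  · exact h
  · omega
  · omega

theorem highestWeightSpace_eq_S_sup_R (hjr : j + 1 < r) :
    highestWeightSpace r hr n l = 𝒟.S l ⊔ 𝒟.R l := by
  refine le_antisymm (highestWeightSpace_le_of 𝒟 fun s x hs hx hx0 => ?_) (sup_le S_le R_le)
  obtain ⟨h, -⟩ | ⟨α, hα, i, h, f, hf, hv, a, rfl⟩ | ⟨α, hα, i, h, f, hf, hv, a, rfl⟩ :=
    eq_smul_of_mem hj (by omega) hs hx hx0
  · omega
  · exact Submodule.mem_sup_left (Submodule.smul_mem _ _
      (Submodule.subset_span ⟨hv, s, α, hα, i, j, h, f, hf, rfl⟩))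
  · exact Submodule.mem_sup_right (Submodule.smul_mem _ _
      (Submodule.subset_span ⟨hv, s, α, hα, j, i, h, f, hf, rfl⟩))

/-- If `l ≤ j < r - 1`, then the highest weight vectors are the `w^R_0`. -/
theorem exists_of_mem_of_le (hlj : l ≤ j) (hjr : j + 1 < r) {s : Fin 𝒟.card} {x : VPow r n}
    (hs : x ∈ 𝒟.summand s) (hx : x ∈ highestWeightSpace r hr n l) (hx0 : x ≠ 0) :
    ∃ (α : ℂ) (hα : α ^ 4 = 1) (i : ℕ) (h : j + i + 2 = r)
      (f : DEmbedding (projModule r α hα j i h) (steinbergPow r hr n)),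
      LinearMap.range f.toLin = 𝒟.summand s ∧ f.toLin (wR j i 0) ∈ weightSpace r n l ∧
      ∃ a : ℂ, x = a • f.toLin (wR j i 0) := by
  obtain ⟨h, -⟩ | ⟨α, hα, i, h, f, hf, hv, a, rfl⟩ | h :=
    eq_smul_of_mem hj (by omega) hs hx hx0
  · omega
  · exact absurd hv (map_wS_zero_notMem f hlj)
  · exact h

theorem highestWeightSpace_eq_R (hlj : l ≤ j) (hjr : j + 1 < r) :
    highestWeightSpace r hr n l = 𝒟.R l := by
  refine le_antisymm (highestWeightSpace_le_of 𝒟 fun s x hs hx hx0 => ?_) R_le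
  obtain ⟨α, hα, i, h, f, hf, hv, a, rfl⟩ := exists_of_mem_of_le hj hlj hjr hs hx hx0
  exact Submodule.smul_mem _ _ (Submodule.subset_span ⟨hv, s, α, hα, j, i, h, f, hf, rfl⟩)

omit hj in
-- The residue attached to the degree `l - j - 1` is `r - 2 - j`. It is at least `l - j - 1` because
-- `l < r`, so in that degree all highest weight vectors are combinations of vectors `w^R_0`.
theorem modEq_sub (hj : (j : ℤ) ≡ (n : ℤ) + 2 * ((l : ℤ) - 1) [ZMOD r]) (hjl : j < l) (hl : l < r) :
    ((r - 2 - j : ℕ) : ℤ) ≡ (n : ℤ) + 2 * (((l - j - 1 : ℕ) : ℤ) - 1) [ZMOD r] := by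
  have h1 : ((r - 2 - j : ℕ) : ℤ) = r - 2 - j := by omega
  have h2 : ((l - j - 1 : ℕ) : ℤ) = l - j - 1 := by omega
  rw [h1, h2]
  obtain ⟨b, hb⟩ := hj.dvd
  refine (Int.modEq_iff_dvd).2 ⟨b - 1, ?_⟩
  linear_combination hb

/-- The operator `F^{j+1}` is injective on `W_{n,l-j-1}`. -/
theorem eq_zero_of_F_pow_eq_zero (𝒟 : Decomposition r hr n) (hjl : j < l) (hl : l < r)
    {x : VPow r n} (hx : x ∈ highestWeightSpace r hr n (l - j - 1))
    (hF : ((steinbergPow r hr n).F ^ (j + 1)) x = 0) : x = 0 := by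
  have h1 := ker_inf_iSup_le (X := VPow r n) (Y := VPow r n)
    (N := fun s => 𝒟.summand s ⊓ highestWeightSpace r hr n (l - j - 1)) (N' := 𝒟.summand)
    (τ := fun s => s) 𝒟.indep Function.injective_id ((steinbergPow r hr n).F ^ (j + 1))
    fun s x hx => F_pow_mem (Submodule.mem_inf.1 hx).1 _
  have h2 := h1 ⟨hF, 𝒟.highestWeightSpace_le _ hx⟩
  have h3 : (⨆ s, (𝒟.summand s ⊓ highestWeightSpace r hr n (l - j - 1)) ⊓
      LinearMap.ker ((steinbergPow r hr n).F ^ (j + 1))) ≤ ⊥ := by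
    refine iSup_le fun s x hx => ?_
    rw [Submodule.mem_bot]
    by_contra hx0
    obtain ⟨α, hα, i, h, f, hf, hv, a, rfl⟩ := exists_of_mem_of_le (modEq_sub hj hjl hl)
      (by omega) (by omega) hx.1.1 hx.1.2 hx0
    obtain rfl : i = j := by omega
    obtain ⟨c, hc, h4⟩ := exists_F_pow_map_wR_zero f
    have h5 : ((steinbergPow r hr n).F ^ (i + 1)) (a • f.toLin (wR (r - 2 - i) i 0)) = 0 := hx.2
    rw [map_smul, h4, smul_smul, smul_eq_zero, mul_eq_zero, map_eq_zero_iff _ f.injective] at h5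
    obtain (h5 | h5) | h5 := h5
    · exact hx0 (by rw [h5, zero_smul])
    · exact hc h5
    · exact wS_zero_ne_zero _ _ h5
  exact (Submodule.mem_bot _).1 (h3 h2)

/-- `S_{n,l} = F^{j+1} W_{n,l-j-1}`. -/
theorem map_F_pow_eq_S (𝒟 : Decomposition r hr n) (hjl : j < l) (hl : l < r) :
    (highestWeightSpace r hr n (l - j - 1)).map ((steinbergPow r hr n).F ^ (j + 1)) = 𝒟.S l := by
  refine le_antisymm (Submodule.map_le_iff_le_comap.2 (highestWeightSpace_le_of 𝒟
    fun s x hs hx hx0 => ?_)) (Submodule.span_le.2 ?_)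
  · obtain ⟨α, hα, i, h, f, hf, hv, a, rfl⟩ := exists_of_mem_of_le (modEq_sub hj hjl hl)
      (by omega) (by omega) hs hx hx0
    obtain rfl : i = j := by omega
    obtain ⟨c, hc, h4⟩ := exists_F_pow_map_wR_zero f
    have h5 : c • f.toLin (wS (r - 2 - i) i 0) ∈ weightSpace r n l := by
      rw [weightSpace_eq_degSpace] at hv ⊢
      have := F_pow_mem_degSpace (hr := hr) (i + 1) hv
      rw [h4] at this
      convert this using 1
      rw [← Nat.cast_add]
      congr 2
      omega
    rw [Submodule.mem_comap, map_smul, h4, smul_smul]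
    exact Submodule.smul_mem _ _ (Submodule.subset_span
      ⟨(Submodule.smul_mem_iff _ hc).1 h5, s, α, hα, _, i, h, f, hf, rfl⟩)
  · rintro v ⟨hv, s, α, hα, i, j', h, f, hf, rfl⟩
    have hx0 : f.toLin (wS i j' 0) ≠ 0 := by
      rw [Ne, map_eq_zero_iff _ f.injective]
      exact wS_zero_ne_zero _ _
    have h1 := dvd_of_k_apply hj hv hx0 hα (k_map_wS_zero f)
    have h2 : (r : ℤ) ∣ j - j' := by
      have := dvd_sub h1 (dvd_refl (r : ℤ))
      have e : (i : ℤ) + j + 2 - r = j - j' := by omega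
      rwa [e] at this
    -- The parameter `j'` of the summand is forced by the weight: both numbers lie between `0` and
    -- `r - 1` and are congruent modulo `r`.
    have h3 : (j : ℤ) - j' = 0 := by
      refine Int.eq_zero_of_abs_lt_dvd h2 ?_
      rw [abs_lt]
      omega
    obtain rfl : j = j' := by omega
    obtain ⟨x, hx, hx'⟩ := exists_mem_highestWeightSpace f hv hjl
    exact ⟨x, hx, hx'⟩

end Decomposition

end RestrictedSl2

end

noncomputable section

namespace RestrictedSl2

/-! ### Images of subrepresentations -/

section Subrepresentations

variable {G X : Type*} [Group G] [AddCommGroup X] [Module ℂ X] {ρ : Representation ℂ G X}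

/-- The image of a subrepresentation under an intertwining operator. -/
def mapSubrepresentation (V : Subrepresentation ρ) (T : Module.End ℂ X)
    (hT : ∀ g, Commute (ρ g) T) : Subrepresentation ρ where
  toSubmodule := V.toSubmodule.map T
  apply_mem_toSubmodule g v hv := by
    obtain ⟨w, hw, rfl⟩ := hv
    exact ⟨ρ g w, V.apply_mem_toSubmodule g hw, (LinearMap.congr_fun (hT g).eq w).symm⟩

theorem nonempty_equiv_mapSubrepresentation (V : Subrepresentation ρ) (T : Module.End ℂ X)
    (hT : ∀ g, Commute (ρ g) T) (h0 : ∀ x ∈ V.toSubmodule, T x = 0 → x = 0) :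
    Nonempty ((mapSubrepresentation V T hT).toRepresentation.Equiv V.toRepresentation) := by
  let φ : V.toSubmodule →ₗ[ℂ] (mapSubrepresentation V T hT).toSubmodule :=
    T.restrict fun x hx => ⟨x, hx, rfl⟩
  have hφ : Function.Bijective φ := by
    refine ⟨(injective_iff_map_eq_zero φ).2 fun x hx => ?_, ?_⟩
    · exact Subtype.ext (h0 x x.2 (congrArg Subtype.val hx))
    · rintro ⟨_, x, hx, rfl⟩
      exact ⟨⟨x, hx⟩, rfl⟩
  exact ⟨(Representation.Equiv.mk (ρ := V.toRepresentation)
    (σ := (mapSubrepresentation V T hT).toRepresentation) (LinearEquiv.ofBijective φ hφ) fun g =>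
    LinearMap.ext fun x => Subtype.ext (LinearMap.congr_fun (hT g).symm.eq (x : X))).symm⟩

theorem not_isSimpleOrder_subrepresentation {S W : Subrepresentation ρ}
    (hle : S.toSubmodule ≤ W.toSubmodule) (h0 : S.toSubmodule ≠ ⊥)
    (h1 : S.toSubmodule ≠ W.toSubmodule) :
    ¬ IsSimpleOrder (Subrepresentation W.toRepresentation) := by
  intro h
  let S' : Subrepresentation W.toRepresentation :=
    { toSubmodule := S.toSubmodule.comap W.toSubmodule.subtype
      apply_mem_toSubmodule := fun g v hv => S.apply_mem_toSubmodule g hv }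
  obtain h | h := h.eq_bot_or_eq_top S'
  · refine h0 ((Submodule.eq_bot_iff _).2 fun x hx => ?_)
    have h2 : (⟨x, hle hx⟩ : W.toSubmodule) ∈ S'.toSubmodule := hx
    rw [h] at h2
    exact congrArg Subtype.val ((Submodule.mem_bot ℂ).1 h2)
  · refine h1 (le_antisymm hle fun x hx => ?_)
    have h2 : (⟨x, hx⟩ : W.toSubmodule) ∈ S'.toSubmodule := by
      rw [h]
      exact Submodule.mem_top
    exact h2

end Subrepresentations

/-! ### The socle part as a representation of the braid group, and its dimension -/

section Socle

variable {r n : ℕ} {hr : 0 < r} {l j : ℕ}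

variable (r hr n) in
/-- The image of `W_{n,l}` under `F^m` as a representation of the braid group. -/
def mapPowRep (m l : ℕ) : Subrepresentation (braidRep r n hr) :=
  mapSubrepresentation (X := VPow r n) (ρ := braidRep r n hr) (highestWeightRep r n hr l) ((steinbergPow r hr n).F ^ m)
    fun g => (braidRep_commute_F g).pow_right m

variable (hj : (j : ℤ) ≡ (n : ℤ) + 2 * ((l : ℤ) - 1) [ZMOD r]) (hjl : j < l) (hl : l < r)
  (𝒟 : Decomposition r hr n)
include hj hjl hl 𝒟

theorem nonempty_equiv_mapPowRep :
    Nonempty ((mapPowRep r n hr (j + 1) (l - j - 1)).toRepresentation.Equiv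
      (highestWeightRep r n hr (l - j - 1)).toRepresentation) :=
  nonempty_equiv_mapSubrepresentation _ _ _ fun _ hx h0 =>
    Decomposition.eq_zero_of_F_pow_eq_zero hj 𝒟 hjl hl hx h0

theorem Decomposition.finrank_S (hn : 0 < n) :
    Module.finrank ℂ (𝒟.S l) = Nat.card (topIndices r n hn (l - j - 1)) := by
  obtain ⟨e⟩ := nonempty_equiv_mapPowRep hj hjl hl 𝒟
  rw [← finrank_highestWeightSpace hr hn, ← 𝒟.map_F_pow_eq_S hj hjl hl]
  exact e.toLinearEquiv.finrank_eq

end Socle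

end RestrictedSl2

end

theorem mainTheorem3 (r n : ℕ) (hr : 0 < r) (hn : 0 < n) :
    Nonempty (Decomposition r hr n) ∧
    ∃ ρ : Representation ℂ (BraidGroup n) (VPow r n),
      (∀ a : Fin (n - 1), ρ (PresentedGroup.of a) = braidOp r hr n a) ∧
      ∃ W : ℕ → Subrepresentation ρ,
        (∀ l, (W l).toSubmodule = highestWeightSpace r hr n l) ∧
        ∀ (𝒟 : Decomposition r hr n) (l j : ℕ), l < r → j ≤ r - 1 →
          (j : ℤ) ≡ (n : ℤ) + 2 * ((l : ℤ) - 1) [ZMOD r] →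
          (j = r - 1 → (W l).toSubmodule = 𝒟.C l) ∧
          (l ≤ j → j < r - 1 → (W l).toSubmodule = 𝒟.R l) ∧
          (j < l → 3 ≤ n →
            ((W l).toSubmodule = 𝒟.S l ⊔ 𝒟.R l ∧ Disjoint (𝒟.S l) (𝒟.R l)) ∧
            ¬ IsSimpleOrder (Subrepresentation (W l).toRepresentation) ∧
            ∃ S : Subrepresentation ρ, S.toSubmodule = 𝒟.S l ∧ S ≤ W l ∧
              Nonempty (S.toRepresentation.Equiv (W (l - j - 1)).toRepresentation)) ∧
          (j < l → n = 2 → (W l).toSubmodule = 𝒟.S l) := by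
  refine ⟨nonempty_decomposition hr hn, braidRep r n hr, braidRep_of, highestWeightRep r n hr,
    fun _ => rfl, fun 𝒟 l j hl hjr hj => ⟨fun h => ?_, fun h1 h2 => ?_, fun hjl hn3 => ?_,
      fun hjl hn2 => ?_⟩⟩
  · exact Decomposition.highestWeightSpace_eq_C hj (by omega)
  · exact Decomposition.highestWeightSpace_eq_R hj h1 (by omega)
  · have hS : (mapPowRep r n hr (j + 1) (l - j - 1)).toSubmodule = 𝒟.S l :=
      𝒟.map_F_pow_eq_S hj hjl hl
    have hle : (mapPowRep r n hr (j + 1) (l - j - 1)).toSubmodule ≤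
        (highestWeightRep r n hr l).toSubmodule := by
      rw [hS]
      exact Decomposition.S_le
    have hfS := 𝒟.finrank_S hj hjl hl hn
    refine ⟨⟨Decomposition.highestWeightSpace_eq_S_sup_R hj (by omega), 𝒟.disjoint_S_R l⟩,
      not_isSimpleOrder_subrepresentation (X := VPow r n) (ρ := braidRep r n hr)
        (S := mapPowRep r n hr (j + 1) (l - j - 1)) (W := highestWeightRep r n hr l) hle (fun h => ?_) (fun h => ?_),
      mapPowRep r n hr (j + 1) (l - j - 1), hS, hle, nonempty_equiv_mapPowRep hj hjl hl 𝒟⟩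
    -- `S` is non-zero, having the dimension of `W_{n,l-j-1}`, which is positive for `n ≥ 2`.
    · rw [hS] at h
      rw [h, finrank_bot] at hfS
      have := card_topIndices_pos (r := r) (n := n) (l := l - j - 1) (by omega) (by omega)
      omega
    -- `S` is proper, since for `n ≥ 3` the dimension is strictly larger in degree `l` than in
    -- degree `l - j - 1`.
    · rw [hS] at h
      rw [h] at hfS
      have h1 := finrank_highestWeightSpace hr hn l
      have h2 := card_topIndices_lt (r := r) (n := n) hl (l' := l - j - 1) (by omega) hn3
      have h3 : Nat.card (topIndices r n hn l) = Nat.card (topIndices r n hn (l - j - 1)) :=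
        h1.symm.trans hfS
      omega
  · subst hn2
    -- For `n = 2` both spaces are lines, so the inclusion `S ≤ W` is an equality.
    refine (eq_of_le_of_finrank_eq (X := VPow r 2)
      (Decomposition.S_le (𝒟 := 𝒟) (l := l)) ?_).symm
    exact (𝒟.finrank_S hj hjl hl hn).trans ((card_topIndices_two (by omega)).trans
      ((finrank_highestWeightSpace hr hn l).trans (card_topIndices_two hl)).symm)
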